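/- **Theorem (Global convergence of PINNs).** *Domain, measure.* Let $d\ge 1$ and let $\Omega\subset\mathbb R^d$ be compact with boundary of class $C^{3,\alpha}$ for some $\alpha\in(0,1)$ (near each boundary point, $\Omega$ is the region on one side of the graph of a $C^{3,\alpha}$ function). Let $\mu$ be a finite measure on $\Omega$, equivalent to Lebesgue measure on $\Omega$, such that the logarithm of its Radon–Nikodym derivative is bounded. Let $\mathcal H^p$ ($p=1,2$) be the space of $f\in L^2(\mu)$ whose weak derivatives $D_\alpha f$, $|\alpha|\le p$, in the interior of $\Omega$ lie in $L^2(\mu)$, with norm $\sum_{|\alpha|\le p}\|D_\alpha f\|_{L^2(\mu)}$; let $\mathcal H^1_0$ be the closure in $\mathcal H^1$ of the smooth functions with compact support in the interior of $\Omega$, and $\mathcal H^2_{(0)}=\mathcal H^2\cap\mathcal H^1_0$. *PDE.* Let $\mathcal A f=\sum_{i,j}a_{ij}\partial_i\partial_j f+\sum_i b_i\partial_i f+c_0f$ be a linear differential operator of order at most two with measurable coefficients that are bounded on $\Omega$ (so that $|\mathcal Af_1-\mathcal Af_2|\le k\sum_{|\alpha|\le 2}|D_\alpha f_1-D_\alpha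 f_2|$). Assume that $\mathcal A$ has a bounded inverse: there is $k>0$ such that for every $\tilde g\in L^2(\mu)$ the problem $\mathcal A v=\tilde g$ in $\Omega$, $v=0$ on $\partial\Omega$, has a unique solution $v\in\mathcal H^2_{(0)}$, and $\|v\|_{L^2(\mu)}\le k\|\tilde g\|_{L^2(\mu)}$. Let $g\in L^2(\mu)$ and let $u\in\mathcal H^2_{(0)}$ be the solution of $\mathcal Au=g$ in $\Omega$, $u=0$ on $\partial\Omega$. *Observations.* Let $M\ge1$, $x_1,\dots,x_M\in\Omega$ and $\mu_{\mathbf x}=\frac1M\sum_{i=1}^M\delta_{x_i}$. The solution $u$ is represented by a function, vanishing on $\partial\Omega$, such that $u(x_i)=\lim_{r\to0}\frac{1}{|B(x_i,r)|}\int_{B(x_i,r)}u\,dy$ at every interior observation point $x_i$ (this holds in particular if $u$ is continuous at these points; for $d\le 3$ the continuous representative of $u$ has this property). *Network.* Let $\eta\in C^3_b(\mathbb R^d)$ with $\eta>0$ in the interior of $\Omega$, and $\eta=0$, $\nabla\eta\ne0$ on $\partial\Omega$. Let $\sigma\in C^4_b(\mathbb R)$ be non-constant. Let $(c,w,b)$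 be a random vector in $\mathbb R\times\mathbb R^d\times\mathbb R$ with $|c|<K_0$ almost surely for a constant $K_0$, $\mathbb E[c]=0$, $\mathbb P((w,b)\in D)>0$ for every nonempty open set $D\subseteq\mathbb R^{d+1}$, $\mathbb E|w_k|^4<\infty$ for $k=1,\dots,d$, and $\mathbb E|b|<\infty$. With $\varphi(x)=\varphi_{c,w,b}(x)=\eta(x)\,c\,\sigma(w\cdot x+b)$ put $$U(x,y)=\mathbb E\big[\nabla_{c,w,b}\mathcal A\varphi(x)\cdot\nabla_{c,w,b}\varphi(y)\big],\qquad B(x,y)=\mathbb E\big[\nabla_{c,w,b}\varphi(x)\cdot\nabla_{c,w,b}\varphi(y)\big],$$ $$\mathcal U f(y)=\int_\Omega f(x)U(x,y)\,d\mu(x),\qquad \mathcal B\mathbf v(y)=\frac1M\sum_{i=1}^M v_i\,B(x_i,y).$$ *Wide-limit PINN approximator.* Let $(Q_t)_{t\ge0}$ be a curve of functions in $\mathcal H^2_{(0)}$ that solves $$\frac{dQ_t}{dt}=-\mathcal U[\mathcal AQ_t-g]-\mathcal B\big[(Q_t(x_i)-u(x_i))_{i=1}^M\big],\qquad Q_0=0,$$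 for all $t\ge0$, with the derivative taken both in the $\mathcal H^2$ norm and pointwise at every point of $\Omega$. *Conclusion.* Then $$\lim_{t\to\infty}\Big(\|Q_t-u\|_{L^2(\mu)}^2+\|Q_t-u\|_{L^2(\mu_{\mathbf x})}^2\Big)=0 .$$ -/

import Mathlib

open MeasureTheory Filter Topology
open scoped ENNReal NNReal ContDiff

namespace PINN

/-- `ℝ^d` with its Euclidean structure. -/
abbrev Euc (d : ℕ) : Type := EuclideanSpace ℝ (Fin d)

noncomputable section

/-! ### The domain -/

/-- The boundary of the closed set `Ω` is of class `C^{3,α}` for some `α ∈ (0,1)`: near every boundary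
point, and for a suitable unit vector `e` playing the role of the last coordinate axis, `Ω` is the
region above the graph of a function `γ` (of the component of `x` orthogonal to `e`) which is three
times continuously differentiable with `α`-Hölder third derivative. -/
def HasC3HolderBoundary {d : ℕ} (Ω : Set (Euc d)) : Prop :=
  ∃ α : ℝ≥0, 0 < α ∧ α < 1 ∧ ∀ p ∈ frontier Ω, ∃ r : ℝ, 0 < r ∧ ∃ e : Euc d, ‖e‖ = 1 ∧
    ∃ γ : Euc d → ℝ, ContDiff ℝ 3 γ ∧ (∃ C : ℝ≥0, HolderWith C α (iteratedFDeriv ℝ 3 γ)) ∧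
      ∀ x ∈ Metric.ball p r, x ∈ Ω ↔ γ (x - inner ℝ x e • e) ≤ inner ℝ x e

/-- `μ` is a finite measure on `Ω`, equivalent to Lebesgue measure on `Ω`, and the logarithm of its
Radon-Nikodym derivative is (essentially) bounded. -/
structure IsSamplingMeasure {d : ℕ} (Ω : Set (Euc d)) (μ : Measure (Euc d)) : Prop where
  finite : IsFiniteMeasure μ
  ac : μ ≪ volume.restrict Ω
  ca : volume.restrict Ω ≪ μ
  log_bdd : ∃ K : ℝ, ∀ᵐ x ∂(volume.restrict Ω),
    |Real.log (μ.rnDeriv (volume.restrict Ω) x).toReal| ≤ K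

/-! ### Partial derivatives, classical and weak -/

/-- The classical partial derivative `∂ᵢ f`. -/
def partialDeriv {d : ℕ} (i : Fin d) (f : Euc d → ℝ) (x : Euc d) : ℝ :=
  fderiv ℝ f x (EuclideanSpace.single i 1)

/-- Test functions: smooth with compact support in the interior of `Ω`. -/
structure IsTestFunction {d : ℕ} (Ω : Set (Euc d)) (φ : Euc d → ℝ) : Prop where
  smooth : ContDiff ℝ ∞ φ
  compact : HasCompactSupport φ
  support : tsupport φ ⊆ interior Ω

/-- `v` is a weak `i`-th partial derivative of `u` in the interior of `Ω`. -/
structure IsWeakPartial {d : ℕ} (Ω : Set (Euc d)) (i : Fin d) (u v : Euc d → ℝ) : Prop where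
  left_int : LocallyIntegrableOn u (interior Ω)
  right_int : LocallyIntegrableOn v (interior Ω)
  parts : ∀ φ : Euc d → ℝ, IsTestFunction Ω φ →
    ∫ x in interior Ω, u x * partialDeriv i φ x = -∫ x in interior Ω, v x * φ x

open Classical in
/-- The weak `i`-th partial derivative of `u` (unique up to null sets; `0` if there is none). -/
def weakPartial {d : ℕ} (Ω : Set (Euc d)) (i : Fin d) (u : Euc d → ℝ) : Euc d → ℝ :=
  if h : ∃ v, IsWeakPartial Ω i u v then h.choose else 0

/-! ### Sobolev spaces -/

/-- `u ∈ ℋ¹`: `u` and its weak first derivatives exist in `L²(μ)`. -/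
def MemH1 {d : ℕ} (Ω : Set (Euc d)) (μ : Measure (Euc d)) (u : Euc d → ℝ) : Prop :=
  MemLp u 2 μ ∧ ∀ i, (∃ v, IsWeakPartial Ω i u v) ∧ MemLp (weakPartial Ω i u) 2 μ

/-- `u ∈ ℋ²`: all weak derivatives of `u` of order at most two exist in `L²(μ)`. -/
def MemH2 {d : ℕ} (Ω : Set (Euc d)) (μ : Measure (Euc d)) (u : Euc d → ℝ) : Prop :=
  MemH1 Ω μ u ∧ ∀ i, MemH1 Ω μ (weakPartial Ω i u)

/-- The `ℋ¹` norm. -/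
def h1Norm {d : ℕ} (Ω : Set (Euc d)) (μ : Measure (Euc d)) (u : Euc d → ℝ) : ℝ≥0∞ :=
  eLpNorm u 2 μ + ∑ i, eLpNorm (weakPartial Ω i u) 2 μ

/-- The `ℋ²` norm. -/
def h2Norm {d : ℕ} (Ω : Set (Euc d)) (μ : Measure (Euc d)) (u : Euc d → ℝ) : ℝ≥0∞ :=
  h1Norm Ω μ u + ∑ i, ∑ j, eLpNorm (weakPartial Ω i (weakPartial Ω j u)) 2 μ

/-- `u ∈ ℋ¹₀`: `u` is an `ℋ¹` limit of test functions. -/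
def MemH10 {d : ℕ} (Ω : Set (Euc d)) (μ : Measure (Euc d)) (u : Euc d → ℝ) : Prop :=
  MemH1 Ω μ u ∧ ∃ φ : ℕ → Euc d → ℝ, (∀ n, IsTestFunction Ω (φ n)) ∧
    Tendsto (fun n => h1Norm Ω μ (u - φ n)) atTop (𝓝 0)

/-- `ℋ²₍₀₎ = ℋ² ∩ ℋ¹₀`. -/
def MemH20 {d : ℕ} (Ω : Set (Euc d)) (μ : Measure (Euc d)) (u : Euc d → ℝ) : Prop :=
  MemH2 Ω μ u ∧ MemH10 Ω μ u

/-! ### The partial differential operator -/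

/-- Coefficients of a linear differential operator of order at most two,
`𝒜f = ∑ᵢⱼ aᵢⱼ ∂ᵢ∂ⱼf + ∑ᵢ bᵢ ∂ᵢf + c f`. -/
structure DiffOp (d : ℕ) where
  a : Fin d → Fin d → Euc d → ℝ
  b : Fin d → Euc d → ℝ
  c : Euc d → ℝ

/-- `𝒜f`, where `D i` is the notion of `i`-th partial derivative that is used. -/
def DiffOp.applyWith {d : ℕ} (A : DiffOp d) (D : Fin d → (Euc d → ℝ) → Euc d → ℝ)
    (f : Euc d → ℝ) (x : Euc d) : ℝ :=
  ∑ i, ∑ j, A.a i j x * D i (D j f) x + ∑ i, A.b i x * D i f x + A.c x * f x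

/-- `𝒜f` for a twice differentiable function `f`. -/
def DiffOp.classical {d : ℕ} (A : DiffOp d) : (Euc d → ℝ) → Euc d → ℝ :=
  A.applyWith partialDeriv

/-- `𝒜f` for `f ∈ ℋ²`, through weak derivatives. -/
def DiffOp.weak {d : ℕ} (A : DiffOp d) (Ω : Set (Euc d)) : (Euc d → ℝ) → Euc d → ℝ :=
  A.applyWith (weakPartial Ω)

/-- The coefficients are measurable, and bounded on `Ω`. For a linear operator of order two,
boundedness of the coefficients is the pointwise Lipschitz condition
`|𝒜f₁(x) - 𝒜f₂(x)| ≤ k ∑_{|α| ≤ 2} |D_α f₁(x) - D_α f₂(x)|` (take quadratic polynomials). -/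
structure DiffOp.IsLipschitz {d : ℕ} (A : DiffOp d) (Ω : Set (Euc d)) : Prop where
  meas_a : ∀ i j, Measurable (A.a i j)
  meas_b : ∀ i, Measurable (A.b i)
  meas_c : Measurable A.c
  bdd : ∃ k : ℝ, 0 < k ∧ ∀ x ∈ Ω,
    (∀ i j, |A.a i j x| ≤ k) ∧ (∀ i, |A.b i x| ≤ k) ∧ |A.c x| ≤ k

/-- `u` is a strong Sobolev solution of `𝒜u = g` in `Ω`, `u = 0` on `∂Ω`. -/
def IsSolution {d : ℕ} (Ω : Set (Euc d)) (μ : Measure (Euc d)) (A : DiffOp d)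
    (g u : Euc d → ℝ) : Prop :=
  MemH20 Ω μ u ∧ A.weak Ω u =ᵐ[μ] g

/-- `𝒜` has a bounded inverse on `L²(μ)`: for every `g ∈ L²(μ)` the Dirichlet problem has exactly one
solution `u` in `ℋ²₍₀₎` (up to null sets), and `‖u‖ ≤ k ‖g‖` in `L²(μ)`. -/
def HasBoundedInverse {d : ℕ} (Ω : Set (Euc d)) (μ : Measure (Euc d)) (A : DiffOp d) : Prop :=
  ∃ k : ℝ≥0, 0 < k ∧ ∀ g : Euc d → ℝ, MemLp g 2 μ →
    (∃ u, IsSolution Ω μ A g u ∧ eLpNorm u 2 μ ≤ k * eLpNorm g 2 μ) ∧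
    ∀ u₁ u₂, IsSolution Ω μ A g u₁ → IsSolution Ω μ A g u₂ → u₁ =ᵐ[μ] u₂

/-! ### The network -/

/-- The auxiliary function `η ∈ C³_b(ℝ^d)`: positive inside `Ω`, zero on `∂Ω`, where its derivative does
not vanish. (As `η = 0` on `∂Ω`, the gradient is normal there, so that this is `∇η · n ≠ 0`.) -/
structure IsAuxiliary {d : ℕ} (Ω : Set (Euc d)) (η : Euc d → ℝ) : Prop where
  contDiff : ContDiff ℝ 3 η
  bdd : ∀ k : ℕ, k ≤ 3 → ∃ C : ℝ, ∀ x, ‖iteratedFDeriv ℝ k η x‖ ≤ C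
  pos : ∀ x ∈ interior Ω, 0 < η x
  zero : ∀ x ∈ frontier Ω, η x = 0
  deriv_ne : ∀ x ∈ frontier Ω, fderiv ℝ η x ≠ 0

/-- The activation function: `σ ∈ C⁴_b(ℝ)`, not constant. -/
structure IsActivation (σ : ℝ → ℝ) : Prop where
  contDiff : ContDiff ℝ 4 σ
  bdd : ∀ k : ℕ, k ≤ 4 → ∃ C : ℝ, ∀ z, |iteratedDeriv k σ z| ≤ C
  nonconst : ¬ ∃ z₀ : ℝ, ∀ z, σ z = z₀

/-- The common law `ν` of the initial parameters `(c, w, b)` of a hidden unit. -/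
structure IsInitialLaw {d : ℕ} (ν : Measure (ℝ × Euc d × ℝ)) : Prop where
  prob : IsProbabilityMeasure ν
  bdd_c : ∃ K₀ : ℝ, ∀ᵐ θ ∂ν, |θ.1| < K₀
  mean_c : ∫ θ, θ.1 ∂ν = 0
  full_support : ∀ D : Set (Euc d × ℝ), IsOpen D → D.Nonempty → 0 < ν (Prod.snd ⁻¹' D)
  moment_w : ∀ k : Fin d, Integrable (fun θ => |θ.2.1 k| ^ 4) ν
  moment_b : Integrable (fun θ => |θ.2.2|) ν

/-- One hidden unit times `η`: `η(x) c σ(w · x + b)`. -/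
def neuron {d : ℕ} (η : Euc d → ℝ) (σ : ℝ → ℝ) (c : ℝ) (w : Euc d) (b : ℝ) (x : Euc d) : ℝ :=
  η x * c * σ (inner ℝ w x + b)

/-- `∇_{c,w,b} F · ∇_{c,w,b} G` at `(c, w, b)`. -/
def paramGradDot {d : ℕ} (F G : ℝ → Euc d → ℝ → ℝ) (c : ℝ) (w : Euc d) (b : ℝ) : ℝ :=
  deriv (fun c' => F c' w b) c * deriv (fun c' => G c' w b) c
    + ∑ k, partialDeriv k (fun w' => F c w' b) w * partialDeriv k (fun w' => G c w' b) w
    + deriv (fun b' => F c w b') b * deriv (fun b' => G c w b') b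

/-- `U(x,y) = 𝔼[∇𝒜[η(x)cσ(w·x+b)] · ∇[η(y)cσ(w·y+b)]]`. -/
def kernelU {d : ℕ} (A : DiffOp d) (η : Euc d → ℝ) (σ : ℝ → ℝ) (ν : Measure (ℝ × Euc d × ℝ))
    (x y : Euc d) : ℝ :=
  ∫ θ, paramGradDot (fun c w b => A.classical (neuron η σ c w b) x)
    (fun c w b => neuron η σ c w b y) θ.1 θ.2.1 θ.2.2 ∂ν

/-- `B(x,y) = 𝔼[∇[cη(x)σ(w·x+b)] · ∇[cη(y)σ(w·y+b)]]`. -/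
def kernelB {d : ℕ} (η : Euc d → ℝ) (σ : ℝ → ℝ) (ν : Measure (ℝ × Euc d × ℝ))
    (x y : Euc d) : ℝ :=
  ∫ θ, paramGradDot (fun c w b => neuron η σ c w b x)
    (fun c w b => neuron η σ c w b y) θ.1 θ.2.1 θ.2.2 ∂ν

/-- `(𝒰r)(y) = ∫ r(x) U(x,y) dμ(x)`. -/
def opU {d : ℕ} (μ : Measure (Euc d)) (A : DiffOp d) (η : Euc d → ℝ) (σ : ℝ → ℝ)
    (ν : Measure (ℝ × Euc d × ℝ)) (r : Euc d → ℝ) (y : Euc d) : ℝ :=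
  ∫ x, r x * kernelU A η σ ν x y ∂μ

/-- `(ℬv)(y) = (1/M) ∑ᵢ vᵢ B(xᵢ,y)`. -/
def opB {d M : ℕ} (X : Fin M → Euc d) (η : Euc d → ℝ) (σ : ℝ → ℝ)
    (ν : Measure (ℝ × Euc d × ℝ)) (v : Fin M → ℝ) (y : Euc d) : ℝ :=
  1 / (M : ℝ) * ∑ i, v i * kernelB η σ ν (X i) y

/-- The empirical measure `μ_𝐱 = (1/M) ∑ᵢ δ_{xᵢ}` of the observation points. -/
def empiricalMeasure {d M : ℕ} (X : Fin M → Euc d) : Measure (Euc d) :=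
  (M : ℝ≥0∞)⁻¹ • ∑ i, Measure.dirac (X i)

/-- The vector field of the training dynamics: `q ↦ -𝒰[𝒜q - g] - ℬ[q - u]`. -/
def limitField {d M : ℕ} (Ω : Set (Euc d)) (μ : Measure (Euc d)) (A : DiffOp d)
    (η : Euc d → ℝ) (σ : ℝ → ℝ) (ν : Measure (ℝ × Euc d × ℝ)) (X : Fin M → Euc d)
    (g u q : Euc d → ℝ) (y : Euc d) : ℝ :=
  -opU μ A η σ ν (fun x => A.weak Ω q x - g x) y - opB X η σ ν (fun i => q (X i) - u (X i)) y

/-- `Q` is the wide-limit PINN approximator: it solves `dQ_t/dt = -𝒰[𝒜Q_t - g] - ℬ[Q_t - u]`, `Q_0 = 0`,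
for `t ≥ 0`, as a curve in `ℋ²₍₀₎` and, so that the values at the observation points make sense, also at
every point of `Ω`. -/
structure IsWideLimit {d M : ℕ} (Ω : Set (Euc d)) (μ : Measure (Euc d)) (A : DiffOp d)
    (η : Euc d → ℝ) (σ : ℝ → ℝ) (ν : Measure (ℝ × Euc d × ℝ)) (X : Fin M → Euc d)
    (g u : Euc d → ℝ) (Q : ℝ → Euc d → ℝ) : Prop where
  mem : ∀ t, 0 ≤ t → MemH20 Ω μ (Q t)
  init : ∀ y ∈ Ω, Q 0 y = 0
  ode : ∀ t, 0 ≤ t →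
    Tendsto (fun s => h2Norm Ω μ fun y =>
        (s - t)⁻¹ * (Q s y - Q t y) - limitField Ω μ A η σ ν X g u (Q t) y)
      (𝓝[Set.Ici 0 \ {t}] t) (𝓝 0)
  ode_pointwise : ∀ t, 0 ≤ t → ∀ y ∈ Ω,
    HasDerivWithinAt (fun s => Q s y) (limitField Ω μ A η σ ν X g u (Q t) y) (Set.Ici 0) t

end

end PINN

/-! The residuals `z_t = (𝒜Q_t - g, (Q_t(x_i) - u(x_i))_i)` live in `L²` of the disjoint union of
`μ` and `1/M` times counting measure. Let `T` send `z` to the function `∫ k(y, ·) z(y)` of the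
parameters, where `k(y, ·)` consists of the parameter derivatives of the residual of one hidden unit
at `y`. The kernels `U` and `B` are expectations of products of such derivatives, so applying `𝒜`
and the evaluations at the `x_i` to the vector field gives `z' = -T†T z`
(`isGradientFlow_residual`). Such a flow tends to zero, without a rate, as soon as `z_0 ⊥ ker T`
(`IsGradientFlow.tendsto_zero`): the energy `‖T z_t‖²` decays like `1/t`; since `z_0` lies in the
closure of the range of `T†`, this forces `⟨z_0, z_t⟩ → 0`; and `‖z_t‖² = ⟨z_0, z_{2t}⟩` because
`T†T` is self-adjoint. The bounded inverse of `𝒜` turns `𝒜Q_t → g` into `Q_t → u` in `L²(μ)`.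

As `Q_0 = 0` and `𝒜u = g`, it remains to see that every `v ∈ ker T` satisfies `∫ v 𝒜u dμ + (1/M) ∑
v_i u(x_i) = 0` (`integral_mul_weak_add_sum_eq_zero`). The left side is a functional `Λ` of order
two applied to `u`, and there are two approximation problems to solve.

Interior approximation by ridge functions. The component of `T v = 0` belonging to the outer weight
says `Λ(η σ(w · x + b)) = 0` for almost all `(w, b)`, hence for all of them by continuity and full
support. Mollify `σ` to make it smooth; no derivative of a bounded non-constant smooth function with
bounded derivatives vanishes identically, so differentiating `n` times in the length of `w` at zero
shows that `p ↦ Λ(ηp)` kills all powers `(w · x)^n`. Summing the exponential series on the bounded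
set `Ω`, it kills all plane waves, and by Fourier inversion all test functions `p` on the whole
space (`integral_eq_zero_of_ridgeTransform`).

Passage to the boundary. One must reach `u`, which is `η` times `u/η`, and the quotient has to be
regular enough. Localized near a boundary point, Hardy's inequality gives `u/η ∈ L²` because `u` is
a limit of test functions. A weighted inequality of Rellich type, obtained by integrating the
divergence of `∂_e v ∇v - ½|∇v|² e` against a weight, gives `∇(u/η) ∈ L²`, and then the product rule
gives `η D²(u/η) ∈ L²`. Translating the quotient inwards removes its singularity from `Ω`, so that
it can be mollified; the missing factor `η` in the second derivatives is supplied by the coefficient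
`η q₂` of `p ↦ Λ(ηp)` (`pairing_of_boundaryBall`).

In the interior, values of `u` are only known as limits of means over balls. A radial mollifier is
an average of ball indicators, so mollifications converge to exactly these values
(`tendsto_mollify`). A smooth partition separates the boundary from the interior observation points,
and boundary observation points contribute nothing since `η` and `u` vanish there
(`pairing_eq_zero`). -/

namespace PINN

/-! ### Gradient flows of quadratic forms in a Hilbert space -/

section GradientFlow

variable {Z H : Type*} [NormedAddCommGroup Z] [InnerProductSpace ℝ Z] [CompleteSpace Z]
  [NormedAddCommGroup H] [InnerProductSpace ℝ H] [CompleteSpace H]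

open ContinuousLinearMap (adjoint)

/-- A solution on `[0, ∞)` of the linear gradient flow `z' = -T†T z`. -/
def IsGradientFlow (T : Z →L[ℝ] H) (z : ℝ → Z) : Prop :=
  ∀ t, 0 ≤ t → HasDerivWithinAt z (-(adjoint T (T (z t)))) (Set.Ici 0) t

variable {T : Z →L[ℝ] H} {z : ℝ → Z}

lemma IsGradientFlow.continuousOn (hz : IsGradientFlow T z) : ContinuousOn z (Set.Ici 0) :=
  fun t ht => (hz t ht).continuousWithinAt

lemma IsGradientFlow.hasDerivAt (hz : IsGradientFlow T z) {t : ℝ} (ht : 0 < t) :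
    HasDerivAt z (-(adjoint T (T (z t)))) t :=
  (hz t ht.le).hasDerivAt (Ici_mem_nhds ht)

/-- Since `T†T` is self-adjoint, `s ↦ ⟨z(t-s), z(t+s)⟩` has zero derivative; compare `s = 0` with `s
= t`. This reduces norm convergence to weak convergence tested against the single vector `z 0`. -/
lemma IsGradientFlow.norm_sq_eq (hz : IsGradientFlow T z) {t : ℝ} (ht : 0 ≤ t) :
    ‖z t‖ ^ 2 = inner ℝ (z 0) (z (2 * t)) := by
  have hcont : ContinuousOn (fun s => inner ℝ (z (t - s)) (z (t + s))) (Set.Icc 0 t) := by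
    apply ContinuousOn.inner
    · exact hz.continuousOn.comp (by fun_prop) fun s hs => by simpa using hs.2
    · exact hz.continuousOn.comp (by fun_prop) fun s hs => by
        have := hs.1; simp only [Set.mem_Ici]; linarith
  have hder : ∀ s ∈ Set.Ico (0 : ℝ) t, HasDerivWithinAt
      (fun s => inner ℝ (z (t - s)) (z (t + s))) 0 (Set.Ici s) s := by
    intro s hs
    have h1 : HasDerivAt (fun s => z (t - s)) (adjoint T (T (z (t - s)))) s := by
      have := (hz.hasDerivAt (t := t - s) (by linarith [hs.2])).scomp s
        ((hasDerivAt_id s).const_sub t)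
      simpa [Function.comp_def] using this
    have h2 : HasDerivWithinAt (fun s => z (t + s)) (-adjoint T (T (z (t + s)))) (Set.Ici s) s := by
      have := (hz (t + s) (by linarith [hs.1])).scomp s
        (((hasDerivAt_id s).const_add t).hasDerivWithinAt (s := Set.Ici s))
        (fun x hx => by
          have h1 := hs.1; have h2 : s ≤ x := hx
          simp only [Set.mem_Ici]; linarith)
      simpa [Function.comp_def] using this
    refine (h1.hasDerivWithinAt.inner ℝ h2).congr_deriv ?_
    rw [inner_neg_right, ContinuousLinearMap.adjoint_inner_right,
      ContinuousLinearMap.adjoint_inner_left, neg_add_cancel]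
  have := constant_of_has_deriv_right_zero hcont hder t (Set.right_mem_Icc.2 ht)
  simp only [sub_self, sub_zero, add_zero] at this
  rw [two_mul, this, real_inner_self_eq_norm_sq]

lemma IsGradientFlow.hasDerivAt_norm_sq (hz : IsGradientFlow T z) {t : ℝ} (ht : 0 < t) :
    HasDerivAt (fun s => ‖z s‖ ^ 2) (-(2 * ‖T (z t)‖ ^ 2)) t := by
  refine (hz.hasDerivAt ht).norm_sq.congr_deriv ?_
  rw [inner_neg_right, ContinuousLinearMap.adjoint_inner_right, real_inner_self_eq_norm_sq]
  ring

lemma IsGradientFlow.hasDerivAt_norm_map_sq (hz : IsGradientFlow T z) {t : ℝ} (ht : 0 < t) :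
    HasDerivAt (fun s => ‖T (z s)‖ ^ 2) (-(2 * ‖adjoint T (T (z t))‖ ^ 2)) t := by
  refine (T.hasFDerivAt.comp_hasDerivAt t (hz.hasDerivAt ht)).norm_sq.congr_deriv ?_
  rw [map_neg, inner_neg_right, Function.comp_apply]
  rw [← ContinuousLinearMap.adjoint_inner_left, real_inner_self_eq_norm_sq]
  ring

lemma IsGradientFlow.antitoneOn_norm_sq (hz : IsGradientFlow T z) :
    AntitoneOn (fun s => ‖z s‖ ^ 2) (Set.Ici 0) := by
  apply antitoneOn_of_deriv_nonpos (convex_Ici 0) (hz.continuousOn.norm.pow 2)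
  · intro t ht
    rw [interior_Ici] at ht
    exact (hz.hasDerivAt_norm_sq ht).differentiableAt.differentiableWithinAt
  · intro t ht
    rw [interior_Ici] at ht
    change deriv (fun s => ‖z s‖ ^ 2) t ≤ 0
    rw [(hz.hasDerivAt_norm_sq ht).deriv]
    nlinarith [sq_nonneg ‖T (z t)‖]

lemma IsGradientFlow.antitoneOn_norm_map_sq (hz : IsGradientFlow T z) :
    AntitoneOn (fun s => ‖T (z s)‖ ^ 2) (Set.Ici 0) := by
  apply antitoneOn_of_deriv_nonpos (convex_Ici 0)
    ((T.continuous.comp_continuousOn hz.continuousOn).norm.pow 2)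
  · intro t ht
    rw [interior_Ici] at ht
    exact (hz.hasDerivAt_norm_map_sq ht).differentiableAt.differentiableWithinAt
  · intro t ht
    rw [interior_Ici] at ht
    change deriv (fun s => ‖T (z s)‖ ^ 2) t ≤ 0
    rw [(hz.hasDerivAt_norm_map_sq ht).deriv]
    nlinarith [sq_nonneg ‖adjoint T (T (z t))‖]

lemma IsGradientFlow.norm_le (hz : IsGradientFlow T z) {t : ℝ} (ht : 0 ≤ t) :
    ‖z t‖ ≤ ‖z 0‖ :=
  (sq_le_sq₀ (norm_nonneg _) (norm_nonneg _)).1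
    (hz.antitoneOn_norm_sq (Set.mem_Ici.2 le_rfl) ht ht)

/-- `t ‖T z(t)‖² ≤ ‖z(0)‖²`. -/
lemma IsGradientFlow.mul_norm_map_sq_le (hz : IsGradientFlow T z) {t : ℝ} (ht : 0 < t) :
    t * ‖T (z t)‖ ^ 2 ≤ ‖z 0‖ ^ 2 := by
  -- The mean value theorem for `‖z‖²` produces an `s < t` with `2 t ‖T z(s)‖² = ‖z 0‖² - ‖z t‖²`,
  -- and `‖T z‖` has not increased between `s` and `t`.
  obtain ⟨s, hs, hs'⟩ := exists_hasDerivAt_eq_slope (fun s => ‖z s‖ ^ 2)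
    (fun s => -(2 * ‖T (z s)‖ ^ 2)) ht
    ((hz.continuousOn.mono Set.Icc_subset_Ici_self).norm.pow 2)
    (fun s hs => hz.hasDerivAt_norm_sq hs.1)
  have h1 := hz.antitoneOn_norm_map_sq (Set.mem_Ici.2 hs.1.le) (Set.mem_Ici.2 ht.le) hs.2.le
  simp only [sub_zero] at hs' h1
  rw [eq_div_iff ht.ne'] at hs'
  nlinarith [sq_nonneg ‖z t‖, sq_nonneg ‖T (z t)‖]

lemma IsGradientFlow.tendsto_norm_map (hz : IsGradientFlow T z) :
    Tendsto (fun t => ‖T (z t)‖) atTop (𝓝 0) := by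
  have h : Tendsto (fun t => ‖T (z t)‖ ^ 2) atTop (𝓝 0) := by
    refine squeeze_zero' (Eventually.of_forall fun t => sq_nonneg _) ?_
      (tendsto_const_nhds.div_atTop tendsto_id (a := ‖z 0‖ ^ 2))
    filter_upwards [eventually_gt_atTop 0] with t ht
    rw [le_div_iff₀ (by exact ht), mul_comm]
    exact hz.mul_norm_map_sq_le ht
  simpa [Real.sqrt_sq] using h.sqrt

/-- The gradient flow converges to `0` if it starts in the orthogonal complement of `ker T`. -/
theorem IsGradientFlow.tendsto_zero (hz : IsGradientFlow T z) (h0 : z 0 ∈ T.kerᗮ) :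
    Tendsto z atTop (𝓝 0) := by
  -- Replace `z 0` by a nearby `T†h`: then `⟨T†h, z t⟩ = ⟨h, T (z t)⟩` tends to zero, and the error
  -- is controlled by `‖z t‖ ≤ ‖z 0‖`.
  have hweak : Tendsto (fun t => inner ℝ (z 0) (z t)) atTop (𝓝 0) := by
    rw [Metric.tendsto_nhds]
    intro ε hε
    rw [ContinuousLinearMap.orthogonal_ker] at h0
    have h0' : z 0 ∈ closure (Set.range (adjoint T)) := by
      rw [← SetLike.mem_coe, Submodule.topologicalClosure_coe] at h0
      exact h0
    -- The `+ 1` keeps the tolerance meaningful when `z 0 = 0`.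
    obtain ⟨_, ⟨h, rfl⟩, hh⟩ := Metric.mem_closure_iff.1 h0' (ε / (2 * (‖z 0‖ + 1))) (by positivity)
    have hlim : Tendsto (fun t => ‖h‖ * ‖T (z t)‖) atTop (𝓝 0) := by
      simpa using hz.tendsto_norm_map.const_mul ‖h‖
    filter_upwards [hlim.eventually (gt_mem_nhds (half_pos hε)), eventually_ge_atTop 0]
      with t ht ht0
    rw [dist_zero_right]
    have hsplit : inner ℝ (z 0) (z t)
        = inner ℝ (z 0 - adjoint T h) (z t) + inner ℝ h (T (z t)) := by
      rw [inner_sub_left, ContinuousLinearMap.adjoint_inner_left]; ring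
    rw [hsplit]
    have h1 : ‖inner ℝ (z 0 - adjoint T h) (z t)‖ ≤ ε / 2 := by
      refine (norm_inner_le_norm _ _).trans ?_
      rw [dist_eq_norm] at hh
      calc ‖z 0 - adjoint T h‖ * ‖z t‖
          ≤ (ε / (2 * (‖z 0‖ + 1))) * (‖z 0‖ + 1) := by
            gcongr
            linarith [hz.norm_le ht0]
        _ = ε / 2 := by field_simp
    calc _ ≤ _ := norm_add_le _ _
      _ ≤ ε / 2 + ‖h‖ * ‖T (z t)‖ := add_le_add h1 (norm_inner_le_norm _ _)
      _ < ε := by linarith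
  rw [tendsto_zero_iff_norm_tendsto_zero]
  -- Upgrade to norm convergence through `‖z t‖² = ⟨z 0, z (2t)⟩`.
  have h2 : Tendsto (fun t => ‖z t‖ ^ 2) atTop (𝓝 0) := by
    refine (hweak.comp (tendsto_id.const_mul_atTop (two_pos : (0 : ℝ) < 2))).congr' ?_
    filter_upwards [eventually_ge_atTop 0] with t ht
    simp [hz.norm_sq_eq ht]
  simpa [Real.sqrt_sq] using h2.sqrt

end GradientFlow

end PINN

namespace PINN

set_option linter.unusedSectionVars false

/-! ### Integral operators with dominated kernels -/

section KernelOperator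

variable {Y Θ : Type*} [MeasurableSpace Y] [MeasurableSpace Θ]
  {m : Measure Y} {ν : Measure Θ} [IsFiniteMeasure m] [SFinite ν]

/-- A jointly measurable kernel `k : Y → Θ → ℝ` with `|k y θ| ≤ G θ` for some `G ∈ L²(ν)`. -/
structure IsDominatedKernel (ν : Measure Θ) (k : Y → Θ → ℝ) (G : Θ → ℝ) : Prop where
  meas : Measurable (Function.uncurry k)
  bound : ∀ y θ, |k y θ| ≤ G θ
  memLp : MemLp G 2 ν

variable {k : Y → Θ → ℝ} {G : Θ → ℝ}

lemma IsDominatedKernel.integrable_mul (hk : IsDominatedKernel ν k G) {z : Y → ℝ}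
    (hz : Integrable z m) (θ : Θ) : Integrable (fun y => k y θ * z y) m :=
  hz.bdd_mul (c := G θ) (hk.meas.comp (measurable_id.prodMk measurable_const)).aestronglyMeasurable
    (Eventually.of_forall fun y => hk.bound y θ)

lemma IsDominatedKernel.abs_integral_le (hk : IsDominatedKernel ν k G) {z : Y → ℝ}
    (hz : Integrable z m) (θ : Θ) : |∫ y, k y θ * z y ∂m| ≤ G θ * ∫ y, |z y| ∂m := by
  rw [← integral_const_mul]
  refine (abs_integral_le_integral_abs).trans
    (integral_mono (hk.integrable_mul hz θ).abs (hz.abs.const_mul _) fun y => ?_)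
  simp only [abs_mul]
  exact mul_le_mul_of_nonneg_right (hk.bound y θ) (abs_nonneg _)

lemma IsDominatedKernel.memLp_integral (hk : IsDominatedKernel ν k G) {z : Y → ℝ}
    (hz : Integrable z m) : MemLp (fun θ => ∫ y, k y θ * z y ∂m) 2 ν := by
  refine (hk.memLp.mul_const (∫ y, |z y| ∂m)).mono ?_ (Eventually.of_forall fun θ => ?_)
  · refine AEStronglyMeasurable.integral_prod_right' (μ := ν) (ν := m)
      (f := fun q : Θ × Y => k q.2 q.1 * z q.2) ?_
    exact (hk.meas.comp measurable_swap).aestronglyMeasurable.mul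
      (hz.aestronglyMeasurable.comp_snd)
  · rw [Real.norm_eq_abs, Real.norm_eq_abs]
    exact (hk.abs_integral_le hz θ).trans (le_abs_self _)

lemma integrable_of_Lp (z : Lp ℝ 2 m) : Integrable z m :=
  (Lp.memLp z).integrable one_le_two

/-- Cauchy–Schwarz on a finite measure space; the constant enters the bound for the norm of the
kernel operator. -/
lemma integral_abs_le_norm (z : Lp ℝ 2 m) :
    ∫ y, |z y| ∂m ≤ (m Set.univ ^ ((1 : ℝ) - 1 / 2)).toReal * ‖z‖ := by
  have h1 : ∫ y, |z y| ∂m = (eLpNorm z 1 m).toReal := by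
    rw [eLpNorm_one_eq_lintegral_enorm, ← integral_norm_eq_lintegral_enorm
      (Lp.aestronglyMeasurable z)]
    simp
  rw [h1, Lp.norm_def, ← ENNReal.toReal_mul, mul_comm]
  apply ENNReal.toReal_mono
  · exact ENNReal.mul_ne_top (Lp.eLpNorm_ne_top z)
      (ENNReal.rpow_ne_top_of_nonneg (by norm_num) (measure_ne_top _ _))
  · have := eLpNorm_le_eLpNorm_mul_rpow_measure_univ (p := 1) (q := 2) (μ := m) one_le_two
      (Lp.aestronglyMeasurable z)
    simpa using this

/-- The operator `z ↦ ∫ k(y, ·) z(y) dm(y)` from `L²(m)` to `L²(ν)`. -/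
noncomputable def IsDominatedKernel.op (m : Measure Y) [IsFiniteMeasure m]
    (hk : IsDominatedKernel ν k G) :
    Lp ℝ 2 m →L[ℝ] Lp ℝ 2 ν :=
  LinearMap.mkContinuous
    { toFun := fun z => (hk.memLp_integral (integrable_of_Lp z)).toLp _
      map_add' := fun z z' => by
        rw [← MemLp.toLp_add, MemLp.toLp_eq_toLp_iff]
        refine Eventually.of_forall fun θ => ?_
        simp only [Pi.add_apply]
        rw [← integral_add (hk.integrable_mul (integrable_of_Lp z) θ)
          (hk.integrable_mul (integrable_of_Lp z') θ)]
        refine integral_congr_ae ?_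
        filter_upwards [Lp.coeFn_add z z'] with y hy
        rw [hy, Pi.add_apply, mul_add]
      map_smul' := fun a z => by
        rw [RingHom.id_apply, ← MemLp.toLp_const_smul, MemLp.toLp_eq_toLp_iff]
        refine Eventually.of_forall fun θ => ?_
        simp only [Pi.smul_apply, smul_eq_mul]
        rw [← integral_const_mul]
        refine integral_congr_ae ?_
        filter_upwards [Lp.coeFn_smul a z] with y hy
        rw [hy, Pi.smul_apply, smul_eq_mul]; ring }
    (‖hk.memLp.toLp G‖ * (m Set.univ ^ ((1 : ℝ) - 1 / 2)).toReal) (by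
      intro z
      rw [mul_assoc]
      refine le_trans ?_ (mul_le_mul_of_nonneg_left (integral_abs_le_norm z) (norm_nonneg _))
      refine (Lp.norm_le_mul_norm_of_ae_le_mul ?_).trans_eq (mul_comm _ _)
      filter_upwards [MemLp.coeFn_toLp (hk.memLp_integral (integrable_of_Lp z)),
        MemLp.coeFn_toLp hk.memLp] with θ h1 h2
      simp only [LinearMap.coe_mk, AddHom.coe_mk]
      rw [h1, h2, Real.norm_eq_abs, Real.norm_eq_abs, mul_comm]
      exact (hk.abs_integral_le (integrable_of_Lp z) θ).trans
        (mul_le_mul_of_nonneg_right (le_abs_self _) (integral_nonneg fun _ => abs_nonneg _)))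

lemma IsDominatedKernel.op_coeFn (hk : IsDominatedKernel ν k G) (z : Lp ℝ 2 m) :
    hk.op m z =ᵐ[ν] fun θ => ∫ y, k y θ * z y ∂m :=
  MemLp.coeFn_toLp (hk.memLp_integral (integrable_of_Lp z))

lemma IsDominatedKernel.integrable_mul_right (hk : IsDominatedKernel ν k G) {h : Θ → ℝ}
    (hh : MemLp h 2 ν) (y : Y) : Integrable (fun θ => k y θ * h θ) ν := by
  have h1 : MemLp (k y) 2 ν := hk.memLp.mono
    (hk.meas.comp (measurable_const.prodMk measurable_id)).aestronglyMeasurable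
    (Eventually.of_forall fun θ => by
      rw [Real.norm_eq_abs, Real.norm_eq_abs]; exact (hk.bound y θ).trans (le_abs_self _))
  exact h1.integrable_mul hh

lemma IsDominatedKernel.abs_integral_right_le (hk : IsDominatedKernel ν k G) {h : Θ → ℝ}
    (hh : MemLp h 2 ν) (y : Y) : |∫ θ, k y θ * h θ ∂ν| ≤ ∫ θ, |G θ * h θ| ∂ν := by
  refine abs_integral_le_integral_abs.trans
    (integral_mono (hk.integrable_mul_right hh y).abs (hk.memLp.integrable_mul hh).abs fun θ => ?_)
  simp only [abs_mul]
  exact mul_le_mul_of_nonneg_right ((hk.bound y θ).trans (le_abs_self _)) (abs_nonneg _)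

lemma IsDominatedKernel.aestronglyMeasurable_integral_right (hk : IsDominatedKernel ν k G)
    {h : Θ → ℝ} (hh : MemLp h 2 ν) (m : Measure Y) [SFinite m] :
    AEStronglyMeasurable (fun y => ∫ θ, k y θ * h θ ∂ν) m := by
  refine AEStronglyMeasurable.integral_prod_right' (μ := m) (ν := ν)
    (f := fun q : Y × Θ => k q.1 q.2 * h q.2) ?_
  exact hk.meas.aestronglyMeasurable.mul (hh.aestronglyMeasurable.comp_snd)

lemma IsDominatedKernel.memLp_integral_right (hk : IsDominatedKernel ν k G) {h : Θ → ℝ}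
    (hh : MemLp h 2 ν) : MemLp (fun y => ∫ θ, k y θ * h θ ∂ν) 2 m := by
  refine MemLp.of_bound (hk.aestronglyMeasurable_integral_right hh m) (∫ θ, |G θ * h θ| ∂ν)
    (Eventually.of_forall fun y => ?_)
  exact hk.abs_integral_right_le hh y

lemma IsDominatedKernel.integrable_prod (hk : IsDominatedKernel ν k G) {z : Y → ℝ}
    (hz : Integrable z m) {h : Θ → ℝ} (hh : MemLp h 2 ν) :
    Integrable (fun q : Y × Θ => k q.1 q.2 * h q.2 * z q.1) (m.prod ν) := by
  have h1 : Integrable (fun q : Y × Θ => |z q.1| * |G q.2 * h q.2|) (m.prod ν) :=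
    hz.abs.mul_prod (hk.memLp.integrable_mul hh).abs
  refine h1.mono ((hk.meas.aestronglyMeasurable.mul (hh.aestronglyMeasurable.comp_snd)).mul
    hz.aestronglyMeasurable.comp_fst) (Eventually.of_forall fun q => ?_)
  simp only [Real.norm_eq_abs, abs_mul, abs_abs]
  rw [mul_comm |z q.1|]
  exact mul_le_mul_of_nonneg_right (mul_le_mul_of_nonneg_right
    ((hk.bound _ _).trans (le_abs_self _)) (abs_nonneg _)) (abs_nonneg _)

lemma IsDominatedKernel.integral_comm (hk : IsDominatedKernel ν k G) {z : Y → ℝ}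
    (hz : Integrable z m) {h : Θ → ℝ} (hh : MemLp h 2 ν) :
    ∫ θ, (∫ y, k y θ * z y ∂m) * h θ ∂ν = ∫ y, (∫ θ, k y θ * h θ ∂ν) * z y ∂m := by
  simp_rw [← integral_mul_const]
  rw [integral_integral_swap]
  · refine integral_congr_ae (Eventually.of_forall fun y => integral_congr_ae
      (Eventually.of_forall fun θ => ?_))
    simp only; ring
  · refine (hk.integrable_prod hz hh).swap.congr (Eventually.of_forall fun q => ?_)
    simp [Function.uncurry]; ring

/-- By Fubini, the adjoint integrates the same kernel over the other variable. Hence `T†T` is the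
integral operator with kernel `∫ k(y, θ) k(y', θ) dν(θ)`, which is how the kernels of the training
dynamics arise. -/
lemma IsDominatedKernel.adjoint_op_coeFn (hk : IsDominatedKernel ν k G) (h : Lp ℝ 2 ν) :
    ContinuousLinearMap.adjoint (hk.op m) h =ᵐ[m] fun y => ∫ θ, k y θ * h θ ∂ν := by
  have key : ContinuousLinearMap.adjoint (hk.op m) h
      = (hk.memLp_integral_right (m := m) (Lp.memLp h)).toLp _ := by
    refine ext_inner_left ℝ fun z => ?_
    rw [ContinuousLinearMap.adjoint_inner_right, L2.inner_def, L2.inner_def]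
    have h1 : ∫ θ, inner ℝ (hk.op m z θ) (h θ) ∂ν
        = ∫ θ, (∫ y, k y θ * z y ∂m) * h θ ∂ν := by
      refine integral_congr_ae ?_
      filter_upwards [hk.op_coeFn z] with θ hθ
      rw [hθ, real_inner_comm]; rfl
    rw [h1, hk.integral_comm (integrable_of_Lp z) (Lp.memLp h)]
    refine integral_congr_ae ?_
    filter_upwards [MemLp.coeFn_toLp (hk.memLp_integral_right (m := m) (Lp.memLp h))] with y hy
    rw [hy]; rfl
  rw [key]
  exact MemLp.coeFn_toLp _

end KernelOperator

end PINN

/-! ### Ridge functions of a bounded non-constant activation determine compactly supported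
functionals of order two. -/

namespace PINN

/-! ### Ridge functionals annihilating a bounded activation function -/

section Ridge

open scoped Convolution

variable {Y : Type*} [MeasurableSpace Y] {κ : Measure Y} {R : ℝ} {τ : Y → ℝ}

lemma integrable_mul_comp {a : Y → ℝ} (ha : Integrable a κ) (hτ : Measurable τ)
    (hR : ∀ y, |τ y| ≤ R) {e : ℝ → ℝ} (he : Continuous e) :
    Integrable (fun y => a y * e (τ y)) κ := by
  obtain ⟨C, hC⟩ := (isCompact_Icc (a := -R) (b := R)).exists_bound_of_continuousOn he.continuousOn
  exact ha.mul_bdd (c := C) (he.measurable.comp hτ).aestronglyMeasurable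
    (Eventually.of_forall fun y => hC _ (abs_le.1 (hR y)))

/-- The variable `τ` is bounded, so near a given `l` the derivative is only evaluated on a compact
rectangle, where continuity supplies the dominating constant. -/
lemma hasDerivAt_integral_mul_comp {a : Y → ℝ} (ha : Integrable a κ) (hτ : Measurable τ)
    (hR : ∀ y, |τ y| ≤ R) {e e' : ℝ → ℝ → ℝ} (he : Continuous (Function.uncurry e))
    (he' : Continuous (Function.uncurry e')) (hd : ∀ l t, HasDerivAt (fun l => e l t) (e' l t) l)
    (l : ℝ) :
    HasDerivAt (fun l => ∫ y, a y * e l (τ y) ∂κ) (∫ y, a y * e' l (τ y) ∂κ) l := by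
  obtain ⟨C, hC⟩ := ((isCompact_Icc (a := l - 1) (b := l + 1)).prod
    (isCompact_Icc (a := -R) (b := R))).exists_bound_of_continuousOn he'.continuousOn
  have hcont : ∀ l, Continuous (e l) := fun l => he.comp (Continuous.prodMk_right l)
  have hcont' : ∀ l, Continuous (e' l) := fun l => he'.comp (Continuous.prodMk_right l)
  refine (hasDerivAt_integral_of_dominated_loc_of_deriv_le (bound := fun y => |a y| * C)
    (F := fun l y => a y * e l (τ y)) (F' := fun l y => a y * e' l (τ y))
    (Metric.ball_mem_nhds l one_pos)
    (Eventually.of_forall fun l => (integrable_mul_comp ha hτ hR (hcont l)).aestronglyMeasurable)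
    (integrable_mul_comp ha hτ hR (hcont l))
    (integrable_mul_comp ha hτ hR (hcont' l)).aestronglyMeasurable
    (Eventually.of_forall fun y x hx => ?_) (ha.abs.mul_const _)
    (Eventually.of_forall fun y x _ => (hd x (τ y)).const_mul (a y))).2
  rw [norm_mul, Real.norm_eq_abs]
  refine mul_le_mul_of_nonneg_left (hC (x, τ y) ⟨?_, abs_le.1 (hR y)⟩) (abs_nonneg _)
  rw [Real.ball_eq_Ioo] at hx
  exact ⟨hx.1.le, hx.2.le⟩

/-- Differentiate the annihilation identity `n` times in `l` and put `l = 0`: the function `t ↦ S 0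
(l t + b)` contributes `S n b * t ^ n`, and the terms with factors `l` and `l ^ 2` contribute `S n
b` times the first and second derivative of `t ^ n`. -/
lemma moments_eq_zero {a0 a1 a2 : Y → ℝ} (h0 : Integrable a0 κ) (h1 : Integrable a1 κ)
    (h2 : Integrable a2 κ) (hτ : Measurable τ) (hR : ∀ y, |τ y| ≤ R) {S : ℕ → ℝ → ℝ}
    (hS : ∀ k z, HasDerivAt (S k) (S (k + 1) z) z)
    (hann : ∀ l b, ∫ y, a0 y * S 0 (l * τ y + b) ∂κ + ∫ y, a1 y * (l * S 1 (l * τ y + b)) ∂κ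
      + ∫ y, a2 y * (l ^ 2 * S 2 (l * τ y + b)) ∂κ = 0) (n : ℕ) (b : ℝ) :
    S n b * (∫ y, a0 y * τ y ^ n ∂κ + n * ∫ y, a1 y * τ y ^ (n - 1) ∂κ
      + n * (n - 1) * ∫ y, a2 y * τ y ^ (n - 2) ∂κ) = 0 := by
  have hSc : ∀ k, Continuous (S k) := fun k =>
    continuous_iff_continuousAt.2 fun z => (hS k z).continuousAt
  have hSd : ∀ k l t, HasDerivAt (fun l => S k (l * t + b)) (t * S (k + 1) (l * t + b)) l := by
    intro k l t
    have := (hS k (l * t + b)).comp l (((hasDerivAt_id l).mul_const t).add_const b)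
    refine this.congr_deriv ?_
    simp [mul_comm]
  -- By Leibniz, `e0 n`, `e1 n`, `e2 n` are the `n`-th derivatives in `l` of `S 0 (l t + b)`, `l * S
  -- 1 (l t + b)` and `l ^ 2 * S 2 (l t + b)`. Truncated subtraction in the exponents is harmless,
  -- as the factors `n` and `n (n - 1)` vanish there.
  let e0 : ℕ → ℝ → ℝ → ℝ := fun n l t => t ^ n * S n (l * t + b)
  let e1 : ℕ → ℝ → ℝ → ℝ := fun n l t =>
    n * t ^ (n - 1) * S n (l * t + b) + l * (t ^ n * S (n + 1) (l * t + b))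
  let e2 : ℕ → ℝ → ℝ → ℝ := fun n l t =>
    n * (n - 1) * t ^ (n - 2) * S n (l * t + b) + l * (2 * n * t ^ (n - 1) * S (n + 1) (l * t + b))
      + l ^ 2 * (t ^ n * S (n + 2) (l * t + b))
  have c0 : ∀ n, Continuous (Function.uncurry (e0 n)) := fun n => by
    have := hSc n
    simp only [e0, Function.uncurry_def]; fun_prop
  have c1 : ∀ n, Continuous (Function.uncurry (e1 n)) := fun n => by
    have := hSc n; have := hSc (n + 1)
    simp only [e1, Function.uncurry_def]; fun_prop
  have c2 : ∀ n, Continuous (Function.uncurry (e2 n)) := fun n => by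
    have := hSc n; have := hSc (n + 1); have := hSc (n + 2)
    simp only [e2, Function.uncurry_def]; fun_prop
  have d0 : ∀ n l t, HasDerivAt (fun l => e0 n l t) (e0 (n + 1) l t) l := fun n l t => by
    refine ((hSd n l t).const_mul (t ^ n)).congr_deriv ?_
    simp only [e0]; ring
  have d1 : ∀ n l t, HasDerivAt (fun l => e1 n l t) (e1 (n + 1) l t) l := fun n l t => by
    refine (((hSd n l t).const_mul (n * t ^ (n - 1))).add
      ((hasDerivAt_id l).mul ((hSd (n + 1) l t).const_mul (t ^ n)))).congr_deriv ?_
    rcases n with _ | n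
    · simp [e1]
    · simp [e1]; ring
  have d2 : ∀ n l t, HasDerivAt (fun l => e2 n l t) (e2 (n + 1) l t) l := fun n l t => by
    refine ((((hSd n l t).const_mul (n * (n - 1) * t ^ (n - 2))).add
      ((hasDerivAt_id l).mul ((hSd (n + 1) l t).const_mul (2 * n * t ^ (n - 1))))).add
      ((hasDerivAt_pow 2 l).mul ((hSd (n + 2) l t).const_mul (t ^ n)))).congr_deriv ?_
    rcases n with _ | _ | n
    · simp [e2]; ring
    · simp [e2]; ring
    · simp [e2]; ring
  have key : ∀ n l, ∫ y, a0 y * e0 n l (τ y) ∂κ + ∫ y, a1 y * e1 n l (τ y) ∂κ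
      + ∫ y, a2 y * e2 n l (τ y) ∂κ = 0 := by
    intro n
    induction n with
    | zero => intro l; simpa [e0, e1, e2] using hann l b
    | succ n ih =>
      intro l
      have hd := ((hasDerivAt_integral_mul_comp h0 hτ hR (c0 n) (c0 (n + 1)) (d0 n) l).add
        (hasDerivAt_integral_mul_comp h1 hτ hR (c1 n) (c1 (n + 1)) (d1 n) l)).add
        (hasDerivAt_integral_mul_comp h2 hτ hR (c2 n) (c2 (n + 1)) (d2 n) l)
      refine hd.unique ((hasDerivAt_const l (0 : ℝ)).congr_of_eventuallyEq
        (Eventually.of_forall fun l => ?_))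
      exact ih l
  have := key n 0
  simp only [e0, e1, e2, zero_mul, zero_add, add_zero, ne_eq, OfNat.ofNat_ne_zero,
    not_false_eq_true, zero_pow] at this
  rw [mul_add, mul_add, ← mul_assoc (S n b), ← mul_assoc (S n b), ← integral_const_mul,
    ← integral_const_mul, ← integral_const_mul, ← this]
  congr 1
  · congr 1
    · exact integral_congr_ae (Eventually.of_forall fun y => by simp only; ring)
    · exact integral_congr_ae (Eventually.of_forall fun y => by simp only; ring)
  · exact integral_congr_ae (Eventually.of_forall fun y => by simp only; ring)

/-- If some derivative vanished identically, the function would be a polynomial. The degree is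
lowered step by step: an affine function that is bounded is constant. This is the only place where
boundedness of the activation is needed for its nonlinearity. -/
lemma exists_deriv_ne_zero {S : ℕ → ℝ → ℝ} (hS : ∀ k z, HasDerivAt (S k) (S (k + 1) z) z)
    (hb : ∀ k, ∃ C, ∀ z, |S k z| ≤ C) (hne : ∃ z z', S 0 z ≠ S 0 z') (n : ℕ) :
    ∃ b, S n b ≠ 0 := by
  by_contra! h
  have hconst : ∀ k, (∀ b, S (k + 1) b = 0) → ∀ z z', S k z = S k z' := fun k hk =>
    is_const_of_deriv_eq_zero (fun z => (hS k z).differentiableAt)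
      (fun z => by rw [(hS k z).deriv, hk])
  have hdesc : ∀ k, (∀ b, S (k + 1) b = 0) → ∀ b, S 1 b = 0 := by
    intro k
    induction k with
    | zero => exact fun h => h
    | succ k ih =>
      intro hk
      apply ih
      intro b
      set c := S (k + 1) b with hc
      have hlin : ∀ z, S k z - c * z = S k 0 - c * 0 := fun z =>
        is_const_of_deriv_eq_zero (f := fun z => S k z - c * z)
          (fun z => ((hS k z).sub ((hasDerivAt_id z).const_mul c)).differentiableAt)
          (fun z => by
            have := ((hS k z).sub ((hasDerivAt_id z).const_mul c)).deriv
            rw [hconst (k + 1) hk z b, mul_one, ← hc, sub_self] at this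
            exact this) z 0
      obtain ⟨C, hC⟩ := hb k
      by_contra hne
      have h1 := hlin ((2 * C + 1) / c)
      rw [mul_div_cancel₀ _ hne] at h1
      have h2 := abs_le.1 (hC ((2 * C + 1) / c))
      have h3 := abs_le.1 (hC 0)
      linarith [h2.1, h2.2, h3.1, h3.2]
  obtain ⟨z, z', hzz⟩ := hne
  rcases n with _ | n
  · exact hzz ((h z).trans (h z').symm)
  · exact hzz (hconst 0 (hdesc n h) z z')

/-- The exponential series may be integrated term by term, since `|τ| ≤ R` makes its terms summable
like `R ^ n / n!`. -/
lemma hasSum_moments {a : Y → ℝ} (ha : Integrable a κ) (hτ : Measurable τ)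
    (hR : ∀ y, |τ y| ≤ R) :
    HasSum (fun n : ℕ => Complex.I ^ n / n.factorial * ((∫ y, a y * τ y ^ n ∂κ : ℝ) : ℂ))
      (∫ y, (a y : ℂ) * Complex.exp (τ y * Complex.I) ∂κ) := by
  let F : ℕ → Y → ℂ := fun n y => (a y : ℂ) * ((τ y * Complex.I) ^ n / n.factorial)
  have hFn : ∀ n y, F n y = Complex.I ^ n / n.factorial * ((a y * τ y ^ n : ℝ) : ℂ) := by
    intro n y; simp only [F]; push_cast; ring
  have hint : ∀ n, Integrable (F n) κ := by
    intro n
    have := ((integrable_mul_comp ha hτ hR (continuous_pow n)).ofReal (𝕜 := ℂ)).const_mul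
      (Complex.I ^ n / n.factorial)
    exact this.congr (Eventually.of_forall fun y => (hFn n y).symm)
  have hbound : ∀ n y, ‖F n y‖ ≤ |a y| * (R ^ n / n.factorial) := by
    intro n y
    simp only [F, norm_mul, norm_div, norm_pow, Complex.norm_real, Complex.norm_I, mul_one,
      Real.norm_eq_abs, Complex.norm_natCast]
    gcongr
    exact hR y
  have hsum : Summable fun n => ∫ y, ‖F n y‖ ∂κ := by
    refine Summable.of_nonneg_of_le (fun n => integral_nonneg fun _ => norm_nonneg _) (fun n => ?_)
      ((Real.summable_pow_div_factorial R).mul_left (∫ y, |a y| ∂κ))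
    rw [← integral_mul_const]
    exact integral_mono (hint n).norm (ha.abs.mul_const _) (hbound n)
  have h1 := hasSum_integral_of_summable_integral_norm hint hsum
  have h2 : (fun n => ∫ y, F n y ∂κ)
      = fun n : ℕ => Complex.I ^ n / n.factorial * ((∫ y, a y * τ y ^ n ∂κ : ℝ) : ℂ) := by
    funext n
    rw [← integral_complex_ofReal, ← integral_const_mul]
    exact integral_congr_ae (Eventually.of_forall (hFn n))
  rw [h2] at h1
  have h3 : ∫ y, (a y : ℂ) * Complex.exp (τ y * Complex.I) ∂κ = ∫ y, ∑' n, F n y ∂κ := by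
    refine integral_congr_ae (Eventually.of_forall fun y => ?_)
    simp only [F]
    rw [tsum_mul_left, Complex.exp_eq_exp_ℂ, NormedSpace.exp_eq_tsum_div]
  rw [h3]
  exact h1

/-- The hypothesis says that `f ↦ ∫ (a0 f(τ) + a1 f'(τ) + a2 f''(τ))` kills all powers. The
exponential series then shows that it kills `f(t) = exp(it)`, whose derivatives bring the factors
`i` and `-1`. -/
lemma integral_exp_eq_zero_of_moments {a0 a1 a2 : Y → ℝ} (h0 : Integrable a0 κ)
    (h1 : Integrable a1 κ) (h2 : Integrable a2 κ) (hτ : Measurable τ) (hR : ∀ y, |τ y| ≤ R)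
    (hmom : ∀ n : ℕ, ∫ y, a0 y * τ y ^ n ∂κ + n * ∫ y, a1 y * τ y ^ (n - 1) ∂κ
      + n * (n - 1) * ∫ y, a2 y * τ y ^ (n - 2) ∂κ = 0) :
    ∫ y, (a0 y : ℂ) * Complex.exp (τ y * Complex.I) ∂κ
      + Complex.I * ∫ y, (a1 y : ℂ) * Complex.exp (τ y * Complex.I) ∂κ
      - ∫ y, (a2 y : ℂ) * Complex.exp (τ y * Complex.I) ∂κ = 0 := by
  -- Shifting the series by two, one and zero places aligns the terms that come from the power `n +
  -- 2`; the terms split off are handled by the cases `n = 0` and `n = 1` of the hypothesis.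
  have s0 := (hasSum_nat_add_iff' 2).2 (hasSum_moments h0 hτ hR)
  have s1 := ((hasSum_nat_add_iff' 1).2 (hasSum_moments h1 hτ hR)).mul_left Complex.I
  have s2 := hasSum_moments h2 hτ hR
  have hs := (s0.add s1).sub s2
  have hzero := hs.unique (by
    convert hasSum_zero using 1
    funext n
    have := congrArg (fun x : ℝ => Complex.I ^ (n + 2) / (n + 2).factorial * (x : ℂ)) (hmom (n + 2))
    simp only [Complex.ofReal_zero, mul_zero] at this
    rw [← this]
    have e1 : n + 2 - 1 = n + 1 := rfl
    have e2 : n + 2 - 2 = n := rfl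
    rw [e1, e2]
    have f1 : (((n + 2).factorial : ℕ) : ℂ) = (n + 2) * (n + 1) * n.factorial := by
      rw [Nat.factorial_succ, Nat.factorial_succ]; push_cast; ring
    have f2 : (((n + 1).factorial : ℕ) : ℂ) = (n + 1) * n.factorial := by
      rw [Nat.factorial_succ]; push_cast; ring
    rw [f1, f2]
    have g0 : (n.factorial : ℂ) ≠ 0 := by exact_mod_cast n.factorial_ne_zero
    have g1 : (n : ℂ) + 1 ≠ 0 := by exact_mod_cast n.succ_ne_zero
    have g2 : (n : ℂ) + 2 ≠ 0 := by exact_mod_cast (n + 1).succ_ne_zero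
    push_cast
    field_simp
    rw [pow_add Complex.I n 2, Complex.I_sq, pow_succ Complex.I n]
    linear_combination (n + 2) * Complex.I ^ n * ((∫ y, a1 y * τ y ^ (n + 1) ∂κ : ℝ) : ℂ)
      * Complex.I_sq)
  have m0 : ∫ y, a0 y ∂κ = 0 := by simpa using hmom 0
  have m1 : ∫ y, a0 y * τ y ∂κ = -∫ y, a1 y ∂κ := by
    have : ∫ y, a0 y * τ y ∂κ + ∫ y, a1 y ∂κ = 0 := by simpa using hmom 1
    linarith
  simp only [Finset.sum_range_succ, Finset.sum_range_zero, zero_add, pow_zero, pow_one, mul_one,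
    Nat.factorial_zero, Nat.factorial_one, Nat.cast_one, div_one, one_mul, m0, m1] at hzero
  rw [Complex.ofReal_zero, Complex.ofReal_neg] at hzero
  linear_combination hzero

/-- A functional of order two in a bounded variable `τ` which annihilates all the functions
`t ↦ σ(λt + b)`, for a bounded non-constant `σ`, annihilates `t ↦ exp(it)`. -/
theorem integral_exp_eq_zero_of_annihilates {a0 a1 a2 : Y → ℝ} (h0 : Integrable a0 κ)
    (h1 : Integrable a1 κ) (h2 : Integrable a2 κ) (hτ : Measurable τ) (hR : ∀ y, |τ y| ≤ R)
    [SFinite κ]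
    {s0 s1 s2 : ℝ → ℝ} (hs0 : ∀ z, HasDerivAt s0 (s1 z) z) (hs1 : ∀ z, HasDerivAt s1 (s2 z) z)
    (hc2 : Continuous s2) {C : ℝ} (b0 : ∀ z, |s0 z| ≤ C) (b1 : ∀ z, |s1 z| ≤ C)
    (b2 : ∀ z, |s2 z| ≤ C) (hne : ∃ z z', s0 z ≠ s0 z')
    (hann : ∀ l b, ∫ y, a0 y * s0 (l * τ y + b) ∂κ + ∫ y, a1 y * (l * s1 (l * τ y + b)) ∂κ
      + ∫ y, a2 y * (l ^ 2 * s2 (l * τ y + b)) ∂κ = 0) :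
    ∫ y, (a0 y : ℂ) * Complex.exp (τ y * Complex.I) ∂κ
      + Complex.I * ∫ y, (a1 y : ℂ) * Complex.exp (τ y * Complex.I) ∂κ
      - ∫ y, (a2 y : ℂ) * Complex.exp (τ y * Complex.I) ∂κ = 0 := by
  have hc0 : Continuous s0 := continuous_iff_continuousAt.2 fun z => (hs0 z).continuousAt
  have hc1 : Continuous s1 := continuous_iff_continuousAt.2 fun z => (hs1 z).continuousAt
  -- a smooth mollification of `s0` that is still not constant
  obtain ⟨z, z', hzz⟩ := hne
  let φ : ℕ → ContDiffBump (0 : ℝ) := fun n =>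
    ⟨1 / (n + 1 : ℝ) / 2, 1 / (n + 1 : ℝ), by positivity, half_lt_self (by positivity)⟩
  have hφ : Tendsto (fun n => (φ n).rOut) atTop (𝓝 0) := tendsto_one_div_add_atTop_nhds_zero_nat
  obtain ⟨n, hn⟩ : ∃ n,
      ((φ n).normed volume ⋆[ContinuousLinearMap.lsmul ℝ ℝ, volume] s0) z
      ≠ ((φ n).normed volume ⋆[ContinuousLinearMap.lsmul ℝ ℝ, volume] s0) z' := by
    by_contra! h
    have l1 := ContDiffBump.convolution_tendsto_right_of_continuous (μ := volume) hφ hc0 z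
    have l2 := ContDiffBump.convolution_tendsto_right_of_continuous (μ := volume) hφ hc0 z'
    simp only [h] at l1
    exact hzz (tendsto_nhds_unique l1 l2)
  set ρ : ℝ → ℝ := (φ n).normed volume with hρ
  have hρs : ContDiff ℝ ∞ ρ := (φ n).contDiff_normed
  have hρc : HasCompactSupport ρ := (φ n).hasCompactSupport_normed
  have hρks : ∀ k, ContDiff ℝ ∞ (iteratedDeriv k ρ) := fun k => by
    rw [iteratedDeriv_eq_iterate]; exact ContDiff.iterate_deriv k hρs
  have hρkc : ∀ k, HasCompactSupport (iteratedDeriv k ρ) := fun k => by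
    induction k with
    | zero => simpa using hρc
    | succ k ih => rw [iteratedDeriv_succ]; exact ih.deriv
  -- All derivatives fall on the bump `ρ`, so the mollified activation has bounded derivatives of
  -- every order, as arbitrarily many differentiations in `l` require.
  let S : ℕ → ℝ → ℝ := fun k => iteratedDeriv k ρ ⋆[ContinuousLinearMap.lsmul ℝ ℝ, volume] s0
  have hS : ∀ k z, HasDerivAt (S k) (S (k + 1) z) z := fun k z => by
    simp only [S, iteratedDeriv_succ]
    exact (hρkc k).hasDerivAt_convolution_left _ ((hρks k).of_le (by simp))
      hc0.locallyIntegrable z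
  have hSb : ∀ k, ∃ C, ∀ z, |S k z| ≤ C := fun k => by
    refine ⟨∫ t, |iteratedDeriv k ρ t| * C, fun z => ?_⟩
    have hi : Integrable (iteratedDeriv k ρ) :=
      (hρks k).continuous.integrable_of_hasCompactSupport (hρkc k)
    simp only [S, convolution_def, ContinuousLinearMap.lsmul_apply, smul_eq_mul]
    refine abs_integral_le_integral_abs.trans (integral_mono_of_nonneg
      (Eventually.of_forall fun _ => abs_nonneg _) (hi.abs.mul_const _)
      (Eventually.of_forall fun t => ?_))
    simp only [abs_mul]
    exact mul_le_mul_of_nonneg_left (b0 _) (abs_nonneg _)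
  have hρi : Integrable ρ := hρs.continuous.integrable_of_hasCompactSupport hρc
  have hconv : ∀ (f f' : ℝ → ℝ), Continuous f → Continuous f' → (∀ z, HasDerivAt f (f' z) z) →
      (∀ z, |f z| ≤ C) → (∀ z, |f' z| ≤ C) → ∀ z,
      HasDerivAt (fun z => ∫ t, ρ t * f (z - t)) (∫ t, ρ t * f' (z - t)) z := by
    intro f f' hf hf' hd hb hb' z
    have hi : ∀ g : ℝ → ℝ, Continuous g → (∀ z, |g z| ≤ C) → ∀ z,
        Integrable fun t => ρ t * g (z - t) := fun g hg hgb z =>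
      hρi.mul_bdd (c := C) (by fun_prop) (Eventually.of_forall fun t => hgb _)
    refine (hasDerivAt_integral_of_dominated_loc_of_deriv_le (bound := fun t => |ρ t| * C)
      (F := fun z t => ρ t * f (z - t)) (F' := fun z t => ρ t * f' (z - t))
      (Metric.ball_mem_nhds z one_pos)
      (Eventually.of_forall fun l => (hi f hf hb l).aestronglyMeasurable) (hi f hf hb z)
      (hi f' hf' hb' z).aestronglyMeasurable
      (Eventually.of_forall fun t x _ => ?_) (hρi.abs.mul_const _)
      (Eventually.of_forall fun t x _ => ?_)).2
    · rw [norm_mul, Real.norm_eq_abs]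
      exact mul_le_mul_of_nonneg_left (hb' _) (abs_nonneg _)
    · have := (hd (x - t)).comp x ((hasDerivAt_id x).sub_const t)
      exact (this.congr_deriv (by simp)).const_mul (ρ t)
  have hS0 : ∀ z, S 0 z = ∫ t, ρ t * s0 (z - t) := fun z => by
    simp [S, convolution_def]
  -- The first two derivatives can also be put on `s0` instead of `ρ`; in this form the annihilation
  -- hypothesis can be averaged.
  have hS1 : ∀ z, S 1 z = ∫ t, ρ t * s1 (z - t) := fun z =>
    (hS 0 z).unique ((hconv s0 s1 hc0 hc1 hs0 b0 b1 z).congr_of_eventuallyEq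
      (Eventually.of_forall hS0))
  have hS2 : ∀ z, S 2 z = ∫ t, ρ t * s2 (z - t) := fun z =>
    (hS 1 z).unique ((hconv s1 s2 hc1 hc2 hs1 b1 b2 z).congr_of_eventuallyEq
      (Eventually.of_forall hS1))
  have hfub : ∀ (a : Y → ℝ), Integrable a κ → ∀ s : ℝ → ℝ, Continuous s → (∀ z, |s z| ≤ C) →
      ∀ l b, ∫ y, a y * (∫ t, ρ t * s (l * τ y + b - t)) ∂κ
        = ∫ t, ρ t * ∫ y, a y * s (l * τ y + (b - t)) ∂κ := by
    intro a ha s hs hsb l b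
    simp_rw [← integral_const_mul]
    rw [integral_integral_swap]
    · refine integral_congr_ae (Eventually.of_forall fun t => integral_congr_ae
        (Eventually.of_forall fun y => ?_))
      simp only [add_sub_assoc]; ring
    · have : Integrable (fun q : Y × ℝ => a q.1 * ρ q.2) (κ.prod volume) := ha.mul_prod hρi
      refine (this.mul_bdd (c := C) (g := fun q : Y × ℝ => s (l * τ q.1 + b - q.2)) ?_
        (Eventually.of_forall fun q => hsb _)).congr (Eventually.of_forall fun q => ?_)
      · refine (hs.measurable.comp ?_).aestronglyMeasurable
        exact (((hτ.comp measurable_fst).const_mul l).add_const b).sub measurable_snd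
      · simp [Function.uncurry]; ring
  have hiρ : ∀ (a : Y → ℝ), Integrable a κ → ∀ s : ℝ → ℝ, Continuous s → (∀ z, |s z| ≤ C) →
      ∀ l b, Integrable (fun t => ρ t * ∫ y, a y * s (l * τ y + (b - t)) ∂κ) := by
    intro a ha s hs hsb l b
    have hm : StronglyMeasurable (Function.uncurry fun (t : ℝ) (y : Y) =>
        s (l * τ y + (b - t))) := by
      refine (hs.measurable.comp ?_).stronglyMeasurable
      exact ((hτ.comp measurable_snd).const_mul l).add (measurable_fst.const_sub b)
    refine hρi.mul_bdd (c := ∫ y, |a y| * C ∂κ) ?_ (Eventually.of_forall fun t => ?_)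
    · exact AEStronglyMeasurable.integral_prod_right' (μ := volume) (ν := κ)
        (f := fun q : ℝ × Y => a q.2 * s (l * τ q.2 + (b - q.1)))
        (ha.aestronglyMeasurable.comp_snd.mul hm.aestronglyMeasurable)
    · refine abs_integral_le_integral_abs.trans (integral_mono_of_nonneg
        (Eventually.of_forall fun _ => abs_nonneg _) (ha.abs.mul_const _)
        (Eventually.of_forall fun y => ?_))
      simp only [abs_mul]
      exact mul_le_mul_of_nonneg_left (hsb _) (abs_nonneg _)
  -- The hypothesis holds for every bias, so it may be shifted to `b - t` and integrated against `ρ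
  -- t`.
  have hannS : ∀ l b, ∫ y, a0 y * S 0 (l * τ y + b) ∂κ + ∫ y, a1 y * (l * S 1 (l * τ y + b)) ∂κ
      + ∫ y, a2 y * (l ^ 2 * S 2 (l * τ y + b)) ∂κ = 0 := by
    intro l b
    simp_rw [hS0, hS1, hS2]
    have r1 : ∀ y, a1 y * (l * ∫ t, ρ t * s1 (l * τ y + b - t))
        = (a1 y * l) * ∫ t, ρ t * s1 (l * τ y + b - t) := fun y => by ring
    have r2 : ∀ y, a2 y * (l ^ 2 * ∫ t, ρ t * s2 (l * τ y + b - t))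
        = (a2 y * l ^ 2) * ∫ t, ρ t * s2 (l * τ y + b - t) := fun y => by ring
    simp_rw [r1, r2]
    rw [hfub _ h0 _ hc0 b0, hfub _ (h1.mul_const l) _ hc1 b1, hfub _ (h2.mul_const _) _ hc2 b2,
      ← integral_add (hiρ _ h0 _ hc0 b0 l b) (hiρ _ (h1.mul_const l) _ hc1 b1 l b),
      ← integral_add (by
          exact (hiρ _ h0 _ hc0 b0 l b).add (hiρ _ (h1.mul_const l) _ hc1 b1 l b))
        (hiρ _ (h2.mul_const _) _ hc2 b2 l b)]
    refine integral_eq_zero_of_ae (Eventually.of_forall fun t => ?_)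
    have := hann l (b - t)
    simp only [mul_assoc, Pi.zero_apply]
    rw [← mul_add, ← mul_add, this, mul_zero]
  refine integral_exp_eq_zero_of_moments h0 h1 h2 hτ hR fun n => ?_
  -- The bias is chosen separately for every `n`, so as to divide by `S n b`.
  obtain ⟨b, hb⟩ := exists_deriv_ne_zero hS hSb ⟨z, z', by simpa [S] using hn⟩ n
  exact (mul_eq_zero.1 (moments_eq_zero h0 h1 h2 hτ hR hS hannS n b)).resolve_left hb

end Ridge

end PINN

namespace PINN

/-! ### Functionals of order two annihilating all plane waves -/

section PlaneWaves

open scoped SchwartzMap FourierTransform LineDeriv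

variable {d : ℕ} {Y : Type*} [MeasurableSpace Y] {κ : Measure Y}

lemma integrable_mul_exp {a : Y → ℝ} (ha : Integrable a κ) {τ : Y → ℝ} (hτ : Measurable τ) :
    Integrable (fun y => (a y : ℂ) * Complex.exp (τ y * Complex.I)) κ := by
  refine ha.ofReal.mul_bdd (c := 1) ?_ (Eventually.of_forall fun y => ?_)
  · exact (Complex.measurable_exp.comp
      ((Complex.measurable_ofReal.comp hτ).mul_const _)).aestronglyMeasurable
  · rw [Complex.norm_exp_ofReal_mul_I]

/-- Write the inverse Fourier transform as a superposition of plane waves and exchange the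
integrals. The factor `2π` comes from the normalization `exp(2πi ξ · x)` of the transform. -/
lemma integral_mul_fourierInv [SFinite κ] {a : Y → ℝ} (ha : Integrable a κ) {π : Y → Euc d}
    (hπ : Measurable π) (g : 𝓢(Euc d, ℂ)) :
    Integrable (fun ξ => g ξ *
      ∫ y, (a y : ℂ) * Complex.exp ((inner ℝ ((2 * Real.pi) • ξ) (π y) : ℝ) * Complex.I) ∂κ) ∧
    ∫ y, (a y : ℂ) * (𝓕⁻ g) (π y) ∂κ = ∫ ξ, g ξ *
      ∫ y, (a y : ℂ) * Complex.exp ((inner ℝ ((2 * Real.pi) • ξ) (π y) : ℝ) * Complex.I) ∂κ := by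
  have hint : Integrable (fun q : Y × Euc d => (a q.1 : ℂ) * g q.2 *
      Complex.exp ((inner ℝ ((2 * Real.pi) • q.2) (π q.1) : ℝ) * Complex.I)) (κ.prod volume) := by
    refine ((ha.ofReal (𝕜 := ℂ)).mul_prod g.integrable).mul_bdd (c := 1) ?_
      (Eventually.of_forall fun y => ?_)
    · refine (Complex.measurable_exp.comp
        ((Complex.measurable_ofReal.comp ?_).mul_const _)).aestronglyMeasurable
      exact (Measurable.const_smul measurable_snd (2 * Real.pi)).inner (hπ.comp measurable_fst)
    · rw [Complex.norm_exp_ofReal_mul_I]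
  constructor
  · have := hint.integral_prod_right
    refine this.congr (Eventually.of_forall fun ξ => ?_)
    simp only
    rw [← integral_const_mul]
    exact integral_congr_ae (Eventually.of_forall fun y => by simp only; ring)
  · calc ∫ y, (a y : ℂ) * (𝓕⁻ g) (π y) ∂κ
        = ∫ y, (∫ ξ, (a y : ℂ) * g ξ *
            Complex.exp ((inner ℝ ((2 * Real.pi) • ξ) (π y) : ℝ) * Complex.I)) ∂κ := by
          refine integral_congr_ae (Eventually.of_forall fun y => ?_)
          simp only [SchwartzMap.fourierInv_coe, Real.fourierInv_eq']
          rw [← integral_const_mul]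
          refine integral_congr_ae (Eventually.of_forall fun ξ => ?_)
          simp only [inner_smul_left, smul_eq_mul, RCLike.conj_to_real]
          ring
      _ = ∫ ξ, ∫ y, (a y : ℂ) * g ξ *
            Complex.exp ((inner ℝ ((2 * Real.pi) • ξ) (π y) : ℝ) * Complex.I) ∂κ :=
          integral_integral_swap hint
      _ = _ := by
          refine integral_congr_ae (Eventually.of_forall fun ξ => ?_)
          simp only
          rw [← integral_const_mul]
          exact integral_congr_ae (Eventually.of_forall fun y => by simp only; ring)

/-- A functional of order two that annihilates all plane waves annihilates the smooth functions
with compact support. -/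
theorem integral_eq_zero_of_planeWaves [SFinite κ] {π : Y → Euc d} (hπ : Measurable π)
    {α : Y → ℝ} {β : Fin d → Y → ℝ} {γ : Fin d → Fin d → Y → ℝ} (hα : Integrable α κ)
    (hβ : ∀ i, Integrable (β i) κ) (hγ : ∀ i j, Integrable (γ i j) κ)
    (hw : ∀ w : Euc d, ∫ y, (α y : ℂ) * Complex.exp ((inner ℝ w (π y) : ℝ) * Complex.I) ∂κ
      + Complex.I * ∫ y, ((∑ i, w i * β i y : ℝ) : ℂ)
        * Complex.exp ((inner ℝ w (π y) : ℝ) * Complex.I) ∂κ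
      - ∫ y, ((∑ i, ∑ j, w i * w j * γ i j y : ℝ) : ℂ)
        * Complex.exp ((inner ℝ w (π y) : ℝ) * Complex.I) ∂κ = 0)
    {p : Euc d → ℝ} (hp : ContDiff ℝ ∞ p) (hpc : HasCompactSupport p) :
    ∫ y, α y * p (π y) ∂κ + ∑ i, ∫ y, β i y * partialDeriv i p (π y) ∂κ
      + ∑ i, ∑ j, ∫ y, γ i j y * partialDeriv i (partialDeriv j p) (π y) ∂κ = 0 := by
  let f : 𝓢(Euc d, ℂ) := HasCompactSupport.toSchwartzMap (f := fun x => (p x : ℂ))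
    (hpc.comp_left (g := fun r : ℝ => (r : ℂ)) Complex.ofReal_zero)
    (Complex.ofRealCLM.contDiff.comp hp)
  have hf : ∀ x, f x = p x := fun x => rfl
  let e : Fin d → Euc d := fun i => EuclideanSpace.single i 1
  have hofReal : ∀ (q : Euc d → ℝ) (x : Euc d), DifferentiableAt ℝ q x → ∀ v,
      fderiv ℝ (fun x => (q x : ℂ)) x v = (fderiv ℝ q x v : ℂ) := by
    intro q x hq v
    have := (Complex.ofRealCLM.hasFDerivAt.comp x hq.hasFDerivAt).fderiv
    have h2 : (fun x => (q x : ℂ)) = Complex.ofRealCLM ∘ q := rfl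
    rw [h2, this]; rfl
  have hpd : ∀ j, ContDiff ℝ ∞ (partialDeriv j p) := fun j =>
    (hp.fderiv_right (m := ∞) (by simp)).clm_apply contDiff_const
  have hf1 : ∀ i x,
      (∂_{e i} f) x = ((partialDeriv i p x : ℝ) : ℂ) := fun i x => by
    rw [SchwartzMap.lineDerivOp_apply_eq_fderiv]
    exact hofReal p x (hp.differentiable (by simp) x) _
  have hf2 : ∀ i j x,
      (∂_{e i} (∂_{e j} f)) x = ((partialDeriv i (partialDeriv j p) x : ℝ) : ℂ) := by
    intro i j x
    rw [SchwartzMap.lineDerivOp_apply_eq_fderiv]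
    have : ((∂_{e j} f : 𝓢(Euc d, ℂ)) : Euc d → ℂ) = fun x => (partialDeriv j p x : ℂ) :=
      funext (hf1 j)
    rw [this]
    exact hofReal _ x ((hpd j).differentiable (by simp) x) _
  have htg : ∀ i, (fun ξ : Euc d => (inner ℝ ξ (e i) : ℝ)).HasTemperateGrowth := fun i => by
    fun_prop
  have hin : ∀ i (ξ : Euc d), inner ℝ ξ (e i) = ξ i := fun i ξ => by
    simp [e, EuclideanSpace.inner_single_right]
  -- On the Fourier side derivatives become multiplications, so the functional of order two becomes
  -- a single integral against `𝓕 f`.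
  have hF1 : ∀ i ξ, (𝓕 (∂_{e i} f)) ξ = (2 * Real.pi * Complex.I) * (ξ i * (𝓕 f) ξ) := by
    intro i ξ
    rw [SchwartzMap.fourier_lineDerivOp_eq, smul_apply,
      SchwartzMap.smulLeftCLM_apply_apply (htg i), hin, smul_eq_mul, Complex.real_smul]
  have hF2 : ∀ i j ξ, (𝓕 (∂_{e i} (∂_{e j} f))) ξ
      = (2 * Real.pi * Complex.I) * (ξ i * ((2 * Real.pi * Complex.I) * (ξ j * (𝓕 f) ξ))) := by
    intro i j ξ
    rw [SchwartzMap.fourier_lineDerivOp_eq, smul_apply,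
      SchwartzMap.smulLeftCLM_apply_apply (htg i), hin, smul_eq_mul, Complex.real_smul, hF1]
  set E : (Y → ℝ) → Euc d → ℂ := fun a ξ =>
    ∫ y, (a y : ℂ) * Complex.exp ((inner ℝ ((2 * Real.pi) • ξ) (π y) : ℝ) * Complex.I) ∂κ with hE
  have key : ∀ (a : Y → ℝ), Integrable a κ → ∀ (h : 𝓢(Euc d, ℂ)) (q : Euc d → ℝ),
      (∀ x, h x = q x) → Integrable (fun ξ => (𝓕 h) ξ * E a ξ) ∧
        ((∫ y, a y * q (π y) ∂κ : ℝ) : ℂ) = ∫ ξ, (𝓕 h) ξ * E a ξ := by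
    intro a ha h q hq
    obtain ⟨h1, h2⟩ := integral_mul_fourierInv ha hπ (𝓕 h)
    refine ⟨h1, ?_⟩
    rw [← h2, ← integral_complex_ofReal]
    refine integral_congr_ae (Eventually.of_forall fun y => ?_)
    simp only [FourierTransform.fourierInv_fourier_eq, hq]
    push_cast; rfl
  have hm : ∀ ξ : Euc d, Measurable fun y => (inner ℝ ((2 * Real.pi) • ξ) (π y) : ℝ) :=
    fun ξ => measurable_const.inner hπ
  rw [← Complex.ofReal_eq_zero]
  push_cast
  obtain ⟨i0, k0⟩ := key α hα f p hf
  have i1 := fun i => (key (β i) (hβ i) (∂_{e i} f) _ (hf1 i)).1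
  have k1 := fun i => (key (β i) (hβ i) (∂_{e i} f) _ (hf1 i)).2
  have i2 := fun i j => (key (γ i j) (hγ i j) (∂_{e i} (∂_{e j} f)) _ (hf2 i j)).1
  have k2 := fun i j => (key (γ i j) (hγ i j) (∂_{e i} (∂_{e j} f)) _ (hf2 i j)).2
  simp_rw [k0, k1, k2]
  rw [← integral_finsetSum _ fun i _ => i1 i]
  simp_rw [← fun i => integral_finsetSum _ fun j (_ : j ∈ (Finset.univ : Finset (Fin d))) => i2 i j]
  have i2' : ∀ i, Integrable fun ξ => ∑ j, (𝓕 (∂_{e i} (∂_{e j} f))) ξ * E (γ i j) ξ :=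
    fun i => integrable_finsetSum _ fun j _ => i2 i j
  rw [← integral_finsetSum _ fun i _ => i2' i,
    ← integral_add i0 (integrable_finsetSum _ fun i _ => i1 i), ← integral_add
      (by exact i0.add (integrable_finsetSum _ fun i _ => i1 i))
      (integrable_finsetSum _ fun i _ => i2' i)]
  refine integral_eq_zero_of_ae (Eventually.of_forall fun ξ => ?_)
  -- The integrand is `𝓕 f ξ` times the functional applied to the plane wave of frequency `2πξ`,
  -- hence zero pointwise.
  have h := hw ((2 * Real.pi) • ξ)
  have s1 : ∫ y, ((∑ i, ((2 * Real.pi) • ξ) i * β i y : ℝ) : ℂ)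
      * Complex.exp ((inner ℝ ((2 * Real.pi) • ξ) (π y) : ℝ) * Complex.I) ∂κ
      = ∑ i, (2 * Real.pi * ξ i : ℂ) * E (β i) ξ := by
    simp_rw [hE, ← integral_const_mul]
    rw [← integral_finsetSum _ fun i _ => (integrable_mul_exp (hβ i) (hm ξ)).const_mul _]
    refine integral_congr_ae (Eventually.of_forall fun y => ?_)
    simp only [PiLp.smul_apply, smul_eq_mul]
    push_cast
    rw [Finset.sum_mul]
    exact Finset.sum_congr rfl fun i _ => by ring
  have s2 : ∫ y, ((∑ i, ∑ j, ((2 * Real.pi) • ξ) i * ((2 * Real.pi) • ξ) j * γ i j y : ℝ) : ℂ)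
      * Complex.exp ((inner ℝ ((2 * Real.pi) • ξ) (π y) : ℝ) * Complex.I) ∂κ
      = ∑ i, ∑ j, (2 * Real.pi * ξ i * (2 * Real.pi * ξ j) : ℂ) * E (γ i j) ξ := by
    simp_rw [hE, ← integral_const_mul]
    have hi : ∀ i j, Integrable (fun y => (2 * Real.pi * ξ i * (2 * Real.pi * ξ j) : ℂ) *
        ((γ i j y : ℂ) *
          Complex.exp ((inner ℝ ((2 * Real.pi) • ξ) (π y) : ℝ) * Complex.I))) κ :=
      fun i j => (integrable_mul_exp (hγ i j) (hm ξ)).const_mul _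
    simp_rw [← fun i => integral_finsetSum _
      fun j (_ : j ∈ (Finset.univ : Finset (Fin d))) => hi i j]
    rw [← integral_finsetSum _ fun i _ => integrable_finsetSum _ fun j _ => hi i j]
    refine integral_congr_ae (Eventually.of_forall fun y => ?_)
    simp only [PiLp.smul_apply, smul_eq_mul]
    push_cast
    rw [Finset.sum_mul]
    refine Finset.sum_congr rfl fun i _ => ?_
    rw [Finset.sum_mul]
    exact Finset.sum_congr rfl fun j _ => by ring
  rw [s1, s2] at h
  simp only [Pi.zero_apply]
  simp_rw [hF1, hF2]
  have t1 : ∑ i, (2 * Real.pi * Complex.I) * (ξ i * (𝓕 f) ξ) * E (β i) ξ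
      = (𝓕 f) ξ * (Complex.I * ∑ i, (2 * Real.pi * ξ i : ℂ) * E (β i) ξ) := by
    simp_rw [Finset.mul_sum]
    exact Finset.sum_congr rfl fun i _ => by ring
  have t2 : ∑ i, ∑ j, (2 * Real.pi * Complex.I)
      * (ξ i * ((2 * Real.pi * Complex.I) * (ξ j * (𝓕 f) ξ))) * E (γ i j) ξ
      = (𝓕 f) ξ * -(∑ i, ∑ j, (2 * Real.pi * ξ i * (2 * Real.pi * ξ j) : ℂ) * E (γ i j) ξ) := by
    simp_rw [← Finset.sum_neg_distrib, Finset.mul_sum]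
    refine Finset.sum_congr rfl fun i _ => Finset.sum_congr rfl fun j _ => ?_
    linear_combination (2 * Real.pi * (2 * Real.pi)) * ξ i * ξ j * (𝓕 f) ξ * E (γ i j) ξ
      * Complex.I_sq
  rw [t1, t2]
  linear_combination (𝓕 f) ξ * h

end PlaneWaves

end PINN

/-! ### Mollification, weak derivatives and measure-theoretic tools. -/

namespace PINN

/-! ### A radial mollifier -/

section Mollifier

open scoped Convolution

variable {d : ℕ}

/-- A bump function on the line, supported in `[1/4, 3/4]`. -/
noncomputable def radialWeight : ContDiffBump (1 / 2 : ℝ) :=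
  ⟨1 / 8, 1 / 4, by norm_num, by norm_num⟩

lemma radialWeight_eq_zero_of_ge {s : ℝ} (hs : 3 / 4 ≤ s) : radialWeight s = 0 :=
  radialWeight.zero_of_le_dist (by
    rw [Real.dist_eq, abs_of_nonneg (by linarith)]
    simp only [radialWeight]; linarith)

/-- The radial profile `t ↦ ∫_t^1 φ` of the mollifier. -/
noncomputable def radialProfile (t : ℝ) : ℝ := ∫ s in t..1, radialWeight s

lemma hasDerivAt_radialProfile (t : ℝ) : HasDerivAt radialProfile (-radialWeight t) t :=
  intervalIntegral.integral_hasDerivAt_left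
    (radialWeight.continuous.intervalIntegrable _ _)
    radialWeight.continuous.stronglyMeasurable.stronglyMeasurableAtFilter
    radialWeight.continuous.continuousAt

lemma contDiff_radialProfile : ContDiff ℝ ∞ radialProfile := by
  rw [contDiff_infty_iff_deriv]
  refine ⟨fun t => (hasDerivAt_radialProfile t).differentiableAt, ?_⟩
  have : deriv radialProfile = fun t => -radialWeight t :=
    funext fun t => (hasDerivAt_radialProfile t).deriv
  rw [this]
  exact radialWeight.contDiff.neg

lemma radialProfile_eq_zero {t : ℝ} (ht : 3 / 4 ≤ t) : radialProfile t = 0 := by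
  rw [radialProfile, intervalIntegral.integral_congr (g := fun _ => 0)]
  · simp
  · intro s hs
    refine radialWeight_eq_zero_of_ge ?_
    rcases Set.mem_uIcc.1 hs with h | h
    · linarith [h.1]
    · linarith [h.1]

/-- Layer-cake form of the profile. It exhibits the mollifier as a weighted superposition of
indicators of balls, so that mollification averages the integrals over balls. -/
lemma radialProfile_eq_integral {t : ℝ} (ht : 0 ≤ t) :
    radialProfile t = ∫ s in Set.Ioc 0 1, Set.indicator {s | t < s} radialWeight s := by
  by_cases h1 : t ≤ 1
  · rw [radialProfile, intervalIntegral.integral_of_le h1,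
      setIntegral_indicator (s := Set.Ioc 0 1) (t := {s | t < s}) measurableSet_Ioi]
    congr 2
    ext s
    simp only [Set.mem_Ioc, Set.mem_inter_iff, Set.mem_ofPred_eq]
    constructor
    · rintro ⟨h, h'⟩; exact ⟨⟨by linarith, h'⟩, h⟩
    · rintro ⟨⟨_, h'⟩, h⟩; exact ⟨h, h'⟩
  · rw [radialProfile_eq_zero (by linarith)]
    symm
    refine setIntegral_eq_zero_of_forall_eq_zero fun s hs => ?_
    rw [Set.indicator_of_notMem]
    simp only [Set.mem_ofPred_eq, not_lt]
    linarith [hs.2]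

lemma radialProfile_nonneg {t : ℝ} (ht : 0 ≤ t) : 0 ≤ radialProfile t := by
  rw [radialProfile_eq_integral ht]
  exact integral_nonneg fun s => Set.indicator_nonneg (fun _ _ => radialWeight.nonneg) _

lemma radialProfile_zero_pos : 0 < radialProfile 0 := by
  rw [radialProfile, intervalIntegral.integral_eq_integral_of_support_subset]
  · exact radialWeight.integral_pos
  · rw [radialWeight.support_eq, Real.ball_eq_Ioo]
    refine Set.Ioo_subset_Ioc_self.trans (Set.Ioc_subset_Ioc ?_ ?_) <;>
      simp only [radialWeight] <;> norm_num

/-- The mollifiers before normalization. -/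
noncomputable def preKernel (d n : ℕ) (z : Euc d) : ℝ :=
  radialProfile (‖((n : ℝ) + 1) • z‖ ^ 2)

lemma preKernel_nonneg (n : ℕ) (z : Euc d) : 0 ≤ preKernel d n z :=
  radialProfile_nonneg (sq_nonneg _)

lemma contDiff_preKernel (n : ℕ) : ContDiff ℝ ∞ (preKernel d n) :=
  contDiff_radialProfile.comp ((contDiff_id.const_smul _).norm_sq ℝ)

lemma support_preKernel_subset (n : ℕ) :
    Function.support (preKernel d n) ⊆ Metric.closedBall 0 (1 / ((n : ℝ) + 1)) := by
  intro z hz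
  have hn : (0 : ℝ) < n + 1 := by positivity
  rw [mem_closedBall_zero_iff, le_div_iff₀ hn]
  by_contra! h
  refine hz (radialProfile_eq_zero ?_)
  rw [norm_smul, Real.norm_of_nonneg hn.le]
  nlinarith

lemma hasCompactSupport_preKernel (n : ℕ) : HasCompactSupport (preKernel d n) :=
  HasCompactSupport.of_support_subset_isCompact (isCompact_closedBall _ _)
    (support_preKernel_subset n)

lemma integrable_preKernel (n : ℕ) : Integrable (preKernel d n) :=
  (contDiff_preKernel n).continuous.integrable_of_hasCompactSupport (hasCompactSupport_preKernel n)

lemma integral_preKernel_pos (d n : ℕ) : 0 < ∫ z, preKernel d n z :=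
  (contDiff_preKernel n).continuous.integral_pos_of_hasCompactSupport_nonneg_nonzero
    (x := 0) (hasCompactSupport_preKernel n) (preKernel_nonneg n) (by
      simp [preKernel, radialProfile_zero_pos.ne'])

/-- A smooth radial approximate identity with support in the ball of radius `1 / (n + 1)`. -/
noncomputable def kernel (d n : ℕ) (z : Euc d) : ℝ :=
  (∫ z, preKernel d n z)⁻¹ * preKernel d n z

lemma kernel_nonneg (n : ℕ) (z : Euc d) : 0 ≤ kernel d n z :=
  mul_nonneg (inv_nonneg.2 (integral_preKernel_pos d n).le) (preKernel_nonneg n z)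

lemma contDiff_kernel (n : ℕ) : ContDiff ℝ ∞ (kernel d n) :=
  contDiff_const.mul (contDiff_preKernel n)

lemma support_kernel_subset (n : ℕ) :
    Function.support (kernel d n) ⊆ Metric.closedBall 0 (1 / ((n : ℝ) + 1)) :=
  (Function.support_mul_subset_right _ (preKernel d n)).trans (support_preKernel_subset n)

lemma hasCompactSupport_kernel (n : ℕ) : HasCompactSupport (kernel d n) :=
  HasCompactSupport.of_support_subset_isCompact (isCompact_closedBall _ _)
    (support_kernel_subset n)

lemma integrable_kernel (n : ℕ) : Integrable (kernel d n) :=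
  (integrable_preKernel n).const_mul _

lemma integral_kernel (d n : ℕ) : ∫ z, kernel d n z = 1 := by
  simp_rw [kernel]
  rw [integral_const_mul, inv_mul_cancel₀ (integral_preKernel_pos d n).ne']

/-- Convolution with the mollifier. -/
noncomputable def mollify (n : ℕ) (f : Euc d → ℝ) : Euc d → ℝ :=
  kernel d n ⋆[ContinuousLinearMap.lsmul ℝ ℝ, volume] f

lemma mollify_apply (n : ℕ) (f : Euc d → ℝ) (x : Euc d) :
    mollify n f x = ∫ z, kernel d n z * f (x - z) := rfl

lemma mollify_apply' (n : ℕ) (f : Euc d → ℝ) (x : Euc d) :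
    mollify n f x = ∫ y, kernel d n (x - y) * f y := by
  rw [mollify, convolution_eq_swap]; rfl

lemma contDiff_mollify (n : ℕ) {f : Euc d → ℝ} (hf : LocallyIntegrable f) :
    ContDiff ℝ ∞ (mollify n f) :=
  (hasCompactSupport_kernel n).contDiff_convolution_left _ (contDiff_kernel n) hf

lemma support_mollify_subset (n : ℕ) (f : Euc d → ℝ) :
    Function.support (mollify n f) ⊆ Metric.cthickening (1 / ((n : ℝ) + 1)) (tsupport f) := by
  intro x hx
  by_contra hx'
  refine hx ?_
  rw [mollify_apply]
  refine integral_eq_zero_of_ae (Eventually.of_forall fun z => ?_)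
  by_cases hz : z ∈ Metric.closedBall (0 : Euc d) (1 / ((n : ℝ) + 1))
  · have : f (x - z) = 0 := by
      by_contra hf
      refine hx' (Metric.mem_cthickening_of_dist_le x (x - z) _ _ (subset_tsupport _ hf) ?_)
      simpa [dist_eq_norm] using hz
    simp [this]
  · have : kernel d n z = 0 := by
      by_contra h
      exact hz (support_kernel_subset n h)
    simp [this]

lemma tsupport_mollify_subset (n : ℕ) (f : Euc d → ℝ) :
    tsupport (mollify n f) ⊆ Metric.cthickening (1 / ((n : ℝ) + 1)) (tsupport f) :=
  closure_minimal (support_mollify_subset n f) Metric.isClosed_cthickening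

lemma hasCompactSupport_mollify (n : ℕ) {f : Euc d → ℝ} (hf : HasCompactSupport f) :
    HasCompactSupport (mollify n f) :=
  HasCompactSupport.of_support_subset_isCompact hf.isCompact.cthickening
    (support_mollify_subset n f)

lemma abs_mollify_le (n : ℕ) {f : Euc d → ℝ} {C : ℝ} (hC : ∀ x, |f x| ≤ C) (x : Euc d) :
    |mollify n f x| ≤ C := by
  rw [mollify_apply]
  refine abs_integral_le_integral_abs.trans ?_
  calc ∫ z, |kernel d n z * f (x - z)| ≤ ∫ z, kernel d n z * C := by
        refine integral_mono_of_nonneg (Eventually.of_forall fun _ => abs_nonneg _)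
          ((integrable_kernel n).mul_const _) (Eventually.of_forall fun z => ?_)
        simp only [abs_mul, abs_of_nonneg (kernel_nonneg n z)]
        exact mul_le_mul_of_nonneg_left (hC _) (kernel_nonneg n z)
    _ = C := by rw [integral_mul_const, integral_kernel, one_mul]

/-- If the means of `f` over small balls around `x` tend to `a`, so do the mollifications of `f`
at `x`. -/
theorem tendsto_mollify {f : Euc d → ℝ} (hf : LocallyIntegrable f) {x : Euc d} {a : ℝ}
    (ha : Tendsto (fun r : ℝ => ⨍ y in Metric.ball x r, f y) (𝓝[>] 0) (𝓝 a)) :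
    Tendsto (fun n => mollify n f x) atTop (𝓝 a) := by
  -- Fubini for the layer-cake form: the indicator of `|(n+1)(x-y)|² < s` is that of the ball of
  -- radius `√s / (n+1)` about `x`.
  have hslice : ∀ (n : ℕ) (g : Euc d → ℝ), LocallyIntegrable g →
      IntegrableOn (fun s : ℝ => radialWeight s * ∫ y in Metric.ball x (√s / (n + 1)), g y)
        (Set.Ioc (0 : ℝ) 1) ∧
      ∫ y, preKernel d n (x - y) * g y = ∫ s in Set.Ioc (0 : ℝ) 1, radialWeight s *
        ∫ y in Metric.ball x (√s / (n + 1)), g y := by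
    intro n g hg
    have hn : (0 : ℝ) < n + 1 := by positivity
    have hmem : ∀ (s : ℝ) (y : Euc d),
        ‖((n : ℝ) + 1) • (x - y)‖ ^ 2 < s ↔ y ∈ Metric.ball x (√s / (n + 1)) := by
      intro s y
      rw [Metric.mem_ball', dist_eq_norm, lt_div_iff₀ hn, norm_smul, Real.norm_of_nonneg hn.le,
        mul_comm, Real.lt_sqrt (by positivity)]
    have hball : ∀ y, y ∉ Metric.ball x 1 → ∀ s ∈ Set.Ioc (0 : ℝ) 1,
        y ∉ Metric.ball x (√s / (n + 1)) := by
      intro y hy s hs h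
      refine hy (Metric.ball_subset_ball ?_ h)
      rw [div_le_one hn]
      have : √s ≤ 1 := by rw [Real.sqrt_le_one]; exact hs.2
      have : (0 : ℝ) ≤ n := by positivity
      linarith
    -- The function `g` is only locally integrable; all the balls lie in the unit ball, so it may be
    -- cut off there before Fubini is applied.
    have hI : Integrable (Function.uncurry fun (y : Euc d) (s : ℝ) =>
        Set.indicator {s | ‖((n : ℝ) + 1) • (x - y)‖ ^ 2 < s} radialWeight s
          * (Metric.ball x 1).indicator g y)
        (volume.prod (volume.restrict (Set.Ioc (0 : ℝ) 1))) := by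
      have hgi : Integrable ((Metric.ball x 1).indicator g) := by
        rw [integrable_indicator_iff measurableSet_ball]
        exact (hg.integrableOn_isCompact (isCompact_closedBall x 1)).mono_set
          Metric.ball_subset_closedBall
      have h1 : Integrable (fun q : Euc d × ℝ => (Metric.ball x 1).indicator g q.1 *
          radialWeight q.2) (volume.prod (volume.restrict (Set.Ioc (0 : ℝ) 1))) :=
        hgi.mul_prod (radialWeight.continuous.integrable_of_hasCompactSupport
          radialWeight.hasCompactSupport).integrableOn
      have hms : MeasurableSet {q : Euc d × ℝ | ‖((n : ℝ) + 1) • (x - q.1)‖ ^ 2 < q.2} :=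
        measurableSet_lt (by fun_prop) measurable_snd
      refine (h1.indicator hms).congr (Eventually.of_forall fun q => ?_)
      simp only [Function.uncurry, Set.indicator_apply, Set.mem_ofPred_eq]
      split_ifs <;> simp [mul_comm]
    have hinner : ∀ s ∈ Set.Ioc (0 : ℝ) 1,
        ∫ y, Set.indicator {s | ‖((n : ℝ) + 1) • (x - y)‖ ^ 2 < s} radialWeight s
          * (Metric.ball x 1).indicator g y
        = radialWeight s * ∫ y in Metric.ball x (√s / (n + 1)), g y := by
      intro s hs
      rw [← integral_indicator measurableSet_ball, ← integral_const_mul]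
      refine integral_congr_ae (Eventually.of_forall fun y => ?_)
      by_cases hy : y ∈ Metric.ball x (√s / (n + 1))
      · have hy1 : y ∈ Metric.ball x 1 := by
          by_contra h
          exact hball y h s hs hy
        simp only [Set.indicator_of_mem hy, Set.indicator_of_mem hy1]
        rw [Set.indicator_of_mem (by rw [Set.mem_ofPred_eq, hmem]; exact hy)]
      · simp only [Set.indicator_of_notMem hy]
        rw [Set.indicator_of_notMem (by rw [Set.mem_ofPred_eq, hmem]; exact hy)]
        simp
    constructor
    · refine (Integrable.integral_prod_right hI).congr ?_
      filter_upwards [ae_restrict_mem measurableSet_Ioc] with s hs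
      exact hinner s hs
    · calc ∫ y, preKernel d n (x - y) * g y
          = ∫ y, (∫ s in Set.Ioc (0 : ℝ) 1,
              Set.indicator {s | ‖((n : ℝ) + 1) • (x - y)‖ ^ 2 < s} radialWeight s
                * (Metric.ball x 1).indicator g y) := by
            refine integral_congr_ae (Eventually.of_forall fun y => ?_)
            simp only [preKernel]
            rw [radialProfile_eq_integral (sq_nonneg _), integral_mul_const]
            by_cases hy : y ∈ Metric.ball x 1
            · rw [Set.indicator_of_mem hy]
            · rw [Set.indicator_of_notMem hy, mul_zero, setIntegral_eq_zero_of_forall_eq_zero,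
                zero_mul]
              intro s hs
              rw [Set.indicator_of_notMem]
              rw [Set.mem_ofPred_eq, hmem]
              exact hball y hy s hs
        _ = ∫ s in Set.Ioc (0 : ℝ) 1, ∫ y,
              Set.indicator {s | ‖((n : ℝ) + 1) • (x - y)‖ ^ 2 < s} radialWeight s
                * (Metric.ball x 1).indicator g y := integral_integral_swap hI
        _ = _ := setIntegral_congr_fun measurableSet_Ioc hinner
  have hone : ∀ n : ℕ, ∫ s in Set.Ioc (0 : ℝ) 1, radialWeight s *
      (∫ y in Metric.ball x (√s / ((n : ℝ) + 1)), (fun _ => (1 : ℝ)) y)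
      = ∫ s in Set.Ioc (0 : ℝ) 1, radialWeight s *
      volume.real (Metric.ball x (√s / ((n : ℝ) + 1))) := by
    intro n
    simp
  -- Slicing the constant function `1` expresses the normalization by the volumes of the same balls.
  have hconst : ∀ n, ∫ z, preKernel d n z = ∫ s in Set.Ioc (0 : ℝ) 1, radialWeight s *
      volume.real (Metric.ball x (√s / ((n : ℝ) + 1))) := by
    intro n
    rw [← hone n, ← (hslice n (fun _ => 1) (locallyIntegrable_const 1)).2]
    simp only [mul_one]
    rw [integral_sub_left_eq_self (fun z => preKernel d n z) volume x]
  rw [Metric.tendsto_atTop]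
  intro ε hε
  have hev : ∀ᶠ r : ℝ in 𝓝[>] 0, |(⨍ y in Metric.ball x r, f y) - a| < ε / 2 :=
    ha.eventually (Metric.ball_mem_nhds a (half_pos hε))
  obtain ⟨δ, hδ, hδ'⟩ := mem_nhdsGT_iff_exists_Ioc_subset.1 hev
  obtain ⟨N, hN⟩ := exists_nat_one_div_lt (show (0 : ℝ) < δ from hδ)
  refine ⟨N, fun n hn => ?_⟩
  have hn1 : (0 : ℝ) < n + 1 := by positivity
  set c := ∫ z, preKernel d n z with hc
  have hcpos : 0 < c := integral_preKernel_pos d n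
  have hm : mollify n f x = c⁻¹ * ∫ s in Set.Ioc (0 : ℝ) 1, radialWeight s *
      ∫ y in Metric.ball x (√s / (n + 1)), f y := by
    rw [← (hslice n f hf).2, mollify_apply', ← integral_const_mul]
    exact integral_congr_ae (Eventually.of_forall fun y => by simp [kernel, hc, mul_assoc])
  have hint1 : IntegrableOn (fun s : ℝ => radialWeight s *
      ∫ y in Metric.ball x (√s / (n + 1)), f y) (Set.Ioc (0 : ℝ) 1) := (hslice n f hf).1
  have hint2 : IntegrableOn (fun s : ℝ => radialWeight s *
      volume.real (Metric.ball x (√s / ((n : ℝ) + 1)))) (Set.Ioc (0 : ℝ) 1) := by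
    simpa using (hslice n (fun _ => 1) (locallyIntegrable_const 1)).1
  -- The error is thus an average of `mean over a ball - a` with the nonnegative weights
  -- `radialWeight s * volume(ball)`. Only the limit of the means enters, no Lebesgue point.
  have hdiff : mollify n f x - a = c⁻¹ * ∫ s in Set.Ioc (0 : ℝ) 1, (radialWeight s *
      (∫ y in Metric.ball x (√s / (n + 1)), f y)
      - a * (radialWeight s * volume.real (Metric.ball x (√s / ((n : ℝ) + 1))))) := by
    rw [integral_sub hint1 (hint2.const_mul a), integral_const_mul, ← hconst, ← hc, mul_sub, ← hm]
    field_simp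
  rw [Real.dist_eq, hdiff, abs_mul, abs_of_pos (inv_pos.2 hcpos)]
  have hle : |∫ s in Set.Ioc (0 : ℝ) 1, (radialWeight s *
      (∫ y in Metric.ball x (√s / (n + 1)), f y)
      - a * (radialWeight s * volume.real (Metric.ball x (√s / ((n : ℝ) + 1)))))|
      ≤ ε / 2 * c := by
    rw [hc, hconst n, ← integral_const_mul]
    refine abs_integral_le_integral_abs.trans (setIntegral_mono_on
      (hint1.sub (hint2.const_mul a)).abs (hint2.const_mul _) measurableSet_Ioc fun s hs => ?_)
    have hr : 0 < √s / (n + 1) := div_pos (Real.sqrt_pos.2 hs.1) hn1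
    have hrδ : √s / (n + 1) ≤ δ := by
      have h1 : √s ≤ 1 := by rw [Real.sqrt_le_one]; exact hs.2
      calc √s / (n + 1) ≤ 1 / (n + 1) := by gcongr
        _ ≤ 1 / (N + 1) := by gcongr
        _ ≤ δ := hN.le
    have h1 : |(⨍ y in Metric.ball x (√s / (n + 1)), f y) - a| < ε / 2 := hδ' ⟨hr, hrδ⟩
    have hvol : 0 < volume.real (Metric.ball x (√s / ((n : ℝ) + 1))) :=
      ENNReal.toReal_pos (Metric.measure_ball_pos _ _ hr).ne' measure_ball_lt_top.ne
    have h2 : ∫ y in Metric.ball x (√s / (n + 1)), f y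
        = volume.real (Metric.ball x (√s / ((n : ℝ) + 1)))
          * ⨍ y in Metric.ball x (√s / (n + 1)), f y := by
      rw [setAverage_eq, smul_eq_mul, mul_inv_cancel_left₀ hvol.ne']
    rw [h2]
    calc _ = |radialWeight s * volume.real (Metric.ball x (√s / ((n : ℝ) + 1)))
          * ((⨍ y in Metric.ball x (√s / (n + 1)), f y) - a)| := by congr 1; ring
      _ = radialWeight s * volume.real (Metric.ball x (√s / ((n : ℝ) + 1)))
          * |(⨍ y in Metric.ball x (√s / (n + 1)), f y) - a| := by
          rw [abs_mul, abs_of_nonneg (mul_nonneg radialWeight.nonneg hvol.le)]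
      _ ≤ radialWeight s * volume.real (Metric.ball x (√s / ((n : ℝ) + 1))) * (ε / 2) :=
          mul_le_mul_of_nonneg_left h1.le (mul_nonneg radialWeight.nonneg hvol.le)
      _ = _ := by ring
  calc _ ≤ c⁻¹ * (ε / 2 * c) := mul_le_mul_of_nonneg_left hle (inv_pos.2 hcpos).le
    _ = ε / 2 := by field_simp
    _ < ε := half_lt_self hε

end Mollifier

end PINN

namespace PINN

/-! ### Mollification and translation in `L²` -/

section LTwo

variable {d : ℕ}

lemma tendsto_average_ball {f : Euc d → ℝ} (hf : LocallyIntegrable f) {x : Euc d}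
    (hx : ContinuousAt f x) :
    Tendsto (fun r : ℝ => ⨍ y in Metric.ball x r, f y) (𝓝[>] 0) (𝓝 (f x)) := by
  rw [Metric.nhds_basis_closedBall.tendsto_right_iff]
  intro ε hε
  obtain ⟨δ, hδ, hδ'⟩ := Metric.mem_nhds_iff.1 (hx (Metric.closedBall_mem_nhds (f x) hε))
  filter_upwards [Ioo_mem_nhdsGT hδ] with r hr
  refine (convex_closedBall (f x) ε).set_average_mem Metric.isClosed_closedBall
    (Metric.measure_ball_pos _ _ hr.1).ne' measure_ball_lt_top.ne ?_ ?_
  · filter_upwards [ae_restrict_mem measurableSet_ball] with y hy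
    exact hδ' (Metric.ball_subset_ball hr.2.le hy)
  · exact (hf.integrableOn_isCompact (isCompact_closedBall x r)).mono_set
      Metric.ball_subset_closedBall

lemma eLpNorm_two_sq {α : Type*} [MeasurableSpace α] (f : α → ℝ) (μ : Measure α) :
    eLpNorm f 2 μ ^ 2 = ∫⁻ x, ‖f x‖ₑ ^ 2 ∂μ := by
  have := eLpNorm_nnreal_pow_eq_lintegral (f := f) (μ := μ) (p := 2) two_ne_zero
  have e : ((2 : ℝ≥0) : ℝ) = ((2 : ℕ) : ℝ) := by norm_num
  simp only [e, ENNReal.rpow_natCast] at this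
  exact this

/-- Translations act continuously on `L²`. -/
lemma tendsto_eLpNorm_translate {f : Euc d → ℝ} (hf : MemLp f 2) :
    Tendsto (fun a : Euc d => eLpNorm (fun x => f (x + a) - f x) 2) (𝓝 0) (𝓝 0) := by
  let g : Euc d → C(Euc d, Euc d) := fun a => ⟨fun x => x + a, by fun_prop⟩
  have hgc : Continuous g := by
    refine ContinuousMap.continuous_of_continuous_uncurry _ ?_
    change Continuous fun q : Euc d × Euc d => q.2 + q.1
    fun_prop
  have hgm : ∀ a, MeasurePreserving (g a) (volume : Measure (Euc d)) volume := fun a =>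
    measurePreserving_add_right volume a
  have hc : Continuous fun a => Lp.compMeasurePreserving (g a) (hgm a) (hf.toLp f) :=
    continuous_const.compMeasurePreservingLp hgc hgm (by norm_num)
  have h0 := (hc.tendsto 0)
  have hz : Lp.compMeasurePreserving (g 0) (hgm 0) (hf.toLp f) = hf.toLp f := by
    rw [Lp.toLp_compMeasurePreserving, MemLp.toLp_eq_toLp_iff]
    exact Eventually.of_forall fun x => by simp [g]
  rw [hz, Lp.tendsto_Lp_iff_tendsto_eLpNorm'] at h0
  refine h0.congr fun a => eLpNorm_congr_ae ?_
  rw [Lp.toLp_compMeasurePreserving]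
  filter_upwards [MemLp.coeFn_toLp (hf.comp_measurePreserving (hgm a)), MemLp.coeFn_toLp hf]
    with x h1 h2
  rw [Pi.sub_apply, h1, h2]; rfl

lemma sq_lintegral_le {α : Type*} [MeasurableSpace α] {ρ : Measure α} [IsProbabilityMeasure ρ]
    {g : α → ℝ≥0∞} (hg : AEMeasurable g ρ) : (∫⁻ z, g z ∂ρ) ^ 2 ≤ ∫⁻ z, g z ^ 2 ∂ρ := by
  have := ENNReal.lintegral_mul_le_Lp_mul_Lq ρ Real.HolderConjugate.two_two hg
    (aemeasurable_const (b := (1 : ℝ≥0∞)))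
  simp only [Pi.mul_apply, mul_one, ENNReal.one_rpow, lintegral_const, measure_univ] at this
  calc (∫⁻ z, g z ∂ρ) ^ 2 ≤ ((∫⁻ z, g z ^ (2 : ℝ) ∂ρ) ^ (1 / (2 : ℝ))) ^ 2 := by gcongr
    _ = _ := by
      rw [← ENNReal.rpow_natCast, ← ENNReal.rpow_mul]
      norm_num

/-- Mollifications converge in `L²`. -/
theorem tendsto_eLpNorm_mollify {f : Euc d → ℝ} (hf : MemLp f 2) :
    Tendsto (fun n => eLpNorm (mollify n f - f) 2) atTop (𝓝 0) := by
  -- A measurable representative is needed for joint measurability of `f (x - z) - f x` in Tonelli's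
  -- theorem.
  wlog hfm : StronglyMeasurable f generalizing f
  · have hae := hf.aestronglyMeasurable.ae_eq_mk
    refine (this ((memLp_congr_ae hae).1 hf) hf.aestronglyMeasurable.stronglyMeasurable_mk).congr
      fun n => eLpNorm_congr_ae ?_
    have hmol : mollify n (hf.aestronglyMeasurable.mk f) = mollify n f := by
      funext x
      rw [mollify_apply', mollify_apply']
      refine integral_congr_ae ?_
      filter_upwards [hae] with y hy
      rw [hy]
    filter_upwards [hae] with x hx
    rw [hmol, Pi.sub_apply, Pi.sub_apply, hx]
  rw [ENNReal.tendsto_nhds_zero]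
  intro ε hε
  obtain ⟨δ, hδ, hδ'⟩ := Metric.mem_nhds_iff.1
    ((ENNReal.tendsto_nhds_zero.1 (tendsto_eLpNorm_translate hf)) ε hε)
  obtain ⟨N, hN⟩ := exists_nat_one_div_lt hδ
  filter_upwards [eventually_ge_atTop N] with n hn
  -- With the mollifier as a probability measure, Cauchy–Schwarz and Tonelli bound the squared error
  -- by the average over small `z` of `‖f(· - z) - f‖²`.
  set ρ : Measure (Euc d) := volume.withDensity fun z => ENNReal.ofReal (kernel d n z) with hρ
  have hkm : Measurable fun z => ENNReal.ofReal (kernel d n z) :=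
    (contDiff_kernel n).continuous.measurable.ennreal_ofReal
  have hprob : IsProbabilityMeasure ρ := ⟨by
    rw [hρ, withDensity_apply _ MeasurableSet.univ, Measure.restrict_univ,
      ← ofReal_integral_eq_lintegral_ofReal (integrable_kernel n)
        (Eventually.of_forall (kernel_nonneg n)), integral_kernel, ENNReal.ofReal_one]⟩
  have hpt : ∀ x, ‖(mollify n f - f) x‖ₑ ≤ ∫⁻ z, ‖f (x - z) - f x‖ₑ ∂ρ := by
    intro x
    have h1 : (mollify n f - f) x = ∫ z, kernel d n z * (f (x - z) - f x) := by
      have hi : Integrable fun z => kernel d n z * f (x - z) := by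
        have h := (hasCompactSupport_kernel (d := d) n).convolutionExists_left
          (ContinuousLinearMap.lsmul ℝ ℝ) (contDiff_kernel n).continuous
          (hf.locallyIntegrable one_le_two) x
        exact h
      simp_rw [mul_sub]
      rw [integral_sub hi ((integrable_kernel n).mul_const _), integral_mul_const,
        integral_kernel, one_mul, Pi.sub_apply, mollify_apply]
    rw [h1]
    refine (enorm_integral_le_lintegral_enorm _).trans_eq ?_
    rw [hρ, lintegral_withDensity_eq_lintegral_mul _ hkm]
    · refine lintegral_congr fun z => ?_
      rw [Pi.mul_apply, enorm_mul, Real.enorm_of_nonneg (kernel_nonneg n z)]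
    · exact ((hfm.measurable.comp (measurable_const.sub measurable_id)).sub_const _).enorm
  have hsq : eLpNorm (mollify n f - f) 2 ^ 2 ≤ ε ^ 2 := by
    rw [eLpNorm_two_sq]
    calc ∫⁻ x, ‖(mollify n f - f) x‖ₑ ^ 2
        ≤ ∫⁻ x, (∫⁻ z, ‖f (x - z) - f x‖ₑ ^ 2 ∂ρ) := by
          refine lintegral_mono fun x => ?_
          refine (pow_le_pow_left' (hpt x) 2).trans (sq_lintegral_le ?_)
          exact ((hfm.measurable.comp (measurable_const.sub measurable_id)).sub_const
            _).enorm.aemeasurable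
      _ = ∫⁻ z, (∫⁻ x, ‖f (x - z) - f x‖ₑ ^ 2) ∂ρ := by
          rw [lintegral_lintegral_swap]
          exact (((hfm.measurable.comp (measurable_fst.sub measurable_snd)).sub
            (hfm.measurable.comp measurable_fst)).enorm.pow_const 2).aemeasurable
      _ ≤ ∫⁻ z, ε ^ 2 ∂ρ := by
          refine lintegral_mono_ae ?_
          rw [hρ, ae_withDensity_iff hkm]
          refine Eventually.of_forall fun z hz => ?_
          have hz' : z ∈ Metric.closedBall (0 : Euc d) (1 / ((n : ℝ) + 1)) := by
            refine support_kernel_subset n fun h => hz ?_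
            rw [h, ENNReal.ofReal_zero]
          have hzδ : -z ∈ Metric.ball (0 : Euc d) δ := by
            rw [mem_ball_zero_iff, norm_neg]
            rw [mem_closedBall_zero_iff] at hz'
            refine hz'.trans_lt (lt_of_le_of_lt ?_ hN)
            gcongr
          have h3 : eLpNorm (fun x => f (x + -z) - f x) 2 volume ≤ ε := hδ' hzδ
          have := pow_le_pow_left' h3 2
          rw [eLpNorm_two_sq] at this
          simpa [sub_eq_add_neg] using this
      _ = ε ^ 2 := by simp
  exact (ENNReal.pow_le_pow_left_iff two_ne_zero).1 hsq

end LTwo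

end PINN

namespace PINN

/-! ### Calculus of partial derivatives -/

section Partial

open scoped Convolution

variable {d : ℕ} {Ω : Set (Euc d)} {i : Fin d}

lemma partialDeriv_congr {f g : Euc d → ℝ} {x : Euc d} (h : f =ᶠ[𝓝 x] g) :
    partialDeriv i f x = partialDeriv i g x := by
  rw [partialDeriv, partialDeriv, h.fderiv_eq]

lemma partialDeriv_mul {f g : Euc d → ℝ} {x : Euc d} (hf : DifferentiableAt ℝ f x)
    (hg : DifferentiableAt ℝ g x) :
    partialDeriv i (fun x => f x * g x) x
      = f x * partialDeriv i g x + partialDeriv i f x * g x := by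
  simp only [partialDeriv]
  rw [fderiv_fun_mul hf hg]
  simp [mul_comm]

lemma partialDeriv_add {f g : Euc d → ℝ} {x : Euc d} (hf : DifferentiableAt ℝ f x)
    (hg : DifferentiableAt ℝ g x) :
    partialDeriv i (fun x => f x + g x) x = partialDeriv i f x + partialDeriv i g x := by
  simp only [partialDeriv]
  rw [fderiv_fun_add hf hg]
  simp

lemma partialDeriv_sum {ι : Type*} {s : Finset ι} {f : ι → Euc d → ℝ} {x : Euc d}
    (hf : ∀ j ∈ s, DifferentiableAt ℝ (f j) x) :
    partialDeriv i (fun x => ∑ j ∈ s, f j x) x = ∑ j ∈ s, partialDeriv i (f j) x := by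
  simp only [partialDeriv]
  rw [fderiv_fun_sum hf]
  simp

lemma partialDeriv_const (c : ℝ) (x : Euc d) : partialDeriv i (fun _ => c) x = 0 := by
  simp [partialDeriv]

lemma ContDiff.partialDeriv {f : Euc d → ℝ} {m n : WithTop ℕ∞} (hf : ContDiff ℝ n f)
    (hmn : m + 1 ≤ n) : ContDiff ℝ m (PINN.partialDeriv i f) :=
  (hf.fderiv_right hmn).clm_apply contDiff_const

lemma ContDiffOn.partialDeriv {f : Euc d → ℝ} {m n : WithTop ℕ∞} {U : Set (Euc d)}
    (hf : ContDiffOn ℝ n f U) (hU : IsOpen U) (hmn : m + 1 ≤ n) :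
    ContDiffOn ℝ m (PINN.partialDeriv i f) U :=
  (hf.fderiv_of_isOpen hU hmn).clm_apply contDiffOn_const

lemma partialDeriv_of_notMem_tsupport {f : Euc d → ℝ} {x : Euc d} (hx : x ∉ tsupport f) :
    partialDeriv i f x = 0 := by
  rw [partialDeriv_congr (notMem_tsupport_iff_eventuallyEq.1 hx)]
  exact partialDeriv_const 0 x

lemma tsupport_partialDeriv_subset (f : Euc d → ℝ) :
    tsupport (partialDeriv i f) ⊆ tsupport f :=
  closure_minimal (fun x hx => by
    by_contra h
    exact hx (partialDeriv_of_notMem_tsupport h)) (isClosed_tsupport f)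

lemma _root_.HasCompactSupport.partialDeriv {f : Euc d → ℝ} (hf : HasCompactSupport f) :
    HasCompactSupport (partialDeriv i f) :=
  hf.mono' ((subset_tsupport _).trans (tsupport_partialDeriv_subset f))

lemma fderiv_apply_eq_sum (f : Euc d → ℝ) (x v : Euc d) :
    fderiv ℝ f x v = ∑ i, v i * partialDeriv i f x := by
  have hv : v = ∑ i, v i • EuclideanSpace.single i (1 : ℝ) := by
    ext j
    simp [Finset.sum_apply, Pi.single_apply]
  conv_lhs => rw [hv]
  simp [partialDeriv]

lemma contDiff_mul_of_tsupport {n : WithTop ℕ∞} {U : Set (Euc d)} (hU : IsOpen U)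
    {m φ : Euc d → ℝ} (hm : ContDiffOn ℝ n m U) (hφ : ContDiff ℝ n φ) (hs : tsupport φ ⊆ U) :
    ContDiff ℝ n (fun x => m x * φ x) := by
  rw [contDiff_iff_contDiffAt]
  intro x
  by_cases hx : x ∈ tsupport φ
  · exact (hm.contDiffAt (hU.mem_nhds (hs hx))).mul hφ.contDiffAt
  · refine (contDiffAt_const (c := (0 : ℝ))).congr_of_eventuallyEq ?_
    filter_upwards [notMem_tsupport_iff_eventuallyEq.1 hx] with y hy
    rw [hy]; simp

/-- The integral of a directional derivative of a `C¹` function with compact support vanishes. -/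
lemma integral_fderiv_eq_zero {G : Euc d → ℝ} (hG : ContDiff ℝ 1 G) (hc : HasCompactSupport G)
    (e : Euc d) : ∫ x, fderiv ℝ G x e = 0 := by
  have hi : Integrable fun x => fderiv ℝ G x e :=
    ((hG.continuous_fderiv one_ne_zero).clm_apply continuous_const).integrable_of_hasCompactSupport
      (hc.fderiv_apply ℝ e)
  have := integral_mul_fderiv_eq_neg_fderiv_mul_of_integrable (μ := (volume : Measure (Euc d)))
    (f := fun _ => (1 : ℝ)) (g := G) (v := e) (by simp) (by simpa using hi)
    (by simpa using hG.continuous.integrable_of_hasCompactSupport hc)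
    (fun x _ => by fun_prop) (fun x _ => (hG.differentiable one_ne_zero) x)
  simpa using this

lemma integrable_mul_of_tsupport {U : Set (Euc d)} {u g : Euc d → ℝ}
    (hu : LocallyIntegrableOn u U) (hg : Continuous g) (hc : HasCompactSupport g)
    (hs : tsupport g ⊆ U) : Integrable (fun x => u x * g x) := by
  have h1 : IntegrableOn (fun x => u x * g x) (tsupport g) :=
    (hu.integrableOn_compact_subset hs hc.isCompact).mul_continuousOn hg.continuousOn hc.isCompact
  refine (integrableOn_iff_integrable_of_support_subset fun x hx => ?_).1 h1
  exact subset_tsupport _ fun h => hx (by simp [h])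

/-! ### Weak derivatives -/

lemma setIntegral_interior_mul_eq {u g : Euc d → ℝ} {U : Set (Euc d)} (hs : tsupport g ⊆ U) :
    ∫ x in U, u x * g x = ∫ x, u x * g x :=
  setIntegral_eq_integral_of_forall_compl_eq_zero fun x hx => by
    rw [image_eq_zero_of_notMem_tsupport fun h => hx (hs h), mul_zero]

lemma IsTestFunction.partialDeriv_tsupport {φ : Euc d → ℝ} (hφ : IsTestFunction Ω φ) :
    tsupport (partialDeriv i φ) ⊆ interior Ω :=
  (tsupport_partialDeriv_subset φ).trans hφ.support

/-- The `i`-th partial derivative of the mollification of a globally weakly differentiable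
function. -/
lemma partialDeriv_mollify {V V1 : Euc d → ℝ} (hV : IsWeakPartial Set.univ i V V1) (n : ℕ) :
    partialDeriv i (mollify n V) = mollify n V1 := by
  funext x
  have hloc : LocallyIntegrable V := by
    have := hV.left_int
    rwa [interior_univ, locallyIntegrableOn_univ] at this
  have hk1 : ContDiff ℝ 1 (kernel d n) := (contDiff_kernel n).of_le (by simp)
  have h1 := (hasCompactSupport_kernel n).hasFDerivAt_convolution_left
    (ContinuousLinearMap.lsmul ℝ ℝ) hk1 hloc x
  have h2 : partialDeriv i (mollify n V) x = ∫ z, partialDeriv i (kernel d n) z * V (x - z) := by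
    rw [partialDeriv, mollify, h1.fderiv, convolution_def]
    have hex := ((hasCompactSupport_kernel n).fderiv ℝ).convolutionExists_left
      ((ContinuousLinearMap.lsmul ℝ ℝ).precompL (Euc d)) (hk1.continuous_fderiv one_ne_zero)
      hloc x
    rw [ContinuousLinearMap.integral_apply hex]
    rfl
  have h3 : ∫ z, partialDeriv i (kernel d n) z * V (x - z)
      = ∫ y, partialDeriv i (kernel d n) (x - y) * V y := by
    rw [← integral_sub_left_eq_self _ volume x]
    simp
  let φ : Euc d → ℝ := fun y => kernel d n (x - y)
  have hφs : ContDiff ℝ ∞ φ := (contDiff_kernel n).comp (contDiff_const.sub contDiff_id)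
  have hφc : HasCompactSupport φ :=
    (hasCompactSupport_kernel n).comp_homeomorph (Homeomorph.subLeft x)
  have hφd : ∀ y, partialDeriv i φ y = -partialDeriv i (kernel d n) (x - y) := by
    intro y
    have hd : HasFDerivAt φ ((fderiv ℝ (kernel d n) (x - y)).comp
        (-ContinuousLinearMap.id ℝ (Euc d))) y :=
      ((hk1.differentiable one_ne_zero) (x - y)).hasFDerivAt.comp y
        ((hasFDerivAt_id y).const_sub x)
    rw [partialDeriv, hd.fderiv]
    simp [partialDeriv]
  have h4 := hV.parts φ ⟨hφs, hφc, by simp⟩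
  simp only [interior_univ, Measure.restrict_univ, hφd, mul_neg, integral_neg, neg_inj] at h4
  rw [h2, h3, mollify_apply']
  simp_rw [mul_comm (partialDeriv i (kernel d n) _), mul_comm (kernel d n _)]
  exact h4

lemma isWeakPartial_of_contDiffOn {f : Euc d → ℝ} (hf : ContDiffOn ℝ 1 f (interior Ω)) :
    IsWeakPartial Ω i f (partialDeriv i f) := by
  have hc1 : ContinuousOn (partialDeriv i f) (interior Ω) :=
    (ContDiffOn.partialDeriv (m := 0) hf isOpen_interior (by simp)).continuousOn
  refine ⟨hf.continuousOn.locallyIntegrableOn isOpen_interior.measurableSet,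
    hc1.locallyIntegrableOn isOpen_interior.measurableSet, fun φ hφ => ?_⟩
  have hφ1 : ContDiff ℝ 1 φ := hφ.smooth.of_le (by simp)
  have hG := contDiff_mul_of_tsupport isOpen_interior hf hφ1 hφ.support
  have hGc : HasCompactSupport fun x => f x * φ x := hφ.compact.mul_left
  have h0 := integral_fderiv_eq_zero hG hGc (EuclideanSpace.single i 1)
  have hl : ∀ x, fderiv ℝ (fun x => f x * φ x) x (EuclideanSpace.single i 1)
      = f x * partialDeriv i φ x + partialDeriv i f x * φ x := by
    intro x
    by_cases hx : x ∈ interior Ω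
    · exact partialDeriv_mul ((hf.contDiffAt (isOpen_interior.mem_nhds hx)).differentiableAt
        one_ne_zero) (hφ1.differentiable one_ne_zero x)
    · have hx' : x ∉ tsupport φ := fun h => hx (hφ.support h)
      rw [image_eq_zero_of_notMem_tsupport hx', partialDeriv_of_notMem_tsupport hx']
      have : x ∉ tsupport fun x => f x * φ x := fun h => hx' (tsupport_mul_subset_right h)
      have := partialDeriv_of_notMem_tsupport (i := i) this
      rw [partialDeriv] at this
      rw [this]; simp
  simp_rw [hl] at h0
  rw [setIntegral_interior_mul_eq hφ.partialDeriv_tsupport, setIntegral_interior_mul_eq hφ.support]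
  rw [integral_add] at h0
  · linarith
  · exact integrable_mul_of_tsupport
      (hf.continuousOn.locallyIntegrableOn isOpen_interior.measurableSet)
      (ContDiff.partialDeriv (m := 0) hφ1 (by simp)).continuous hφ.compact.partialDeriv
      hφ.partialDeriv_tsupport
  · exact integrable_mul_of_tsupport (hc1.locallyIntegrableOn isOpen_interior.measurableSet)
      hφ1.continuous hφ.compact hφ.support

/-- Weak derivatives can be tested with `C¹` functions. -/
lemma IsWeakPartial.parts_of_contDiff_one {u v : Euc d → ℝ} (h : IsWeakPartial Ω i u v)
    {φ : Euc d → ℝ} (hφ : ContDiff ℝ 1 φ) (hc : HasCompactSupport φ)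
    (hs : tsupport φ ⊆ interior Ω) :
    ∫ x, u x * partialDeriv i φ x = -∫ x, v x * φ x := by
  obtain ⟨δ, hδ, hδs⟩ := hc.isCompact.exists_cthickening_subset_open isOpen_interior hs
  obtain ⟨N, hN⟩ := exists_nat_one_div_lt hδ
  set K := Metric.cthickening δ (tsupport φ) with hK
  have hKc : IsCompact K := hc.isCompact.cthickening
  have hφ' : Continuous (partialDeriv i φ) :=
    (ContDiff.partialDeriv (m := 0) hφ (by simp)).continuous
  have hwk : IsWeakPartial Set.univ i φ (partialDeriv i φ) :=
    isWeakPartial_of_contDiffOn hφ.contDiffOn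
  have hsub : ∀ n ≥ N, tsupport (mollify n φ) ⊆ K := fun n hn =>
    (tsupport_mollify_subset n φ).trans (Metric.cthickening_mono
      (le_trans (by gcongr) hN.le) _)
  have htest : ∀ n ≥ N, IsTestFunction Ω (mollify n φ) := fun n hn =>
    ⟨contDiff_mollify n hφ.continuous.locallyIntegrable, hasCompactSupport_mollify n hc,
      (hsub n hn).trans hδs⟩
  -- The mollifications have their supports in the fixed compact set `K`, are uniformly bounded and
  -- converge pointwise. Hence local integrability of `w` suffices for dominated convergence.
  have hlim : ∀ (w g : Euc d → ℝ), LocallyIntegrableOn w (interior Ω) → Continuous g →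
      HasCompactSupport g → (∀ n ≥ N, tsupport (mollify n g) ⊆ K) →
      Tendsto (fun n => ∫ x, w x * mollify n g x) atTop (𝓝 (∫ x, w x * g x)) := by
    intro w g hw hg hgc hgK
    obtain ⟨C, hC⟩ := hg.bounded_above_of_compact_support hgc
    have hwK : IntegrableOn w K := hw.integrableOn_compact_subset hδs hKc
    have heq : ∀ n ≥ N, ∫ x, w x * mollify n g x = ∫ x in K, w x * mollify n g x := fun n hn =>
      (setIntegral_interior_mul_eq (hgK n hn)).symm
    have hg0 : ∀ x ∉ K, g x = 0 := by
      intro x hx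
      refine tendsto_nhds_unique (tendsto_mollify hg.locallyIntegrable
        (tendsto_average_ball hg.locallyIntegrable hg.continuousAt)) (tendsto_const_nhds.congr' ?_)
      filter_upwards [eventually_ge_atTop N] with n hn
      exact (image_eq_zero_of_notMem_tsupport fun h => hx (hgK n hn h)).symm
    have heq' : ∫ x, w x * g x = ∫ x in K, w x * g x :=
      (setIntegral_eq_integral_of_forall_compl_eq_zero fun x hx => by rw [hg0 x hx, mul_zero]).symm
    rw [heq']
    refine Tendsto.congr' (f₁ := fun n => ∫ x in K, w x * mollify n g x) ?_ ?_
    · filter_upwards [eventually_ge_atTop N] with n hn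
      exact (heq n hn).symm
    · refine tendsto_integral_of_dominated_convergence (fun x => |w x| * C) ?_ ?_ ?_ ?_
      · exact fun n => hwK.aestronglyMeasurable.mul
          (contDiff_mollify n hg.locallyIntegrable).continuous.aestronglyMeasurable
      · exact hwK.abs.mul_const C
      · refine fun n => Eventually.of_forall fun x => ?_
        rw [norm_mul]
        exact mul_le_mul_of_nonneg_left (abs_mollify_le n hC x) (abs_nonneg _)
      · refine Eventually.of_forall fun x => ?_
        exact (tendsto_mollify hg.locallyIntegrable
          (tendsto_average_ball hg.locallyIntegrable hg.continuousAt)).const_mul (w x)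
  have hl := hlim v φ h.right_int hφ.continuous hc hsub
  have hr := hlim u (partialDeriv i φ) h.left_int hφ' hc.partialDeriv fun n hn => by
    rw [← partialDeriv_mollify hwk]
    exact (tsupport_partialDeriv_subset _).trans (hsub n hn)
  refine tendsto_nhds_unique hr (hl.neg.congr' ?_)
  filter_upwards [eventually_ge_atTop N] with n hn
  have := h.parts _ (htest n hn)
  rw [setIntegral_interior_mul_eq (htest n hn).support,
    setIntegral_interior_mul_eq (htest n hn).partialDeriv_tsupport, partialDeriv_mollify hwk] at this
  exact this.symm

/-- The product of a weakly differentiable function on `Ω` with a `C¹` function with compact support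
in the interior of `Ω` is weakly differentiable on the whole space. -/
lemma IsWeakPartial.mul_cutoff {u v m : Euc d → ℝ} (h : IsWeakPartial Ω i u v)
    (hm : ContDiff ℝ 1 m) (hc : HasCompactSupport m) (hs : tsupport m ⊆ interior Ω) :
    IsWeakPartial Set.univ i (fun x => m x * u x)
      (fun x => m x * v x + partialDeriv i m x * u x) := by
  have hmd : Continuous (partialDeriv i m) :=
    (ContDiff.partialDeriv (m := 0) hm (by simp)).continuous
  have j1 : Integrable fun x => m x * u x := by
    simpa only [mul_comm] using integrable_mul_of_tsupport h.left_int hm.continuous hc hs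
  have j2 : Integrable fun x => m x * v x := by
    simpa only [mul_comm] using integrable_mul_of_tsupport h.right_int hm.continuous hc hs
  have j3 : Integrable fun x => partialDeriv i m x * u x := by
    simpa only [mul_comm] using integrable_mul_of_tsupport h.left_int hmd hc.partialDeriv
      ((tsupport_partialDeriv_subset m).trans hs)
  refine ⟨j1.locallyIntegrable.locallyIntegrableOn _,
    (j2.add j3).locallyIntegrable.locallyIntegrableOn _, fun φ hφ => ?_⟩
  have hφ1 : ContDiff ℝ 1 φ := hφ.smooth.of_le (by simp)
  have hφ' : Continuous (partialDeriv i φ) :=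
    (ContDiff.partialDeriv (m := 0) hφ1 (by simp)).continuous
  have hψ : ContDiff ℝ 1 fun x => m x * φ x := hm.mul hφ1
  have hψs : tsupport (fun x => m x * φ x) ⊆ interior Ω := tsupport_mul_subset_left.trans hs
  -- The product `m φ` is only as smooth as the cutoff `m`, which is why testing with `C¹` functions
  -- was needed.
  have key := h.parts_of_contDiff_one hψ hc.mul_right hψs
  have i1 : Integrable fun x => u x * (m x * partialDeriv i φ x) :=
    integrable_mul_of_tsupport h.left_int (hm.continuous.mul hφ') hc.mul_right
      (tsupport_mul_subset_left.trans hs)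
  have i2 : Integrable fun x => u x * (partialDeriv i m x * φ x) :=
    integrable_mul_of_tsupport h.left_int (hmd.mul hφ1.continuous) hc.partialDeriv.mul_right
      (tsupport_mul_subset_left.trans ((tsupport_partialDeriv_subset m).trans hs))
  have i3 : Integrable fun x => v x * (m x * φ x) :=
    integrable_mul_of_tsupport h.right_int hψ.continuous hc.mul_right hψs
  have hpt : ∀ x, u x * partialDeriv i (fun x => m x * φ x) x
      = u x * (m x * partialDeriv i φ x) + u x * (partialDeriv i m x * φ x) := fun x => by
    rw [partialDeriv_mul (hm.differentiable one_ne_zero x) (hφ1.differentiable one_ne_zero x),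
      mul_add]
  simp_rw [hpt] at key
  rw [integral_add i1 i2] at key
  simp only [interior_univ, Measure.restrict_univ]
  have e1 : ∀ x, m x * u x * partialDeriv i φ x = u x * (m x * partialDeriv i φ x) :=
    fun x => by ring
  have e2 : ∀ x, (m x * v x + partialDeriv i m x * u x) * φ x
      = v x * (m x * φ x) + u x * (partialDeriv i m x * φ x) := fun x => by ring
  simp_rw [e1, e2]
  rw [integral_add i3 i2]
  linarith

/-- The fundamental lemma of the calculus of variations. It makes the choice in `weakPartial`
immaterial up to null sets. -/
lemma IsWeakPartial.ae_eq {u v v' : Euc d → ℝ} (h : IsWeakPartial Ω i u v)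
    (h' : IsWeakPartial Ω i u v') : v =ᵐ[volume.restrict (interior Ω)] v' := by
  have hz := isOpen_interior.ae_eq_zero_of_integral_contDiff_smul_eq_zero
    (μ := (volume : Measure (Euc d))) (h.right_int.sub h'.right_int) (fun φ hφ hφc hφs => by
      have ht : IsTestFunction Ω φ := ⟨hφ, hφc, hφs⟩
      have h1 := h.parts φ ht
      rw [h'.parts φ ht, setIntegral_interior_mul_eq hφs, setIntegral_interior_mul_eq hφs] at h1
      have i1 := integrable_mul_of_tsupport h.right_int hφ.continuous hφc hφs
      have i2 := integrable_mul_of_tsupport h'.right_int hφ.continuous hφc hφs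
      have : ∀ x, φ x • (v - v') x = v x * φ x - v' x * φ x := fun x => by
        simp only [smul_eq_mul, Pi.sub_apply]; ring
      simp_rw [this]
      rw [integral_sub i1 i2]
      linarith)
  rw [Filter.EventuallyEq, ae_restrict_iff' isOpen_interior.measurableSet]
  filter_upwards [hz] with x hx hxΩ
  have := hx hxΩ
  simp only [Pi.sub_apply] at this
  linarith

lemma _root_.MeasureTheory.LocallyIntegrableOn.congr_ae_restrict {u u' : Euc d → ℝ}
    {U : Set (Euc d)} (h : LocallyIntegrableOn u U) (hU : IsOpen U)
    (huu : u =ᵐ[volume.restrict U] u') : LocallyIntegrableOn u' U := by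
  rw [locallyIntegrableOn_iff hU.isLocallyClosed] at h ⊢
  intro K hK hKc
  exact (h K hK hKc).congr (ae_restrict_of_ae_restrict_of_subset hK huu)

lemma IsWeakPartial.congr {u u' v v' : Euc d → ℝ} (h : IsWeakPartial Ω i u v)
    (hu : u =ᵐ[volume.restrict (interior Ω)] u') (hv : v =ᵐ[volume.restrict (interior Ω)] v') :
    IsWeakPartial Ω i u' v' := by
  refine ⟨h.left_int.congr_ae_restrict isOpen_interior hu,
    h.right_int.congr_ae_restrict isOpen_interior hv, fun φ hφ => ?_⟩
  have h1 : ∫ x in interior Ω, u' x * partialDeriv i φ x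
      = ∫ x in interior Ω, u x * partialDeriv i φ x :=
    integral_congr_ae (by filter_upwards [hu] with x hx; rw [hx])
  have h2 : ∫ x in interior Ω, v' x * φ x = ∫ x in interior Ω, v x * φ x :=
    integral_congr_ae (by filter_upwards [hv] with x hx; rw [hx])
  rw [h1, h2, h.parts φ hφ]

lemma IsWeakPartial.linear {u v u' v' : Euc d → ℝ} (h : IsWeakPartial Ω i u v)
    (h' : IsWeakPartial Ω i u' v') (a b : ℝ) :
    IsWeakPartial Ω i (fun x => a * u x + b * u' x) (fun x => a * v x + b * v' x) := by
  refine ⟨(h.left_int.smul a).add (h'.left_int.smul b),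
    (h.right_int.smul a).add (h'.right_int.smul b), fun φ hφ => ?_⟩
  have hφ' : Continuous (partialDeriv i φ) :=
    (ContDiff.partialDeriv (m := 0) (n := 1) (hφ.smooth.of_le (by simp)) (by simp)).continuous
  have i1 := integrable_mul_of_tsupport h.left_int hφ' hφ.compact.partialDeriv
    hφ.partialDeriv_tsupport
  have i1' := integrable_mul_of_tsupport h'.left_int hφ' hφ.compact.partialDeriv
    hφ.partialDeriv_tsupport
  have i2 := integrable_mul_of_tsupport h.right_int hφ.smooth.continuous hφ.compact hφ.support
  have i2' := integrable_mul_of_tsupport h'.right_int hφ.smooth.continuous hφ.compact hφ.support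
  have e1 := h.parts φ hφ
  have e2 := h'.parts φ hφ
  rw [setIntegral_interior_mul_eq hφ.partialDeriv_tsupport,
    setIntegral_interior_mul_eq hφ.support] at e1 e2 ⊢
  have r1 : ∀ x, (a * u x + b * u' x) * partialDeriv i φ x
      = a * (u x * partialDeriv i φ x) + b * (u' x * partialDeriv i φ x) := fun x => by ring
  have r2 : ∀ x, (a * v x + b * v' x) * φ x = a * (v x * φ x) + b * (v' x * φ x) :=
    fun x => by ring
  simp_rw [r1, r2]
  rw [integral_add (i1.const_mul a) (i1'.const_mul b), integral_add (i2.const_mul a)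
    (i2'.const_mul b), integral_const_mul, integral_const_mul, integral_const_mul,
    integral_const_mul, e1, e2]
  ring

lemma isWeakPartial_weakPartial {u : Euc d → ℝ} (h : ∃ v, IsWeakPartial Ω i u v) :
    IsWeakPartial Ω i u (weakPartial Ω i u) := by
  rw [weakPartial, dif_pos h]
  exact h.choose_spec

lemma IsWeakPartial.weakPartial_ae_eq {u v : Euc d → ℝ} (h : IsWeakPartial Ω i u v) :
    weakPartial Ω i u =ᵐ[volume.restrict (interior Ω)] v :=
  (isWeakPartial_weakPartial ⟨v, h⟩).ae_eq h

end Partial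

end PINN

namespace PINN

/-! ### Growth in a direction, and the boundary as a null set -/

section Growth

open scoped Pointwise

variable {d : ℕ} {Ω : Set (Euc d)} {η : Euc d → ℝ}

lemma add_mul_le_of_le_fderiv {S : Set (Euc d)} (hS : Convex ℝ S) (hη : Differentiable ℝ η)
    {e : Euc d} {c : ℝ} (hc : ∀ x ∈ S, c ≤ fderiv ℝ η x e) {x : Euc d} {t : ℝ} (ht : 0 ≤ t)
    (hx : x ∈ S) (hxt : x + t • e ∈ S) : η x + c * t ≤ η (x + t • e) := by
  have hd : ∀ s : ℝ, HasDerivAt (fun s : ℝ => η (x + s • e)) (fderiv ℝ η (x + s • e) e) s := by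
    intro s
    have h1 : HasDerivAt (fun s : ℝ => x + s • e) e s := by
      simpa using ((hasDerivAt_id s).smul_const e).const_add x
    exact (hη (x + s • e)).hasFDerivAt.comp_hasDerivAt s h1
  have hmem : ∀ s ∈ Set.Icc 0 t, x + s • e ∈ S := by
    intro s hs
    rcases ht.eq_or_lt with rfl | ht'
    · have : s = 0 := le_antisymm hs.2 hs.1
      simpa [this] using hx
    · have := hS.add_smul_mem (t := s / t) hx hxt ⟨div_nonneg hs.1 ht, div_le_one_of_le₀ hs.2 ht⟩
      rwa [smul_smul, div_mul_cancel₀ _ ht'.ne'] at this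
  have := (convex_Icc (0 : ℝ) t).mul_sub_le_image_sub_of_le_deriv (f := fun s => η (x + s • e))
    (C := c) (fun s _ => (hd s).continuousAt.continuousWithinAt)
    (fun s _ => (hd s).differentiableAt.differentiableWithinAt)
    (fun s hs => by
      rw [(hd s).deriv]
      exact hc _ (hmem s (interior_subset hs)))
    0 ⟨le_rfl, ht⟩ t ⟨ht, le_rfl⟩ ht
  simp at this
  linarith

lemma IsAuxiliary.differentiable (hη : IsAuxiliary Ω η) : Differentiable ℝ η :=
  hη.contDiff.differentiable (by norm_num)

/-- Near a boundary point `η` increases strictly in some direction `e`, so the translates of its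
local zero set by distinct multiples of `e` are disjoint. A bounded set with infinitely many
disjoint translates by a bounded sequence has measure zero. -/
lemma IsAuxiliary.volume_frontier (hη : IsAuxiliary Ω η) : volume (frontier Ω) = 0 := by
  refine measure_null_of_locally_null _ fun p hp => ?_
  obtain ⟨e, he⟩ : ∃ e, 0 < fderiv ℝ η p e := by
    have : ∃ e, fderiv ℝ η p e ≠ 0 := by
      by_contra h
      push Not at h
      exact hη.deriv_ne p hp (by ext1 e; simp [h])
    obtain ⟨e, he⟩ := this
    rcases he.lt_or_gt with h | h
    · exact ⟨-e, by simpa using h⟩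
    · exact ⟨e, h⟩
  have he0 : e ≠ 0 := by rintro rfl; simp at he
  set c := fderiv ℝ η p e / 2 with hc
  have hcont : Continuous fun x => fderiv ℝ η x e :=
    (hη.contDiff.continuous_fderiv (by norm_num)).clm_apply continuous_const
  obtain ⟨ρ, hρ, hball⟩ := Metric.eventually_nhds_iff_ball.1
    (hcont.continuousAt.eventually (lt_mem_nhds (show c < fderiv ℝ η p e by linarith)))
  set s := Metric.ball p ρ ∩ {x | η x = 0} with hs
  refine ⟨frontier Ω ∩ Metric.ball p ρ,
    inter_mem self_mem_nhdsWithin (mem_nhdsWithin_of_mem_nhds (Metric.ball_mem_nhds p hρ)),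
    measure_mono_null (fun x hx => ⟨hx.2, hη.zero x hx.1⟩ : _ ⊆ s) ?_⟩
  refine Measure.addHaar_eq_zero_of_disjoint_translates volume
    (fun n : ℕ => (1 / ((n : ℝ) + 1)) • e) ?_ ?_
    (Metric.isOpen_ball.measurableSet.inter (hη.differentiable.continuous.measurable
      (measurableSet_singleton (0 : ℝ))))
  · refine isBounded_iff_forall_norm_le.2 ⟨‖e‖, ?_⟩
    rintro _ ⟨n, rfl⟩
    simp only
    rw [norm_smul, Real.norm_of_nonneg (by positivity)]
    refine mul_le_of_le_one_left (norm_nonneg _) ?_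
    rw [div_le_one (by positivity)]
    linarith [n.cast_nonneg (α := ℝ)]
  · have key : ∀ (m n : ℕ), m < n →
        Disjoint (({(1 / ((m : ℝ) + 1)) • e} : Set (Euc d)) + s)
          (({(1 / ((n : ℝ) + 1)) • e} : Set (Euc d)) + s) := by
      intro m n hmn
      rw [Set.disjoint_left]
      rintro z hz hz'
      rw [Set.singleton_add] at hz hz'
      obtain ⟨x, hx, rfl⟩ := hz
      obtain ⟨y, hy, hxy⟩ := hz'
      simp only at hxy
      have hlt : 1 / ((n : ℝ) + 1) < 1 / ((m : ℝ) + 1) := by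
        apply one_div_lt_one_div_of_lt (by positivity)
        exact_mod_cast Nat.succ_lt_succ hmn
      have hyx : y = x + (1 / ((m : ℝ) + 1) - 1 / ((n : ℝ) + 1)) • e := by
        rw [sub_smul]
        rw [← sub_eq_zero] at hxy ⊢
        rw [← hxy]; abel
      have := add_mul_le_of_le_fderiv (convex_ball p ρ) hη.differentiable
        (fun x hx => (hball x hx).le) (t := 1 / ((m : ℝ) + 1) - 1 / ((n : ℝ) + 1))
        (by linarith) hx.1 (hyx ▸ hy.1)
      rw [← hyx, hx.2, hy.2] at this
      have hcpos : 0 < c := by linarith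
      nlinarith
    intro m n hmn
    rcases lt_or_gt_of_ne hmn with h | h
    · exact key m n h
    · exact (key n m h).symm

lemma interior_ae_eq (hΩ : IsClosed Ω) (h0 : volume (frontier Ω) = 0) :
    interior Ω =ᵐ[volume] Ω := by
  refine ae_eq_set.2 ⟨?_, ?_⟩
  · rw [Set.sdiff_eq_empty.2 interior_subset, measure_empty]
  · rwa [← hΩ.frontier_eq]

end Growth

/-! ### Two-sided bounds for the density of the sampling measure. -/

section Sampling

variable {d : ℕ} {Ω : Set (Euc d)} {μ : Measure (Euc d)}

/-- The sampling measure has a density bounded from above and below. -/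
lemma IsSamplingMeasure.exists_density (hμ : IsSamplingMeasure Ω μ) (hΩ : IsCompact Ω)
    (h0 : volume (frontier Ω) = 0) :
    ∃ (ρ : Euc d → ℝ) (K : ℝ), 0 < K ∧ Measurable ρ ∧
      (∀ᵐ x ∂(volume.restrict (interior Ω)), 0 < ρ x ∧ ρ x ≤ K ∧ 1 ≤ K * ρ x) ∧
      (∀ f : Euc d → ℝ, ∫ x, f x ∂μ = ∫ x in interior Ω, ρ x * f x) ∧
      μ ≤ ENNReal.ofReal K • volume.restrict (interior Ω) ∧
      volume.restrict (interior Ω) ≤ ENNReal.ofReal K • μ := by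
  have hr : volume.restrict (interior Ω) = volume.restrict Ω :=
    Measure.restrict_congr_set (interior_ae_eq hΩ.isClosed h0)
  have := hμ.finite
  have : IsFiniteMeasure (volume.restrict Ω) := ⟨by
    rw [Measure.restrict_apply_univ]; exact hΩ.measure_lt_top⟩
  obtain ⟨K, hK⟩ := hμ.log_bdd
  rw [hr]
  set l := volume.restrict Ω with hl
  set R := μ.rnDeriv l with hR
  have hpos : ∀ᵐ x ∂l, 0 < R x := hμ.ca.ae_le (Measure.rnDeriv_pos hμ.ac)
  have htop : ∀ᵐ x ∂l, R x < ⊤ := Measure.rnDeriv_lt_top μ l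
  have hbd : ∀ᵐ x ∂l, 0 < (R x).toReal ∧ (R x).toReal ≤ Real.exp K ∧
      1 ≤ Real.exp K * (R x).toReal := by
    filter_upwards [hpos, htop, hK] with x h1 h2 h3
    have h4 : 0 < (R x).toReal := ENNReal.toReal_pos h1.ne' h2.ne
    have h5 := abs_le.1 h3
    refine ⟨h4, ?_, ?_⟩
    · rw [← Real.exp_log h4]; exact Real.exp_le_exp.2 h5.2
    · rw [← Real.exp_log h4, ← Real.exp_add, Real.one_le_exp_iff]
      linarith
  -- A bound `K` for the absolute value of the logarithm of the density puts the density between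
  -- `exp (-K)` and `exp K`.
  refine ⟨fun x => (R x).toReal, Real.exp K, Real.exp_pos K,
    (Measure.measurable_rnDeriv μ l).ennreal_toReal, hbd, fun f => ?_, ?_, ?_⟩
  · exact (integral_rnDeriv_smul hμ.ac).symm
  · rw [← Measure.withDensity_rnDeriv_eq μ l hμ.ac, ← withDensity_const]
    refine withDensity_mono ?_
    filter_upwards [hbd, htop] with x h1 h2
    rw [← hR, ← ENNReal.ofReal_toReal h2.ne]
    exact ENNReal.ofReal_le_ofReal h1.2.1
  · conv_rhs => rw [← Measure.withDensity_rnDeriv_eq μ l hμ.ac]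
    rw [← withDensity_smul _ (Measure.measurable_rnDeriv μ l)]
    conv_lhs => rw [← withDensity_one (μ := l)]
    refine withDensity_mono ?_
    filter_upwards [hbd, htop] with x h1 h2
    simp only [Pi.one_apply, Pi.smul_apply, smul_eq_mul]
    rw [← hR, ← ENNReal.ofReal_toReal h2.ne, ← ENNReal.ofReal_mul (Real.exp_pos K).le]
    exact ENNReal.one_le_ofReal.2 h1.2.2

end Sampling

/-! ### Square integrable functions with square integrable derivatives up to order two -/

section Triple

variable {d : ℕ} {Ω : Set (Euc d)}

/-- `u` has weak derivatives `u1 i` and `u2 i j` of order one and two in the interior of `Ω`, and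
all of these are square integrable. -/
structure IsH2Triple (Ω : Set (Euc d)) (u : Euc d → ℝ) (u1 : Fin d → Euc d → ℝ)
    (u2 : Fin d → Fin d → Euc d → ℝ) : Prop where
  first : ∀ i, IsWeakPartial Ω i u (u1 i)
  second : ∀ i j, IsWeakPartial Ω i (u1 j) (u2 i j)
  memLp : MemLp u 2 (volume.restrict (interior Ω))
  memLp1 : ∀ i, MemLp (u1 i) 2 (volume.restrict (interior Ω))
  memLp2 : ∀ i j, MemLp (u2 i j) 2 (volume.restrict (interior Ω))

lemma memLp_mul_of_tsupport {u m : Euc d → ℝ} (hu : MemLp u 2 (volume.restrict (interior Ω)))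
    (hm : Continuous m) (hc : HasCompactSupport m) (hs : tsupport m ⊆ interior Ω) :
    MemLp (fun x => m x * u x) 2 := by
  obtain ⟨C, hC⟩ := hm.bounded_above_of_compact_support hc
  have h1 : MemLp (fun x => m x * u x) 2 (volume.restrict (interior Ω)) := by
    refine (hu.const_mul C).of_le (hm.aestronglyMeasurable.mul hu.aestronglyMeasurable) ?_
    refine Eventually.of_forall fun x => ?_
    rw [norm_mul, norm_mul]
    exact mul_le_mul_of_nonneg_right ((hC x).trans (le_abs_self C)) (norm_nonneg _)
  rw [← memLp_indicator_iff_restrict isOpen_interior.measurableSet] at h1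
  refine (memLp_congr_ae (Eventually.of_forall fun x => ?_)).1 h1
  by_cases hx : x ∈ interior Ω
  · simp [hx]
  · simp [hx, image_eq_zero_of_notMem_tsupport fun h => hx (hs h)]

/-- The product rule, applied twice. A cutoff with compact support in the interior makes the product
weakly differentiable on the whole space, where it can be translated and mollified. -/
lemma IsH2Triple.mul_cutoff {u : Euc d → ℝ} {u1 : Fin d → Euc d → ℝ}
    {u2 : Fin d → Fin d → Euc d → ℝ} (h : IsH2Triple Ω u u1 u2) {m : Euc d → ℝ}
    (hm : ContDiff ℝ 2 m) (hc : HasCompactSupport m) (hs : tsupport m ⊆ interior Ω) :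
    IsH2Triple Set.univ (fun x => m x * u x) (fun i x => m x * u1 i x + partialDeriv i m x * u x)
      (fun i j x => m x * u2 i j x + partialDeriv i m x * u1 j x
        + (partialDeriv j m x * u1 i x + partialDeriv i (partialDeriv j m) x * u x)) := by
  have hm1 : ContDiff ℝ 1 m := hm.of_le (by norm_num)
  have hmi : ∀ i, ContDiff ℝ 1 (partialDeriv i m) :=
    fun i => ContDiff.partialDeriv hm (by norm_num)
  have hmij : ∀ i j, Continuous (partialDeriv i (partialDeriv j m)) :=
    fun i j => (ContDiff.partialDeriv (m := 0) (hmi j) (by simp)).continuous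
  have hsi : ∀ i, tsupport (partialDeriv i m) ⊆ interior Ω :=
    fun i => (tsupport_partialDeriv_subset m).trans hs
  have hsij : ∀ i j, tsupport (partialDeriv i (partialDeriv j m)) ⊆ interior Ω :=
    fun i j => (tsupport_partialDeriv_subset _).trans (hsi j)
  refine ⟨fun i => (h.first i).mul_cutoff hm1 hc hs, fun i j => ?_, ?_, fun i => ?_,
    fun i j => ?_⟩
  · have h1 := (h.second i j).mul_cutoff hm1 hc hs
    have h2 := (h.first i).mul_cutoff (hmi j) hc.partialDeriv (hsi j)
    simpa using h1.linear h2 1 1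
  all_goals rw [interior_univ, Measure.restrict_univ]
  · exact memLp_mul_of_tsupport h.memLp hm.continuous hc hs
  · exact (memLp_mul_of_tsupport (h.memLp1 i) hm.continuous hc hs).add
      (memLp_mul_of_tsupport h.memLp (hmi i).continuous hc.partialDeriv (hsi i))
  · exact ((memLp_mul_of_tsupport (h.memLp2 i j) hm.continuous hc hs).add
      (memLp_mul_of_tsupport (h.memLp1 j) (hmi i).continuous hc.partialDeriv (hsi i))).add
      ((memLp_mul_of_tsupport (h.memLp1 i) (hmi j).continuous hc.partialDeriv (hsi j)).add
      (memLp_mul_of_tsupport h.memLp (hmij i j) hc.partialDeriv.partialDeriv (hsij i j)))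

lemma tendsto_integral_mul_of_tendsto_eLpNorm {q V : Euc d → ℝ} {W : ℕ → Euc d → ℝ}
    (hq : MemLp q 2) (hV : MemLp V 2) (hW : ∀ n, MemLp (W n) 2)
    (h : Tendsto (fun n => eLpNorm (W n - V) 2) atTop (𝓝 0)) :
    Tendsto (fun n => ∫ x, q x * W n x) atTop (𝓝 (∫ x, q x * V x)) := by
  refine tendsto_integral_of_L1 _ (hq.integrable_mul hV).aestronglyMeasurable
    (Eventually.of_forall fun n => hq.integrable_mul (hW n)) ?_
  refine tendsto_of_tendsto_of_tendsto_of_le_of_le tendsto_const_nhds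
    (h := fun n => eLpNorm q 2 * eLpNorm (W n - V) 2)
    (by simpa using ENNReal.Tendsto.const_mul h (Or.inr hq.eLpNorm_ne_top)) (fun n => zero_le)
    fun n => ?_
  have := eLpNorm_smul_le_mul_eLpNorm (p := 2) (q := 2) (r := 1) ((hW n).sub hV).1 hq.1
  rw [eLpNorm_one_eq_lintegral_enorm] at this
  refine le_trans (le_of_eq ?_) this
  refine lintegral_congr fun x => ?_
  simp [mul_sub]

end Triple

end PINN

/-! ### From products of `η` with test functions to Sobolev functions that vanish on the boundary.
-/

namespace PINN

/-! ### Extension of a distribution of order two to Sobolev functions -/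

section Extension

variable {d : ℕ} {ι : Type*} [Fintype ι]

/-- The distribution `p ↦ ∫ (α p + ∑ βᵢ ∂ᵢp + ∑ γᵢⱼ ∂ᵢ∂ⱼp) + ∑ₘ κₘ p(Xₘ)` vanishes. -/
def Annihilates (α : Euc d → ℝ) (β : Fin d → Euc d → ℝ) (γ : Fin d → Fin d → Euc d → ℝ)
    (κ : ι → ℝ) (X : ι → Euc d) : Prop :=
  ∀ p : Euc d → ℝ, ContDiff ℝ ∞ p → HasCompactSupport p →
    (∫ x, α x * p x) + ∑ i, (∫ x, β i x * partialDeriv i p x)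
      + ∑ i, ∑ j, (∫ x, γ i j x * partialDeriv i (partialDeriv j p) x) + ∑ m, κ m * p (X m) = 0

lemma partialDeriv_comp_add_right (i : Fin d) (f : Euc d → ℝ) (a : Euc d) :
    partialDeriv i (fun x => f (x + a)) = fun x => partialDeriv i f (x + a) := by
  funext x
  rw [partialDeriv, fderiv_comp_add_right, partialDeriv]

lemma memLp_comp_add_right {f : Euc d → ℝ} (hf : MemLp f 2) (a : Euc d) :
    MemLp (fun x => f (x + a)) 2 :=
  hf.comp_measurePreserving (measurePreserving_add_right volume a)

lemma memLp_mollify {f : Euc d → ℝ} (hf : MemLp f 2) (hc : HasCompactSupport f) (n : ℕ) :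
    MemLp (mollify n f) 2 :=
  (contDiff_mollify n (hf.locallyIntegrable (by norm_num))).continuous.memLp_of_hasCompactSupport
    (hasCompactSupport_mollify n hc)

variable {V : Euc d → ℝ} {V1 : Fin d → Euc d → ℝ} {V2 : Fin d → Fin d → Euc d → ℝ}

lemma IsH2Triple.memLp_univ (h : IsH2Triple Set.univ V V1 V2) : MemLp V 2 := by
  simpa using h.memLp

lemma IsH2Triple.memLp1_univ (h : IsH2Triple Set.univ V V1 V2) (i : Fin d) : MemLp (V1 i) 2 := by
  simpa using h.memLp1 i

lemma IsH2Triple.memLp2_univ (h : IsH2Triple Set.univ V V1 V2) (i j : Fin d) :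
    MemLp (V2 i j) 2 := by
  simpa using h.memLp2 i j

lemma IsH2Triple.contDiff_mollify (h : IsH2Triple Set.univ V V1 V2) (n : ℕ) :
    ContDiff ℝ ∞ (mollify n V) :=
  PINN.contDiff_mollify n (h.memLp_univ.locallyIntegrable (by norm_num))

lemma IsH2Triple.partialDeriv_mollify (h : IsH2Triple Set.univ V V1 V2) (n : ℕ) (i : Fin d) :
    partialDeriv i (mollify n V) = mollify n (V1 i) :=
  PINN.partialDeriv_mollify (h.first i) n

lemma IsH2Triple.partialDeriv_partialDeriv_mollify (h : IsH2Triple Set.univ V V1 V2) (n : ℕ)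
    (i j : Fin d) : partialDeriv i (partialDeriv j (mollify n V)) = mollify n (V2 i j) := by
  rw [h.partialDeriv_mollify, PINN.partialDeriv_mollify (h.second i j) n]

/-- Translated mollifications of `V` are admissible test functions. Their derivatives up to order
two converge in `L²`, and their values at the points converge by `tendsto_mollify`. The translation
is kept for pushing quotients by `η` inwards; values are only needed where the weight is not zero,
which excludes observation points on the boundary. -/
lemma Annihilates.extend {α : Euc d → ℝ} {β : Fin d → Euc d → ℝ}
    {γ : Fin d → Fin d → Euc d → ℝ} {κ : ι → ℝ} {X : ι → Euc d} (h : Annihilates α β γ κ X)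
    (hα : MemLp α 2) (hβ : ∀ i, MemLp (β i) 2) (hγ : ∀ i j, MemLp (γ i j) 2)
    (hV : IsH2Triple Set.univ V V1 V2) (hc : HasCompactSupport V) (a : Euc d) (v : ι → ℝ)
    (hv : ∀ m, κ m ≠ 0 →
      Tendsto (fun r : ℝ => ⨍ y in Metric.ball (X m + a) r, V y) (𝓝[>] 0) (𝓝 (v m))) :
    (∫ x, α x * V (x + a)) + ∑ i, (∫ x, β i x * V1 i (x + a))
      + ∑ i, ∑ j, (∫ x, γ i j x * V2 i j (x + a)) + ∑ m, κ m * v m = 0 := by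
  have hconv : ∀ {q f : Euc d → ℝ}, MemLp q 2 → MemLp f 2 → (∀ n, MemLp (mollify n f) 2) →
      Tendsto (fun n => ∫ x, q x * mollify n f (x + a)) atTop (𝓝 (∫ x, q x * f (x + a))) := by
    intro q f hq hf hfn
    refine tendsto_integral_mul_of_tendsto_eLpNorm hq (memLp_comp_add_right hf a)
      (fun n => memLp_comp_add_right (hfn n) a) ?_
    refine (tendsto_eLpNorm_mollify hf).congr fun n => ?_
    exact (eLpNorm_comp_measurePreserving ((hfn n).sub hf).1
      (measurePreserving_add_right volume a)).symm
  have hVn := fun n => memLp_mollify hV.memLp_univ hc n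
  have hVn1 : ∀ i n, MemLp (mollify n (V1 i)) 2 := by
    intro i n
    rw [← hV.partialDeriv_mollify]
    exact (ContDiff.partialDeriv (m := 0) (hV.contDiff_mollify n)
      (by simp)).continuous.memLp_of_hasCompactSupport (hasCompactSupport_mollify n hc).partialDeriv
  have hVn2 : ∀ i j n, MemLp (mollify n (V2 i j)) 2 := by
    intro i j n
    rw [← hV.partialDeriv_partialDeriv_mollify]
    exact (ContDiff.partialDeriv (m := 0) (ContDiff.partialDeriv (m := 1) (hV.contDiff_mollify n)
      (by norm_cast)) (by simp)).continuous.memLp_of_hasCompactSupport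
      (hasCompactSupport_mollify n hc).partialDeriv.partialDeriv
  have hz : ∀ n : ℕ, (∫ x, α x * mollify n V (x + a))
      + ∑ i, (∫ x, β i x * mollify n (V1 i) (x + a))
      + ∑ i, ∑ j, (∫ x, γ i j x * mollify n (V2 i j) (x + a))
      + ∑ m, κ m * mollify n V (X m + a) = 0 := by
    intro n
    have hp1 : ∀ i, partialDeriv i (fun x => mollify n V (x + a))
        = fun x => mollify n (V1 i) (x + a) := fun i => by
      rw [partialDeriv_comp_add_right, hV.partialDeriv_mollify]
    have hp2 : ∀ i j, partialDeriv i (fun x => mollify n (V1 j) (x + a))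
        = fun x => mollify n (V2 i j) (x + a) := fun i j => by
      rw [partialDeriv_comp_add_right, PINN.partialDeriv_mollify (hV.second i j) n]
    have := h (fun x => mollify n V (x + a))
      ((hV.contDiff_mollify n).comp (contDiff_id.add contDiff_const))
      ((hasCompactSupport_mollify n hc).comp_homeomorph (Homeomorph.addRight a))
    simpa only [hp1, hp2] using this
  have hval : ∀ m, Tendsto (fun n => κ m * mollify n V (X m + a)) atTop (𝓝 (κ m * v m)) := by
    intro m
    by_cases hm : κ m = 0
    · simp [hm]
    · exact (tendsto_mollify (hV.memLp_univ.locallyIntegrable (by norm_num)) (hv m hm)).const_mul _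
  have hlim := (((hconv hα hV.memLp_univ hVn).add (tendsto_finsetSum Finset.univ fun i _ =>
    hconv (hβ i) (hV.memLp1_univ i) (hVn1 i))).add (tendsto_finsetSum Finset.univ fun i _ =>
    tendsto_finsetSum Finset.univ fun j _ => hconv (hγ i j) (hV.memLp2_univ i j) (hVn2 i j))).add
    (tendsto_finsetSum Finset.univ fun m _ => hval m)
  exact tendsto_nhds_unique hlim (tendsto_const_nhds.congr fun n => (hz n).symm)

end Extension

/-! ### The boundary in terms of the auxiliary function -/

section Boundary

variable {d : ℕ} {Ω : Set (Euc d)} {η : Euc d → ℝ}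

/-- Near a boundary point, `Ω` is the set where `η ≥ 0`, and `η` grows in a direction `e` which is
almost normal. -/
structure IsBoundaryBall (Ω : Set (Euc d)) (η : Euc d → ℝ) (p e : Euc d) (ρ c : ℝ) : Prop where
  rho_pos : 0 < ρ
  c_pos : 0 < c
  norm_e : ‖e‖ = 1
  le_fderiv : ∀ x ∈ Metric.ball p ρ, c ≤ fderiv ℝ η x e
  tangential : ∀ x ∈ Metric.ball p ρ,
    ∑ i, (partialDeriv i η x - fderiv ℝ η x e * e i) ^ 2 ≤ (c / 4) ^ 2
  mem_interior : ∀ x ∈ Metric.ball p ρ, x ∈ interior Ω ↔ 0 < η x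

lemma IsBoundaryBall.mono {p e : Euc d} {ρ c ρ' : ℝ} (h : IsBoundaryBall Ω η p e ρ c)
    (h0 : 0 < ρ') (hρ : ρ' ≤ ρ) : IsBoundaryBall Ω η p e ρ' c :=
  ⟨h0, h.c_pos, h.norm_e, fun x hx => h.le_fderiv x (Metric.ball_subset_ball hρ hx),
    fun x hx => h.tangential x (Metric.ball_subset_ball hρ hx),
    fun x hx => h.mem_interior x (Metric.ball_subset_ball hρ hx)⟩

/-- The graph gives a defining function `F`, and `η` vanishes where `F = 0`. So `dη` is a multiple
of `dF` at `p`, nonzero by assumption and positive because `η > 0` inside. The direction `e` is the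
normalized gradient of `η` at `p`: there the gradient has no component orthogonal to `e`, and by
continuity only a small one nearby. -/
lemma exists_isBoundaryBall (hΩ : IsClosed Ω) (hΩ' : HasC3HolderBoundary Ω)
    (hη : IsAuxiliary Ω η) {p : Euc d} (hp : p ∈ frontier Ω) :
    ∃ (e : Euc d) (ρ c : ℝ), IsBoundaryBall Ω η p e ρ c := by
  obtain ⟨_, _, _, h⟩ := hΩ'
  obtain ⟨r, hr, g, hg, γ, hγ, -, hgraph⟩ := h p hp
  have hη1 : Continuous (fderiv ℝ η) := hη.contDiff.continuous_fderiv (by norm_num)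
  -- The height above the graph: locally `Ω = {F ≥ 0}`, and `F` grows with slope exactly one along
  -- the axis `g`.
  set F : Euc d → ℝ := fun x => inner ℝ x g - γ (x - inner ℝ x g • g) with hF
  have hFd : ContDiff ℝ 3 F := by
    have : ContDiff ℝ 3 fun x : Euc d => inner ℝ x g := contDiff_id.inner ℝ contDiff_const
    exact this.sub (hγ.comp (contDiff_id.sub (this.smul contDiff_const)))
  have hFt : ∀ x (t : ℝ), F (x + t • g) = F x + t := by
    intro x t
    have h1 : inner ℝ (x + t • g) g = inner ℝ x g + t := by
      rw [inner_add_left, inner_smul_left, real_inner_self_eq_norm_sq, hg]; simp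
    simp only [hF, h1, add_smul]
    rw [show x + t • g - (inner ℝ x g • g + t • g) = x - inner ℝ x g • g by abel]
    ring
  have hΩF : ∀ x ∈ Metric.ball p r, x ∈ Ω ↔ 0 ≤ F x := fun x hx => by
    rw [hgraph x hx, hF, sub_nonneg]
  have hint : ∀ x ∈ Metric.ball p r, 0 < F x → x ∈ interior Ω := by
    intro x hx hFx
    rw [mem_interior_iff_mem_nhds]
    filter_upwards [Metric.isOpen_ball.mem_nhds hx,
      hFd.continuous.continuousAt.eventually (lt_mem_nhds hFx)] with y hy hFy
    exact (hΩF y hy).2 hFy.le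
  have hline : ∀ (x v : Euc d), Continuous fun t : ℝ => x + t • v := fun x v => by fun_prop
  have hfr : ∀ x ∈ Metric.ball p r, F x ≤ 0 → x ∉ interior Ω := by
    intro x hx hFx hxi
    have hev : ∀ᶠ t : ℝ in 𝓝 0, x + t • g ∈ Ω ∩ Metric.ball p r :=
      (hline x g).continuousAt.eventually_mem
        (by simpa using inter_mem (mem_interior_iff_mem_nhds.1 hxi) (Metric.isOpen_ball.mem_nhds hx))
    obtain ⟨δ, hδ, hball⟩ := Metric.eventually_nhds_iff_ball.1 hev
    have := hball (-(δ / 2)) (by simp [abs_of_pos, hδ])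
    have := (hΩF _ this.2).1 this.1
    rw [hFt] at this
    linarith
  have hfr0 : ∀ x ∈ Metric.ball p r, F x = 0 → x ∈ frontier Ω := fun x hx hFx => by
    rw [hΩ.frontier_eq]
    exact ⟨(hΩF x hx).2 hFx.ge, hfr x hx hFx.le⟩
  have hpr : p ∈ Metric.ball p r := Metric.mem_ball_self hr
  have hFp : F p = 0 := by
    refine le_antisymm ?_ ?_
    · by_contra hcon
      exact hp.2 (hint p hpr (not_le.1 hcon))
    · exact (hΩF p hpr).1 (hΩ.frontier_subset hp)
  have hηd := hη.differentiable
  -- The curve `p + t w - F(p + t w) g` stays on the boundary for small `t`, so `η` vanishes along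
  -- it; differentiate at `t = 0`.
  have hker : ∀ w, fderiv ℝ η p w = fderiv ℝ F p w * fderiv ℝ η p g := by
    intro w
    set curve : ℝ → Euc d := fun t => p + t • w - F (p + t • w) • g with hcurve
    have hlin : HasDerivAt (fun t : ℝ => p + t • w) w 0 := by
      simpa using ((hasDerivAt_id (0 : ℝ)).smul_const w).const_add p
    have hc0 : curve 0 = p := by simp [hcurve, hFp]
    have hFline : HasDerivAt (fun t : ℝ => F (p + t • w)) (fderiv ℝ F p w) 0 := by
      have : HasFDerivAt F (fderiv ℝ F p) (p + (0 : ℝ) • w) := by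
        simpa using (hFd.differentiable (by norm_num) p).hasFDerivAt
      exact this.comp_hasDerivAt 0 hlin
    have hcd : HasDerivAt curve (w - fderiv ℝ F p w • g) 0 :=
      hlin.sub (hFline.smul_const g)
    have hcomp : HasDerivAt (η ∘ curve) (fderiv ℝ η p (w - fderiv ℝ F p w • g)) 0 := by
      have : HasFDerivAt η (fderiv ℝ η p) (curve 0) := by
        rw [hc0]; exact (hηd p).hasFDerivAt
      exact this.comp_hasDerivAt 0 hcd
    have hzero : η ∘ curve =ᶠ[𝓝 0] fun _ => 0 := by
      filter_upwards [hcd.continuousAt.eventually_mem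
        (by rw [hc0]; exact Metric.isOpen_ball.mem_nhds hpr)] with t ht
      refine hη.zero _ (hfr0 _ ht ?_)
      have := hFt (p + t • w) (-F (p + t • w))
      simp only [hcurve]
      rw [sub_eq_add_neg, ← neg_smul, this]; ring
    have h0 := hcomp.unique ((hasDerivAt_const (0 : ℝ) (0 : ℝ)).congr_of_eventuallyEq hzero)
    rw [map_sub, map_smul, smul_eq_mul] at h0
    linarith
  have hgne : fderiv ℝ η p g ≠ 0 := by
    intro h0
    refine hη.deriv_ne p hp ?_
    ext1 w
    rw [hker w, h0, mul_zero]; rfl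
  have hηp : η p = 0 := hη.zero p hp
  -- The points `p + t g` with small `t > 0` are interior, so the difference quotients of `η` are
  -- positive.
  have hgpos : 0 < fderiv ℝ η p g := by
    refine lt_of_le_of_ne ?_ hgne.symm
    have hlin : HasDerivAt (fun t : ℝ => p + t • g) g 0 := by
      simpa using ((hasDerivAt_id (0 : ℝ)).smul_const g).const_add p
    have hd : HasDerivAt (fun t : ℝ => η (p + t • g)) (fderiv ℝ η p g) 0 := by
      have : HasFDerivAt η (fderiv ℝ η p) (p + (0 : ℝ) • g) := by simpa using (hηd p).hasFDerivAt
      exact this.comp_hasDerivAt 0 hlin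
    have hsl := (hasDerivWithinAt_iff_tendsto_slope' (by simp)).1
      (hd.hasDerivWithinAt (s := Set.Ioi 0))
    refine ge_of_tendsto hsl ?_
    have hev : ∀ᶠ t : ℝ in 𝓝[>] 0, p + t • g ∈ Metric.ball p r :=
      ((hline p g).continuousAt.eventually_mem
        (by simpa using Metric.isOpen_ball.mem_nhds hpr)).filter_mono nhdsWithin_le_nhds
    filter_upwards [hev, self_mem_nhdsWithin] with t ht ht0
    have ht0' : 0 < t := ht0
    have h1 : 0 < η (p + t • g) := hη.pos _ (hint _ ht (by rw [hFt, hFp]; linarith))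
    rw [slope_def_field]
    simp only [zero_smul, add_zero, hηp, sub_zero]
    positivity
  set v : Euc d := WithLp.toLp 2 fun i => partialDeriv i η p with hv
  have hvin : ∀ w, fderiv ℝ η p w = ∑ i, w i * v i := fun w => fderiv_apply_eq_sum η p w
  have hv0 : v ≠ 0 := by
    intro h0
    rw [hvin, h0] at hgpos
    simp at hgpos
  set n := ‖v‖ with hn
  have hnpos : 0 < n := norm_pos_iff.2 hv0
  have hnsq : ∑ i, v i * v i = n ^ 2 := by
    rw [hn, EuclideanSpace.norm_sq_eq]
    exact Finset.sum_congr rfl fun i _ => by rw [Real.norm_eq_abs, sq_abs, sq]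
  set e : Euc d := n⁻¹ • v with he
  have hep : fderiv ℝ η p e = n := by
    rw [he, map_smul, hvin, hnsq, smul_eq_mul]
    field_simp
  have hecont : Continuous fun x => fderiv ℝ η x e := hη1.clm_apply continuous_const
  have hpcont : ∀ i, Continuous (partialDeriv i η) := fun i => hη1.clm_apply continuous_const
  -- At `p` the derivative of `η` along `e` equals `n`, the length of the gradient; half of it
  -- survives nearby and serves as the constant `c`.
  have ev1 : ∀ᶠ x in 𝓝 p, n / 2 < fderiv ℝ η x e :=
    hecont.continuousAt.eventually (lt_mem_nhds (by simp only [hep]; linarith))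
  have ev2 : ∀ᶠ x in 𝓝 p,
      ∑ i, (partialDeriv i η x - fderiv ℝ η x e * e i) ^ 2 < (n / 2 / 4) ^ 2 := by
    have hcts : Continuous fun x => ∑ i, (partialDeriv i η x - fderiv ℝ η x e * e i) ^ 2 :=
      continuous_finsetSum _ fun i _ => ((hpcont i).sub (hecont.mul continuous_const)).pow 2
    refine hcts.continuousAt.eventually (gt_mem_nhds ?_)
    have : ∀ i, partialDeriv i η p - fderiv ℝ η p e * e i = 0 := by
      intro i
      rw [hep, he]
      simp only [PiLp.smul_apply, smul_eq_mul, hv]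
      field_simp
      ring
    simp only [this]
    simp
    positivity
  have hgcont : Continuous fun x => fderiv ℝ η x g := hη1.clm_apply continuous_const
  obtain ⟨ρ₁, hρ₁, hball₁⟩ := Metric.eventually_nhds_iff_ball.1
    ((hgcont.continuousAt.eventually (lt_mem_nhds (half_lt_self hgpos))).and
      (Metric.isOpen_ball.mem_nhds hpr))
  have ev3 : ∀ᶠ x in 𝓝 p, |F x| < ρ₁ / 2 :=
    hFd.continuous.abs.continuousAt.eventually (gt_mem_nhds (by simpa [hFp] using hρ₁))
  obtain ⟨ρ₂, hρ₂, hball₂⟩ := Metric.eventually_nhds_iff_ball.1 ((ev1.and ev2).and ev3)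
  refine ⟨e, min ρ₂ (ρ₁ / 2), n / 2, by positivity, by positivity, ?_, fun x hx => ?_,
    fun x hx => ?_, fun x hx => ?_⟩
  · rw [he, norm_smul, norm_inv, Real.norm_of_nonneg hnpos.le, ← hn]
    field_simp
  · exact (hball₂ x (Metric.ball_subset_ball (min_le_left _ _) hx)).1.1.le
  · exact (hball₂ x (Metric.ball_subset_ball (min_le_left _ _) hx)).1.2.le
  -- A point with `F x ≤ 0` reaches the boundary by moving the distance `-F x` along `g`. As `η`
  -- increases along the way and ends at zero, `η x ≤ 0`. The halved radii keep this foot point in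
  -- the ball of radius `ρ₁`.
  · have hFx := (hball₂ x (Metric.ball_subset_ball (min_le_left _ _) hx)).2
    have hx1 : dist x p < ρ₁ / 2 := (lt_of_lt_of_le hx (min_le_right _ _))
    have hxb : x ∈ Metric.ball p ρ₁ := Metric.mem_ball.2 (by linarith)
    have hxr := (hball₁ x hxb).2
    have hfoot : x + (-F x) • g ∈ Metric.ball p ρ₁ := by
      rw [Metric.mem_ball, dist_eq_norm]
      calc ‖x + -F x • g - p‖ = ‖(x - p) + -F x • g‖ := by congr 1; abel
        _ ≤ ‖x - p‖ + ‖-F x • g‖ := norm_add_le _ _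
        _ < ρ₁ / 2 + ρ₁ / 2 := by
            rw [norm_smul, hg, mul_one, norm_neg, Real.norm_eq_abs, ← dist_eq_norm]
            linarith
        _ = ρ₁ := by ring
    have hη0 : η (x + (-F x) • g) = 0 :=
      hη.zero _ (hfr0 _ (hball₁ _ hfoot).2 (by rw [hFt]; ring))
    constructor
    · exact hη.pos x
    · intro hηx
      refine hint x hxr ?_
      by_contra hcon
      push Not at hcon
      have := add_mul_le_of_le_fderiv (convex_ball p ρ₁) hηd (fun y hy => (hball₁ y hy).1.le)
        (t := -F x) (by linarith) hxb hfoot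
      rw [hη0] at this
      nlinarith

end Boundary

end PINN

namespace PINN

/-! ### Weighted inequalities of Hardy and Rellich type near the boundary -/

section Weight

/-- The weight `s₊² / (s² + ε²)`. -/
noncomputable def weight (ε s : ℝ) : ℝ := max s 0 ^ 2 / (s ^ 2 + ε ^ 2)

variable {ε : ℝ}

lemma weight_nonneg (ε s : ℝ) : 0 ≤ weight ε s := by
  unfold weight; positivity

lemma max_zero_sq_le (s : ℝ) : max s 0 ^ 2 ≤ s ^ 2 := by
  rcases le_total s 0 with h | h
  · rw [max_eq_right h]; nlinarith [sq_nonneg s]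
  · rw [max_eq_left h]

lemma weight_le_one (hε : 0 < ε) (s : ℝ) : weight ε s ≤ 1 := by
  unfold weight
  rw [div_le_one (by positivity)]
  nlinarith [max_zero_sq_le s, sq_nonneg ε]

lemma weight_le (hε : 0 < ε) (s : ℝ) : weight ε s ≤ (s / ε) ^ 2 := by
  unfold weight
  rw [div_pow]
  refine div_le_div₀ (sq_nonneg s) (max_zero_sq_le s) (by positivity) ?_
  nlinarith [sq_nonneg s]

lemma weight_of_nonpos {s : ℝ} (hs : s ≤ 0) : weight ε s = 0 := by
  simp [weight, max_eq_right hs]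

lemma continuous_weight (hε : 0 < ε) : Continuous (weight ε) := by
  unfold weight
  exact ((continuous_id.max continuous_const).pow 2).div (by fun_prop) fun s => by positivity

lemma hasDerivAt_max_zero_pow_three (s : ℝ) :
    HasDerivAt (fun s : ℝ => max s 0 ^ 3) (3 * max s 0 ^ 2) s := by
  rcases lt_trichotomy s 0 with h | rfl | h
  · have : (fun s : ℝ => max s 0 ^ 3) =ᶠ[𝓝 s] fun _ => 0 := by
      filter_upwards [gt_mem_nhds h] with x hx
      simp [max_eq_right hx.le]
    rw [max_eq_right h.le]
    simpa using (hasDerivAt_const s (0 : ℝ)).congr_of_eventuallyEq this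
  · rw [hasDerivAt_iff_tendsto_slope_zero]
    simp only [max_self, zero_add, smul_eq_mul]
    have h0 : Tendsto (fun t : ℝ => t ^ 2) (𝓝[≠] 0) (𝓝 (3 * (0 : ℝ) ^ 2)) := by
      have : Continuous fun t : ℝ => t ^ 2 := by fun_prop
      simpa using (this.tendsto 0).mono_left nhdsWithin_le_nhds
    have h1 : (3 * (0 : ℝ) ^ 2) = 0 := by norm_num
    rw [h1] at h0 ⊢
    refine squeeze_zero_norm (fun t => ?_) h0
    rcases le_total t 0 with h | h
    · simp [max_eq_right h]; positivity
    · rw [max_eq_left h]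
      rcases h.eq_or_lt with rfl | h
      · simp
      · rw [Real.norm_eq_abs, abs_of_nonneg (by simp; positivity)]
        apply le_of_eq
        field_simp
        ring
  · have : (fun s : ℝ => max s 0 ^ 3) =ᶠ[𝓝 s] fun s => s ^ 3 := by
      filter_upwards [lt_mem_nhds h] with x hx
      simp [max_eq_left hx.le]
    rw [max_eq_left h.le]
    simpa using (hasDerivAt_pow 3 s).congr_of_eventuallyEq this

/-- Here `s * weight ε s = s₊³ / (s² + ε²)`, which is `C¹`. Its derivative exceeds the weight by a
term between `0` and twice the weight; this is the quantity `t ≤ 2θ` in `rellich_pointwise`. -/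
lemma hasDerivAt_mul_weight (hε : 0 < ε) (s : ℝ) :
    HasDerivAt (fun s => s * weight ε s)
      (weight ε s + 2 * ε ^ 2 / (s ^ 2 + ε ^ 2) * weight ε s) s := by
  have hd : s ^ 2 + ε ^ 2 ≠ 0 := by positivity
  have h1 := (hasDerivAt_max_zero_pow_three s).div
    (((hasDerivAt_pow 2 s).add_const (ε ^ 2))) hd
  have hm : ∀ s : ℝ, s * max s 0 ^ 2 = max s 0 ^ 3 := by
    intro s
    rcases le_total s 0 with h | h
    · simp [max_eq_right h]
    · simp [max_eq_left h]; ring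
  refine (h1.congr_of_eventuallyEq (Eventually.of_forall fun x => ?_)).congr_deriv ?_
  · simp [weight, ← hm, mul_div_assoc]
  · rw [weight, ← hm]
    field_simp
    push_cast
    ring

lemma contDiff_mul_weight (hε : 0 < ε) : ContDiff ℝ 1 fun s => s * weight ε s := by
  rw [contDiff_one_iff_deriv]
  refine ⟨fun s => (hasDerivAt_mul_weight hε s).differentiableAt, ?_⟩
  have : deriv (fun s => s * weight ε s)
      = fun s => weight ε s + 2 * ε ^ 2 / (s ^ 2 + ε ^ 2) * weight ε s :=
    funext fun s => (hasDerivAt_mul_weight hε s).deriv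
  rw [this]
  have hw := continuous_weight hε
  exact hw.add ((continuous_const.div (by fun_prop) fun s => by positivity).mul hw)

end Weight

/-! ### Rellich and Hardy inequalities for smooth functions. -/

section Inequalities

variable {d : ℕ}

lemma _root_.HasCompactSupport.sq {f : Euc d → ℝ} (hf : HasCompactSupport f) :
    HasCompactSupport fun x => f x ^ 2 := by
  simp_rw [pow_two]
  exact hf.mul_left

lemma integrable_sq_of_hasCompactSupport {f : Euc d → ℝ} (hf : Continuous f)
    (hc : HasCompactSupport f) : Integrable fun x => f x ^ 2 :=
  Continuous.integrable_of_hasCompactSupport (by fun_prop) hc.sq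

lemma eLpNorm_le_of_integral_sq_le {f g : Euc d → ℝ} (hf : Integrable fun x => f x ^ 2)
    (hg : Integrable fun x => g x ^ 2) {C : ℝ} (hC : 0 ≤ C)
    (h : ∫ x, f x ^ 2 ≤ C ^ 2 * ∫ x, g x ^ 2) :
    eLpNorm f 2 ≤ ENNReal.ofReal C * eLpNorm g 2 := by
  have key : ∀ {f : Euc d → ℝ}, Integrable (fun x => f x ^ 2) →
      eLpNorm f 2 ^ 2 = ENNReal.ofReal (∫ x, f x ^ 2) := by
    intro f hf
    rw [eLpNorm_two_sq, ofReal_integral_eq_lintegral_ofReal hf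
      (Eventually.of_forall fun x => sq_nonneg _)]
    refine lintegral_congr fun x => ?_
    rw [Real.enorm_eq_ofReal_abs, ← ENNReal.ofReal_pow (abs_nonneg _), sq_abs]
  rw [← ENNReal.pow_le_pow_left_iff (two_ne_zero)]
  rw [mul_pow, key hf, key hg, ← ENNReal.ofReal_pow hC, ← ENNReal.ofReal_mul (by positivity)]
  exact ENNReal.ofReal_le_ofReal h

/-- To be read with `a = ∇v`, `n = ∇h`, `L = Δv`, `s = h`, where `θ` is the weight and `θ + t` the
derivative of `s * weight`. Splitting `X = ne * ae + W` into a part along `e` and a small rest, the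
left side is `θ F ae - ne ((θ - t) ae² + ½ t S) - (θ - t) W ae - ½ θ ne S` with `F = s L + 2 X` and
`S = |a|²`. The last term yields `-c/2`; the rest `W` costs `c/4` and Young's inequality for `F ae`
costs `c/8`, leaving `-c/8`. -/
lemma rellich_pointwise {a n e : Fin d → ℝ} {θ t c L s : ℝ} (he : ∑ k, e k ^ 2 = 1)
    (hθ : 0 ≤ θ) (ht0 : 0 ≤ t) (ht : t ≤ 2 * θ) (hc : 0 < c) {ne X ae : ℝ} (hnc : c ≤ ne)
    (hX : X = ∑ k, n k * a k) (hae : ae = ∑ k, e k * a k)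
    (htan : ∑ k, (n k - ne * e k) ^ 2 ≤ (c / 4) ^ 2) :
    (θ + t) * X * ae + s * θ * L * ae - 1 / 2 * (θ + t) * ne * ∑ k, a k ^ 2
      ≤ 2 / c * (θ * (s * L + 2 * X) ^ 2) - c / 8 * (θ * ∑ k, a k ^ 2) := by
  set S := ∑ k, a k ^ 2 with hS
  set F := s * L + 2 * X with hF
  have hS0 : 0 ≤ S := Finset.sum_nonneg fun k _ => sq_nonneg _
  have haeS : ae ^ 2 ≤ S := by
    have := Finset.sum_mul_sq_le_sq_mul_sq Finset.univ e a
    rwa [he, one_mul, ← hae] at this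
  set W := ∑ k, (n k - ne * e k) * a k with hW
  have hXW : X = ne * ae + W := by
    rw [hX, hae, hW, Finset.mul_sum, ← Finset.sum_add_distrib]
    exact Finset.sum_congr rfl fun k _ => by ring
  have hWS : W ^ 2 ≤ (c / 4) ^ 2 * S :=
    (Finset.sum_mul_sq_le_sq_mul_sq Finset.univ _ a).trans (mul_le_mul_of_nonneg_right htan hS0)
  have hWae : |W * ae| ≤ c / 4 * S := by
    refine abs_le_of_sq_le_sq ?_ (by positivity)
    calc (W * ae) ^ 2 = W ^ 2 * ae ^ 2 := by ring
      _ ≤ (c / 4) ^ 2 * S * S := mul_le_mul hWS haeS (sq_nonneg _) (by positivity)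
      _ = (c / 4 * S) ^ 2 := by ring
  have h1 : -((θ - t) * (W * ae)) ≤ θ * (c / 4 * S) := by
    have hab : |θ - t| ≤ θ := abs_le.2 ⟨by linarith, by linarith⟩
    calc -((θ - t) * (W * ae)) ≤ |(θ - t) * (W * ae)| := neg_le_abs _
      _ = |θ - t| * |W * ae| := abs_mul _ _
      _ ≤ θ * (c / 4 * S) := mul_le_mul hab hWae (abs_nonneg _) hθ
  -- For `t > θ` the negative term is absorbed because `ae² ≤ S` and `θ - t + t/2 ≥ 0`.
  have h2 : 0 ≤ (θ - t) * ae ^ 2 + 1 / 2 * t * S := by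
    rcases le_total t θ with h | h
    · have := mul_nonneg (sub_nonneg.2 h) (sq_nonneg ae)
      have := mul_nonneg ht0 hS0
      linarith
    · have := mul_le_mul_of_nonneg_left haeS (sub_nonneg.2 h)
      nlinarith
  have h3 : 0 ≤ ne * ((θ - t) * ae ^ 2 + 1 / 2 * t * S) :=
    mul_nonneg (hc.le.trans hnc) h2
  have h4 : F * ae ≤ 2 / c * F ^ 2 + c / 8 * ae ^ 2 := by
    have : 0 ≤ 2 / c * (F - c / 4 * ae) ^ 2 := by positivity
    have h5 : 2 / c * (F - c / 4 * ae) ^ 2 = 2 / c * F ^ 2 + c / 8 * ae ^ 2 - F * ae := by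
      field_simp
      ring
    linarith
  have h5 : θ * (F * ae) ≤ θ * (2 / c * F ^ 2 + c / 8 * S) :=
    mul_le_mul_of_nonneg_left (h4.trans (by gcongr)) hθ
  have h6 : 0 ≤ (ne - c) * (θ * S) := mul_nonneg (sub_nonneg.2 hnc) (mul_nonneg hθ hS0)
  have e1 : (θ + t) * X * ae + s * θ * L * ae - 1 / 2 * (θ + t) * ne * S
      = θ * (F * ae) - ne * ((θ - t) * ae ^ 2 + 1 / 2 * t * S) - (θ - t) * (W * ae)
        - 1 / 2 * θ * ne * S := by
    rw [hF, hXW]; ring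
  rw [e1]
  nlinarith

/-- The divergence of `Ψ (∂_e v ∇v - ½ |∇v|² e)`. By symmetry of the Hessian, `∇v · ∇(∂_e v)`
cancels against `½ ∂_e |∇v|²`, so only the Laplacian is left among the second derivatives. -/
lemma rellich_divergence {a n e : Fin d → ℝ} {H : Fin d → Fin d → ℝ} (hH : ∀ i j, H i j = H j i)
    (Ψ W ae Q : ℝ) :
    ∑ k, (Ψ * (H k k * ae + a k * (∑ i, e i * H k i) - e k * ∑ i, a i * H k i)
        + W * n k * (a k * ae - 1 / 2 * e k * Q))
      = W * (∑ k, n k * a k) * ae + Ψ * (∑ i, H i i) * ae - 1 / 2 * W * (∑ k, e k * n k) * Q := by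
  have hs : ∑ k, a k * (∑ i, e i * H k i) = ∑ k, e k * ∑ i, a i * H k i := by
    simp_rw [Finset.mul_sum]
    rw [Finset.sum_comm]
    refine Finset.sum_congr rfl fun i _ => Finset.sum_congr rfl fun j _ => ?_
    rw [hH i j]; ring
  have h1 : ∑ k, (Ψ * (H k k * ae + a k * (∑ i, e i * H k i) - e k * ∑ i, a i * H k i)
        + W * n k * (a k * ae - 1 / 2 * e k * Q))
      = Ψ * ((∑ i, H i i) * ae + ∑ k, a k * (∑ i, e i * H k i) - ∑ k, e k * ∑ i, a i * H k i)
        + (W * (∑ k, n k * a k) * ae - 1 / 2 * W * (∑ k, e k * n k) * Q) := by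
    rw [Finset.sum_mul, Finset.mul_sum, Finset.sum_mul, Finset.mul_sum, Finset.sum_mul,
      ← Finset.sum_add_distrib, ← Finset.sum_sub_distrib, Finset.mul_sum,
      ← Finset.sum_sub_distrib, ← Finset.sum_add_distrib]
    exact Finset.sum_congr rfl fun k _ => by ring
  rw [h1, hs]
  ring

variable {h v : Euc d → ℝ} {S : Set (Euc d)} {e : Euc d} {c ε : ℝ}

lemma sum_sq_of_norm_eq_one (he : ‖e‖ = 1) : ∑ k, e k ^ 2 = 1 := by
  have := EuclideanSpace.norm_sq_eq e
  rw [he] at this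
  simpa using this.symm

/-- A weighted inequality of Rellich type. -/
lemma rellich_inequality (hh : ContDiff ℝ 2 h) (he : ‖e‖ = 1) (hc : 0 < c) (hε : 0 < ε)
    (hS : ∀ x ∈ S, c ≤ fderiv ℝ h x e)
    (htan : ∀ x ∈ S, ∑ i, (partialDeriv i h x - fderiv ℝ h x e * e i) ^ 2 ≤ (c / 4) ^ 2)
    (hv : ContDiff ℝ ∞ v) (hvc : HasCompactSupport v) (hvS : tsupport v ⊆ S) (k : Fin d) :
    eLpNorm (fun x => √(weight ε (h x)) * partialDeriv k v x) 2
      ≤ ENNReal.ofReal (4 / c) * eLpNorm (fun x => √(weight ε (h x)) *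
        (h x * ∑ i, partialDeriv i (partialDeriv i v) x
          + 2 * ∑ i, partialDeriv i h x * partialDeriv i v x)) 2 := by
  have hv1 : ∀ i, ContDiff ℝ ∞ (partialDeriv i v) := fun i => ContDiff.partialDeriv hv (by simp)
  have hv2 : ∀ i j, ContDiff ℝ ∞ (partialDeriv i (partialDeriv j v)) :=
    fun i j => ContDiff.partialDeriv (hv1 j) (by simp)
  have hh1 : ∀ i, Continuous (partialDeriv i h) :=
    fun i => (ContDiff.partialDeriv (m := 1) hh (by norm_num)).continuous
  have hd1 : ∀ i x, DifferentiableAt ℝ (partialDeriv i v) x :=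
    fun i x => (hv1 i).differentiable (by simp) x
  have hsymm : ∀ i j x, partialDeriv i (partialDeriv j v) x
      = partialDeriv j (partialDeriv i v) x := by
    intro i j x
    have hdd : DifferentiableAt ℝ (fderiv ℝ v) x :=
      (hv.fderiv_right (m := 1) (by norm_cast)).differentiable one_ne_zero x
    have hij : ∀ i j, partialDeriv i (partialDeriv j v) x
        = fderiv ℝ (fderiv ℝ v) x (EuclideanSpace.single i 1) (EuclideanSpace.single j 1) := by
      intro i j
      have := hdd.hasFDerivAt.clm_apply (hasFDerivAt_const (EuclideanSpace.single j (1 : ℝ)) x)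
      change fderiv ℝ (fun y => fderiv ℝ v y (EuclideanSpace.single j 1)) x _ = _
      rw [this.fderiv]
      simp
    rw [hij, hij]
    exact ((hv.of_le (m := 2) (by norm_cast)).contDiffAt.isSymmSndFDerivAt (by simp)) _ _
  set Ψ : ℝ → ℝ := fun s => s * weight ε s with hΨ
  set ve : Euc d → ℝ := fun x => ∑ i, e i * partialDeriv i v x with hve
  set Q : Euc d → ℝ := fun x => ∑ i, partialDeriv i v x ^ 2 with hQ
  have hves : ContDiff ℝ ∞ ve := ContDiff.sum fun i _ => contDiff_const.mul (hv1 i)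
  have hQs : ContDiff ℝ ∞ Q := ContDiff.sum fun i _ => (hv1 i).pow 2
  -- Rellich's vector field `∂_e v ∇v - ½ |∇v|² e`. Multiplied by `Ψ(h)` it has compact support and
  -- is `C¹`, so its divergence `D` integrates to zero.
  set P : Fin d → Euc d → ℝ := fun k x => partialDeriv k v x * ve x - 1 / 2 * e k * Q x with hP
  have hPs : ∀ k, ContDiff ℝ ∞ (P k) :=
    fun k => ((hv1 k).mul hves).sub (contDiff_const.mul hQs)
  have hΨs : ContDiff ℝ 1 fun x => Ψ (h x) := (contDiff_mul_weight hε).comp (hh.of_le (by norm_num))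
  have hQc : HasCompactSupport Q := by
    refine hvc.mono' fun x hx => ?_
    by_contra hcon
    exact hx (by simp [hQ, partialDeriv_of_notMem_tsupport hcon])
  have hPc : ∀ k, HasCompactSupport (P k) := fun k =>
    (hvc.partialDeriv.mul_right).sub hQc.mul_left
  have hG : ∀ k, ∫ x, partialDeriv k (fun x => Ψ (h x) * P k x) x = 0 := fun k =>
    integral_fderiv_eq_zero (hΨs.mul ((hPs k).of_le (by simp))) (hPc k).mul_left _
  have hGi : ∀ k, Integrable fun x => partialDeriv k (fun x => Ψ (h x) * P k x) x := fun k =>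
    (ContDiff.partialDeriv (m := 0) (hΨs.mul ((hPs k).of_le (by simp)))
      (by simp)).continuous.integrable_of_hasCompactSupport (hPc k).mul_left.partialDeriv
  set D : Euc d → ℝ := fun x => ∑ k, partialDeriv k (fun x => Ψ (h x) * P k x) x with hD
  have hD0 : ∫ x, D x = 0 := by
    rw [hD, integral_finsetSum _ fun k _ => hGi k]
    exact Finset.sum_eq_zero fun k _ => hG k
  set F : Euc d → ℝ := fun x => h x * ∑ i, partialDeriv i (partialDeriv i v) x
          + 2 * ∑ i, partialDeriv i h x * partialDeriv i v x with hF
  have hdP : ∀ k x, partialDeriv k (P k) x = partialDeriv k (partialDeriv k v) x * ve x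
      + partialDeriv k v x * (∑ i, e i * partialDeriv k (partialDeriv i v) x)
      - e k * ∑ i, partialDeriv i v x * partialDeriv k (partialDeriv i v) x := by
    intro k x
    have a1 : partialDeriv k ve x = ∑ i, e i * partialDeriv k (partialDeriv i v) x := by
      rw [hve, partialDeriv_sum fun i _ => (hd1 i x).const_mul (e i)]
      refine Finset.sum_congr rfl fun i _ => ?_
      rw [partialDeriv_mul (by fun_prop) (hd1 i x), partialDeriv_const]
      simp
    have a2 : partialDeriv k Q x
        = 2 * ∑ i, partialDeriv i v x * partialDeriv k (partialDeriv i v) x := by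
      simp_rw [hQ, sq]
      rw [partialDeriv_sum fun i _ => (hd1 i x).fun_mul (hd1 i x), Finset.mul_sum]
      refine Finset.sum_congr rfl fun i _ => ?_
      rw [partialDeriv_mul (hd1 i x) (hd1 i x)]
      ring
    have a3 : partialDeriv k (P k) x = partialDeriv k (fun x => partialDeriv k v x * ve x) x
        + partialDeriv k (fun x => (-(1 / 2) * e k) * Q x) x := by
      rw [← partialDeriv_add ((hd1 k x).fun_mul (hves.differentiable (by simp) x))
        ((hQs.differentiable (by simp) x).const_mul _)]
      congr 1
      funext y
      rw [hP]; ring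
    rw [a3, partialDeriv_mul (hd1 k x) (hves.differentiable (by simp) x),
      partialDeriv_mul (by fun_prop) (hQs.differentiable (by simp) x), a1, a2, partialDeriv_const]
    ring
  have hdG : ∀ k x, partialDeriv k (fun x => Ψ (h x) * P k x) x
      = Ψ (h x) * partialDeriv k (P k) x + (weight ε (h x)
        + 2 * ε ^ 2 / (h x ^ 2 + ε ^ 2) * weight ε (h x)) * partialDeriv k h x * P k x := by
    intro k x
    rw [partialDeriv_mul (hΨs.differentiable one_ne_zero x) ((hPs k).differentiable (by simp) x)]
    congr 2
    have := (hasDerivAt_mul_weight hε (h x)).comp_hasFDerivAt x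
      (hh.differentiable (by norm_num) x).hasFDerivAt
    have h2 : fderiv ℝ (fun x => Ψ (h x)) x = _ := this.fderiv
    rw [partialDeriv, h2]
    simp [partialDeriv]
  have hDeq : ∀ x, D x = (weight ε (h x) + 2 * ε ^ 2 / (h x ^ 2 + ε ^ 2) * weight ε (h x))
        * (∑ k, partialDeriv k h x * partialDeriv k v x) * ve x
      + h x * weight ε (h x) * (∑ i, partialDeriv i (partialDeriv i v) x) * ve x
      - 1 / 2 * (weight ε (h x) + 2 * ε ^ 2 / (h x ^ 2 + ε ^ 2) * weight ε (h x))
        * (∑ k, e k * partialDeriv k h x) * Q x := by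
    intro x
    have := rellich_divergence (a := fun k => partialDeriv k v x) (n := fun k => partialDeriv k h x)
      (e := e) (H := fun i j => partialDeriv i (partialDeriv j v) x) (fun i j => hsymm i j x)
      (Ψ (h x)) (weight ε (h x) + 2 * ε ^ 2 / (h x ^ 2 + ε ^ 2) * weight ε (h x)) (ve x) (Q x)
    rw [← this]
    exact Finset.sum_congr rfl fun k _ => by rw [hdG, hdP]
  -- On the support of `v` this is `rellich_pointwise`; elsewhere all terms vanish. Integrating, `∫
  -- D = 0` bounds the gradient by `F`.
  have hpt : ∀ x, D x ≤ 2 / c * (weight ε (h x) * F x ^ 2)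
      - c / 8 * (weight ε (h x) * Q x) := by
    intro x
    by_cases hx : x ∈ tsupport v
    · have hxS := hvS hx
      have hne : fderiv ℝ h x e = ∑ k, e k * partialDeriv k h x := fderiv_apply_eq_sum h x e
      rw [hDeq x, ← hne]
      refine rellich_pointwise (sum_sq_of_norm_eq_one he) (weight_nonneg _ _) ?_ ?_ hc (hS x hxS)
        rfl rfl (htan x hxS)
      · have := weight_nonneg ε (h x); positivity
      · refine mul_le_mul_of_nonneg_right ?_ (weight_nonneg _ _)
        rw [div_le_iff₀ (by positivity)]
        nlinarith [sq_nonneg (h x)]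
    · have e1 : ∀ k, partialDeriv k v x = 0 := fun k => partialDeriv_of_notMem_tsupport hx
      have e2 : ∀ k, partialDeriv k (partialDeriv k v) x = 0 := fun k =>
        partialDeriv_of_notMem_tsupport fun h => hx (tsupport_partialDeriv_subset v h)
      rw [hDeq x]
      simp [hve, hQ, hF, e1, e2]
  have hwc : Continuous fun x => weight ε (h x) := (continuous_weight hε).comp hh.continuous
  have hFc : Continuous F :=
    (hh.continuous.mul (continuous_finsetSum _ fun i _ => (hv2 i i).continuous)).add
      (continuous_const.mul (continuous_finsetSum _ fun i _ => (hh1 i).mul (hv1 i).continuous))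
  have hFs : HasCompactSupport F := by
    refine hvc.mono' fun x hx => ?_
    by_contra hcon
    have e2 : ∀ k, partialDeriv k (partialDeriv k v) x = 0 := fun k =>
      partialDeriv_of_notMem_tsupport fun h => hcon (tsupport_partialDeriv_subset v h)
    exact hx (by simp [hF, e2, partialDeriv_of_notMem_tsupport hcon])
  have iF : Integrable fun x => weight ε (h x) * F x ^ 2 :=
    (hwc.mul (hFc.pow 2)).integrable_of_hasCompactSupport
      hFs.sq.mul_left
  have iQ : Integrable fun x => weight ε (h x) * Q x :=
    (hwc.mul hQs.continuous).integrable_of_hasCompactSupport hQc.mul_left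
  have ik : Integrable fun x => weight ε (h x) * partialDeriv k v x ^ 2 :=
    (hwc.mul ((hv1 k).continuous.pow 2)).integrable_of_hasCompactSupport
      hvc.partialDeriv.sq.mul_left
  have hint := integral_mono (integrable_finsetSum _ fun k _ => hGi k)
    ((iF.const_mul (2 / c)).sub (iQ.const_mul (c / 8))) hpt
  have hsq : ∀ (f : Euc d → ℝ), (fun x => (√(weight ε (h x)) * f x) ^ 2)
      = fun x => weight ε (h x) * f x ^ 2 := fun f => funext fun x => by
    rw [mul_pow, Real.sq_sqrt (weight_nonneg _ _)]
  refine eLpNorm_le_of_integral_sq_le (by rw [hsq]; exact ik) (by rw [hsq]; exact iF)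
    (by positivity) ?_
  rw [hsq, hsq]
  simp only [Pi.sub_apply] at hint
  rw [show (∫ x, ∑ k, partialDeriv k (fun x => Ψ (h x) * P k x) x) = 0 from hD0,
    integral_sub (iF.const_mul _) (iQ.const_mul _), integral_const_mul, integral_const_mul] at hint
  have hkQ : ∫ x, weight ε (h x) * partialDeriv k v x ^ 2 ≤ ∫ x, weight ε (h x) * Q x := by
    refine integral_mono ik iQ fun x => mul_le_mul_of_nonneg_left ?_ (weight_nonneg _ _)
    exact Finset.single_le_sum (f := fun i => partialDeriv i v x ^ 2)
      (fun i _ => sq_nonneg _) (Finset.mem_univ k)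
  have : c / 8 * ∫ x, weight ε (h x) * partialDeriv k v x ^ 2
      ≤ 2 / c * ∫ x, weight ε (h x) * F x ^ 2 :=
    (mul_le_mul_of_nonneg_left hkQ (by positivity)).trans (by linarith)
  -- Since `8/c * 2/c = (4/c)²`, the constant for the norms is `4/c`.
  have h8 := mul_le_mul_of_nonneg_left this (show 0 ≤ 8 / c by positivity)
  refine le_of_eq_of_le ?_ (h8.trans_eq ?_)
  · rw [← mul_assoc, show 8 / c * (c / 8) = 1 by field_simp, one_mul]
  · rw [← mul_assoc, show 8 / c * (2 / c) = (4 / c) ^ 2 by field_simp; norm_num]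

/-- Hardy's inequality. -/
lemma hardy_inequality (hh : ContDiff ℝ 1 h) (hc : 0 < c) (hS : ∀ x ∈ S, c ≤ fderiv ℝ h x e)
    (hv : ContDiff ℝ 1 v) (hvc : HasCompactSupport v) (hvS : tsupport v ⊆ S)
    (hvh : ∀ x ∈ tsupport v, 0 < h x) :
    eLpNorm (fun x => v x / h x) 2 ≤ ENNReal.ofReal (2 / c) * eLpNorm (fun x => fderiv ℝ v x e) 2 := by
  have hU : IsOpen {x | 0 < h x} := isOpen_lt continuous_const hh.continuous
  have hinv : ContDiffOn ℝ 1 (fun x => (h x)⁻¹) {x | 0 < h x} :=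
    hh.contDiffOn.inv fun x hx => (ne_of_gt hx)
  have hsq : tsupport (fun x => v x ^ 2) ⊆ tsupport v := by
    simp_rw [sq]; exact tsupport_mul_subset_left
  -- The integral of `∂_e (v²/h)` vanishes, while this derivative is `2 (v/h) ∂_e v - ∂_e h (v/h)²`
  -- with `∂_e h ≥ c`. Young's inequality concludes.
  set G : Euc d → ℝ := fun x => (h x)⁻¹ * v x ^ 2 with hG
  have hGs : ContDiff ℝ 1 G := contDiff_mul_of_tsupport hU hinv (hv.pow 2) fun x hx => hvh x (hsq hx)
  have hq : ContDiff ℝ 1 fun x => (h x)⁻¹ * v x :=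
    contDiff_mul_of_tsupport hU hinv hv fun x hx => hvh x hx
  have hGc : HasCompactSupport G :=
    hvc.sq.mul_left
  have hGi : Integrable fun x => fderiv ℝ G x e :=
    ((hGs.continuous_fderiv one_ne_zero).clm_apply continuous_const).integrable_of_hasCompactSupport
      (hGc.fderiv_apply ℝ e)
  have hvi : Integrable fun x => fderiv ℝ v x e ^ 2 :=
    integrable_sq_of_hasCompactSupport
      ((hv.continuous_fderiv one_ne_zero).clm_apply continuous_const) (hvc.fderiv_apply ℝ e)
  have hqi : Integrable fun x => (v x / h x) ^ 2 := by
    have : (fun x => (v x / h x) ^ 2) = fun x => ((h x)⁻¹ * v x) ^ 2 :=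
      funext fun x => by rw [div_eq_inv_mul]
    rw [this]
    exact integrable_sq_of_hasCompactSupport hq.continuous hvc.mul_left
  have hpt : ∀ x, c / 2 * (v x / h x) ^ 2 ≤ 2 / c * fderiv ℝ v x e ^ 2 - fderiv ℝ G x e := by
    intro x
    by_cases hx : x ∈ tsupport v
    · have hx0 := hvh x hx
      have hd : HasFDerivAt G _ x :=
        ((hasDerivAt_inv hx0.ne').comp_hasFDerivAt x (hh.differentiable one_ne_zero x).hasFDerivAt).mul
          ((hv.differentiable one_ne_zero x).hasFDerivAt.pow 2)
      have hval : fderiv ℝ G x e = 2 * (v x / h x) * fderiv ℝ v x e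
          - fderiv ℝ h x e * (v x / h x) ^ 2 := by
        rw [hd.fderiv]
        simp
        field_simp
        ring
      rw [hval]
      have h1 := mul_le_mul_of_nonneg_right (hS x (hvS hx)) (sq_nonneg (v x / h x))
      have h2 : 0 ≤ 2 / c * (fderiv ℝ v x e - c / 2 * (v x / h x)) ^ 2 := by positivity
      have h3 : 2 / c * (fderiv ℝ v x e - c / 2 * (v x / h x)) ^ 2 = 2 / c * fderiv ℝ v x e ^ 2
          - 2 * (v x / h x) * fderiv ℝ v x e + c / 2 * (v x / h x) ^ 2 := by
        generalize v x / h x = q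
        field_simp
        ring
      linarith
    · have e1 : v =ᶠ[𝓝 x] fun _ => 0 := notMem_tsupport_iff_eventuallyEq.1 hx
      have e2 : G =ᶠ[𝓝 x] fun _ => 0 := by
        filter_upwards [e1] with y hy
        simp [hG, hy]
      rw [e1.fderiv_eq, e2.fderiv_eq, e1.eq_of_nhds]
      simp
  have hint := integral_mono (hqi.const_mul (c / 2)) ((hvi.const_mul (2 / c)).sub hGi) hpt
  simp only [Pi.sub_apply] at hint
  rw [integral_sub (hvi.const_mul _) hGi, integral_fderiv_eq_zero hGs hGc, integral_const_mul,
    integral_const_mul] at hint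
  refine eLpNorm_le_of_integral_sq_le hqi hvi (by positivity) ?_
  have h8 := mul_le_mul_of_nonneg_left hint (show 0 ≤ 2 / c by positivity)
  refine le_of_eq_of_le ?_ (h8.trans_eq ?_)
  · rw [← mul_assoc, show 2 / c * (c / 2) = 1 by field_simp, one_mul]
  · rw [sub_zero, ← mul_assoc, sq]

end Inequalities

end PINN

namespace PINN

/-! ### Convergence in `L²` -/

section ConvergenceLTwo

lemma tendsto_eLpNorm_of_dominated {α : Type*} [MeasurableSpace α] {μ : Measure α}
    {f : ℕ → α → ℝ} {G : α → ℝ} (hf : ∀ n, AEStronglyMeasurable (f n) μ) (hG : MemLp G 2 μ)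
    (hb : ∀ n, ∀ᵐ x ∂μ, |f n x| ≤ |G x|)
    (hl : ∀ᵐ x ∂μ, Tendsto (fun n => f n x) atTop (𝓝 0)) :
    Tendsto (fun n => eLpNorm (f n) 2 μ) atTop (𝓝 0) := by
  have hsq : Tendsto (fun n => eLpNorm (f n) 2 μ ^ 2) atTop (𝓝 0) := by
    simp_rw [eLpNorm_two_sq]
    rw [show (0 : ℝ≥0∞) = ∫⁻ _, 0 ∂μ by simp]
    refine tendsto_lintegral_of_dominated_convergence' (fun x => ‖G x‖ₑ ^ 2)
      (fun n => (hf n).enorm.pow_const 2) (fun n => ?_) ?_ ?_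
    · filter_upwards [hb n] with x hx
      gcongr
      exact enorm_le_iff_norm_le.2 hx
    · rw [← eLpNorm_two_sq]
      exact ENNReal.pow_ne_top hG.eLpNorm_ne_top
    · filter_upwards [hl] with x hx
      have := ((ENNReal.continuous_pow 2).tendsto _).comp ((continuous_enorm.tendsto _).comp hx)
      simpa [Function.comp_def] using this
  have := (ENNReal.continuous_rpow_const (y := (1 / 2 : ℝ))).tendsto 0 |>.comp hsq
  rw [ENNReal.zero_rpow_of_pos (by norm_num)] at this
  refine this.congr fun n => ?_
  simp only [Function.comp]
  rw [← ENNReal.rpow_natCast, ← ENNReal.rpow_mul]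
  norm_num

lemma eLpNorm_mul_le_of_abs_le {α : Type*} [MeasurableSpace α] {μ : Measure α} {a f : α → ℝ}
    {C : ℝ} (ha : ∀ x, |a x| ≤ C) :
    eLpNorm (fun x => a x * f x) 2 μ ≤ ENNReal.ofReal C * eLpNorm f 2 μ :=
  eLpNorm_le_mul_eLpNorm_of_ae_le_mul (Eventually.of_forall fun x => by
    rw [norm_mul]; exact mul_le_mul_of_nonneg_right (ha x) (norm_nonneg _)) 2

lemma memLp_mul_of_abs_le {α : Type*} [MeasurableSpace α] {μ : Measure α} {a f : α → ℝ}
    {C : ℝ} (ham : AEStronglyMeasurable a μ) (ha : ∀ x, |a x| ≤ C) (hf : MemLp f 2 μ) :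
    MemLp (fun x => a x * f x) 2 μ :=
  ⟨ham.mul hf.1, (eLpNorm_mul_le_of_abs_le ha).trans_lt
    (ENNReal.mul_lt_top ENNReal.ofReal_lt_top hf.2)⟩

end ConvergenceLTwo

/-! ### Products with smooth functions -/

section Products

variable {d : ℕ} {Ω : Set (Euc d)}

/-- The first derivatives of `m u`. -/
noncomputable def mulFirst (m u : Euc d → ℝ) (u1 : Fin d → Euc d → ℝ) (i : Fin d) (x : Euc d) : ℝ :=
  m x * u1 i x + partialDeriv i m x * u x

/-- The second derivatives of `m u`. -/
noncomputable def mulSecond (m u : Euc d → ℝ) (u1 : Fin d → Euc d → ℝ) (u2 : Fin d → Fin d → Euc d → ℝ)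
    (i j : Fin d) (x : Euc d) : ℝ :=
  m x * u2 i j x + partialDeriv i m x * u1 j x
    + (partialDeriv j m x * u1 i x + partialDeriv i (partialDeriv j m) x * u x)

variable {u : Euc d → ℝ} {u1 : Fin d → Euc d → ℝ} {u2 : Fin d → Fin d → Euc d → ℝ}
  {m m' : Euc d → ℝ} {x : Euc d}

lemma partialDeriv_eventuallyEq {f g : Euc d → ℝ} (h : f =ᶠ[𝓝 x] g) (i : Fin d) :
    partialDeriv i f =ᶠ[𝓝 x] partialDeriv i g :=
  h.eventuallyEq_nhds.mono fun _ hy => partialDeriv_congr hy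

lemma mulFirst_congr (h : m =ᶠ[𝓝 x] m') (i : Fin d) :
    mulFirst m u u1 i x = mulFirst m' u u1 i x := by
  rw [mulFirst, mulFirst, h.eq_of_nhds, partialDeriv_congr h]

lemma mulSecond_congr (h : m =ᶠ[𝓝 x] m') (i j : Fin d) :
    mulSecond m u u1 u2 i j x = mulSecond m' u u1 u2 i j x := by
  rw [mulSecond, mulSecond, h.eq_of_nhds, partialDeriv_congr h, partialDeriv_congr h,
    partialDeriv_congr (partialDeriv_eventuallyEq h j)]

lemma mulFirst_of_notMem_tsupport (h : x ∉ tsupport m) (i : Fin d) :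
    mulFirst m u u1 i x = 0 := by
  rw [mulFirst_congr (notMem_tsupport_iff_eventuallyEq.1 h)]
  simp [mulFirst, partialDeriv]

lemma mulSecond_of_notMem_tsupport (h : x ∉ tsupport m) (i j : Fin d) :
    mulSecond m u u1 u2 i j x = 0 := by
  rw [mulSecond_congr (notMem_tsupport_iff_eventuallyEq.1 h)]
  have : partialDeriv j (0 : Euc d → ℝ) = 0 := by
    funext y; exact partialDeriv_const 0 y
  simp [mulSecond, this]
  simp [partialDeriv]

lemma ContDiffAt.differentiableAt_partialDeriv {f : Euc d → ℝ} (hf : ContDiffAt ℝ 2 f x)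
    (i : Fin d) : DifferentiableAt ℝ (partialDeriv i f) x :=
  ((hf.fderiv_right (m := 1) (by norm_num)).clm_apply contDiffAt_const).differentiableAt
    one_ne_zero

lemma mulFirst_mul {a : Euc d → ℝ} (ha : DifferentiableAt ℝ a x) (hm : DifferentiableAt ℝ m x)
    (i : Fin d) : mulFirst (fun x => a x * m x) u u1 i x
      = a x * mulFirst m u u1 i x + partialDeriv i a x * (m x * u x) := by
  rw [mulFirst, mulFirst, partialDeriv_mul ha hm]
  ring

lemma partialDeriv_partialDeriv_mul {a : Euc d → ℝ} (ha : ContDiffAt ℝ 2 a x)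
    (hm : ContDiffAt ℝ 2 m x) (i j : Fin d) :
    partialDeriv i (partialDeriv j fun x => a x * m x) x
      = a x * partialDeriv i (partialDeriv j m) x + partialDeriv i a x * partialDeriv j m x
        + (partialDeriv j a x * partialDeriv i m x + partialDeriv i (partialDeriv j a) x * m x) := by
  have ha1 := ha.differentiableAt two_ne_zero
  have hm1 := hm.differentiableAt two_ne_zero
  have hev : partialDeriv j (fun x => a x * m x) =ᶠ[𝓝 x]
      fun x => a x * partialDeriv j m x + partialDeriv j a x * m x := by
    filter_upwards [ha.eventually (by norm_cast), hm.eventually (by norm_cast)] with y hya hym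
    exact partialDeriv_mul (hya.differentiableAt two_ne_zero) (hym.differentiableAt two_ne_zero)
  have ha2 := ContDiffAt.differentiableAt_partialDeriv ha j
  have hm2 := ContDiffAt.differentiableAt_partialDeriv hm j
  rw [partialDeriv_congr hev, partialDeriv_add (ha1.fun_mul hm2) (ha2.fun_mul hm1),
    partialDeriv_mul ha1 hm2, partialDeriv_mul ha2 hm1]

lemma mulSecond_mul {a : Euc d → ℝ} (ha : ContDiffAt ℝ 2 a x) (hm : ContDiffAt ℝ 2 m x)
    (i j : Fin d) : mulSecond (fun x => a x * m x) u u1 u2 i j x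
      = a x * mulSecond m u u1 u2 i j x + partialDeriv i a x * mulFirst m u u1 j x
        + partialDeriv j a x * mulFirst m u u1 i x
        + partialDeriv i (partialDeriv j a) x * (m x * u x) := by
  have ha1 := ha.differentiableAt two_ne_zero
  have hm1 := hm.differentiableAt two_ne_zero
  rw [mulSecond, partialDeriv_partialDeriv_mul ha hm, partialDeriv_mul ha1 hm1,
    partialDeriv_mul ha1 hm1, mulSecond, mulFirst, mulFirst]
  ring

/-- A cutoff near infinity of the reciprocal: equal to `1/s` for `s ≥ κ`, and `0` for
`s ≤ κ / 2`. -/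
noncomputable def cutRecip (κ s : ℝ) : ℝ := Real.smoothTransition (2 * s / κ - 1) * s⁻¹

lemma cutRecip_eq_zero {κ s : ℝ} (hκ : 0 < κ) (hs : s ≤ κ / 2) : cutRecip κ s = 0 := by
  rw [cutRecip, Real.smoothTransition.zero_of_nonpos, zero_mul]
  rw [sub_nonpos, div_le_one hκ]
  linarith

lemma cutRecip_eq {κ s : ℝ} (hκ : 0 < κ) (hs : κ ≤ s) : cutRecip κ s = s⁻¹ := by
  rw [cutRecip, Real.smoothTransition.one_of_one_le, one_mul]
  rw [le_sub_iff_add_le, le_div_iff₀ hκ]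
  linarith

lemma contDiff_cutRecip {κ : ℝ} (hκ : 0 < κ) : ContDiff ℝ 3 (cutRecip κ) := by
  rw [contDiff_iff_contDiffAt]
  intro s
  rcases le_or_gt s 0 with hs | hs
  · refine (contDiffAt_const (c := (0 : ℝ))).congr_of_eventuallyEq ?_
    filter_upwards [gt_mem_nhds (show s < κ / 2 by linarith)] with y hy
    exact cutRecip_eq_zero hκ (le_of_lt hy)
  · refine ContDiffAt.mul ?_ (contDiffAt_inv ℝ hs.ne')
    exact (Real.smoothTransition.contDiff (n := 3)).contDiffAt.comp s (by fun_prop)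

end Products

/-! ### The Rellich inequality for Sobolev functions -/

section RellichSobolev

variable {d : ℕ} {V : Euc d → ℝ} {V1 : Fin d → Euc d → ℝ} {V2 : Fin d → Fin d → Euc d → ℝ}
  {h : Euc d → ℝ} {S : Set (Euc d)} {e : Euc d} {c ε : ℝ}

lemma rellich_inequality_of_eq {v : Euc d → ℝ} {v1 v2 : Fin d → Euc d → ℝ} (hh : ContDiff ℝ 2 h)
    (he : ‖e‖ = 1) (hc : 0 < c) (hε : 0 < ε) (hS : ∀ x ∈ S, c ≤ fderiv ℝ h x e)
    (htan : ∀ x ∈ S, ∑ i, (partialDeriv i h x - fderiv ℝ h x e * e i) ^ 2 ≤ (c / 4) ^ 2)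
    (hv : ContDiff ℝ ∞ v) (hvc : HasCompactSupport v) (hvS : tsupport v ⊆ S)
    (h1 : ∀ i, partialDeriv i v = v1 i) (h2 : ∀ i, partialDeriv i (v1 i) = v2 i) (k : Fin d) :
    eLpNorm (fun x => √(weight ε (h x)) * v1 k x) 2
      ≤ ENNReal.ofReal (4 / c) * eLpNorm (fun x => √(weight ε (h x)) *
        (h x * ∑ i, v2 i x + 2 * ∑ i, partialDeriv i h x * v1 i x)) 2 := by
  obtain rfl : (fun i => partialDeriv i v) = v1 := funext h1
  obtain rfl : (fun i => partialDeriv i (partialDeriv i v)) = v2 := funext h2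
  exact rellich_inequality hh he hc hε hS htan hv hvc hvS k

/-- The weight, `h` and its gradient are bounded, so both sides of the smooth inequality pass to the
limit along mollifications. Their supports eventually lie in the open set `S`. -/
lemma IsH2Triple.rellich_inequality (hV : IsH2Triple Set.univ V V1 V2) (hVc : HasCompactSupport V)
    (hSo : IsOpen S) (hVS : tsupport V ⊆ S) (hh : ContDiff ℝ 2 h) {C : ℝ} (hC0 : ∀ x, |h x| ≤ C)
    (hC1 : ∀ i x, |partialDeriv i h x| ≤ C) (he : ‖e‖ = 1) (hc : 0 < c) (hε : 0 < ε)
    (hS : ∀ x ∈ S, c ≤ fderiv ℝ h x e)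
    (htan : ∀ x ∈ S, ∑ i, (partialDeriv i h x - fderiv ℝ h x e * e i) ^ 2 ≤ (c / 4) ^ 2)
    (k : Fin d) :
    eLpNorm (fun x => √(weight ε (h x)) * V1 k x) 2
      ≤ ENNReal.ofReal (4 / c) * eLpNorm (fun x => √(weight ε (h x)) *
        (h x * ∑ i, V2 i i x + 2 * ∑ i, partialDeriv i h x * V1 i x)) 2 := by
  set w : Euc d → ℝ := fun x => √(weight ε (h x)) with hw
  have hwc : Continuous w := Real.continuous_sqrt.comp ((continuous_weight hε).comp hh.continuous)
  have hw1 : ∀ x, |w x| ≤ 1 := fun x => by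
    rw [abs_of_nonneg (Real.sqrt_nonneg _), Real.sqrt_le_iff, one_pow]
    exact ⟨zero_le_one, weight_le_one hε _⟩
  set F : Euc d → ℝ := fun x => h x * ∑ i, V2 i i x + 2 * ∑ i, partialDeriv i h x * V1 i x with hF
  set Fn : ℕ → Euc d → ℝ := fun n x => h x * ∑ i, mollify n (V2 i i) x
    + 2 * ∑ i, partialDeriv i h x * mollify n (V1 i) x with hFn
  have hh1 : ∀ i, Continuous (partialDeriv i h) :=
    fun i => (ContDiff.partialDeriv (m := 1) hh (by norm_num)).continuous
  have hc1 : ∀ i n, Continuous (mollify n (V1 i)) := fun i n =>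
    (PINN.contDiff_mollify n ((hV.memLp1_univ i).locallyIntegrable (by norm_num))).continuous
  have hc2 : ∀ i n, Continuous (mollify n (V2 i i)) := fun i n =>
    (PINN.contDiff_mollify n ((hV.memLp2_univ i i).locallyIntegrable (by norm_num))).continuous
  have hsup : ∀ᶠ n : ℕ in atTop, tsupport (mollify n V) ⊆ S := by
    obtain ⟨δ, hδ, hδs⟩ := hVc.isCompact.exists_cthickening_subset_open hSo hVS
    obtain ⟨N, hN⟩ := exists_nat_one_div_lt hδ
    filter_upwards [eventually_ge_atTop N] with n hn
    exact (tsupport_mollify_subset n V).trans ((Metric.cthickening_mono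
      (le_trans (by gcongr) hN.le) _).trans hδs)
  have hFm : AEStronglyMeasurable F := by
    refine AEStronglyMeasurable.add (hh.continuous.aestronglyMeasurable.mul
      (Finset.aestronglyMeasurable_fun_sum _ fun i _ => (hV.memLp2_univ i i).1))
      (AEStronglyMeasurable.const_mul (Finset.aestronglyMeasurable_fun_sum _ fun i _ =>
        (hh1 i).aestronglyMeasurable.mul (hV.memLp1_univ i).1) 2)
  have hFnm : ∀ n, AEStronglyMeasurable (Fn n) := fun n => by
    refine Continuous.aestronglyMeasurable ?_
    exact (hh.continuous.mul (continuous_finsetSum _ fun i _ => hc2 i n)).add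
      (continuous_const.mul (continuous_finsetSum _ fun i _ => (hh1 i).mul (hc1 i n)))
  have hFlim : Tendsto (fun n => eLpNorm (Fn n - F) 2) atTop (𝓝 0) := by
    have hb : ∀ n, eLpNorm (Fn n - F) 2
        ≤ ∑ i, ENNReal.ofReal C * eLpNorm (mollify n (V2 i i) - V2 i i) 2
          + ∑ i, ENNReal.ofReal (2 * C) * eLpNorm (mollify n (V1 i) - V1 i) 2 := by
      intro n
      have hd2 : ∀ i, AEStronglyMeasurable (mollify n (V2 i i) - V2 i i) := fun i =>
        (hc2 i n).aestronglyMeasurable.sub (hV.memLp2_univ i i).1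
      have hd1 : ∀ i, AEStronglyMeasurable (mollify n (V1 i) - V1 i) := fun i =>
        (hc1 i n).aestronglyMeasurable.sub (hV.memLp1_univ i).1
      have heq : Fn n - F = (∑ i, fun x => h x * (mollify n (V2 i i) - V2 i i) x)
          + ∑ i, fun x => (2 * partialDeriv i h x) * (mollify n (V1 i) - V1 i) x := by
        funext x
        simp only [hFn, hF, Pi.sub_apply, Pi.add_apply, Finset.sum_apply, Finset.mul_sum, mul_sub,
          Finset.sum_sub_distrib, mul_assoc]
        ring
      rw [heq]
      refine (eLpNorm_add_le (Finset.aestronglyMeasurable_sum _ fun i _ =>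
          hh.continuous.aestronglyMeasurable.mul (hd2 i))
        (Finset.aestronglyMeasurable_sum _ fun i _ =>
          (continuous_const.mul (hh1 i)).aestronglyMeasurable.mul (hd1 i)) (by norm_num)).trans ?_
      refine add_le_add ?_ ?_
      · refine (eLpNorm_sum_le (fun i _ => hh.continuous.aestronglyMeasurable.mul (hd2 i))
          (by norm_num)).trans (Finset.sum_le_sum fun i _ => eLpNorm_mul_le_of_abs_le hC0)
      · refine (eLpNorm_sum_le (fun i _ =>
          (continuous_const.mul (hh1 i)).aestronglyMeasurable.mul (hd1 i))
          (by norm_num)).trans (Finset.sum_le_sum fun i _ => eLpNorm_mul_le_of_abs_le fun x => ?_)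
        change |2 * partialDeriv i h x| ≤ 2 * C
        rw [abs_mul, abs_two]
        exact mul_le_mul_of_nonneg_left (hC1 i x) (by norm_num)
    refine tendsto_of_tendsto_of_tendsto_of_le_of_le tendsto_const_nhds ?_ (fun n => zero_le) hb
    have h2 := tendsto_finsetSum Finset.univ fun (i : Fin d) _ => ENNReal.Tendsto.const_mul
      (tendsto_eLpNorm_mollify (hV.memLp2_univ i i)) (Or.inr (ENNReal.ofReal_ne_top (r := C)))
    have h1 := tendsto_finsetSum Finset.univ fun (i : Fin d) _ => ENNReal.Tendsto.const_mul
      (tendsto_eLpNorm_mollify (hV.memLp1_univ i)) (Or.inr (ENNReal.ofReal_ne_top (r := 2 * C)))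
    simpa using h2.add h1
  have hsm : ∀ᶠ n : ℕ in atTop, eLpNorm (fun x => w x * V1 k x) 2
      ≤ eLpNorm (mollify n (V1 k) - V1 k) 2
        + ENNReal.ofReal (4 / c) * (eLpNorm (fun x => w x * F x) 2 + eLpNorm (Fn n - F) 2) := by
    filter_upwards [hsup] with n hn
    have hr : eLpNorm (fun x => w x * mollify n (V1 k) x) 2
        ≤ ENNReal.ofReal (4 / c) * eLpNorm (fun x => w x * Fn n x) 2 :=
      rellich_inequality_of_eq hh he hc hε hS htan (hV.contDiff_mollify n)
        (hasCompactSupport_mollify n hVc) hn (fun i => hV.partialDeriv_mollify n i)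
        (fun i => PINN.partialDeriv_mollify (hV.second i i) n) k
    have t1 : eLpNorm (fun x => w x * V1 k x) 2 ≤ eLpNorm (mollify n (V1 k) - V1 k) 2
        + eLpNorm (fun x => w x * mollify n (V1 k) x) 2 := by
      have heq : (fun x => w x * V1 k x) = (fun x => -w x * (mollify n (V1 k) - V1 k) x)
          + fun x => w x * mollify n (V1 k) x := by
        funext x; simp; ring
      rw [heq]
      refine (eLpNorm_add_le (hwc.neg.aestronglyMeasurable.mul
        ((hc1 k n).aestronglyMeasurable.sub (hV.memLp1_univ k).1))
        (hwc.mul (hc1 k n)).aestronglyMeasurable (by norm_num)).trans (add_le_add ?_ le_rfl)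
      refine (eLpNorm_mul_le_of_abs_le (C := 1) fun x => ?_).trans (by simp)
      change |-w x| ≤ 1
      rw [abs_neg]; exact hw1 x
    have t2 : eLpNorm (fun x => w x * Fn n x) 2
        ≤ eLpNorm (fun x => w x * F x) 2 + eLpNorm (Fn n - F) 2 := by
      have heq : (fun x => w x * Fn n x) = (fun x => w x * F x)
          + fun x => w x * (Fn n - F) x := by
        funext x; simp; ring
      rw [heq]
      refine (eLpNorm_add_le (hwc.aestronglyMeasurable.mul hFm)
        (hwc.aestronglyMeasurable.mul ((hFnm n).sub hFm)) (by norm_num)).trans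
        (add_le_add le_rfl ?_)
      exact (eLpNorm_mul_le_of_abs_le hw1).trans (by simp)
    exact t1.trans (add_le_add le_rfl (hr.trans (mul_le_mul' le_rfl t2)))
  have hlim := (tendsto_eLpNorm_mollify (hV.memLp1_univ k)).add (ENNReal.Tendsto.const_mul
    (tendsto_const_nhds (x := eLpNorm (fun x => w x * F x) 2) |>.add hFlim)
    (Or.inr (ENNReal.ofReal_ne_top (r := 4 / c))))
  have := ge_of_tendsto hlim hsm
  simpa using this

end RellichSobolev

end PINN

namespace PINN

/-! ### The quotient of a Sobolev function by the auxiliary function, near the boundary -/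

section Quotient

variable {d : ℕ} {Ω : Set (Euc d)} {η : Euc d → ℝ}

lemma abs_partialDeriv_le (i : Fin d) (f : Euc d → ℝ) (x : Euc d) :
    |partialDeriv i f x| ≤ ‖fderiv ℝ f x‖ := by
  have := (fderiv ℝ f x).le_opNorm (EuclideanSpace.single i 1)
  simpa [partialDeriv] using this

lemma partialDeriv_partialDeriv_eq {f : Euc d → ℝ} {x : Euc d} (hf : ContDiffAt ℝ 2 f x)
    (i j : Fin d) : partialDeriv i (partialDeriv j f) x
      = fderiv ℝ (fderiv ℝ f) x (EuclideanSpace.single i 1) (EuclideanSpace.single j 1) := by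
  have hdd : DifferentiableAt ℝ (fderiv ℝ f) x :=
    (hf.fderiv_right (m := 1) (by norm_num)).differentiableAt one_ne_zero
  have := hdd.hasFDerivAt.clm_apply (hasFDerivAt_const (EuclideanSpace.single j (1 : ℝ)) x)
  change fderiv ℝ (fun y => fderiv ℝ f y (EuclideanSpace.single j 1)) x _ = _
  rw [this.fderiv]
  simp

lemma IsAuxiliary.exists_bound (hη : IsAuxiliary Ω η) : ∃ C : ℝ, 0 ≤ C ∧ ∀ x, |η x| ≤ C ∧
    (∀ i, |partialDeriv i η x| ≤ C) ∧ ∀ i j, |partialDeriv i (partialDeriv j η) x| ≤ C := by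
  obtain ⟨C0, h0⟩ := hη.bdd 0 (by norm_num)
  obtain ⟨C1, h1⟩ := hη.bdd 1 (by norm_num)
  obtain ⟨C2, h2⟩ := hη.bdd 2 (by norm_num)
  have k0 : ∀ x, |η x| ≤ C0 := fun x => by simpa using h0 x
  have k1 : ∀ i x, |partialDeriv i η x| ≤ C1 := fun i x =>
    (abs_partialDeriv_le i η x).trans (by
      have := h1 x
      rwa [← zero_add 1, ← norm_iteratedFDeriv_fderiv, norm_iteratedFDeriv_zero] at this)
  have k2 : ∀ i j x, |partialDeriv i (partialDeriv j η) x| ≤ C2 := fun i j x => by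
    have := h2 x
    rw [← one_add_one_eq_two, ← norm_iteratedFDeriv_fderiv, ← zero_add 1,
      ← norm_iteratedFDeriv_fderiv, norm_iteratedFDeriv_zero] at this
    rw [partialDeriv_partialDeriv_eq (hη.contDiff.contDiffAt.of_le (by norm_num))]
    have h3 := (fderiv ℝ (fderiv ℝ η) x (EuclideanSpace.single i 1)).le_opNorm
      (EuclideanSpace.single j 1)
    have h4 := (fderiv ℝ (fderiv ℝ η) x).le_opNorm (EuclideanSpace.single i 1)
    simp at h3 h4
    exact h3.trans (h4.trans this)
  have hC0 : 0 ≤ C0 := (abs_nonneg _).trans (k0 0)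
  refine ⟨max C0 (max C1 C2), le_max_of_le_left hC0, fun x => ⟨(k0 x).trans (le_max_left _ _),
    fun i => (k1 i x).trans ((le_max_left _ _).trans (le_max_right _ _)),
    fun i j => (k2 i j x).trans ((le_max_right _ _).trans (le_max_right _ _))⟩⟩

/-- `u` is a limit of test functions in the Sobolev norm of order one; the first derivatives of `u`
are `u1 i`. -/
def IsLimitOfTest (Ω : Set (Euc d)) (u : Euc d → ℝ) (u1 : Fin d → Euc d → ℝ) : Prop :=
  ∃ φ : ℕ → Euc d → ℝ, (∀ n, IsTestFunction Ω (φ n)) ∧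
    Tendsto (fun n => eLpNorm (u - φ n) 2 (volume.restrict (interior Ω))) atTop (𝓝 0) ∧
    ∀ i, Tendsto (fun n => eLpNorm (u1 i - partialDeriv i (φ n)) 2
      (volume.restrict (interior Ω))) atTop (𝓝 0)

variable {p e : Euc d} {ρ c : ℝ} {u : Euc d → ℝ} {u1 : Fin d → Euc d → ℝ}
  {u2 : Fin d → Fin d → Euc d → ℝ} {χ : Euc d → ℝ}

lemma abs_apply_le_of_norm_eq_one (he : ‖e‖ = 1) (i : Fin d) : |e i| ≤ 1 := by
  have := PiLp.norm_apply_le e i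
  rwa [he, Real.norm_eq_abs] at this

lemma eLpNorm_fderiv_mul_le (he : ‖e‖ = 1) {φ : Euc d → ℝ} (hχ : ContDiff ℝ 1 χ)
    (hφ : ContDiff ℝ 1 φ) {C : ℝ} (hC : ∀ x, |χ x| ≤ C) (hC1 : ∀ i x, |partialDeriv i χ x| ≤ C) :
    eLpNorm (fun x => fderiv ℝ (fun x => χ x * φ x) x e) 2 ≤
      ∑ i, (ENNReal.ofReal C * eLpNorm (partialDeriv i φ) 2
        + ENNReal.ofReal C * eLpNorm φ 2) := by
  have hd : ∀ {f : Euc d → ℝ}, ContDiff ℝ 1 f → ∀ i, Continuous (partialDeriv i f) :=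
    fun hf i => (ContDiff.partialDeriv (m := 0) hf (by simp)).continuous
  have heq : (fun x => fderiv ℝ (fun x => χ x * φ x) x e)
      = ∑ i, ((fun x => (e i * χ x) * partialDeriv i φ x)
        + fun x => (e i * partialDeriv i χ x) * φ x) := by
    funext x
    rw [fderiv_apply_eq_sum, Finset.sum_apply]
    refine Finset.sum_congr rfl fun i _ => ?_
    rw [partialDeriv_mul (hχ.differentiable one_ne_zero x) (hφ.differentiable one_ne_zero x)]
    simp only [Pi.add_apply]
    ring
  have hbd : ∀ {a : ℝ} i, |a| ≤ C → |e i * a| ≤ C := fun {a} i h => by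
    rw [abs_mul]
    exact (mul_le_of_le_one_left (abs_nonneg _) (abs_apply_le_of_norm_eq_one he i)).trans h
  have m1 : ∀ i, Continuous fun x => (e i * χ x) * partialDeriv i φ x := fun i =>
    (continuous_const.mul hχ.continuous).mul (hd hφ i)
  have m2 : ∀ i, Continuous fun x => (e i * partialDeriv i χ x) * φ x := fun i =>
    (continuous_const.mul (hd hχ i)).mul hφ.continuous
  rw [heq]
  refine (eLpNorm_sum_le (fun i _ => ((m1 i).add (m2 i)).aestronglyMeasurable)
    (by norm_num)).trans (Finset.sum_le_sum fun i _ => ?_)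
  refine (eLpNorm_add_le (m1 i).aestronglyMeasurable (m2 i).aestronglyMeasurable
    (by norm_num)).trans (add_le_add ?_ ?_)
  · exact eLpNorm_mul_le_of_abs_le fun x => hbd i (hC x)
  · exact eLpNorm_mul_le_of_abs_le fun x => hbd i (hC1 i x)

lemma exists_bound_of_hasCompactSupport (hχ : ContDiff ℝ 2 χ) (hχc : HasCompactSupport χ) :
    ∃ C : ℝ, 0 ≤ C ∧ ∀ x, |χ x| ≤ C ∧
      (∀ i, |partialDeriv i χ x| ≤ C) ∧ ∀ i j, |partialDeriv i (partialDeriv j χ) x| ≤ C := by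
  have h1 : ∀ i, ContDiff ℝ 1 (partialDeriv i χ) := fun i =>
    ContDiff.partialDeriv hχ (by norm_num)
  have h2 : ∀ i j, Continuous (partialDeriv i (partialDeriv j χ)) := fun i j =>
    (ContDiff.partialDeriv (m := 0) (h1 j) (by simp)).continuous
  obtain ⟨C0, k0⟩ := hχ.continuous.bounded_above_of_compact_support hχc
  choose C1 k1 using fun i =>
    (h1 i).continuous.bounded_above_of_compact_support hχc.partialDeriv
  choose C2 k2 using fun i j =>
    (h2 i j).bounded_above_of_compact_support hχc.partialDeriv.partialDeriv
  have hC0 : 0 ≤ C0 := (norm_nonneg _).trans (k0 0)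
  have hC1 : ∀ i, 0 ≤ C1 i := fun i => (norm_nonneg _).trans (k1 i 0)
  have hC2 : ∀ i j, 0 ≤ C2 i j := fun i j => (norm_nonneg _).trans (k2 i j 0)
  have s1 : 0 ≤ ∑ i, C1 i := Finset.sum_nonneg fun i _ => hC1 i
  have s2 : 0 ≤ ∑ i, ∑ j, C2 i j :=
    Finset.sum_nonneg fun i _ => Finset.sum_nonneg fun j _ => hC2 i j
  refine ⟨C0 + ∑ i, C1 i + ∑ i, ∑ j, C2 i j, by positivity, fun x => ⟨?_, fun i => ?_,
    fun i j => ?_⟩⟩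
  · have : |χ x| ≤ C0 := k0 x
    linarith
  · have h3 : |partialDeriv i χ x| ≤ C1 i := k1 i x
    have := Finset.single_le_sum (f := C1) (fun i _ => hC1 i) (Finset.mem_univ i)
    linarith
  · have h3 : |partialDeriv i (partialDeriv j χ) x| ≤ C2 i j := k2 i j x
    have := Finset.single_le_sum (f := C2 i) (fun j _ => hC2 i j) (Finset.mem_univ j)
    have := Finset.single_le_sum (f := fun i => ∑ j, C2 i j)
      (fun i _ => Finset.sum_nonneg fun j _ => hC2 i j) (Finset.mem_univ i)
    linarith

lemma contDiffOn_quotient (hη : IsAuxiliary Ω η) (hχ : ContDiff ℝ ∞ χ) :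
    ContDiffOn ℝ 3 (fun x => (η x)⁻¹ * χ x) (interior Ω) :=
  (hη.contDiff.contDiffOn.inv fun x hx => (hη.pos x hx).ne').mul (hχ.of_le (by norm_cast)).contDiffOn

/-- Hardy's inequality: `χ u / η` is square integrable. -/
lemma memLp_quotient (hη : IsAuxiliary Ω η) (hB : IsBoundaryBall Ω η p e ρ c)
    (hu : IsH2Triple Ω u u1 u2) (hu0 : IsLimitOfTest Ω u u1) (hχ : ContDiff ℝ ∞ χ)
    (hχc : HasCompactSupport χ) (hχs : tsupport χ ⊆ Metric.ball p ρ) :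
    MemLp (fun x => (η x)⁻¹ * χ x * u x) 2 (volume.restrict (interior Ω)) := by
  obtain ⟨φ, hφ, hl0, hl1⟩ := hu0
  obtain ⟨C, hC0, hC⟩ := exists_bound_of_hasCompactSupport (hχ.of_le (m := 2) (by norm_cast)) hχc
  have hqc := (contDiffOn_quotient hη hχ).continuousOn
  set l := volume.restrict (interior Ω) with hl
  have hφ1 : ∀ n, ContDiff ℝ 1 (φ n) := fun n => (hφ n).smooth.of_le (by simp)
  have hφd : ∀ n i, Continuous (partialDeriv i (φ n)) := fun n i =>
    (ContDiff.partialDeriv (m := 0) (hφ1 n) (by simp)).continuous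
  -- Hardy's inequality applies to `χ φ n`, whose support avoids the zeros of `η`. Its bound is
  -- uniform in `n`, and Fatou's lemma along an almost everywhere convergent subsequence transfers
  -- it to `u`.
  obtain ⟨ns, hns, hae⟩ := (tendstoInMeasure_of_tendsto_eLpNorm (μ := l) (p := 2) (f := φ) (g := u)
    two_ne_zero (fun n => (hφ n).smooth.continuous.aestronglyMeasurable) hu.memLp.1
    (by simpa only [eLpNorm_sub_comm] using hl0)).exists_seq_tendsto_ae
  refine ⟨((hqc.aestronglyMeasurable isOpen_interior.measurableSet).mul hu.memLp.1), ?_⟩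
  have hlim : ∀ᵐ x ∂l, Tendsto (fun k => (η x)⁻¹ * χ x * φ (ns k) x) atTop
      (𝓝 ((η x)⁻¹ * χ x * u x)) := by
    filter_upwards [hae] with x hx
    exact hx.const_mul _
  have hsup : ∀ f : Euc d → ℝ, tsupport f ⊆ interior Ω → eLpNorm f 2 = eLpNorm f 2 l :=
    fun f hf => (eLpNorm_restrict_eq_of_support_subset ((subset_tsupport f).trans hf)).symm
  set B : ℕ → ℝ≥0∞ := fun n => ENNReal.ofReal (2 / c) * ∑ i, (ENNReal.ofReal C *
    (eLpNorm (u1 i) 2 l + eLpNorm (u1 i - partialDeriv i (φ n)) 2 l)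
    + ENNReal.ofReal C * (eLpNorm u 2 l + eLpNorm (u - φ n) 2 l)) with hBdef
  have hbound : ∀ n, eLpNorm (fun x => (η x)⁻¹ * χ x * φ n x) 2 l ≤ B n := by
    intro n
    have hv : ContDiff ℝ 1 fun x => χ x * φ n x := (hχ.of_le (by simp)).mul (hφ1 n)
    have hH := hardy_inequality (e := e) (hη.contDiff.of_le (by norm_num)) hB.c_pos hB.le_fderiv hv
      hχc.mul_right (tsupport_mul_subset_left.trans hχs)
      (fun x hx => hη.pos x ((hφ n).support (tsupport_mul_subset_right hx)))
    have e1 : (fun x => (η x)⁻¹ * χ x * φ n x) = fun x => χ x * φ n x / η x := by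
      funext x; rw [div_eq_inv_mul, mul_assoc]
    rw [e1]
    refine (eLpNorm_mono_measure _ Measure.restrict_le_self).trans (hH.trans ?_)
    refine mul_le_mul' le_rfl ((eLpNorm_fderiv_mul_le hB.norm_e (hχ.of_le (by simp)) (hφ1 n)
      (fun x => (hC x).1) (fun i x => (hC x).2.1 i)).trans ?_)
    refine Finset.sum_le_sum fun i _ => add_le_add (mul_le_mul' le_rfl ?_) (mul_le_mul' le_rfl ?_)
    · rw [hsup _ (hφ n).partialDeriv_tsupport]
      have : partialDeriv i (φ n) = u1 i - (u1 i - partialDeriv i (φ n)) := by simp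
      conv_lhs => rw [this]
      exact eLpNorm_sub_le (hu.memLp1 i).1 ((hu.memLp1 i).1.sub (hφd n i).aestronglyMeasurable)
        (by norm_num)
    · rw [hsup _ (hφ n).support]
      have : φ n = u - (u - φ n) := by simp
      conv_lhs => rw [this]
      exact eLpNorm_sub_le hu.memLp.1 (hu.memLp.1.sub (hφ1 n).continuous.aestronglyMeasurable)
        (by norm_num)
  have hBlim : Tendsto B atTop (𝓝 (ENNReal.ofReal (2 / c) * ∑ i, (ENNReal.ofReal C *
      (eLpNorm (u1 i) 2 l + 0) + ENNReal.ofReal C * (eLpNorm u 2 l + 0)))) := by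
    refine ENNReal.Tendsto.const_mul (tendsto_finsetSum _ fun i _ => Tendsto.add
      (ENNReal.Tendsto.const_mul (tendsto_const_nhds.add (hl1 i)) (Or.inr ENNReal.ofReal_ne_top))
      (ENNReal.Tendsto.const_mul (tendsto_const_nhds.add hl0) (Or.inr ENNReal.ofReal_ne_top)))
      (Or.inr ENNReal.ofReal_ne_top)
  have hfat := Lp.eLpNorm_lim_le_liminf_eLpNorm (p := 2) (μ := l)
    (f := fun k x => (η x)⁻¹ * χ x * φ (ns k) x) (fun k =>
      (hqc.aestronglyMeasurable isOpen_interior.measurableSet).mul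
        (hφ1 _).continuous.aestronglyMeasurable) _ hlim
  refine lt_of_le_of_lt (hfat.trans ((liminf_le_liminf (Eventually.of_forall fun k =>
    hbound (ns k))).trans (hBlim.comp hns.tendsto_atTop).liminf_eq.le)) ?_
  refine ENNReal.mul_lt_top ENNReal.ofReal_lt_top (ENNReal.sum_lt_top.2 fun i _ => ?_)
  rw [add_zero, add_zero]
  exact ENNReal.add_lt_top.2 ⟨ENNReal.mul_lt_top ENNReal.ofReal_lt_top (hu.memLp1 i).2,
    ENNReal.mul_lt_top ENNReal.ofReal_lt_top hu.memLp.2⟩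

/-- The products `η⁻¹ χ u`, with the singularity at the boundary cut off, have global weak
derivatives. -/
lemma isH2Triple_cutRecip (hη : IsAuxiliary Ω η) (hB : IsBoundaryBall Ω η p e ρ c)
    (hu : IsH2Triple Ω u u1 u2) (hχ : ContDiff ℝ ∞ χ) (hχc : HasCompactSupport χ)
    (hχs : tsupport χ ⊆ Metric.ball p ρ) {κ : ℝ} (hκ : 0 < κ) :
    IsH2Triple Set.univ (fun x => cutRecip κ (η x) * χ x * u x)
        (mulFirst (fun x => cutRecip κ (η x) * χ x) u u1)
        (mulSecond (fun x => cutRecip κ (η x) * χ x) u u1 u2) ∧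
      tsupport (fun x => cutRecip κ (η x) * χ x) ⊆ interior Ω := by
  have hsub : tsupport (fun x => cutRecip κ (η x) * χ x) ⊆ interior Ω := by
    have h1 : tsupport (fun x => cutRecip κ (η x) * χ x) ⊆ {x | κ / 2 ≤ η x} := by
      refine closure_minimal (fun x hx => ?_)
        (isClosed_le continuous_const hη.differentiable.continuous)
      by_contra hcon
      exact hx (by simp only [cutRecip_eq_zero hκ (le_of_lt (not_le.1 hcon)), zero_mul])
    intro x hx
    have h2 : κ / 2 ≤ η x := h1 hx
    exact (hB.mem_interior x (hχs (tsupport_mul_subset_right hx))).2 (by linarith)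
  refine ⟨hu.mul_cutoff ?_ hχc.mul_left hsub, hsub⟩
  exact (((contDiff_cutRecip hκ).comp hη.contDiff).of_le (by norm_num)).mul
    (hχ.of_le (by norm_cast))

lemma cutRecip_mul_eventuallyEq (hη : IsAuxiliary Ω η) {κ : ℝ} (hκ : 0 < κ) {x : Euc d}
    (hx : κ < η x) :
    (fun x => cutRecip κ (η x) * χ x) =ᶠ[𝓝 x] fun x => (η x)⁻¹ * χ x := by
  filter_upwards [hη.differentiable.continuous.continuousAt.eventually (lt_mem_nhds hx)] with y hy
  rw [cutRecip_eq hκ hy.le]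

lemma mul_quotient_eventuallyEq (hη : IsAuxiliary Ω η) {x : Euc d} (hx : x ∈ interior Ω) :
    (fun x => η x * ((η x)⁻¹ * χ x)) =ᶠ[𝓝 x] χ := by
  filter_upwards [isOpen_interior.mem_nhds hx] with y hy
  exact mul_inv_cancel_left₀ (hη.pos y hy).ne' _

/-- The product rule for `χ u = η * (η⁻¹ χ u)`. It serves both to read off regularity of the
quotient and to reassemble `χ u` from it. -/
lemma mulFirst_quotient (hη : IsAuxiliary Ω η) (hχ : ContDiff ℝ ∞ χ) {x : Euc d}
    (hx : x ∈ interior Ω) (i : Fin d) : mulFirst χ u u1 i x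
      = η x * mulFirst (fun x => (η x)⁻¹ * χ x) u u1 i x
        + partialDeriv i η x * ((η x)⁻¹ * χ x * u x) := by
  rw [← mulFirst_congr (mul_quotient_eventuallyEq hη hx),
    mulFirst_mul (hη.differentiable x) (((contDiffOn_quotient hη hχ).contDiffAt
      (isOpen_interior.mem_nhds hx)).differentiableAt (by norm_num))]

lemma mulSecond_quotient (hη : IsAuxiliary Ω η) (hχ : ContDiff ℝ ∞ χ) {x : Euc d}
    (hx : x ∈ interior Ω) (i j : Fin d) : mulSecond χ u u1 u2 i j x
      = η x * mulSecond (fun x => (η x)⁻¹ * χ x) u u1 u2 i j x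
        + partialDeriv i η x * mulFirst (fun x => (η x)⁻¹ * χ x) u u1 j x
        + partialDeriv j η x * mulFirst (fun x => (η x)⁻¹ * χ x) u u1 i x
        + partialDeriv i (partialDeriv j η) x * ((η x)⁻¹ * χ x * u x) := by
  rw [← mulSecond_congr (mul_quotient_eventuallyEq hη hx),
    mulSecond_mul (hη.contDiff.contDiffAt.of_le (by norm_num))
      (((contDiffOn_quotient hη hχ).contDiffAt (isOpen_interior.mem_nhds hx)).of_le (by norm_num))]

lemma aestronglyMeasurable_mulFirst {m : Euc d → ℝ} (hu : IsH2Triple Ω u u1 u2)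
    (hm : ContDiffOn ℝ 2 m (interior Ω)) (i : Fin d) :
    AEStronglyMeasurable (mulFirst m u u1 i) (volume.restrict (interior Ω)) := by
  have h1 : ContinuousOn (partialDeriv i m) (interior Ω) :=
    (ContDiffOn.partialDeriv (m := 1) hm isOpen_interior (by norm_num)).continuousOn
  exact ((hm.continuousOn.aestronglyMeasurable isOpen_interior.measurableSet).mul
    (hu.memLp1 i).1).add
    ((h1.aestronglyMeasurable isOpen_interior.measurableSet).mul hu.memLp.1)

lemma aestronglyMeasurable_mulSecond {m : Euc d → ℝ} (hu : IsH2Triple Ω u u1 u2)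
    (hm : ContDiffOn ℝ 2 m (interior Ω)) (i j : Fin d) :
    AEStronglyMeasurable (mulSecond m u u1 u2 i j) (volume.restrict (interior Ω)) := by
  have h1 : ∀ i, ContDiffOn ℝ 1 (partialDeriv i m) (interior Ω) := fun i =>
    ContDiffOn.partialDeriv hm isOpen_interior (by norm_num)
  have h2 : ContinuousOn (partialDeriv i (partialDeriv j m)) (interior Ω) :=
    (ContDiffOn.partialDeriv (m := 0) (h1 j) isOpen_interior (by norm_num)).continuousOn
  have hms := isOpen_interior (s := Ω).measurableSet
  exact (((hm.continuousOn.aestronglyMeasurable hms).mul (hu.memLp2 i j).1).add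
    (((h1 i).continuousOn.aestronglyMeasurable hms).mul (hu.memLp1 j).1)).add
    ((((h1 j).continuousOn.aestronglyMeasurable hms).mul (hu.memLp1 i).1).add
    ((h2.aestronglyMeasurable hms).mul hu.memLp.1))

lemma memLp_mulFirst (hu : IsH2Triple Ω u u1 u2) (hχ : ContDiff ℝ ∞ χ) (hχc : HasCompactSupport χ)
    (i : Fin d) : MemLp (mulFirst χ u u1 i) 2 (volume.restrict (interior Ω)) := by
  obtain ⟨C, -, hC⟩ := exists_bound_of_hasCompactSupport (hχ.of_le (m := 2) (by norm_cast)) hχc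
  have h1 : Continuous (partialDeriv i χ) :=
    (ContDiff.partialDeriv (m := 0) hχ (by simp)).continuous
  exact (memLp_mul_of_abs_le hχ.continuous.aestronglyMeasurable (fun x => (hC x).1)
    (hu.memLp1 i)).add (memLp_mul_of_abs_le h1.aestronglyMeasurable (fun x => (hC x).2.1 i) hu.memLp)

lemma memLp_mulSecond (hu : IsH2Triple Ω u u1 u2) (hχ : ContDiff ℝ ∞ χ)
    (hχc : HasCompactSupport χ) (i j : Fin d) :
    MemLp (mulSecond χ u u1 u2 i j) 2 (volume.restrict (interior Ω)) := by
  obtain ⟨C, -, hC⟩ := exists_bound_of_hasCompactSupport (hχ.of_le (m := 2) (by norm_cast)) hχc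
  have h1 : ∀ i, ContDiff ℝ ∞ (partialDeriv i χ) := fun i => ContDiff.partialDeriv hχ (by simp)
  have h2 : Continuous (partialDeriv i (partialDeriv j χ)) :=
    (ContDiff.partialDeriv (m := 0) (h1 j) (by simp)).continuous
  exact ((memLp_mul_of_abs_le hχ.continuous.aestronglyMeasurable (fun x => (hC x).1)
    (hu.memLp2 i j)).add (memLp_mul_of_abs_le (h1 i).continuous.aestronglyMeasurable
      (fun x => (hC x).2.1 i) (hu.memLp1 j))).add
    ((memLp_mul_of_abs_le (h1 j).continuous.aestronglyMeasurable
      (fun x => (hC x).2.1 j) (hu.memLp1 i)).add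
    (memLp_mul_of_abs_le h2.aestronglyMeasurable (fun x => (hC x).2.2 i j) hu.memLp))

/-- Apply the Rellich inequality with `h = η - κ`. The weight vanishes where `η ≤ κ`, so the
quotient may be replaced there by its truncation `cutRecip κ (η x) * χ x * u x`, which is of Sobolev
order two on the whole space. -/
lemma rellich_quotient (hη : IsAuxiliary Ω η) (hB : IsBoundaryBall Ω η p e ρ c)
    (hu : IsH2Triple Ω u u1 u2) (hχ : ContDiff ℝ ∞ χ) (hχc : HasCompactSupport χ)
    (hχs : tsupport χ ⊆ Metric.ball p ρ) {κ ε : ℝ} (hκ : 0 < κ) (hε : 0 < ε) (k : Fin d) :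
    eLpNorm (fun x => √(weight ε (η x - κ)) * mulFirst (fun x => (η x)⁻¹ * χ x) u u1 k x) 2
        (volume.restrict (interior Ω))
      ≤ ENNReal.ofReal (4 / c) * eLpNorm (fun x => √(weight ε (η x - κ)) *
        ((η x - κ) * ∑ i, mulSecond (fun x => (η x)⁻¹ * χ x) u u1 u2 i i x
          + 2 * ∑ i, partialDeriv i η x * mulFirst (fun x => (η x)⁻¹ * χ x) u u1 i x)) 2
        (volume.restrict (interior Ω)) := by
  obtain ⟨hV, hVs⟩ := isH2Triple_cutRecip hη hB hu hχ hχc hχs hκ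
  obtain ⟨C, hC0, hC⟩ := hη.exists_bound
  have hpd : ∀ i x, partialDeriv i (fun x => η x - κ) x = partialDeriv i η x := fun i x => by
    rw [partialDeriv, fderiv_sub_const, partialDeriv]
  have hR := hV.rellich_inequality (S := Metric.ball p ρ) (h := fun x => η x - κ) (e := e) (c := c)
    (ε := ε) (C := C + κ) (hχc.mul_left.mul_right) Metric.isOpen_ball
    ((tsupport_mul_subset_left.trans tsupport_mul_subset_right).trans hχs)
    ((hη.contDiff.of_le (by norm_num)).sub contDiff_const)
    (fun x => (abs_sub _ _).trans (by rw [abs_of_pos hκ]; linarith [(hC x).1]))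
    (fun i x => by rw [hpd]; linarith [(hC x).2.1 i])
    hB.norm_e hB.c_pos hε (fun x hx => by rw [fderiv_sub_const]; exact hB.le_fderiv x hx)
    (fun x hx => by simp only [hpd, fderiv_sub_const]; exact hB.tangential x hx) k
  simp only [hpd] at hR
  set w : Euc d → ℝ := fun x => √(weight ε (η x - κ)) with hw
  have hw0 : ∀ x, η x ≤ κ → w x = 0 := fun x hx => by
    simp [hw, weight_of_nonpos (sub_nonpos.2 hx)]
  have hmod : ∀ (f g : Euc d → ℝ), (∀ x, κ < η x → f x = g x) →
      (fun x => w x * f x) = fun x => w x * g x := by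
    intro f g hfg
    funext x
    rcases le_or_gt (η x) κ with hx | hx
    · rw [hw0 x hx, zero_mul, zero_mul]
    · rw [hfg x hx]
  have e1 := hmod (mulFirst (fun x => cutRecip κ (η x) * χ x) u u1 k)
    (mulFirst (fun x => (η x)⁻¹ * χ x) u u1 k)
    fun x hx => mulFirst_congr (cutRecip_mul_eventuallyEq hη hκ hx) k
  have e2 := hmod (fun x => (η x - κ) * ∑ i, mulSecond (fun x => cutRecip κ (η x) * χ x) u u1 u2 i i x
      + 2 * ∑ i, partialDeriv i η x * mulFirst (fun x => cutRecip κ (η x) * χ x) u u1 i x)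
    (fun x => (η x - κ) * ∑ i, mulSecond (fun x => (η x)⁻¹ * χ x) u u1 u2 i i x
          + 2 * ∑ i, partialDeriv i η x * mulFirst (fun x => (η x)⁻¹ * χ x) u u1 i x)
    fun x hx => by
      have h1 := cutRecip_mul_eventuallyEq (χ := χ) hη hκ hx
      simp only [mulFirst_congr h1, mulSecond_congr h1]
  have e3 : Function.support (fun x => w x * ((η x - κ) *
      ∑ i, mulSecond (fun x => cutRecip κ (η x) * χ x) u u1 u2 i i x
      + 2 * ∑ i, partialDeriv i η x * mulFirst (fun x => cutRecip κ (η x) * χ x) u u1 i x))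
      ⊆ interior Ω := by
    intro x hx
    by_contra hcon
    have hx' : x ∉ tsupport (fun x => cutRecip κ (η x) * χ x) := fun h => hcon (hVs h)
    refine hx ?_
    simp only [mulFirst_of_notMem_tsupport hx', mulSecond_of_notMem_tsupport hx']
    simp
  rw [← eLpNorm_restrict_eq_of_support_subset e3] at hR
  rw [e1] at hR
  have hR2 := (eLpNorm_mono_measure _
    (Measure.restrict_le_self (s := interior Ω))).trans hR
  rwa [e2] at hR2

/-- The first derivatives of `χ u / η` are square integrable. -/
lemma memLp_quotient_first (hη : IsAuxiliary Ω η) (hB : IsBoundaryBall Ω η p e ρ c)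
    (hu : IsH2Triple Ω u u1 u2) (hu0 : IsLimitOfTest Ω u u1) (hχ : ContDiff ℝ ∞ χ)
    (hχc : HasCompactSupport χ) (hχs : tsupport χ ⊆ Metric.ball p ρ) (k : Fin d) :
    MemLp (mulFirst (fun x => (η x)⁻¹ * χ x) u u1 k) 2 (volume.restrict (interior Ω)) := by
  obtain ⟨C, hC0, hC⟩ := hη.exists_bound
  have hP := memLp_quotient hη hB hu hu0 hχ hχc hχs
  have hq2 := (contDiffOn_quotient hη hχ).of_le (m := 2) (by norm_num)
  have hms := isOpen_interior (s := Ω).measurableSet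
  have hηc : Continuous η := hη.differentiable.continuous
  have hη1 : ∀ i, ContDiff ℝ 2 (partialDeriv i η) := fun i =>
    ContDiff.partialDeriv hη.contDiff (by norm_num)
  have hη2 : ∀ i j, Continuous (partialDeriv i (partialDeriv j η)) := fun i j =>
    (ContDiff.partialDeriv (m := 1) (hη1 j) (by norm_num)).continuous
  set l := volume.restrict (interior Ω) with hl
  set P1 := mulFirst (fun x => (η x)⁻¹ * χ x) u u1 with hP1
  set L : Euc d → ℝ := fun x => ∑ i, mulSecond (fun x => (η x)⁻¹ * χ x) u u1 u2 i i x with hL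
  have hP1m : ∀ i, AEStronglyMeasurable (P1 i) l := aestronglyMeasurable_mulFirst hu hq2
  have hLm : AEStronglyMeasurable L l :=
    Finset.aestronglyMeasurable_fun_sum _ fun i _ => aestronglyMeasurable_mulSecond hu hq2 i i
  -- By the product rule `G = Δ(χu) - Δη * (χu/η)`, hence `G ∈ L²`, although neither `L` nor `P1` is
  -- yet known to be square integrable.
  set G : Euc d → ℝ := fun x => η x * L x + 2 * ∑ i, partialDeriv i η x * P1 i x with hG
  have hGL : MemLp G 2 l := by
    have h1 : MemLp (fun x => (∑ i, mulSecond χ u u1 u2 i i x)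
        - ∑ i, partialDeriv i (partialDeriv i η) x * ((η x)⁻¹ * χ x * u x)) 2 l :=
      (memLp_finsetSum _ fun i _ => memLp_mulSecond hu hχ hχc i i).sub
        (memLp_finsetSum _ fun i _ => memLp_mul_of_abs_le (hη2 i i).aestronglyMeasurable
          (fun x => (hC x).2.2 i i) hP)
    refine (memLp_congr_ae ?_).1 h1
    filter_upwards [ae_restrict_mem hms] with x hx
    simp only [mulSecond_quotient hη hχ hx, Finset.sum_add_distrib, hG, hL, Finset.mul_sum, hP1]
    simp only [two_mul, Finset.sum_add_distrib]
    ring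
  have hηP1 : ∀ i, MemLp (fun x => η x * P1 i x) 2 l := by
    intro i
    have h1 : MemLp (fun x => mulFirst χ u u1 i x - partialDeriv i η x * ((η x)⁻¹ * χ x * u x)) 2 l :=
      (memLp_mulFirst hu hχ hχc i).sub (memLp_mul_of_abs_le
        (hη1 i).continuous.aestronglyMeasurable (fun x => (hC x).2.1 i) hP)
    refine (memLp_congr_ae ?_).1 h1
    filter_upwards [ae_restrict_mem hms] with x hx
    rw [mulFirst_quotient hη hχ hx]
    ring
  -- From `η² L = η G - 2 η ∇η · P1`. This weaker integrability of `L` controls the error `-κ L`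
  -- made by using `η - κ` instead of `η`.
  have hη2L : MemLp (fun x => η x ^ 2 * L x) 2 l := by
    have h1 : MemLp (fun x => η x * G x - ∑ i, (2 * partialDeriv i η x) * (η x * P1 i x)) 2 l :=
      (memLp_mul_of_abs_le hηc.aestronglyMeasurable (fun x => (hC x).1) hGL).sub
        (memLp_finsetSum _ fun i _ => memLp_mul_of_abs_le
          (continuous_const.mul (hη1 i).continuous).aestronglyMeasurable (C := 2 * C)
          (fun x => by
            rw [abs_mul, abs_two]
            linarith [(hC x).2.1 i]) (hηP1 i))
    refine (memLp_congr_ae (Eventually.of_forall fun x => ?_)).1 h1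
    simp only [hG, mul_add, Finset.mul_sum]
    rw [add_sub_assoc, ← Finset.sum_sub_distrib, Finset.sum_eq_zero fun i _ => by ring]
    ring
  have hwc : ∀ ε : ℝ, 0 < ε → Continuous fun s => √(weight ε s) := fun ε hε =>
    Real.continuous_sqrt.comp (continuous_weight hε)
  set κ : ℕ → ℝ := fun n => 1 / ((n : ℝ) + 1) with hκdef
  have hκ : ∀ n, 0 < κ n := fun n => by positivity
  have hκ0 : Tendsto κ atTop (𝓝 0) := tendsto_one_div_add_atTop_nhds_zero_nat
  -- First let `κ → 0` with `ε` fixed; the resulting bound does not depend on `ε`, which is sent to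
  -- zero afterwards.
  have hε : ∀ ε : ℝ, 0 < ε → eLpNorm (fun x => √(weight ε (η x)) * P1 k x) 2 l
      ≤ ENNReal.ofReal (4 / c) * eLpNorm G 2 l := by
    intro ε hε
    have hw1 : ∀ s, |√(weight ε s)| ≤ 1 := fun s => by
      rw [abs_of_nonneg (Real.sqrt_nonneg _), Real.sqrt_le_iff, one_pow]
      exact ⟨zero_le_one, weight_le_one hε _⟩
    have hwm : ∀ n, AEStronglyMeasurable (fun x => √(weight ε (η x - κ n))) l := fun n =>
      ((hwc ε hε).comp (hηc.sub continuous_const)).aestronglyMeasurable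
    have hb : ∀ n, eLpNorm (fun x => √(weight ε (η x - κ n)) * P1 k x) 2 l
        ≤ ENNReal.ofReal (4 / c) * (eLpNorm G 2 l
          + eLpNorm (fun x => √(weight ε (η x - κ n)) * (-κ n * L x)) 2 l) := by
      intro n
      refine (rellich_quotient hη hB hu hχ hχc hχs (hκ n) hε k).trans (mul_le_mul' le_rfl ?_)
      have heq : (fun x => √(weight ε (η x - κ n)) * ((η x - κ n) * L x
          + 2 * ∑ i, partialDeriv i η x * P1 i x)) = (fun x => √(weight ε (η x - κ n)) * G x)
          + fun x => √(weight ε (η x - κ n)) * (-κ n * L x) := by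
        funext x
        simp only [hG, Pi.add_apply]
        ring
      refine (congrArg (fun f => eLpNorm f 2 l) heq).le.trans
        ((eLpNorm_add_le ((hwm n).mul hGL.1) ((hwm n).mul (hLm.const_mul _)) (by norm_num)).trans
        (add_le_add ((eLpNorm_mul_le_of_abs_le (C := 1) fun x => hw1 _).trans (by simp)) le_rfl))
    -- Where the weight is not zero, `κ < η` and `√weight ≤ η/ε`, so the error is dominated by `η²
    -- |L| / ε`.
    have hrest : Tendsto (fun n => eLpNorm (fun x => √(weight ε (η x - κ n)) * (-κ n * L x)) 2 l)
        atTop (𝓝 0) := by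
      refine tendsto_eLpNorm_of_dominated (fun n => (hwm n).mul (hLm.const_mul _))
        (hη2L.const_mul (1 / ε)) (fun n => ?_) ?_
      · filter_upwards [ae_restrict_mem hms] with x hx
        have hηx := hη.pos x hx
        rcases le_or_gt (η x) (κ n) with h | h
        · simp only [weight_of_nonpos (sub_nonpos.2 h), Real.sqrt_zero, zero_mul, abs_zero]
          positivity
        · have h1 : √(weight ε (η x - κ n)) ≤ η x / ε := by
            rw [Real.sqrt_le_iff]
            refine ⟨by positivity, (weight_le hε _).trans ?_⟩
            have : 0 ≤ η x - κ n := by linarith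
            have := hκ n
            gcongr
            linarith
          rw [abs_mul, abs_mul, abs_mul, abs_mul, abs_neg, abs_of_pos (hκ n),
            abs_of_nonneg (Real.sqrt_nonneg _), abs_of_pos (by positivity : 0 < 1 / ε),
            abs_of_nonneg (sq_nonneg (η x))]
          calc √(weight ε (η x - κ n)) * (κ n * |L x|) ≤ η x / ε * (η x * |L x|) := by gcongr
            _ = 1 / ε * (η x ^ 2 * |L x|) := by ring
      · filter_upwards with x
        refine squeeze_zero_norm (a := fun n => κ n * |L x|) (fun n => ?_)
          (by simpa using hκ0.mul_const |L x|)
        rw [norm_mul, norm_mul, norm_neg, Real.norm_of_nonneg (hκ n).le, Real.norm_eq_abs,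
          Real.norm_eq_abs]
        exact mul_le_of_le_one_left (by have := hκ n; positivity) (hw1 _)
    have hlim : ∀ᵐ x ∂l, Tendsto (fun n => √(weight ε (η x - κ n)) * P1 k x) atTop
        (𝓝 (√(weight ε (η x)) * P1 k x)) := by
      filter_upwards with x
      refine Tendsto.mul_const _ (((hwc ε hε).tendsto _).comp ?_)
      simpa using tendsto_const_nhds.sub hκ0
    have hfat := Lp.eLpNorm_lim_le_liminf_eLpNorm (p := 2) (μ := l)
      (fun n => (hwm n).mul (hP1m k)) _ hlim
    have hB' := (ENNReal.Tendsto.const_mul (tendsto_const_nhds (x := eLpNorm G 2 l) |>.add hrest)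
      (Or.inr (ENNReal.ofReal_ne_top (r := 4 / c)))).liminf_eq
    rw [add_zero] at hB'
    exact hfat.trans ((liminf_le_liminf (Eventually.of_forall hb)).trans hB'.le)
  have hlim : ∀ᵐ x ∂l, Tendsto (fun n => √(weight (κ n) (η x)) * P1 k x) atTop (𝓝 (P1 k x)) := by
    filter_upwards [ae_restrict_mem hms] with x hx
    have hηx := hη.pos x hx
    have h1 : Tendsto (fun n => weight (κ n) (η x)) atTop (𝓝 1) := by
      have : Tendsto (fun n => η x ^ 2 / (η x ^ 2 + κ n ^ 2)) atTop
          (𝓝 (η x ^ 2 / (η x ^ 2 + 0 ^ 2))) :=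
        tendsto_const_nhds.div (tendsto_const_nhds.add (hκ0.pow 2)) (by positivity)
      rw [zero_pow two_ne_zero, add_zero, div_self (by positivity)] at this
      exact this.congr fun n => by rw [weight, max_eq_left hηx.le]
    have h2 := ((Real.continuous_sqrt.tendsto 1).comp h1).mul_const (P1 k x)
    simpa using h2
  -- Now `ε` runs through the same null sequence; the weight tends to one in the interior, and
  -- Fatou's lemma removes it.
  have hfat := Lp.eLpNorm_lim_le_liminf_eLpNorm (p := 2) (μ := l) (fun n =>
    (((hwc (κ n) (hκ n)).comp hηc).aestronglyMeasurable).mul (hP1m k)) _ hlim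
  refine ⟨hP1m k, lt_of_le_of_lt (hfat.trans ((liminf_le_liminf (Eventually.of_forall fun n =>
    hε (κ n) (hκ n))).trans (tendsto_const_nhds (x := ENNReal.ofReal (4 / c)
      * eLpNorm G 2 l)).liminf_eq.le)) ?_⟩
  exact ENNReal.mul_lt_top ENNReal.ofReal_lt_top hGL.2

/-- `η` times the second derivatives of `χ u / η` are square integrable. -/
lemma memLp_quotient_second (hη : IsAuxiliary Ω η) (hB : IsBoundaryBall Ω η p e ρ c)
    (hu : IsH2Triple Ω u u1 u2) (hu0 : IsLimitOfTest Ω u u1) (hχ : ContDiff ℝ ∞ χ)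
    (hχc : HasCompactSupport χ) (hχs : tsupport χ ⊆ Metric.ball p ρ) (i j : Fin d) :
    MemLp (fun x => η x * mulSecond (fun x => (η x)⁻¹ * χ x) u u1 u2 i j x) 2
      (volume.restrict (interior Ω)) := by
  obtain ⟨C, hC0, hC⟩ := hη.exists_bound
  have hP := memLp_quotient hη hB hu hu0 hχ hχc hχs
  have hP1 := memLp_quotient_first hη hB hu hu0 hχ hχc hχs
  have hη1 : ∀ i, ContDiff ℝ 2 (partialDeriv i η) := fun i =>
    ContDiff.partialDeriv hη.contDiff (by norm_num)
  have hη2 : Continuous (partialDeriv i (partialDeriv j η)) :=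
    (ContDiff.partialDeriv (m := 1) (hη1 j) (by norm_num)).continuous
  refine (memLp_congr_ae ?_).1 ((((memLp_mulSecond hu hχ hχc i j).sub (memLp_mul_of_abs_le
    (hη1 i).continuous.aestronglyMeasurable (fun x => (hC x).2.1 i) (hP1 j))).sub
    (memLp_mul_of_abs_le (hη1 j).continuous.aestronglyMeasurable (fun x => (hC x).2.1 j) (hP1 i))).sub
    (memLp_mul_of_abs_le hη2.aestronglyMeasurable (fun x => (hC x).2.2 i j) hP))
  filter_upwards [ae_restrict_mem isOpen_interior.measurableSet] with x hx
  simp only [Pi.sub_apply]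
  rw [mulSecond_quotient hη hχ hx]
  ring

end Quotient

end PINN

namespace PINN

/-! ### Functionals on the Sobolev space of order two -/

section Pairing

variable {d : ℕ} {Ω : Set (Euc d)} {η : Euc d → ℝ}

/-- Square integrable coefficients, vanishing outside of the interior of `Ω`. -/
structure IsCoefficient (Ω : Set (Euc d)) (q0 : Euc d → ℝ) (q1 : Fin d → Euc d → ℝ)
    (q2 : Fin d → Fin d → Euc d → ℝ) : Prop where
  memLp0 : MemLp q0 2
  memLp1 : ∀ i, MemLp (q1 i) 2
  memLp2 : ∀ i j, MemLp (q2 i j) 2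
  zero0 : ∀ x, x ∉ interior Ω → q0 x = 0
  zero1 : ∀ i x, x ∉ interior Ω → q1 i x = 0
  zero2 : ∀ i j x, x ∉ interior Ω → q2 i j x = 0

/-- The functional `f ↦ ∫ (q₀ f + ∑ qᵢ ∂ᵢf + ∑ qᵢⱼ ∂ᵢ∂ⱼf)`. -/
noncomputable def pairing (Ω : Set (Euc d)) (q0 : Euc d → ℝ) (q1 : Fin d → Euc d → ℝ)
    (q2 : Fin d → Fin d → Euc d → ℝ) (f : Euc d → ℝ) (f1 : Fin d → Euc d → ℝ)
    (f2 : Fin d → Fin d → Euc d → ℝ) : ℝ :=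
  ∫ x in interior Ω, (q0 x * f x + ∑ i, q1 i x * f1 i x + ∑ i, ∑ j, q2 i j x * f2 i j x)

/-- The coefficients of order zero of `p ↦ q (η p)`. -/
noncomputable def adj0 (η q0 : Euc d → ℝ) (q1 : Fin d → Euc d → ℝ)
    (q2 : Fin d → Fin d → Euc d → ℝ) (x : Euc d) : ℝ :=
  q0 x * η x + ∑ i, q1 i x * partialDeriv i η x
    + ∑ i, ∑ j, q2 i j x * partialDeriv i (partialDeriv j η) x

/-- The coefficients of order one of `p ↦ q (η p)`. -/
noncomputable def adj1 (η : Euc d → ℝ) (q1 : Fin d → Euc d → ℝ)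
    (q2 : Fin d → Fin d → Euc d → ℝ) (i : Fin d) (x : Euc d) : ℝ :=
  q1 i x * η x + ∑ j, (q2 i j x + q2 j i x) * partialDeriv j η x

/-- The coefficients of order two of `p ↦ q (η p)`. -/
def adj2 (η : Euc d → ℝ) (q2 : Fin d → Fin d → Euc d → ℝ) (i j : Fin d) (x : Euc d) : ℝ :=
  q2 i j x * η x

variable {q0 : Euc d → ℝ} {q1 : Fin d → Euc d → ℝ} {q2 : Fin d → Fin d → Euc d → ℝ}

/-- The product rule for `η m` up to order two. The coefficients `q2` are not assumed symmetric,
whence the sum `q2 i j + q2 j i` in order one. -/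
lemma adj_expand (η q0 : Euc d → ℝ) (q1 : Fin d → Euc d → ℝ) (q2 : Fin d → Fin d → Euc d → ℝ)
    (x : Euc d) (m : ℝ) (m1 : Fin d → ℝ) (m2 : Fin d → Fin d → ℝ) :
    adj0 η q0 q1 q2 x * m + ∑ i, adj1 η q1 q2 i x * m1 i + ∑ i, ∑ j, adj2 η q2 i j x * m2 i j
      = q0 x * (η x * m) + ∑ i, q1 i x * (η x * m1 i + partialDeriv i η x * m)
        + ∑ i, ∑ j, q2 i j x * (η x * m2 i j + partialDeriv i η x * m1 j + partialDeriv j η x * m1 i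
          + partialDeriv i (partialDeriv j η) x * m) := by
  have hs : ∑ i, (∑ j, (q2 i j x + q2 j i x) * partialDeriv j η x) * m1 i
      = ∑ i, ∑ j, q2 i j x * (partialDeriv i η x * m1 j + partialDeriv j η x * m1 i) := by
    simp only [add_mul, mul_add, Finset.sum_add_distrib, Finset.sum_mul]
    rw [add_comm]
    congr 1
    · rw [Finset.sum_comm]
      exact Finset.sum_congr rfl fun i _ => Finset.sum_congr rfl fun j _ => by ring
    · exact Finset.sum_congr rfl fun i _ => Finset.sum_congr rfl fun j _ => by ring
  have h1 : ∑ i, adj1 η q1 q2 i x * m1 i = ∑ i, q1 i x * (η x * m1 i)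
      + ∑ i, (∑ j, (q2 i j x + q2 j i x) * partialDeriv j η x) * m1 i := by
    rw [← Finset.sum_add_distrib]
    exact Finset.sum_congr rfl fun i _ => by rw [adj1]; ring
  rw [h1, hs]
  simp only [adj0, adj2, mul_add, add_mul, Finset.sum_add_distrib, Finset.sum_mul, mul_assoc]
  ring

lemma integral_add_sum_add_sum {α : Type*} [MeasurableSpace α] {μ : Measure α} {f : α → ℝ}
    {g : Fin d → α → ℝ} {h : Fin d → Fin d → α → ℝ} (hf : Integrable f μ)
    (hg : ∀ i, Integrable (g i) μ) (hh : ∀ i j, Integrable (h i j) μ) :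
    ∫ x, (f x + ∑ i, g i x + ∑ i, ∑ j, h i j x) ∂μ
      = (∫ x, f x ∂μ) + ∑ i, (∫ x, g i x ∂μ) + ∑ i, ∑ j, (∫ x, h i j x ∂μ) := by
  have i1 : Integrable (fun x => ∑ i, g i x) μ := integrable_finsetSum _ fun i _ => hg i
  have i2 : ∀ i, Integrable (fun x => ∑ j, h i j x) μ := fun i =>
    integrable_finsetSum _ fun j _ => hh i j
  have i3 : Integrable (fun x => ∑ i, ∑ j, h i j x) μ := integrable_finsetSum _ fun i _ => i2 i
  rw [integral_add (by exact hf.add i1) i3, integral_add hf i1,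
    integral_finsetSum _ fun i _ => hg i, integral_finsetSum _ fun i _ => i2 i]
  congr 1
  exact Finset.sum_congr rfl fun i _ => integral_finsetSum _ fun j _ => hh i j

lemma integrable_mul_of_memLp {α : Type*} [MeasurableSpace α] {μ : Measure α} {f g : α → ℝ}
    (hf : MemLp f 2 μ) (hg : MemLp g 2 μ) : Integrable (fun x => f x * g x) μ :=
  hf.integrable_mul hg

lemma tendsto_integral_mul_of_tendsto_eLpNorm' {α : Type*} [MeasurableSpace α] {μ : Measure α}
    {f g : α → ℝ} {F G : ℕ → α → ℝ} (hf : MemLp f 2 μ) (hg : MemLp g 2 μ)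
    (hF : ∀ n, MemLp (F n) 2 μ) (hG : ∀ n, MemLp (G n) 2 μ)
    (h : Tendsto (fun n => eLpNorm (F n - f) 2 μ) atTop (𝓝 0))
    (h' : Tendsto (fun n => eLpNorm (G n - g) 2 μ) atTop (𝓝 0)) :
    Tendsto (fun n => ∫ x, F n x * G n x ∂μ) atTop (𝓝 (∫ x, f x * g x ∂μ)) := by
  have key : ∀ {f g : α → ℝ} (hf : MemLp f 2 μ) (hg : MemLp g 2 μ),
      inner ℝ (hf.toLp f) (hg.toLp g) = ∫ x, f x * g x ∂μ := by
    intro f g hf hg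
    rw [L2.inner_def]
    refine integral_congr_ae ?_
    filter_upwards [hf.coeFn_toLp, hg.coeFn_toLp] with x hx hy
    rw [hx, hy]
    simp [mul_comm]
  have h1 := (Lp.tendsto_Lp_iff_tendsto_eLpNorm'' F hF f hf).2 h
  have h2 := (Lp.tendsto_Lp_iff_tendsto_eLpNorm'' G hG g hg).2 h'
  have := h1.inner (𝕜 := ℝ) h2
  simpa only [key] using this

lemma IsCoefficient.memLp_adj0 (hq : IsCoefficient Ω q0 q1 q2) (hη : IsAuxiliary Ω η) :
    MemLp (adj0 η q0 q1 q2) 2 := by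
  obtain ⟨C, -, hC⟩ := hη.exists_bound
  have hη1 : ∀ i, ContDiff ℝ 2 (partialDeriv i η) := fun i =>
    ContDiff.partialDeriv hη.contDiff (by norm_num)
  have hη2 : ∀ i j, Continuous (partialDeriv i (partialDeriv j η)) := fun i j =>
    (ContDiff.partialDeriv (m := 1) (hη1 j) (by norm_num)).continuous
  have hm : ∀ {a q : Euc d → ℝ}, Continuous a → (∀ x, |a x| ≤ C) → MemLp q 2 →
      MemLp (fun x => q x * a x) 2 := fun ha hb hq => by
    simpa only [mul_comm] using memLp_mul_of_abs_le ha.aestronglyMeasurable hb hq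
  exact ((hm hη.differentiable.continuous (fun x => (hC x).1) hq.memLp0).add
    (memLp_finsetSum _ fun i _ => hm (hη1 i).continuous (fun x => (hC x).2.1 i) (hq.memLp1 i))).add
    (memLp_finsetSum _ fun i _ => memLp_finsetSum _ fun j _ =>
      hm (hη2 i j) (fun x => (hC x).2.2 i j) (hq.memLp2 i j))

lemma IsCoefficient.memLp_adj1 (hq : IsCoefficient Ω q0 q1 q2) (hη : IsAuxiliary Ω η) (i : Fin d) :
    MemLp (adj1 η q1 q2 i) 2 := by
  obtain ⟨C, -, hC⟩ := hη.exists_bound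
  have hη1 : ∀ i, ContDiff ℝ 2 (partialDeriv i η) := fun i =>
    ContDiff.partialDeriv hη.contDiff (by norm_num)
  have hm : ∀ {a q : Euc d → ℝ}, Continuous a → (∀ x, |a x| ≤ C) → MemLp q 2 →
      MemLp (fun x => q x * a x) 2 := fun ha hb hq => by
    simpa only [mul_comm] using memLp_mul_of_abs_le ha.aestronglyMeasurable hb hq
  exact (hm hη.differentiable.continuous (fun x => (hC x).1) (hq.memLp1 i)).add
    (memLp_finsetSum _ fun j _ => hm (hη1 j).continuous (fun x => (hC x).2.1 j)
      ((hq.memLp2 i j).add (hq.memLp2 j i)))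

lemma IsCoefficient.memLp_adj2 (hq : IsCoefficient Ω q0 q1 q2) (hη : IsAuxiliary Ω η)
    (i j : Fin d) : MemLp (adj2 η q2 i j) 2 := by
  obtain ⟨C, -, hC⟩ := hη.exists_bound
  have := memLp_mul_of_abs_le hη.differentiable.continuous.aestronglyMeasurable
    (fun x => (hC x).1) (hq.memLp2 i j)
  refine (memLp_congr_ae (Eventually.of_forall fun x => ?_)).1 this
  rw [adj2, mul_comm]

lemma IsCoefficient.adj_zero (hq : IsCoefficient Ω q0 q1 q2) {x : Euc d} (hx : x ∉ interior Ω) :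
    adj0 η q0 q1 q2 x = 0 ∧ (∀ i, adj1 η q1 q2 i x = 0) ∧ ∀ i j, adj2 η q2 i j x = 0 := by
  simp [adj0, adj1, adj2, hq.zero0 x hx, hq.zero1 _ x hx, hq.zero2 _ _ x hx]

lemma IsCoefficient.pairing_eq (hq : IsCoefficient Ω q0 q1 q2) (f : Euc d → ℝ)
    (f1 : Fin d → Euc d → ℝ) (f2 : Fin d → Fin d → Euc d → ℝ) : pairing Ω q0 q1 q2 f f1 f2
      = ∫ x, (q0 x * f x + ∑ i, q1 i x * f1 i x + ∑ i, ∑ j, q2 i j x * f2 i j x) :=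
  setIntegral_eq_integral_of_forall_compl_eq_zero fun x hx => by
    simp [hq.zero0 x hx, hq.zero1 _ x hx, hq.zero2 _ _ x hx]

variable {ι : Type*} [Fintype ι] {κ : ι → ℝ} {X : ι → Euc d}

lemma isH2Triple_of_contDiff {m : Euc d → ℝ} (hm : ContDiff ℝ 2 m) (hc : HasCompactSupport m) :
    IsH2Triple Set.univ m (fun i => partialDeriv i m)
      (fun i j => partialDeriv i (partialDeriv j m)) := by
  have h1 : ∀ i, ContDiff ℝ 1 (partialDeriv i m) := fun i =>
    ContDiff.partialDeriv hm (by norm_num)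
  have h2 : ∀ i j, Continuous (partialDeriv i (partialDeriv j m)) := fun i j =>
    (ContDiff.partialDeriv (m := 0) (h1 j) (by simp)).continuous
  exact ⟨fun i => isWeakPartial_of_contDiffOn (hm.of_le (by norm_num)).contDiffOn,
    fun i j => isWeakPartial_of_contDiffOn (h1 j).contDiffOn,
    (hm.continuous.memLp_of_hasCompactSupport hc).restrict _,
    fun i => ((h1 i).continuous.memLp_of_hasCompactSupport hc.partialDeriv).restrict _,
    fun i j => ((h2 i j).memLp_of_hasCompactSupport hc.partialDeriv.partialDeriv).restrict _⟩

/-- The functional vanishes on smooth functions with compact support in the interior. -/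
lemma pairing_of_contDiff (hη : IsAuxiliary Ω η) (hq : IsCoefficient Ω q0 q1 q2)
    (h : Annihilates (adj0 η q0 q1 q2) (adj1 η q1 q2) (adj2 η q2) (fun m => κ m * η (X m)) X)
    {f : Euc d → ℝ} (hf : IsTestFunction Ω f) :
    pairing Ω q0 q1 q2 f (fun i => partialDeriv i f) (fun i j => partialDeriv i (partialDeriv j f))
      + ∑ m, κ m * f (X m) = 0 := by
  have hf2 : ContDiff ℝ 2 f := hf.smooth.of_le (by norm_cast)
  have hinv : ContDiffOn ℝ 2 (fun x => (η x)⁻¹) (interior Ω) :=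
    (hη.contDiff.of_le (by norm_num)).contDiffOn.inv fun x hx => (hη.pos x hx).ne'
  -- Dividing by `η` is harmless on the support of `f`, but `m` is only of class `C²`, so
  -- `Annihilates.extend` is needed to test with it.
  set m : Euc d → ℝ := fun x => (η x)⁻¹ * f x with hm
  have hmc : ContDiff ℝ 2 m := contDiff_mul_of_tsupport isOpen_interior hinv hf2 hf.support
  have hms : HasCompactSupport m := hf.compact.mul_left
  have hV := isH2Triple_of_contDiff hmc hms
  have hfm : f = fun x => η x * m x := by
    funext x
    by_cases hx : x ∈ interior Ω
    · exact (mul_inv_cancel_left₀ (hη.pos x hx).ne' _).symm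
    · have : f x = 0 := image_eq_zero_of_notMem_tsupport fun h => hx (hf.support h)
      simp [hm, this]
  have hE := h.extend (hq.memLp_adj0 hη) (hq.memLp_adj1 hη) (hq.memLp_adj2 hη) hV hms 0
    (fun k => m (X k)) fun k _ => by
      rw [add_zero]
      exact tendsto_average_ball hmc.continuous.locallyIntegrable hmc.continuous.continuousAt
  simp only [add_zero] at hE
  rw [← integral_add_sum_add_sum (integrable_mul_of_memLp (hq.memLp_adj0 hη) hV.memLp_univ)
    (fun i => integrable_mul_of_memLp (hq.memLp_adj1 hη i) (hV.memLp1_univ i))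
    (fun i j => integrable_mul_of_memLp (hq.memLp_adj2 hη i j) (hV.memLp2_univ i j))] at hE
  rw [hq.pairing_eq, ← hE]
  congr 1
  · refine integral_congr_ae (Eventually.of_forall fun x => ?_)
    simp only
    rw [adj_expand η q0 q1 q2 x (m x) (fun i => partialDeriv i m x)
      (fun i j => partialDeriv i (partialDeriv j m) x)]
    have d1 : ∀ i, partialDeriv i f x = η x * partialDeriv i m x + partialDeriv i η x * m x :=
      fun i => by
        rw [hfm, partialDeriv_mul (hη.differentiable x) (hmc.differentiable two_ne_zero x)]
    have d2 : ∀ i j, partialDeriv i (partialDeriv j f) x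
        = η x * partialDeriv i (partialDeriv j m) x + partialDeriv i η x * partialDeriv j m x
        + partialDeriv j η x * partialDeriv i m x + partialDeriv i (partialDeriv j η) x * m x :=
      fun i j => by
        rw [hfm, partialDeriv_partialDeriv_mul (hη.contDiff.contDiffAt.of_le (by norm_num))
          hmc.contDiffAt]
        ring
    simp only [d1, d2]
    rw [show f x = η x * m x from congrFun hfm x]
  · refine Finset.sum_congr rfl fun k _ => ?_
    rw [show f (X k) = η (X k) * m (X k) from congrFun hfm (X k), mul_assoc]

variable {u : Euc d → ℝ} {u1 : Fin d → Euc d → ℝ} {u2 : Fin d → Fin d → Euc d → ℝ} {χ : Euc d → ℝ}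

lemma tendsto_average_of_notMem_tsupport {V : Euc d → ℝ} {x : Euc d} (hx : x ∉ tsupport V) :
    Tendsto (fun r : ℝ => ⨍ y in Metric.ball x r, V y) (𝓝[>] 0) (𝓝 0) := by
  obtain ⟨δ, hδ, hb⟩ := Metric.eventually_nhds_iff_ball.1 (notMem_tsupport_iff_eventuallyEq.1 hx)
  refine tendsto_const_nhds.congr' ?_
  filter_upwards [Ioo_mem_nhdsGT hδ] with r hr
  rw [setAverage_eq, setIntegral_eq_zero_of_forall_eq_zero fun y hy =>
    hb y (Metric.ball_subset_ball hr.2.le hy), smul_zero]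

/-- The functional vanishes on `χ u` if `χ` has compact support in the interior and is constant near
the interior observation points. -/
lemma pairing_of_interior (hη : IsAuxiliary Ω η) (hq : IsCoefficient Ω q0 q1 q2)
    (h : Annihilates (adj0 η q0 q1 q2) (adj1 η q1 q2) (adj2 η q2) (fun m => κ m * η (X m)) X)
    (hu : IsH2Triple Ω u u1 u2) (hχ : IsTestFunction Ω χ)
    (hobs : ∀ m, X m ∈ interior Ω →
      Tendsto (fun r : ℝ => ⨍ y in Metric.ball (X m) r, u y) (𝓝[>] 0) (𝓝 (u (X m))))
    (hconst : ∀ m, X m ∈ interior Ω → ∃ b : ℝ, χ =ᶠ[𝓝 (X m)] fun _ => b) :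
    pairing Ω q0 q1 q2 (fun x => χ x * u x) (mulFirst χ u u1) (mulSecond χ u u1 u2)
      + ∑ m, κ m * (χ (X m) * u (X m)) = 0 := by
  have hV : IsH2Triple Set.univ (fun x => χ x * u x) (mulFirst χ u u1) (mulSecond χ u u1 u2) :=
    hu.mul_cutoff (hχ.smooth.of_le (by norm_cast)) hχ.compact hχ.support
  set V : Euc d → ℝ := fun x => χ x * u x with hVdef
  have hVc : HasCompactSupport V := hχ.compact.mul_right
  have hVs : tsupport V ⊆ interior Ω := tsupport_mul_subset_left.trans hχ.support
  have htest : ∀ᶠ n : ℕ in atTop, IsTestFunction Ω (mollify n V) := by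
    obtain ⟨δ, hδ, hδs⟩ := hVc.isCompact.exists_cthickening_subset_open isOpen_interior hVs
    obtain ⟨N, hN⟩ := exists_nat_one_div_lt hδ
    filter_upwards [eventually_ge_atTop N] with n hn
    exact ⟨hV.contDiff_mollify n, hasCompactSupport_mollify n hVc, (tsupport_mollify_subset n V).trans
      ((Metric.cthickening_mono (le_trans (by gcongr) hN.le) _).trans hδs)⟩
  have hz : ∀ᶠ n : ℕ in atTop, ((∫ x, q0 x * mollify n V x)
      + ∑ i, (∫ x, q1 i x * mollify n (mulFirst χ u u1 i) x)
      + ∑ i, ∑ j, (∫ x, q2 i j x * mollify n (mulSecond χ u u1 u2 i j) x))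
      + ∑ m, κ m * mollify n V (X m) = 0 := by
    filter_upwards [htest] with n hn
    have h0 := pairing_of_contDiff hη hq h hn
    have hT := isH2Triple_of_contDiff (hn.smooth.of_le (by norm_cast)) hn.compact
    rw [hq.pairing_eq, integral_add_sum_add_sum (integrable_mul_of_memLp hq.memLp0 hT.memLp_univ)
      (fun i => integrable_mul_of_memLp (hq.memLp1 i) (hT.memLp1_univ i))
      (fun i j => integrable_mul_of_memLp (hq.memLp2 i j) (hT.memLp2_univ i j))] at h0
    have e1 : ∀ i, partialDeriv i (mollify n V) = mollify n (mulFirst χ u u1 i) :=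
      fun i => hV.partialDeriv_mollify n i
    have e2 : ∀ i j, partialDeriv i (mollify n (mulFirst χ u u1 j))
        = mollify n (mulSecond χ u u1 u2 i j) := fun i j => partialDeriv_mollify (hV.second i j) n
    simpa only [e1, e2] using h0
  have hconv : ∀ {q f : Euc d → ℝ}, MemLp q 2 → MemLp f 2 → (∀ n, MemLp (mollify n f) 2) →
      Tendsto (fun n => ∫ x, q x * mollify n f x) atTop (𝓝 (∫ x, q x * f x)) :=
    fun hq hf hfn => tendsto_integral_mul_of_tendsto_eLpNorm hq hf hfn (tendsto_eLpNorm_mollify hf)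
  have hc1 : ∀ i, HasCompactSupport (mulFirst χ u u1 i) := fun i =>
    hχ.compact.mono' fun x hx => by
      by_contra hcon
      exact hx (mulFirst_of_notMem_tsupport hcon i)
  have hc2 : ∀ i j, HasCompactSupport (mulSecond χ u u1 u2 i j) := fun i j =>
    hχ.compact.mono' fun x hx => by
      by_contra hcon
      exact hx (mulSecond_of_notMem_tsupport hcon i j)
  have hval : ∀ m, Tendsto (fun n => κ m * mollify n V (X m)) atTop
      (𝓝 (κ m * (χ (X m) * u (X m)))) := by
    intro m
    refine (tendsto_mollify (hV.memLp_univ.locallyIntegrable (by norm_num)) ?_).const_mul _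
    by_cases hm : X m ∈ interior Ω
    -- Only the means of `u` itself are known to converge; a factor that is constant near the point
    -- passes through them.
    · obtain ⟨b, hb⟩ := hconst m hm
      rw [hb.eq_of_nhds]
      obtain ⟨δ, hδ, hball⟩ := Metric.eventually_nhds_iff_ball.1 hb
      refine ((hobs m hm).const_mul b).congr' ?_
      filter_upwards [Ioo_mem_nhdsGT hδ] with r hr
      rw [setAverage_eq, setAverage_eq, smul_eq_mul, smul_eq_mul,
        mul_left_comm, ← integral_const_mul]
      congr 1
      refine setIntegral_congr_fun measurableSet_ball fun y hy => ?_
      simp only [hVdef]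
      rw [hball y (Metric.ball_subset_ball hr.2.le hy)]
    · have hx : X m ∉ tsupport χ := fun h => hm (hχ.support h)
      rw [image_eq_zero_of_notMem_tsupport hx, zero_mul]
      exact tendsto_average_of_notMem_tsupport fun h => hx (tsupport_mul_subset_left h)
  have hlim := (((hconv hq.memLp0 hV.memLp_univ (memLp_mollify hV.memLp_univ hVc)).add
    (tendsto_finsetSum Finset.univ fun i _ => hconv (hq.memLp1 i) (hV.memLp1_univ i)
      (memLp_mollify (hV.memLp1_univ i) (hc1 i)))).add
    (tendsto_finsetSum Finset.univ fun i _ => tendsto_finsetSum Finset.univ fun j _ =>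
      hconv (hq.memLp2 i j) (hV.memLp2_univ i j)
        (memLp_mollify (hV.memLp2_univ i j) (hc2 i j)))).add
    (tendsto_finsetSum Finset.univ fun m _ => hval m)
  rw [hq.pairing_eq, integral_add_sum_add_sum (integrable_mul_of_memLp hq.memLp0 hV.memLp_univ)
      (fun i => integrable_mul_of_memLp (hq.memLp1 i) (hV.memLp1_univ i))
      (fun i j => integrable_mul_of_memLp (hq.memLp2 i j) (hV.memLp2_univ i j))]
  exact tendsto_nhds_unique hlim (tendsto_const_nhds.congr' (hz.mono fun n hn => hn.symm))

end Pairing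

end PINN

namespace PINN

/-! ### Functionals near the boundary -/

section Boundary

variable {d : ℕ} {Ω : Set (Euc d)} {η : Euc d → ℝ} {q0 : Euc d → ℝ} {q1 : Fin d → Euc d → ℝ}
  {q2 : Fin d → Fin d → Euc d → ℝ} {ι : Type*} [Fintype ι] {κ : ι → ℝ} {X : ι → Euc d}
  {u : Euc d → ℝ} {u1 : Fin d → Euc d → ℝ} {u2 : Fin d → Fin d → Euc d → ℝ} {χ : Euc d → ℝ}
  {p e : Euc d} {ρ c : ℝ}

lemma tendsto_eLpNorm_comp_add_right {f : Euc d → ℝ} (hf : MemLp f 2) {a : ℕ → Euc d}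
    (ha : Tendsto a atTop (𝓝 0)) :
    Tendsto (fun n => eLpNorm ((fun x => f (x + a n)) - f) 2) atTop (𝓝 0) :=
  (tendsto_eLpNorm_translate hf).comp ha

/-- Translating inwards, a quotient by `η` stays away from the zeros of `η`. -/
lemma cutRecip_shift (hη : IsAuxiliary Ω η) (hB : IsBoundaryBall Ω η p e ρ c) {δ ε : ℝ}
    (hδ : Metric.cthickening δ (tsupport χ) ⊆ Metric.ball p ρ) (hε : 0 < ε) (hεδ : ε ≤ δ)
    {x : Euc d} (hx : x ∈ interior Ω) (hxt : x + ε • e ∈ tsupport χ) :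
    x + ε • e ∈ interior Ω ∧ η x ≤ η (x + ε • e) ∧
      (fun x => cutRecip (c * ε / 2) (η x) * χ x) =ᶠ[𝓝 (x + ε • e)] fun x => (η x)⁻¹ * χ x := by
  have hxb : x ∈ Metric.ball p ρ := hδ (Metric.mem_cthickening_of_dist_le _ _ _ _ hxt (by
    simpa [dist_eq_norm, norm_smul, hB.norm_e, abs_of_pos hε] using hεδ))
  have hxb' : x + ε • e ∈ Metric.ball p ρ := hδ (Metric.self_subset_cthickening _ hxt)
  have h1 := add_mul_le_of_le_fderiv (convex_ball p ρ) hη.differentiable hB.le_fderiv hε.le hxb hxb'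
  have h2 := hη.pos x hx
  have h3 : 0 < c * ε := mul_pos hB.c_pos hε
  exact ⟨(hB.mem_interior _ hxb').2 (by linarith), by linarith,
    cutRecip_mul_eventuallyEq hη (by linarith) (by linarith)⟩

/-- Only `η` times the second derivatives of the quotient is square integrable. After an inward
shift `a`, the factor `η(x)` is therefore exchanged for `η(x + a)`, at the price of a ratio that is
at most one and tends to one. -/
lemma tendsto_eLpNorm_ratio (hη : IsAuxiliary Ω η) {q : Euc d → ℝ} (hq : MemLp q 2)
    (hq0 : ∀ x, x ∉ interior Ω → q x = 0) {a : ℕ → Euc d} (ha : Tendsto a atTop (𝓝 0)) :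
    (∀ n, MemLp (fun x => η x / max (η x) (η (x + a n)) * q x) 2) ∧
      Tendsto (fun n => eLpNorm ((fun x => η x / max (η x) (η (x + a n)) * q x) - q) 2)
        atTop (𝓝 0) := by
  have hηc := hη.differentiable.continuous
  have hb : ∀ n x, |η x / max (η x) (η (x + a n)) * q x| ≤ |q x| := by
    intro n x
    by_cases hx : x ∈ interior Ω
    · have h1 := hη.pos x hx
      rw [abs_mul]
      refine mul_le_of_le_one_left (abs_nonneg _) ?_
      rw [abs_of_nonneg (by positivity)]
      exact div_le_one_of_le₀ (le_max_left _ _) (by positivity)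
    · simp [hq0 x hx]
  have hm : ∀ n, AEStronglyMeasurable (fun x => η x / max (η x) (η (x + a n)) * q x) := fun n => by
    refine AEStronglyMeasurable.mul (Measurable.aestronglyMeasurable ?_) hq.1
    exact hηc.measurable.div (by fun_prop)
  have hM : ∀ n, MemLp (fun x => η x / max (η x) (η (x + a n)) * q x) 2 := fun n =>
    hq.mono (hm n) (Eventually.of_forall fun x => by
      simpa only [Real.norm_eq_abs] using hb n x)
  refine ⟨hM, tendsto_eLpNorm_of_dominated (G := fun x => 2 * q x) (fun n => (hm n).sub hq.1)
    (hq.const_mul 2) (fun n => Eventually.of_forall fun x => ?_) (Eventually.of_forall fun x => ?_)⟩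
  · change |_ - q x| ≤ |2 * q x|
    rw [abs_mul, abs_two, two_mul]
    exact (abs_sub _ _).trans (add_le_add_left (hb n x) _)
  · change Tendsto (fun n => _ - q x) _ _
    by_cases hx : x ∈ interior Ω
    · have h1 := hη.pos x hx
      have h2 : Tendsto (fun n => η (x + a n)) atTop (𝓝 (η x)) := by
        have := (hηc.tendsto (x + 0)).comp (tendsto_const_nhds.add ha)
        simpa [Function.comp_def] using this
      have h3 := ((tendsto_const_nhds (x := η x)).div ((tendsto_const_nhds (x := η x)).max h2)
        (by simpa using h1.ne')).mul_const (q x)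
      simpa [h1.ne'] using h3.sub_const (q x)
    · simp [hq0 x hx]

/-- The functional vanishes on `χ u` if `χ` is supported near a boundary point and away from
the interior observation points. -/
lemma pairing_of_boundaryBall (hη : IsAuxiliary Ω η) (hB : IsBoundaryBall Ω η p e ρ c)
    (hq : IsCoefficient Ω q0 q1 q2)
    (h : Annihilates (adj0 η q0 q1 q2) (adj1 η q1 q2) (adj2 η q2) (fun m => κ m * η (X m)) X)
    (hu : IsH2Triple Ω u u1 u2) (hu0 : IsLimitOfTest Ω u u1) (hχ : ContDiff ℝ ∞ χ)
    (hχc : HasCompactSupport χ) (hχs : tsupport χ ⊆ Metric.ball p ρ)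
    (hXη : ∀ m, η (X m) ≠ 0 → X m ∉ Metric.ball p ρ) :
    pairing Ω q0 q1 q2 (fun x => χ x * u x) (mulFirst χ u u1) (mulSecond χ u u1 u2) = 0 := by
  classical
  obtain ⟨δ, hδ, hδs⟩ := hχc.isCompact.exists_cthickening_subset_open Metric.isOpen_ball hχs
  have hms := isOpen_interior (s := Ω).measurableSet
  set P0 := (interior Ω).indicator fun x => (η x)⁻¹ * χ x * u x with hP0
  set P1 := fun i => (interior Ω).indicator (mulFirst (fun x => (η x)⁻¹ * χ x) u u1 i) with hP1
  set P2 := fun i j => (interior Ω).indicator (mulSecond (fun x => (η x)⁻¹ * χ x) u u1 u2 i j)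
    with hP2
  have mP0 : MemLp P0 2 := (memLp_indicator_iff_restrict hms).2
    (memLp_quotient hη hB hu hu0 hχ hχc hχs)
  have mP1 : ∀ i, MemLp (P1 i) 2 := fun i => (memLp_indicator_iff_restrict hms).2
    (memLp_quotient_first hη hB hu hu0 hχ hχc hχs i)
  have mP2 : ∀ i j, MemLp (fun x => η x * P2 i j x) 2 := fun i j => by
    have := (memLp_indicator_iff_restrict hms).2
      (memLp_quotient_second hη hB hu hu0 hχ hχc hχs i j)
    convert this using 1
    funext x
    by_cases hx : x ∈ interior Ω <;> simp [hP2, hx]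
  -- Positive shifts tending to zero, and at most `δ`, so that shifted points stay in the boundary
  -- ball.
  set ε : ℕ → ℝ := fun n => δ / (n + 2) with hε
  have hεpos : ∀ n, 0 < ε n := fun n => by positivity
  have hεδ : ∀ n, ε n ≤ δ := fun n => div_le_self hδ.le (by have := n.cast_nonneg (α := ℝ); linarith)
  set a : ℕ → Euc d := fun n => ε n • e with ha
  have ha0 : Tendsto a atTop (𝓝 0) := by
    have : Tendsto ε atTop (𝓝 0) := tendsto_const_nhds.div_atTop
      (tendsto_natCast_atTop_atTop.atTop_add tendsto_const_nhds)
    simpa using this.smul_const e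
  set m : ℕ → Euc d → ℝ := fun n x => cutRecip (c * ε n / 2) (η x) * χ x with hm
  have hts : ∀ n, tsupport (m n) ⊆ tsupport χ := fun n => tsupport_mul_subset_right
  have hts' : tsupport (fun x => (η x)⁻¹ * χ x) ⊆ tsupport χ := tsupport_mul_subset_right
  -- Shifting along `e` raises `η` by at least `c ε`, above the level `c ε / 2` at which `cutRecip`
  -- truncates. Seen from `Ω`, the truncated quotient is the true one.
  have hV : ∀ n x, x ∈ interior Ω → m n (x + a n) * u (x + a n) = P0 (x + a n) ∧
      (∀ i, mulFirst (m n) u u1 i (x + a n) = P1 i (x + a n)) ∧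
      ∀ i j, mulSecond (m n) u u1 u2 i j (x + a n) = P2 i j (x + a n) := by
    intro n x hx
    by_cases hxt : x + a n ∈ tsupport χ
    · obtain ⟨h1, -, h2⟩ := cutRecip_shift hη hB hδs (hεpos n) (hεδ n) hx hxt
      have h3 : m n (x + a n) = (η (x + a n))⁻¹ * χ (x + a n) := h2.eq_of_nhds
      refine ⟨?_, fun i => ?_, fun i j => ?_⟩
      · rw [hP0, Set.indicator_of_mem h1, h3]
      · refine Eq.trans ?_ (Set.indicator_of_mem h1 _).symm; exact mulFirst_congr h2 i
      · refine Eq.trans ?_ (Set.indicator_of_mem h1 _).symm; exact mulSecond_congr h2 i j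
    · have h1 : x + a n ∉ tsupport (m n) := fun h => hxt (hts n h)
      have h2 : x + a n ∉ tsupport (fun x => (η x)⁻¹ * χ x) := fun h => hxt (hts' h)
      refine ⟨?_, fun i => ?_, fun i j => ?_⟩
      · rw [image_eq_zero_of_notMem_tsupport h1, hP0, Set.indicator_apply,
          image_eq_zero_of_notMem_tsupport hxt]
        simp
      · rw [mulFirst_of_notMem_tsupport h1, show P1 i (x + a n) = _ from Set.indicator_apply _ _ _,
          mulFirst_of_notMem_tsupport h2, ite_self]
      · rw [mulSecond_of_notMem_tsupport h1, show P2 i j (x + a n) = _ from Set.indicator_apply _ _ _,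
          mulSecond_of_notMem_tsupport h2, ite_self]
  -- On the support `η x ≤ η (x + a n)`, so `η q₂` times the shifted second derivative is rewritten
  -- with the ratio; the maximum merely gives a formula meaningful everywhere.
  have hz : ∀ n, (∫ x, adj0 η q0 q1 q2 x * P0 (x + a n))
      + ∑ i, (∫ x, adj1 η q1 q2 i x * P1 i (x + a n))
      + ∑ i, ∑ j, (∫ x, (η x / max (η x) (η (x + a n)) * q2 i j x) *
          (η (x + a n) * P2 i j (x + a n))) = 0 := by
    intro n
    have hE := h.extend (hq.memLp_adj0 hη) (hq.memLp_adj1 hη) (hq.memLp_adj2 hη)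
      (isH2Triple_cutRecip hη hB hu hχ hχc hχs (κ := c * ε n / 2)
        (by have := mul_pos hB.c_pos (hεpos n); linarith)).1
      (hχc.mul_left.mul_right) (a n) 0 (fun k hk => ?_)
    · simp only [Pi.zero_apply, mul_zero, Finset.sum_const_zero, add_zero] at hE
      rw [← hE]
      congr 1
      · congr 1
        · refine integral_congr_ae (Eventually.of_forall fun x => ?_)
          by_cases hx : x ∈ interior Ω
          · exact congrArg (adj0 η q0 q1 q2 x * ·) (hV n x hx).1.symm
          · simp [hq.adj_zero hx]
        · refine Finset.sum_congr rfl fun i _ => integral_congr_ae (Eventually.of_forall fun x => ?_)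
          by_cases hx : x ∈ interior Ω
          · exact congrArg (adj1 η q1 q2 i x * ·) ((hV n x hx).2.1 i).symm
          · simp [hq.adj_zero hx]
      · refine Finset.sum_congr rfl fun i _ => Finset.sum_congr rfl fun j _ =>
          integral_congr_ae (Eventually.of_forall fun x => ?_)
        by_cases hx : x ∈ interior Ω
        · have h2 := (hV n x hx).2.2 i j
          refine Eq.trans ?_ (congrArg (adj2 η q2 i j x * ·) h2.symm)
          change _ = q2 i j x * η x * P2 i j (x + a n)
          by_cases hxt : x + a n ∈ tsupport χ
          · obtain ⟨h3, h4, -⟩ := cutRecip_shift hη hB hδs (hεpos n) (hεδ n) hx hxt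
            have h5 : η (x + a n) ≠ 0 := (hη.pos _ h3).ne'
            simp only
            rw [max_eq_right (show η x ≤ η (x + a n) from h4)]
            field_simp
          · have : P2 i j (x + a n) = 0 := by
              rw [← h2, mulSecond_of_notMem_tsupport fun h => hxt (hts n h)]
            simp [this]
        · simp [hq.adj_zero hx, hq.zero2 i j x hx]
    · refine tendsto_average_of_notMem_tsupport fun hmem => ?_
      have hmem' : X k + a n ∈ tsupport χ := hts n (tsupport_mul_subset_left hmem)
      -- If the shifted observation point met the support of `χ`, the point itself would be in the
      -- ball, against the hypothesis.
      refine hXη k (right_ne_zero_of_mul hk) (hδs (Metric.mem_cthickening_of_dist_le _ _ _ _ hmem' ?_))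
      simpa [ha, dist_eq_norm, norm_smul, hB.norm_e, abs_of_pos (hεpos n)] using hεδ n
  have hconv : ∀ {q f : Euc d → ℝ}, MemLp q 2 → MemLp f 2 →
      Tendsto (fun n => ∫ x, q x * f (x + a n)) atTop (𝓝 (∫ x, q x * f x)) := fun hq hf =>
    tendsto_integral_mul_of_tendsto_eLpNorm hq hf (fun n => memLp_comp_add_right hf _)
      (tendsto_eLpNorm_comp_add_right hf ha0)
  have hconv2 : ∀ i j, Tendsto (fun n => ∫ x, (η x / max (η x) (η (x + a n)) * q2 i j x) *
      (η (x + a n) * P2 i j (x + a n))) atTop (𝓝 (∫ x, q2 i j x * (η x * P2 i j x))) := fun i j =>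
    have hr := tendsto_eLpNorm_ratio hη (hq.memLp2 i j) (hq.zero2 i j) ha0
    tendsto_integral_mul_of_tendsto_eLpNorm' (hq.memLp2 i j) (mP2 i j) hr.1
      (fun n => memLp_comp_add_right (mP2 i j) (a n)) hr.2
      (tendsto_eLpNorm_comp_add_right (mP2 i j) ha0)
  have hlim := ((hconv (hq.memLp_adj0 hη) mP0).add
    (tendsto_finsetSum Finset.univ fun i _ => hconv (hq.memLp_adj1 hη i) (mP1 i))).add
    (tendsto_finsetSum Finset.univ fun i _ => tendsto_finsetSum Finset.univ fun j _ => hconv2 i j)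
  have h0 := tendsto_nhds_unique hlim (tendsto_const_nhds.congr fun n => (hz n).symm)
  rw [← integral_add_sum_add_sum (integrable_mul_of_memLp (hq.memLp_adj0 hη) mP0)
    (fun i => integrable_mul_of_memLp (hq.memLp_adj1 hη i) (mP1 i))
    (fun i j => integrable_mul_of_memLp (hq.memLp2 i j) (mP2 i j))] at h0
  rw [hq.pairing_eq, ← h0]
  refine integral_congr_ae (Eventually.of_forall fun x => ?_)
  by_cases hx : x ∈ interior Ω
  · have he := adj_expand η q0 q1 q2 x (P0 x) (fun i => P1 i x) (fun i j => P2 i j x)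
    simp only [adj2, mul_assoc] at he
    simp only
    rw [he]
    simp only [hP0, hP1, hP2, Set.indicator_of_mem hx]
    simp only [← mulFirst_quotient hη hχ hx, ← mulSecond_quotient hη hχ hx]
    congr 3
    rw [← mul_assoc, ← mul_assoc, mul_inv_cancel₀ (hη.pos x hx).ne', one_mul]
  · simp [hq.adj_zero hx, hq.zero0 x hx, hq.zero1 _ x hx, hq.zero2 _ _ x hx]

end Boundary

end PINN

namespace PINN

/-! ### Functionals on functions vanishing on the boundary -/

section Global

variable {d : ℕ} {Ω : Set (Euc d)} {η : Euc d → ℝ} {q0 : Euc d → ℝ} {q1 : Fin d → Euc d → ℝ}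
  {q2 : Fin d → Fin d → Euc d → ℝ} {ι : Type*} [Fintype ι] {κ : ι → ℝ} {X : ι → Euc d}
  {u : Euc d → ℝ} {u1 : Fin d → Euc d → ℝ} {u2 : Fin d → Fin d → Euc d → ℝ} {χ ψ : Euc d → ℝ}

lemma pairing_congr {m : Euc d → ℝ} (h : ∀ x ∈ interior Ω, χ =ᶠ[𝓝 x] m) :
    pairing Ω q0 q1 q2 (fun x => χ x * u x) (mulFirst χ u u1) (mulSecond χ u u1 u2)
      = pairing Ω q0 q1 q2 (fun x => m x * u x) (mulFirst m u u1) (mulSecond m u u1 u2) := by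
  refine setIntegral_congr_fun isOpen_interior.measurableSet fun x hx => ?_
  simp only [(h x hx).eq_of_nhds, mulFirst_congr (h x hx), mulSecond_congr (h x hx)]

lemma pairing_one (h : ∀ x ∈ interior Ω, χ =ᶠ[𝓝 x] fun _ => 1) :
    pairing Ω q0 q1 q2 (fun x => χ x * u x) (mulFirst χ u u1) (mulSecond χ u u1 u2)
      = pairing Ω q0 q1 q2 u u1 u2 := by
  have h1 : ∀ i x, partialDeriv (d := d) i (fun _ => (1 : ℝ)) x = 0 := fun i x => by
    simp [partialDeriv]
  have h2 : ∀ i : Fin d, partialDeriv i (fun _ : Euc d => (1 : ℝ)) = fun _ => 0 :=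
    fun i => funext (h1 i)
  have h3 : ∀ i x, partialDeriv (d := d) i (fun _ => (0 : ℝ)) x = 0 := fun i x => by
    simp [partialDeriv]
  rw [pairing_congr h]
  refine setIntegral_congr_fun isOpen_interior.measurableSet fun x _ => ?_
  simp only [mulFirst, mulSecond, h2, h3, one_mul, zero_mul, add_zero]

lemma pairing_eq_add (hq : IsCoefficient Ω q0 q1 q2) (hu : IsH2Triple Ω u u1 u2)
    (hχ : ContDiff ℝ ∞ χ) (hχc : HasCompactSupport χ) (hψ : ContDiff ℝ ∞ ψ) :
    pairing Ω q0 q1 q2 (fun x => χ x * u x) (mulFirst χ u u1) (mulSecond χ u u1 u2)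
      = pairing Ω q0 q1 q2 (fun x => χ x * ψ x * u x) (mulFirst (fun x => χ x * ψ x) u u1)
          (mulSecond (fun x => χ x * ψ x) u u1 u2)
        + pairing Ω q0 q1 q2 (fun x => χ x * (1 - ψ x) * u x)
          (mulFirst (fun x => χ x * (1 - ψ x)) u u1)
          (mulSecond (fun x => χ x * (1 - ψ x)) u u1 u2) := by
  have hint : ∀ {m : Euc d → ℝ}, ContDiff ℝ ∞ m → HasCompactSupport m →
      Integrable (fun x => q0 x * (m x * u x) + ∑ i, q1 i x * mulFirst m u u1 i x
        + ∑ i, ∑ j, q2 i j x * mulSecond m u u1 u2 i j x) (volume.restrict (interior Ω)) := by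
    intro m hm hmc
    obtain ⟨C, -, hC⟩ := exists_bound_of_hasCompactSupport (hm.of_le (m := 2) (by norm_cast)) hmc
    exact ((integrable_mul_of_memLp (hq.memLp0.restrict _) (memLp_mul_of_abs_le
      hm.continuous.aestronglyMeasurable (fun x => (hC x).1) hu.memLp)).add
      (integrable_finsetSum _ fun i _ => integrable_mul_of_memLp ((hq.memLp1 i).restrict _)
        (memLp_mulFirst hu hm hmc i))).add
      (integrable_finsetSum _ fun i _ => integrable_finsetSum _ fun j _ =>
        integrable_mul_of_memLp ((hq.memLp2 i j).restrict _) (memLp_mulSecond hu hm hmc i j))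
  have ha : ContDiff ℝ ∞ (fun x => χ x * ψ x) := hχ.mul hψ
  have hb : ContDiff ℝ ∞ (fun x => χ x * (1 - ψ x)) := hχ.mul (contDiff_const.sub hψ)
  have hsum : χ = fun x => χ x * ψ x + χ x * (1 - ψ x) := by funext x; ring
  rw [pairing, pairing, pairing, ← integral_add (hint ha hχc.mul_right) (hint hb hχc.mul_right)]
  refine integral_congr_ae (Eventually.of_forall fun x => ?_)
  have d1 : ∀ i, partialDeriv i χ = fun x => partialDeriv i (fun x => χ x * ψ x) x
      + partialDeriv i (fun x => χ x * (1 - ψ x)) x := fun i => by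
    funext y
    conv_lhs => rw [hsum]
    exact partialDeriv_add (ha.differentiable (by simp) y) (hb.differentiable (by simp) y)
  have d2 : ∀ i j, partialDeriv i (partialDeriv j χ) x
      = partialDeriv i (partialDeriv j (fun x => χ x * ψ x)) x
      + partialDeriv i (partialDeriv j (fun x => χ x * (1 - ψ x))) x := fun i j => by
    rw [d1 j]
    exact partialDeriv_add
      ((ContDiff.partialDeriv (m := ∞) ha (by simp)).differentiable (by simp) x)
      ((ContDiff.partialDeriv (m := ∞) hb (by simp)).differentiable (by simp) x)
  have e1 : ∀ i, mulFirst χ u u1 i x = mulFirst (fun x => χ x * ψ x) u u1 i x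
      + mulFirst (fun x => χ x * (1 - ψ x)) u u1 i x := fun i => by
    rw [mulFirst, mulFirst, mulFirst, congrFun (d1 i) x]; ring
  have e2 : ∀ i j, mulSecond χ u u1 u2 i j x = mulSecond (fun x => χ x * ψ x) u u1 u2 i j x
      + mulSecond (fun x => χ x * (1 - ψ x)) u u1 u2 i j x := fun i j => by
    rw [mulSecond, mulSecond, mulSecond, congrFun (d1 i) x, congrFun (d1 j) x, d2]; ring
  simp only [e1, e2, mul_add, Finset.sum_add_distrib]
  ring

/-- There are finitely many observation points and `p` is not an interior one, so the ball can be
shrunk to avoid the interior ones. -/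
lemma exists_boundaryBall_avoiding (hΩ : IsClosed Ω) (hΩ' : HasC3HolderBoundary Ω)
    (hη : IsAuxiliary Ω η) {p : Euc d} (hp : p ∈ frontier Ω) :
    ∃ (e : Euc d) (ρ c : ℝ), IsBoundaryBall Ω η p e ρ c ∧
      ∀ m, X m ∈ interior Ω → X m ∉ Metric.ball p ρ := by
  obtain ⟨e, ρ, c, hB⟩ := exists_isBoundaryBall hΩ hΩ' hη hp
  have hfin : (X '' {m | X m ∈ interior Ω}).Finite := (Set.toFinite _).image X
  have hmem : (X '' {m | X m ∈ interior Ω})ᶜ ∈ 𝓝 p := by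
    refine hfin.isClosed.isOpen_compl.mem_nhds ?_
    rintro ⟨m, hm, rfl⟩
    exact hp.2 hm
  obtain ⟨r, hr, hball⟩ := Metric.mem_nhds_iff.1 hmem
  exact ⟨e, min r ρ, c, hB.mono (lt_min hr hB.rho_pos) (min_le_right _ _), fun m hm hb =>
    hball (Metric.ball_subset_ball (min_le_left _ _) hb) ⟨m, hm, rfl⟩⟩

/-- A functional annihilating the products of `η` with test functions annihilates the functions of
Sobolev order two which vanish on the boundary. -/
theorem pairing_eq_zero (hΩ : IsCompact Ω) (hΩ' : HasC3HolderBoundary Ω) (hη : IsAuxiliary Ω η)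
    (hq : IsCoefficient Ω q0 q1 q2)
    (h : Annihilates (adj0 η q0 q1 q2) (adj1 η q1 q2) (adj2 η q2) (fun m => κ m * η (X m)) X)
    (hX : ∀ m, X m ∈ Ω) (hu : IsH2Triple Ω u u1 u2) (hu0 : IsLimitOfTest Ω u u1)
    (hbdry : ∀ x ∈ frontier Ω, u x = 0)
    (hobs : ∀ m, X m ∈ interior Ω →
      Tendsto (fun r : ℝ => ⨍ y in Metric.ball (X m) r, u y) (𝓝[>] 0) (𝓝 (u (X m)))) :
    pairing Ω q0 q1 q2 u u1 u2 + ∑ m, κ m * u (X m) = 0 := by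
  classical
  have hΩc := hΩ.isClosed
  have hXmem : ∀ m, X m ∈ interior Ω ∨ X m ∈ frontier Ω := fun m => by
    by_cases hm : X m ∈ interior Ω
    · exact Or.inl hm
    · exact Or.inr ⟨subset_closure (hX m), hm⟩
  choose! e ρ c hB hav using fun (p : Euc d) (hp : p ∈ frontier Ω) =>
    exists_boundaryBall_avoiding (X := X) hΩc hΩ' hη hp
  obtain ⟨t, htf, htc⟩ := (hΩ.of_isClosed_subset isClosed_frontier
      hΩc.frontier_subset).elim_nhds_subcover (fun p => Metric.ball p (ρ p / 2))
      fun p hp => Metric.ball_mem_nhds p (half_pos (hB p hp).rho_pos)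
  have hbump : ∀ p ∈ frontier Ω, ∃ χ : Euc d → ℝ, ContDiff ℝ ∞ χ ∧ HasCompactSupport χ ∧
      tsupport χ ⊆ Metric.ball p (ρ p) ∧ ∀ x ∈ Metric.ball p (ρ p / 2), χ x = 1 := by
    intro p hp
    have hρ := (hB p hp).rho_pos
    let b : ContDiffBump p := ⟨ρ p / 2, 3 * ρ p / 4, by positivity, by linarith⟩
    refine ⟨b, b.contDiff, b.hasCompactSupport, ?_, fun x hx =>
      b.one_of_mem_closedBall (Metric.ball_subset_closedBall hx)⟩
    rw [b.tsupport_eq]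
    exact Metric.closedBall_subset_ball (show 3 * ρ p / 4 < ρ p by linarith)
  choose! χ hχ hχc hχs hχ1 using hbump
  obtain ⟨R, hR, hΩR⟩ := hΩ.isBounded.subset_ball_lt 0 0
  let b : ContDiffBump (0 : Euc d) := ⟨R, R + 1, hR, by linarith⟩
  have hb1 : ∀ x ∈ Ω, b =ᶠ[𝓝 x] fun _ => 1 := fun x hx => by
    filter_upwards [Metric.isOpen_ball.mem_nhds (hΩR hx)] with y hy
    exact b.one_of_mem_closedBall (Metric.ball_subset_closedBall hy)
  -- A cutoff `b`, equal to one near `Ω`, multiplied by `1 - χ p` for finitely many boundary points: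
  -- the full product vanishes near the whole boundary.
  set f : Finset (Euc d) → Euc d → ℝ := fun s x => b x * ∏ p ∈ s, (1 - χ p x) with hf
  have hfs : ∀ s ⊆ t, ContDiff ℝ ∞ (f s) := fun s hs => b.contDiff.mul
    (contDiff_prod fun p hp => contDiff_const.sub (hχ p (htf p (hs hp))))
  have hfc : ∀ s, HasCompactSupport (f s) := fun s => b.hasCompactSupport.mul_right
  -- Each new factor subtracts a function supported in one boundary ball, on which the functional
  -- vanishes.
  have hstep : ∀ s ⊆ t, pairing Ω q0 q1 q2 (fun x => f s x * u x) (mulFirst (f s) u u1)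
      (mulSecond (f s) u u1 u2) = pairing Ω q0 q1 q2 u u1 u2 := by
    intro s
    induction s using Finset.induction_on with
    | empty =>
      intro _
      refine pairing_one fun x hx => ?_
      filter_upwards [hb1 x (interior_subset hx)] with y hy
      simp [hf, hy]
    | insert p s hp ih =>
      intro hs
      have hs' : s ⊆ t := (Finset.subset_insert p s).trans hs
      have hpt : p ∈ frontier Ω := htf p (hs (Finset.mem_insert_self p s))
      have hins : f (insert p s) = fun x => f s x * (1 - χ p x) := by
        funext x
        simp only [hf, Finset.prod_insert hp]
        ring
      rw [← ih hs', pairing_eq_add hq hu (hfs s hs') (hfc s) (hχ p hpt), hins,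
        pairing_of_boundaryBall hη (hB p hpt) hq h hu hu0 ((hfs s hs').mul (hχ p hpt))
          ((hfc s).mul_right) (tsupport_mul_subset_right.trans (hχs p hpt)) (fun m hm =>
            hav p hpt m ((hXmem m).resolve_right fun hX' => hm (hη.zero _ hX'))), zero_add]
  have hzero : ∀ x ∈ frontier Ω, f t =ᶠ[𝓝 x] fun _ => 0 := by
    intro x hx
    obtain ⟨p, hp, hxp⟩ := Set.mem_iUnion₂.1 (htc hx)
    filter_upwards [Metric.isOpen_ball.mem_nhds hxp] with y hy
    simp only [hf]
    rw [Finset.prod_eq_zero hp (by rw [hχ1 p (htf p hp) y hy, sub_self]), mul_zero]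
  -- The product may be nonzero outside `Ω`. As it vanishes near the boundary, its restriction to
  -- the interior remains smooth and is a test function.
  set g : Euc d → ℝ := (interior Ω).indicator (f t) with hg
  have hgint : ∀ x ∈ interior Ω, g =ᶠ[𝓝 x] f t := fun x hx => by
    filter_upwards [isOpen_interior.mem_nhds hx] with y hy
    exact Set.indicator_of_mem hy _
  have hgout : ∀ x, x ∉ interior Ω → g =ᶠ[𝓝 x] 0 := by
    intro x hx
    by_cases hxΩ : x ∈ Ω
    · filter_upwards [hzero x ⟨subset_closure hxΩ, hx⟩] with y hy
      rw [hg, Set.indicator_apply, hy, ite_self, Pi.zero_apply]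
    · filter_upwards [hΩc.isOpen_compl.mem_nhds hxΩ] with y hy
      exact Set.indicator_of_notMem (fun hy' => hy (interior_subset hy')) _
  have hgs : tsupport g ⊆ interior Ω := fun x hx => by
    by_contra hcon
    exact notMem_tsupport_iff_eventuallyEq.2 (hgout x hcon) hx
  have hgtest : IsTestFunction Ω g := by
    refine ⟨contDiff_iff_contDiffAt.2 fun x => ?_, HasCompactSupport.of_support_subset_isCompact hΩ
      ((subset_tsupport g).trans (hgs.trans interior_subset)), hgs⟩
    by_cases hx : x ∈ interior Ω
    · exact (hfs t subset_rfl).contDiffAt.congr_of_eventuallyEq (hgint x hx)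
    · exact (contDiffAt_const (c := (0 : ℝ))).congr_of_eventuallyEq (hgout x hx)
  -- The boundary balls avoid the interior observation points, so no factor changes the value there.
  have hg1 : ∀ m, X m ∈ interior Ω → g =ᶠ[𝓝 (X m)] fun _ => 1 := by
    intro m hm
    have h1 : ∀ᶠ y in 𝓝 (X m), ∀ p ∈ t, χ p y = 0 := by
      rw [Filter.eventually_all_finset]
      intro p hp
      exact notMem_tsupport_iff_eventuallyEq.1 fun hx =>
        hav p (htf p hp) m hm (hχs p (htf p hp) hx)
    filter_upwards [hgint _ hm, h1, hb1 _ (hX m)] with y h2 h3 h4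
    rw [h2]
    simp only [hf]
    rw [h4, Finset.prod_eq_one fun p hp => by rw [h3 p hp, sub_zero], mul_one]
  have hfin := pairing_of_interior hη hq h hu hgtest hobs fun m hm => ⟨1, hg1 m hm⟩
  rw [pairing_congr hgint, hstep t subset_rfl] at hfin
  rw [← hfin]
  congr 1
  refine Finset.sum_congr rfl fun m _ => ?_
  rcases hXmem m with hm | hm
  · rw [(hg1 m hm).eq_of_nhds, one_mul]
  · rw [hbdry _ hm, mul_zero, mul_zero, mul_zero]

end Global

end PINN

/-! ### Parameter derivatives of hidden units, and the kernels they generate. -/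

namespace PINN

/-! ### Ridge functions -/

section Ridge

variable {d : ℕ} {s h : ℝ → ℝ} {f : Euc d → ℝ} {w x : Euc d} {b : ℝ}

/-- The function `x ↦ f(x) s(w · x + b)`. -/
noncomputable def ridge (s : ℝ → ℝ) (f : Euc d → ℝ) (w : Euc d) (b : ℝ) (x : Euc d) : ℝ :=
  f x * s (inner ℝ w x + b)

lemma ContDiff.ridge {n : WithTop ℕ∞} (hs : ContDiff ℝ n s) (hf : ContDiff ℝ n f) :
    ContDiff ℝ n (ridge s f w b) :=
  hf.mul (hs.comp ((contDiff_const.inner ℝ contDiff_id).add contDiff_const))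

lemma partialDeriv_ridge (hs : Differentiable ℝ s) (hf : Differentiable ℝ f) (i : Fin d) :
    partialDeriv i (ridge s f w b)
      = fun x => ridge s (partialDeriv i f) w b x + w i * ridge (deriv s) f w b x := by
  funext x
  have h1 : HasFDerivAt (fun x : Euc d => inner ℝ w x + b) (innerSL ℝ w) x :=
    (innerSL ℝ w).hasFDerivAt.add_const b
  have h2 : HasFDerivAt (fun x : Euc d => s (inner ℝ w x + b))
      (deriv s (inner ℝ w x + b) • innerSL ℝ w) x :=
    (hs _).hasDerivAt.comp_hasFDerivAt x h1
  have h3 : partialDeriv i (fun x : Euc d => s (inner ℝ w x + b)) x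
      = deriv s (inner ℝ w x + b) * w i := by
    rw [partialDeriv, h2.fderiv]
    simp [EuclideanSpace.inner_single_right]
  change partialDeriv i (fun x => f x * s (inner ℝ w x + b)) x = _
  rw [partialDeriv_mul (hf x) h2.differentiableAt, h3]
  simp only [ridge]
  ring

lemma partialDeriv_partialDeriv_ridge (hs : ContDiff ℝ 2 s) (hf : ContDiff ℝ 2 f) (i j : Fin d) :
    partialDeriv i (partialDeriv j (ridge s f w b)) x
      = ridge s (partialDeriv i (partialDeriv j f)) w b x + w i * ridge (deriv s) (partialDeriv j f) w b x
        + (w j * ridge (deriv s) (partialDeriv i f) w b x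
          + w j * (w i * ridge (deriv (deriv s)) f w b x)) := by
  have hs1 : ContDiff ℝ 1 (deriv s) := hs.deriv' (n := 1)
  have hfj : ContDiff ℝ 1 (partialDeriv j f) := ContDiff.partialDeriv hf (by norm_num)
  have hsd := hs.differentiable two_ne_zero
  have hfd := hf.differentiable two_ne_zero
  have r1 : Differentiable ℝ (ridge s (partialDeriv j f) w b) :=
    (ContDiff.ridge (hs.of_le (by norm_num)) hfj).differentiable one_ne_zero
  have r2 : Differentiable ℝ (ridge (deriv s) f w b) :=
    (ContDiff.ridge hs1 (hf.of_le (by norm_num))).differentiable one_ne_zero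
  rw [partialDeriv_ridge hsd hfd, partialDeriv_add (r1 x) ((r2 x).const_mul _),
    partialDeriv_mul (by fun_prop) (r2 x), partialDeriv_const,
    partialDeriv_ridge hsd (hfj.differentiable one_ne_zero),
    partialDeriv_ridge (hs1.differentiable one_ne_zero) hfd]
  ring

/-- The value of a differential operator at a ridge function. -/
lemma DiffOp.classical_ridge (A : DiffOp d) (hs : ContDiff ℝ 2 s) (hf : ContDiff ℝ 2 f) :
    A.classical (ridge s f w b) x
      = ∑ i, ∑ j, A.a i j x * (ridge s (partialDeriv i (partialDeriv j f)) w b x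
          + w i * ridge (deriv s) (partialDeriv j f) w b x
          + (w j * ridge (deriv s) (partialDeriv i f) w b x
            + w j * (w i * ridge (deriv (deriv s)) f w b x)))
        + ∑ i, A.b i x * (ridge s (partialDeriv i f) w b x + w i * ridge (deriv s) f w b x)
        + A.c x * ridge s f w b x := by
  simp only [DiffOp.classical, DiffOp.applyWith, partialDeriv_partialDeriv_ridge hs hf]
  simp only [partialDeriv_ridge (hs.differentiable two_ne_zero) (hf.differentiable two_ne_zero)]

lemma DiffOp.classical_const_mul (A : DiffOp d) (hf : ContDiff ℝ 2 f) (c : ℝ) :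
    A.classical (fun x => c * f x) x = c * A.classical f x := by
  have h1 : ∀ {g : Euc d → ℝ}, ContDiff ℝ 1 g → ∀ i, partialDeriv i (fun x => c * g x)
      = fun x => c * partialDeriv i g x := fun hg i => by
    funext y
    rw [partialDeriv_mul (by fun_prop) (hg.differentiable one_ne_zero y), partialDeriv_const,
      zero_mul, add_zero]
  simp only [DiffOp.classical, DiffOp.applyWith, h1 (hf.of_le (m := 1) (by norm_num)),
    h1 (ContDiff.partialDeriv (m := 1) hf (by norm_num)), mul_add, Finset.mul_sum, mul_left_comm]

lemma partialDeriv_mul_coord (hf : Differentiable ℝ f) (i k : Fin d) :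
    partialDeriv i (fun y => f y * y k)
      = fun y => y k * partialDeriv i f y + (if i = k then 1 else 0) * f y := by
  funext y
  have h1 : partialDeriv i (fun y : Euc d => y k) y = if i = k then 1 else 0 := by
    have : HasFDerivAt (fun y : Euc d => y k) (EuclideanSpace.proj k : Euc d →L[ℝ] ℝ) y :=
      (EuclideanSpace.proj k : Euc d →L[ℝ] ℝ).hasFDerivAt
    rw [partialDeriv, this.fderiv]
    simp [eq_comm]
  rw [partialDeriv_mul (hf y) (by fun_prop), h1]
  ring

lemma partialDeriv_partialDeriv_mul_coord (hf : ContDiff ℝ 2 f) (i j k : Fin d) :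
    partialDeriv i (partialDeriv j (fun y => f y * y k)) x
      = x k * partialDeriv i (partialDeriv j f) x + (if i = k then 1 else 0) * partialDeriv j f x
        + (if j = k then 1 else 0) * partialDeriv i f x := by
  have hfj : Differentiable ℝ (partialDeriv j f) :=
    (ContDiff.partialDeriv (m := 1) hf (by norm_num)).differentiable one_ne_zero
  have hfd := hf.differentiable two_ne_zero
  have h1 : (fun y : Euc d => y k * partialDeriv j f y) = fun y => partialDeriv j f y * y k := by
    funext y; ring
  rw [partialDeriv_mul_coord hfd, partialDeriv_add (by fun_prop) (by fun_prop), h1,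
    partialDeriv_mul_coord hfj, partialDeriv_mul (by fun_prop) (hfd x), partialDeriv_const]
  ring

lemma hasDerivAt_ridge_bias (hs : Differentiable ℝ s) (f : Euc d → ℝ) :
    HasDerivAt (fun b => ridge s f w b x) (ridge (deriv s) f w b x) b := by
  have h1 : HasDerivAt (fun b => inner ℝ w x + b) 1 b := (hasDerivAt_id b).const_add _
  have := ((hs _).hasDerivAt.comp b h1).const_mul (f x)
  simpa [ridge] using this

lemma hasDerivAt_ridge_weight (hs : Differentiable ℝ s) (f : Euc d → ℝ) (k : Fin d) :
    HasDerivAt (fun t : ℝ => ridge s f (w + t • EuclideanSpace.single k 1) b x)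
      (x k * ridge (deriv s) f w b x) 0 := by
  have h1 : HasDerivAt (fun t : ℝ => inner ℝ (w + t • EuclideanSpace.single k (1 : ℝ)) x + b)
      (x k) 0 := by
    have h2 : (fun t : ℝ => inner ℝ (w + t • EuclideanSpace.single k (1 : ℝ)) x + b)
        = fun t => inner ℝ w x + t * x k + b := by
      funext t
      simp [inner_add_left, inner_smul_left, EuclideanSpace.inner_single_left]
    rw [h2]
    simpa using (((hasDerivAt_id (0 : ℝ)).mul_const (x k)).const_add (inner ℝ w x)).add_const b
  have h3 : HasDerivAt s (deriv s (inner ℝ w x + b))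
      (inner ℝ (w + (0 : ℝ) • EuclideanSpace.single k (1 : ℝ)) x + b) := by
    simpa using (hs (inner ℝ w x + b)).hasDerivAt
  refine ((h3.comp (0 : ℝ) h1).const_mul (f x)).congr_deriv ?_
  simp only [ridge]
  ring

lemma hasDerivAt_weight_apply (k i : Fin d) :
    HasDerivAt (fun t : ℝ => (w + t • EuclideanSpace.single k (1 : ℝ)) i) (if i = k then 1 else 0) 0 := by
  have h2 : (fun t : ℝ => (w + t • EuclideanSpace.single k (1 : ℝ)) i)
      = fun t => w i + t * (if i = k then 1 else 0) := by
    funext t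
    simp
  rw [h2]
  simpa using ((hasDerivAt_id (0 : ℝ)).mul_const (if i = k then (1 : ℝ) else 0)).const_add (w i)

lemma partialDeriv_eq_of_hasDerivAt {F : Euc d → ℝ} {k : Fin d} {F' : ℝ}
    (hF : DifferentiableAt ℝ F w)
    (h : HasDerivAt (fun t : ℝ => F (w + t • EuclideanSpace.single k 1)) F' 0) :
    partialDeriv k F w = F' := by
  have h1 := hF.lineDeriv_eq_fderiv (v := EuclideanSpace.single k (1 : ℝ))
  rw [partialDeriv, ← h1, lineDeriv, h.deriv]

lemma differentiable_ridge_weight (hs : Differentiable ℝ s) (f : Euc d → ℝ) :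
    Differentiable ℝ fun w => ridge s f w b x := by
  unfold ridge
  exact (hs.comp ((differentiable_id.inner ℝ (differentiable_const x)).add_const b)).const_mul _

lemma deriv_classical_ridge_bias (A : DiffOp d) (hs : ContDiff ℝ 3 s) (hf : ContDiff ℝ 2 f) :
    HasDerivAt (fun b => A.classical (ridge s f w b) x) (A.classical (ridge (deriv s) f w b) x) b := by
  have hs1 : ContDiff ℝ 2 (deriv s) := hs.deriv' (n := 2)
  have hs2 : ContDiff ℝ 1 (deriv (deriv s)) := hs1.deriv' (n := 1)
  have d0 := hs.differentiable (by norm_num)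
  have d1 := hs1.differentiable two_ne_zero
  have d2 := hs2.differentiable one_ne_zero
  simp only [A.classical_ridge (hs.of_le (by norm_num)) hf, A.classical_ridge hs1 hf]
  exact ((HasDerivAt.fun_sum fun i _ => HasDerivAt.fun_sum fun j _ =>
    (((hasDerivAt_ridge_bias d0 _).add ((hasDerivAt_ridge_bias d1 _).const_mul _)).add
      (((hasDerivAt_ridge_bias d1 _).const_mul _).add
        (((hasDerivAt_ridge_bias d2 _).const_mul _).const_mul _))).const_mul _).add
    (HasDerivAt.fun_sum fun i _ => ((hasDerivAt_ridge_bias d0 _).add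
      ((hasDerivAt_ridge_bias d1 _).const_mul _)).const_mul _)).add
    ((hasDerivAt_ridge_bias d0 _).const_mul _)

/-- The operator acts on `x` and commutes with `∂/∂w_k`, which turns `f σ(w · x + b)` into `f x_k
σ'(w · x + b)`. As the coefficients of the operator are not differentiated, this is checked on the
explicit formula. -/
lemma partialDeriv_classical_ridge_weight (A : DiffOp d) (hs : ContDiff ℝ 3 s)
    (hf : ContDiff ℝ 2 f) (k : Fin d) :
    DifferentiableAt ℝ (fun w => A.classical (ridge s f w b) x) w ∧
    partialDeriv k (fun w => A.classical (ridge s f w b) x) w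
      = A.classical (ridge (deriv s) (fun y => f y * y k) w b) x := by
  have hs1 : ContDiff ℝ 2 (deriv s) := hs.deriv' (n := 2)
  have hs2 : ContDiff ℝ 1 (deriv (deriv s)) := hs1.deriv' (n := 1)
  have d0 := hs.differentiable (by norm_num)
  have d1 := hs1.differentiable two_ne_zero
  have d2 := hs2.differentiable one_ne_zero
  have hdiff : DifferentiableAt ℝ (fun w => A.classical (ridge s f w b) x) w := by
    simp only [A.classical_ridge (hs.of_le (by norm_num)) hf]
    have e0 := fun g => differentiable_ridge_weight (b := b) (x := x) d0 g
    have e1 := fun g => differentiable_ridge_weight (b := b) (x := x) d1 g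
    have e2 := fun g => differentiable_ridge_weight (b := b) (x := x) d2 g
    have ew : ∀ i, Differentiable ℝ fun w : Euc d => w i := fun i => by fun_prop
    exact Differentiable.differentiableAt (((Differentiable.fun_sum fun i _ =>
      Differentiable.fun_sum fun j _ =>
      (((e0 _).add ((ew i).mul (e1 _))).add (((ew j).mul (e1 _)).add
        ((ew j).mul ((ew i).mul (e2 _))))).const_mul _).add
      (Differentiable.fun_sum fun i _ => ((e0 _).add ((ew i).mul (e1 _))).const_mul _)).add
      ((e0 _).const_mul _))
  refine ⟨hdiff, partialDeriv_eq_of_hasDerivAt hdiff ?_⟩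
  have hfk : ContDiff ℝ 2 (fun y => f y * y k) := hf.mul (by fun_prop)
  simp only [A.classical_ridge (hs.of_le (by norm_num)) hf, A.classical_ridge hs1 hfk]
  have e0 := fun g => hasDerivAt_ridge_weight (w := w) (b := b) (x := x) d0 g k
  have e1 := fun g => hasDerivAt_ridge_weight (w := w) (b := b) (x := x) d1 g k
  have e2 := fun g => hasDerivAt_ridge_weight (w := w) (b := b) (x := x) d2 g k
  have ew := fun i => hasDerivAt_weight_apply (w := w) k i
  refine (((HasDerivAt.fun_sum fun i _ => HasDerivAt.fun_sum fun j _ =>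
    (((e0 _).add ((ew i).mul (e1 _))).add (((ew j).mul (e1 _)).add
        ((ew j).mul ((ew i).mul (e2 _))))).const_mul _).add
    (HasDerivAt.fun_sum fun i _ => ((e0 _).add ((ew i).mul (e1 _))).const_mul _)).add
    ((e0 _).const_mul _)).congr_deriv ?_
  congr 1
  · congr 1
    · refine Finset.sum_congr rfl fun i _ => Finset.sum_congr rfl fun j _ => ?_
      simp only [ridge, zero_smul, add_zero, Pi.mul_apply]
      rw [partialDeriv_partialDeriv_mul_coord hf,
        partialDeriv_mul_coord (hf.differentiable two_ne_zero),
        partialDeriv_mul_coord (hf.differentiable two_ne_zero)]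
      ring
    · refine Finset.sum_congr rfl fun i _ => ?_
      simp only [ridge, zero_smul, add_zero,
        partialDeriv_mul_coord (hf.differentiable two_ne_zero)]
      ring
  · simp only [ridge]
    ring

end Ridge

/-! ### Features -/

section Feature

variable {d : ℕ} {η : Euc d → ℝ} {σ : ℝ → ℝ}

/-- The parameters of a hidden unit: the outer weight, the bias, and the inner weights. -/
abbrev Param (d : ℕ) : Type := Option (Option (Fin d))

/-- The activation functions of the derivatives of a hidden unit. -/
noncomputable def act (σ : ℝ → ℝ) : Param d → ℝ → ℝ
  | none => σ
  | some _ => deriv σ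

/-- The spatial profiles of the derivatives of a hidden unit. -/
def profile (η : Euc d → ℝ) : Param d → Euc d → ℝ
  | none => η
  | some none => η
  | some (some k) => fun y => η y * y k

/-- The outer weights of the derivatives of a hidden unit. -/
def coef (c : ℝ) : Param d → ℝ
  | none => 1
  | some _ => c

/-- The derivative of a hidden unit with respect to one of its parameters. -/
noncomputable def feature (η : Euc d → ℝ) (σ : ℝ → ℝ) (q : (ℝ × Euc d × ℝ) × Param d) :
    Euc d → ℝ :=
  fun y => coef q.1.1 q.2 * ridge (act σ q.2) (profile η q.2) q.1.2.1 q.1.2.2 y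

lemma contDiff_profile (hη : ContDiff ℝ 2 η) (j : Param d) : ContDiff ℝ 2 (profile η j) := by
  match j with
  | none => exact hη
  | some none => exact hη
  | some (some k) => exact hη.mul (by fun_prop)

lemma contDiff_act (hσ : ContDiff ℝ 4 σ) (j : Param d) : ContDiff ℝ 3 (act σ j) := by
  match j with
  | none => exact hσ.of_le (by norm_num)
  | some _ => exact hσ.deriv' (n := 3)

lemma contDiff_feature (hη : ContDiff ℝ 2 η) (hσ : ContDiff ℝ 4 σ)
    (q : (ℝ × Euc d × ℝ) × Param d) : ContDiff ℝ 2 (feature η σ q) :=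
  contDiff_const.mul (ContDiff.ridge ((contDiff_act hσ q.2).of_le (by norm_num))
    (contDiff_profile hη q.2))

lemma neuron_eq (c : ℝ) (w : Euc d) (b : ℝ) :
    neuron η σ c w b = fun x => c * ridge σ η w b x := by
  funext x
  simp only [neuron, ridge]
  ring

/-- The scalar product of gradients as a sum over `Param d`; an expectation of it becomes one
integral over `ν.prod Measure.count`, the target space of the residual operator. -/
lemma paramGradDot_eq {F G : ℝ → Euc d → ℝ → ℝ} {c : ℝ} {w : Euc d} {b : ℝ} {f g : Param d → ℝ}
    (hf : deriv (fun c' => F c' w b) c = f none ∧ deriv (fun b' => F c w b') b = f (some none) ∧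
      ∀ k, partialDeriv k (fun w' => F c w' b) w = f (some (some k)))
    (hg : deriv (fun c' => G c' w b) c = g none ∧ deriv (fun b' => G c w b') b = g (some none) ∧
      ∀ k, partialDeriv k (fun w' => G c w' b) w = g (some (some k))) :
    paramGradDot F G c w b = ∑ j, f j * g j := by
  rw [Fintype.sum_option, Fintype.sum_option, paramGradDot, hf.1, hf.2.1, hg.1, hg.2.1]
  simp only [hf.2.2, hg.2.2]
  ring

lemma paramDeriv_neuron (hσ : ContDiff ℝ 4 σ) (c : ℝ) (w : Euc d) (b : ℝ) (y : Euc d) :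
    deriv (fun c' => neuron η σ c' w b y) c = feature η σ ((c, w, b), none) y ∧
    deriv (fun b' => neuron η σ c w b' y) b = feature η σ ((c, w, b), some none) y ∧
    ∀ k, partialDeriv k (fun w' => neuron η σ c w' b y) w
      = feature η σ ((c, w, b), some (some k)) y := by
  have d0 := hσ.differentiable (by norm_num)
  simp only [neuron_eq]
  refine ⟨?_, ((hasDerivAt_ridge_bias d0 η).const_mul c).deriv, fun k => ?_⟩
  · simp [feature, coef, act, profile]
  · refine partialDeriv_eq_of_hasDerivAt ((differentiable_ridge_weight d0 η w).const_mul c) ?_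
    refine ((hasDerivAt_ridge_weight d0 η k).const_mul c).congr_deriv ?_
    simp only [feature, coef, act, profile, ridge]
    ring

lemma paramDeriv_classical_neuron (A : DiffOp d) (hη : ContDiff ℝ 2 η) (hσ : ContDiff ℝ 4 σ)
    (c : ℝ) (w : Euc d) (b : ℝ) (x : Euc d) :
    deriv (fun c' => A.classical (neuron η σ c' w b) x) c
      = A.classical (feature η σ ((c, w, b), none)) x ∧
    deriv (fun b' => A.classical (neuron η σ c w b') x) b
      = A.classical (feature η σ ((c, w, b), some none)) x ∧
    ∀ k, partialDeriv k (fun w' => A.classical (neuron η σ c w' b) x) w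
      = A.classical (feature η σ ((c, w, b), some (some k))) x := by
  have hσ2 : ContDiff ℝ 2 σ := hσ.of_le (by norm_num)
  have hσ3 : ContDiff ℝ 3 σ := hσ.of_le (by norm_num)
  have hcl : ∀ c w b, A.classical (neuron η σ c w b) x = c * A.classical (ridge σ η w b) x :=
    fun c w b => by rw [neuron_eq, A.classical_const_mul (ContDiff.ridge hσ2 hη)]
  have hfe : ∀ j, A.classical (feature η σ ((c, w, b), j)) x
      = coef c j * A.classical (ridge (act σ j) (profile η j) w b) x := fun j =>
    A.classical_const_mul (ContDiff.ridge ((contDiff_act hσ j).of_le (by norm_num))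
      (contDiff_profile hη j)) _
  simp only [hcl, hfe]
  refine ⟨?_, ((deriv_classical_ridge_bias A hσ3 hη).const_mul c).deriv, fun k => ?_⟩
  · simp [coef, act, profile]
  · obtain ⟨h1, h2⟩ := partialDeriv_classical_ridge_weight (b := b) (x := x) (w := w) A hσ3 hη k
    rw [partialDeriv_mul (by fun_prop) h1, partialDeriv_const, zero_mul, add_zero, h2]
    rfl

end Feature

end PINN

namespace PINN

/-! ### Sums of dominated kernels -/

section Dominated

variable {Y Θ : Type*} [MeasurableSpace Y] [MeasurableSpace Θ] {ν : Measure Θ}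

/-- A kernel that is dominated by some square integrable function. -/
def Dominated (ν : Measure Θ) (k : Y → Θ → ℝ) : Prop := ∃ G, IsDominatedKernel ν k G

lemma Dominated.add {k k' : Y → Θ → ℝ} (h : Dominated ν k) (h' : Dominated ν k') :
    Dominated ν (fun y θ => k y θ + k' y θ) := by
  obtain ⟨G, hG⟩ := h
  obtain ⟨G', hG'⟩ := h'
  exact ⟨G + G', hG.meas.add hG'.meas, fun y θ => (abs_add_le _ _).trans
    (add_le_add (hG.bound y θ) (hG'.bound y θ)), hG.memLp.add hG'.memLp⟩

lemma Dominated.sum {ι : Type*} {k : ι → Y → Θ → ℝ} (s : Finset ι) (h : ∀ i, Dominated ν (k i)) :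
    Dominated ν (fun y θ => ∑ i ∈ s, k i y θ) := by
  choose G hG using h
  exact ⟨fun θ => ∑ i ∈ s, G i θ, Finset.measurable_fun_sum s fun i _ => (hG i).meas,
    fun y θ => (Finset.abs_sum_le_sum_abs _ _).trans
      (Finset.sum_le_sum fun i _ => (hG i).bound y θ),
    memLp_finsetSum s fun i _ => (hG i).memLp⟩

lemma Dominated.mul_left {k : Y → Θ → ℝ} (h : Dominated ν k) {α : Y → ℝ} (hα : Measurable α)
    {C : ℝ} (hC : ∀ y, |α y| ≤ C) : Dominated ν (fun y θ => α y * k y θ) := by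
  obtain ⟨G, hG⟩ := h
  refine ⟨fun θ => C * G θ, (hα.comp measurable_fst).mul hG.meas, fun y θ => ?_,
    hG.memLp.const_mul C⟩
  rw [abs_mul]
  exact mul_le_mul (hC y) (hG.bound y θ) (abs_nonneg _) ((abs_nonneg _).trans (hC y))

end Dominated

/-! ### The kernels of the network -/

section Kernels

variable {d : ℕ} {Ω : Set (Euc d)} {η : Euc d → ℝ} {σ : ℝ → ℝ} {ν : Measure (ℝ × Euc d × ℝ)}

instance : MeasurableSpace (Param d) := ⊤

instance : DiscreteMeasurableSpace (Param d) := ⟨fun _ => trivial⟩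

lemma IsActivation.exists_bound (hσ : IsActivation σ) : ∃ C : ℝ, ∀ z, |σ z| ≤ C ∧
    |deriv σ z| ≤ C ∧ |deriv (deriv σ) z| ≤ C ∧ |deriv (deriv (deriv σ)) z| ≤ C := by
  obtain ⟨C0, h0⟩ := hσ.bdd 0 (by norm_num)
  obtain ⟨C1, h1⟩ := hσ.bdd 1 (by norm_num)
  obtain ⟨C2, h2⟩ := hσ.bdd 2 (by norm_num)
  obtain ⟨C3, h3⟩ := hσ.bdd 3 (by norm_num)
  simp only [iteratedDeriv_succ, iteratedDeriv_zero] at h0 h1 h2 h3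
  exact ⟨max (max C0 C1) (max C2 C3), fun z => ⟨(h0 z).trans (by simp), (h1 z).trans (by simp),
    (h2 z).trans (by simp), (h3 z).trans (by simp)⟩⟩

/-- An upper bound for the growth of the features in the parameters. -/
noncomputable def envelope (q : (ℝ × Euc d × ℝ) × Param d) : ℝ :=
  (1 + |q.1.1|) * (1 + ∑ k, q.1.2.1 k ^ 2)

/-- Fourth moments of the weights and boundedness of `c` make `(1 + |c|)(1 + |w|²)` square
integrable. -/
lemma memLp_envelope (hν : IsInitialLaw ν) :
    MemLp (envelope (d := d)) 2 (ν.prod Measure.count) := by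
  have := hν.prob
  obtain ⟨K, hK⟩ := hν.bdd_c
  have h0 : ∀ k : Fin d, MemLp (fun θ : ℝ × Euc d × ℝ => θ.2.1 k ^ 2) 2 ν := fun k => by
    refine (memLp_two_iff_integrable_sq ?_).2 ?_
    · exact (by fun_prop : Measurable fun θ : ℝ × Euc d × ℝ => θ.2.1 k ^ 2).aestronglyMeasurable
    · refine (hν.moment_w k).congr (Eventually.of_forall fun θ => ?_)
      simp only
      rw [← pow_mul, Even.pow_abs ⟨2, rfl⟩]
  have h1 : MemLp (fun θ : ℝ × Euc d × ℝ => 1 + ∑ k, θ.2.1 k ^ 2) 2 ν :=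
    MemLp.add (f := fun _ => (1 : ℝ)) (memLp_const 1) (memLp_finsetSum _ fun k _ => h0 k)
  have h2 : MemLp (fun θ : ℝ × Euc d × ℝ => (1 + |θ.1|) * (1 + ∑ k, θ.2.1 k ^ 2)) 2 ν := by
    refine (h1.const_mul (1 + K)).mono ?_ ?_
    · exact (by fun_prop : Measurable fun θ : ℝ × Euc d × ℝ =>
        (1 + |θ.1|) * (1 + ∑ k, θ.2.1 k ^ 2)).aestronglyMeasurable
    · filter_upwards [hK] with θ hθ
      rw [norm_mul, norm_mul, Real.norm_eq_abs, Real.norm_eq_abs, Real.norm_eq_abs,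
        abs_of_nonneg (by positivity : 0 ≤ 1 + |θ.1|)]
      exact mul_le_mul_of_nonneg_right (le_trans (by linarith) (le_abs_self _)) (abs_nonneg _)
  exact h2.comp_fst _

lemma abs_coef_le (c : ℝ) (j : Param d) : |coef c j| ≤ 1 + |c| := by
  match j with
  | none => simp [coef]
  | some _ => simp [coef]

/-- The profile is bounded on the compact `Ω`, the activation is bounded, and `m` grows at most
quadratically in `w`. The indicator of `Ω` makes the bound uniform over all points. -/
lemma dominated_ridge (hΩ : IsCompact Ω) (hν : IsInitialLaw ν) {p : Param d → Euc d → ℝ}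
    (hp : ∀ j, Continuous (p j)) {s : Param d → ℝ → ℝ} (hs : ∀ j, Continuous (s j)) {C : ℝ}
    (hC : ∀ j z, |s j z| ≤ C) {m : Euc d → ℝ} (hm : Continuous m)
    (hmb : ∀ w, |m w| ≤ 1 + ∑ k, w k ^ 2) :
    Dominated (ν.prod Measure.count) (fun (y : Euc d) (q : (ℝ × Euc d × ℝ) × Param d) =>
      Ω.indicator (fun y => coef q.1.1 q.2 * (m q.1.2.1 * ridge (s q.2) (p q.2) q.1.2.1 q.1.2.2 y))
        y) := by
  choose B hB using fun j => hΩ.exists_bound_of_continuousOn (hp j).continuousOn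
  have hB' : ∀ j, ∀ y ∈ Ω, |p j y| ≤ ∑ j, |B j| := fun j y hy =>
    (hB j y hy).trans ((le_abs_self _).trans
      (Finset.single_le_sum (f := fun j => |B j|) (fun _ _ => abs_nonneg _) (Finset.mem_univ j)))
  have hC0 : 0 ≤ C := (abs_nonneg _).trans (hC none 0)
  have hB0 : 0 ≤ ∑ j, |B j| := Finset.sum_nonneg fun _ _ => abs_nonneg _
  refine ⟨fun q => (∑ j, |B j|) * C * envelope q, ?_, fun y q => ?_,
    (memLp_envelope hν).const_mul _⟩
  · have key : Measurable fun z : (Euc d × (ℝ × Euc d × ℝ)) × Param d =>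
        Ω.indicator (fun y => coef z.1.2.1 z.2 * (m z.1.2.2.1 *
          ridge (s z.2) (p z.2) z.1.2.2.1 z.1.2.2.2 y)) z.1.1 := by
      refine measurable_from_prod_countable_left fun j => ?_
      have h1 : Measurable fun z : Euc d × (ℝ × Euc d × ℝ) =>
          coef z.2.1 j * (m z.2.2.1 * ridge (s j) (p j) z.2.2.1 z.2.2.2 z.1) := by
        have h2 : Continuous fun z : Euc d × (ℝ × Euc d × ℝ) => coef z.2.1 j := by
          match j with
          | none => exact continuous_const
          | some _ => exact continuous_fst.comp continuous_snd
        have h3 := hp j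
        have h4 := hs j
        unfold ridge
        exact Continuous.measurable (by fun_prop)
      exact h1.indicator (hΩ.measurableSet.preimage measurable_fst)
    exact key.comp MeasurableEquiv.prodAssoc.symm.measurable
  · have hE : 0 ≤ envelope q := by
      unfold envelope
      positivity
    by_cases hy : y ∈ Ω
    · rw [Set.indicator_of_mem hy, abs_mul, abs_mul, ridge, abs_mul]
      calc |coef q.1.1 q.2| * (|m q.1.2.1| * (|p q.2 y| * |s q.2 (inner ℝ q.1.2.1 y + q.1.2.2)|))
          ≤ (1 + |q.1.1|) * ((1 + ∑ k, q.1.2.1 k ^ 2) * ((∑ j, |B j|) * C)) := by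
            gcongr
            · exact abs_coef_le _ _
            · exact hmb _
            · exact hB' _ y hy
            · exact hC _ _
        _ = _ := by
            simp only [envelope]
            ring
    · rw [Set.indicator_of_notMem hy, abs_zero]
      positivity

lemma abs_coord_le (w : Euc d) (i : Fin d) : |w i| ≤ 1 + ∑ k, w k ^ 2 := by
  have h1 : w i ^ 2 ≤ ∑ k, w k ^ 2 :=
    Finset.single_le_sum (f := fun k => w k ^ 2) (fun _ _ => sq_nonneg _) (Finset.mem_univ i)
  have h2 := sq_abs (w i)
  nlinarith [sq_nonneg (|w i| - 1)]

lemma abs_coord_mul_le (w : Euc d) (i j : Fin d) : |w i * w j| ≤ 1 + ∑ k, w k ^ 2 := by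
  have h1 : ∀ i, w i ^ 2 ≤ ∑ k, w k ^ 2 := fun i =>
    Finset.single_le_sum (f := fun k => w k ^ 2) (fun _ _ => sq_nonneg _) (Finset.mem_univ i)
  rw [abs_le]
  constructor <;> nlinarith [sq_nonneg (w i - w j), sq_nonneg (w i + w j), h1 i, h1 j]

lemma feature_contDiff_two (hη : IsAuxiliary Ω η) (hσ : IsActivation σ)
    (q : (ℝ × Euc d × ℝ) × Param d) : ContDiff ℝ 2 (feature η σ q) :=
  contDiff_feature (hη.contDiff.of_le (by norm_num)) hσ.contDiff q

lemma act_bound (hσ : IsActivation σ) : ∃ C : ℝ, ∀ (j : Param d) z, |act σ j z| ≤ C ∧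
    |deriv (act σ j) z| ≤ C ∧ |deriv (deriv (act σ j)) z| ≤ C := by
  obtain ⟨C, hC⟩ := hσ.exists_bound
  refine ⟨C, fun j z => ?_⟩
  match j with
  | none => exact ⟨(hC z).1, (hC z).2.1, (hC z).2.2.1⟩
  | some _ => exact ⟨(hC z).2.1, (hC z).2.2.1, (hC z).2.2.2⟩

variable (hΩ : IsCompact Ω) (hη : IsAuxiliary Ω η) (hσ : IsActivation σ) (hν : IsInitialLaw ν)

include hΩ hη hσ hν

lemma dominated_feature : Dominated (ν.prod Measure.count)
    (fun (y : Euc d) q => Ω.indicator (feature η σ q) y) := by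
  obtain ⟨C, hC⟩ := act_bound (d := d) hσ
  have := dominated_ridge hΩ hν (p := profile η) (s := act σ) (C := C) (m := fun _ => 1)
    (fun j => (contDiff_profile (hη.contDiff.of_le (by norm_num)) j).continuous)
    (fun j => (contDiff_act hσ.contDiff j).continuous) (fun j z => (hC j z).1) continuous_const
    (fun w => by
      rw [abs_one]
      exact le_add_of_nonneg_right (Finset.sum_nonneg fun _ _ => sq_nonneg _))
  simp only [one_mul] at this
  exact this

lemma dominated_feature_partialDeriv (i : Fin d) : Dominated (ν.prod Measure.count)
    (fun (y : Euc d) q => Ω.indicator (partialDeriv i (feature η σ q)) y) := by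
  obtain ⟨C, hC⟩ := act_bound (d := d) hσ
  have hp : ∀ j, ContDiff ℝ 2 (profile (d := d) η j) := contDiff_profile (hη.contDiff.of_le (by norm_num))
  have hs : ∀ j, ContDiff ℝ 3 (act (d := d) σ j) := contDiff_act hσ.contDiff
  have h1 := dominated_ridge hΩ hν (p := fun j => partialDeriv i (profile η j)) (s := act σ) (C := C)
    (m := fun _ => 1) (fun j => (ContDiff.partialDeriv (m := 1) (hp j) (by norm_num)).continuous)
    (fun j => (hs j).continuous) (fun j z => (hC j z).1) continuous_const (fun w => by
      rw [abs_one]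
      exact le_add_of_nonneg_right (Finset.sum_nonneg fun _ _ => sq_nonneg _))
  have h2 := dominated_ridge hΩ hν (p := profile η) (s := fun j => deriv (act σ j)) (C := C)
    (m := fun w => w i) (fun j => (hp j).continuous)
    (fun j => ((hs j).deriv' (n := 2)).continuous) (fun j z => (hC j z).2.1) (by fun_prop)
    (fun w => abs_coord_le w i)
  refine Eq.mp (congrArg _ ?_) (h1.add h2)
  funext y q
  by_cases hy : y ∈ Ω
  swap
  · simp [Set.indicator_of_notMem hy]
  simp only [Set.indicator_of_mem hy]
  have hr : ContDiff ℝ 2 (ridge (act σ q.2) (profile η q.2) q.1.2.1 q.1.2.2) :=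
    ContDiff.ridge ((hs q.2).of_le (by norm_num)) (hp q.2)
  change _ = partialDeriv i (fun x => coef q.1.1 q.2 * ridge _ _ _ _ x) y
  rw [partialDeriv_mul (by fun_prop) (hr.differentiable two_ne_zero y), partialDeriv_const,
    partialDeriv_ridge ((hs q.2).differentiable (by norm_num)) ((hp q.2).differentiable two_ne_zero)]
  ring

/-- Two spatial derivatives of a ridge function bring down at most two inner weights, the growth
that `envelope` allows. -/
lemma dominated_feature_partialDeriv_partialDeriv (i j : Fin d) : Dominated (ν.prod Measure.count)
    (fun (y : Euc d) q => Ω.indicator (partialDeriv i (partialDeriv j (feature η σ q))) y) := by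
  obtain ⟨C, hC⟩ := act_bound (d := d) hσ
  have hp : ∀ j, ContDiff ℝ 2 (profile (d := d) η j) := contDiff_profile (hη.contDiff.of_le (by norm_num))
  have hs : ∀ j, ContDiff ℝ 3 (act (d := d) σ j) := contDiff_act hσ.contDiff
  have hp1 : ∀ i j, ContDiff ℝ 1 (partialDeriv i (profile (d := d) η j)) := fun i j =>
    ContDiff.partialDeriv (hp j) (by norm_num)
  have hs1 : ∀ j, ContDiff ℝ 2 (deriv (act (d := d) σ j)) := fun j => (hs j).deriv' (n := 2)
  have h1 := dominated_ridge hΩ hν (p := fun k => partialDeriv i (partialDeriv j (profile η k)))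
    (s := act σ) (C := C)
    (m := fun _ => 1) (fun k => (ContDiff.partialDeriv (m := 0) (hp1 j k) (by simp)).continuous)
    (fun j => (hs j).continuous) (fun j z => (hC j z).1) continuous_const (fun w => by
      rw [abs_one]
      exact le_add_of_nonneg_right (Finset.sum_nonneg fun _ _ => sq_nonneg _))
  have h2 : ∀ i j, _ := fun i j => dominated_ridge hΩ hν (p := fun k => partialDeriv j (profile η k))
    (s := fun k => deriv (act σ k)) (C := C)
    (m := fun w => w i) (fun k => (hp1 j k).continuous)
    (fun j => (hs1 j).continuous) (fun j z => (hC j z).2.1) (by fun_prop)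
    (fun w => abs_coord_le w i)
  have h3 := dominated_ridge hΩ hν (p := profile η) (s := fun k => deriv (deriv (act σ k))) (C := C)
    (m := fun w => w j * w i) (fun k => (hp k).continuous)
    (fun j => ((hs1 j).deriv' (n := 1)).continuous) (fun j z => (hC j z).2.2) (by fun_prop)
    (fun w => abs_coord_mul_le w j i)
  refine Eq.mp (congrArg _ ?_) ((h1.add (h2 i j)).add ((h2 j i).add h3))
  funext y q
  by_cases hy : y ∈ Ω
  swap
  · simp [Set.indicator_of_notMem hy]
  simp only [Set.indicator_of_mem hy]
  have hr : ContDiff ℝ 2 (ridge (act σ q.2) (profile η q.2) q.1.2.1 q.1.2.2) :=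
    ContDiff.ridge ((hs q.2).of_le (by norm_num)) (hp q.2)
  have hc : partialDeriv j (feature η σ q) = fun x => coef q.1.1 q.2 *
      partialDeriv j (ridge (act σ q.2) (profile η q.2) q.1.2.1 q.1.2.2) x := by
    funext x
    change partialDeriv j (fun x => coef q.1.1 q.2 * ridge _ _ _ _ x) x = _
    rw [partialDeriv_mul (by fun_prop) (hr.differentiable two_ne_zero x), partialDeriv_const,
      zero_mul, add_zero]
  rw [hc, partialDeriv_mul (by fun_prop) ((ContDiff.partialDeriv (m := 1) hr
    (by norm_num)).differentiable one_ne_zero y), partialDeriv_const,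
    partialDeriv_partialDeriv_ridge ((hs q.2).of_le (by norm_num)) (hp q.2)]
  ring

lemma dominated_classical_feature {A : DiffOp d} (hA : A.IsLipschitz Ω) :
    Dominated (ν.prod Measure.count)
      (fun (y : Euc d) q => Ω.indicator (A.classical (feature η σ q)) y) := by
  obtain ⟨K, hK, hAK⟩ := hA.bdd
  have hb : ∀ {α : Euc d → ℝ}, (∀ x ∈ Ω, |α x| ≤ K) → ∀ y, |Ω.indicator α y| ≤ K := by
    intro α hα y
    by_cases hy : y ∈ Ω
    · rw [Set.indicator_of_mem hy]; exact hα y hy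
    · rw [Set.indicator_of_notMem hy, abs_zero]; exact hK.le
  have h := ((Dominated.sum Finset.univ fun i => Dominated.sum Finset.univ fun j =>
    (dominated_feature_partialDeriv_partialDeriv hΩ hη hσ hν i j).mul_left
      ((hA.meas_a i j).indicator hΩ.measurableSet) (hb fun x hx => (hAK x hx).1 i j)).add
    (Dominated.sum Finset.univ fun i => (dominated_feature_partialDeriv hΩ hη hσ hν i).mul_left
      ((hA.meas_b i).indicator hΩ.measurableSet) (hb fun x hx => (hAK x hx).2.1 i))).add
    ((dominated_feature hΩ hη hσ hν).mul_left
      (hA.meas_c.indicator hΩ.measurableSet) (hb fun x hx => (hAK x hx).2.2))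
  refine Eq.mp (congrArg _ ?_) h
  funext y q
  by_cases hy : y ∈ Ω
  · simp only [Set.indicator_of_mem hy]; rfl
  · simp [Set.indicator_of_notMem hy]

end Kernels

/-! ### Weak derivatives under the integral sign -/

section Superposition

variable {d : ℕ} {Ω : Set (Euc d)} {Θ : Type*} [MeasurableSpace Θ] {ν : Measure Θ} [SFinite ν]

/-- Test with `φ` and exchange the integrals, which the domination of both kernels permits. -/
lemma isWeakPartial_integral (hΩ : IsCompact Ω) {k k1 : Euc d → Θ → ℝ} (hk : Dominated ν k)
    (hk1 : Dominated ν k1) {i : Fin d} (hw : ∀ θ, IsWeakPartial Ω i (fun y => k y θ) fun y => k1 y θ)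
    {h : Θ → ℝ} (hh : MemLp h 2 ν) :
    IsWeakPartial Ω i (fun y => ∫ θ, k y θ * h θ ∂ν) (fun y => ∫ θ, k1 y θ * h θ ∂ν) := by
  obtain ⟨G, hG⟩ := hk
  obtain ⟨G1, hG1⟩ := hk1
  have : IsFiniteMeasure (volume.restrict (interior Ω)) := ⟨by
    rw [Measure.restrict_apply_univ]
    exact (measure_mono interior_subset).trans_lt hΩ.measure_lt_top⟩
  have hloc : ∀ {f : Euc d → ℝ}, MemLp f 2 (volume.restrict (interior Ω)) →
      LocallyIntegrableOn f (interior Ω) := fun hf =>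
    IntegrableOn.locallyIntegrableOn (hf.integrable one_le_two)
  refine ⟨hloc (hG.memLp_integral_right hh), hloc (hG1.memLp_integral_right hh), fun φ hφ => ?_⟩
  have hφi : Integrable φ (volume.restrict (interior Ω)) :=
    (hφ.smooth.continuous.integrable_of_hasCompactSupport hφ.compact).restrict
  have hφi1 : Integrable (partialDeriv i φ) (volume.restrict (interior Ω)) :=
    ((ContDiff.partialDeriv (m := 0) hφ.smooth (by simp)).continuous.integrable_of_hasCompactSupport
      hφ.compact.partialDeriv).restrict
  rw [← hG.integral_comm hφi1 hh, ← hG1.integral_comm hφi hh, ← integral_neg]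
  refine integral_congr_ae (Eventually.of_forall fun θ => ?_)
  simp only
  rw [(hw θ).parts φ hφ, neg_mul]

end Superposition

end PINN

namespace PINN

/-! ### Sobolev functions and the differential operator -/

section Sobolev

variable {d : ℕ} {Ω : Set (Euc d)} {μ : Measure (Euc d)} {A : DiffOp d}
  {u v : Euc d → ℝ} {u1 v1 : Fin d → Euc d → ℝ} {u2 v2 : Fin d → Fin d → Euc d → ℝ}

/-- Mutual domination of two measures. -/
structure IsComparable {α : Type*} [MeasurableSpace α] (μ l : Measure α) (C : ℝ≥0∞) : Prop where
  ne_top : C ≠ ⊤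
  le : μ ≤ C • l
  ge : l ≤ C • μ

lemma IsComparable.symm {α : Type*} [MeasurableSpace α] {μ l : Measure α} {C : ℝ≥0∞}
    (h : IsComparable μ l C) : IsComparable l μ C := ⟨h.ne_top, h.ge, h.le⟩

lemma IsComparable.memLp {α : Type*} [MeasurableSpace α] {μ l : Measure α} {C : ℝ≥0∞}
    (h : IsComparable μ l C) {f : α → ℝ} (hf : MemLp f 2 l) : MemLp f 2 μ :=
  hf.of_measure_le_smul h.ne_top h.le

lemma IsComparable.absolutelyContinuous {α : Type*} [MeasurableSpace α] {μ l : Measure α}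
    {C : ℝ≥0∞} (h : IsComparable μ l C) : μ ≪ l :=
  Measure.absolutelyContinuous_of_le_smul h.le

lemma IsComparable.ae_eq {α : Type*} [MeasurableSpace α] {μ l : Measure α}
    {C : ℝ≥0∞} (h : IsComparable μ l C) {f g : α → ℝ} (hfg : f =ᵐ[l] g) : f =ᵐ[μ] g :=
  h.absolutelyContinuous.ae_eq hfg

lemma IsComparable.tendsto_eLpNorm {α : Type*} [MeasurableSpace α] {μ l : Measure α} {C : ℝ≥0∞}
    (h : IsComparable μ l C) {ι : Type*} {L : Filter ι} {f : ι → α → ℝ}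
    (hf : Tendsto (fun n => eLpNorm (f n) 2 l) L (𝓝 0)) :
    Tendsto (fun n => eLpNorm (f n) 2 μ) L (𝓝 0) := by
  have hle : ∀ n, eLpNorm (f n) 2 μ ≤ C ^ (1 / 2 : ℝ) * eLpNorm (f n) 2 l := fun n => by
    simpa using eLpNorm_le_of_measure_le_smul h.le (f := f n) (p := 2)
  refine tendsto_of_tendsto_of_tendsto_of_le_of_le tendsto_const_nhds ?_ (fun n => zero_le) hle
  have := ENNReal.Tendsto.const_mul (a := C ^ (1 / 2 : ℝ)) hf
    (Or.inr (ENNReal.rpow_ne_top_of_nonneg (by norm_num) h.ne_top))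
  simpa using this

variable {C : ℝ≥0∞} (hc : IsComparable μ (volume.restrict (interior Ω)) C)

lemma IsH2Triple.linear (hu : IsH2Triple Ω u u1 u2) (hv : IsH2Triple Ω v v1 v2) (a b : ℝ) :
    IsH2Triple Ω (fun x => a * u x + b * v x) (fun i x => a * u1 i x + b * v1 i x)
      (fun i j x => a * u2 i j x + b * v2 i j x) :=
  ⟨fun i => (hu.first i).linear (hv.first i) a b, fun i j => (hu.second i j).linear (hv.second i j) a b,
    (hu.memLp.const_mul a).add (hv.memLp.const_mul b),
    fun i => ((hu.memLp1 i).const_mul a).add ((hv.memLp1 i).const_mul b),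
    fun i j => ((hu.memLp2 i j).const_mul a).add ((hv.memLp2 i j).const_mul b)⟩

lemma IsH2Triple.congr (hu : IsH2Triple Ω u u1 u2) (h : u =ᵐ[volume.restrict (interior Ω)] v) :
    IsH2Triple Ω v u1 u2 :=
  ⟨fun i => (hu.first i).congr h EventuallyEq.rfl, hu.second, hu.memLp.ae_eq h, hu.memLp1, hu.memLp2⟩

lemma IsH2Triple.weakPartial_ae_eq (hu : IsH2Triple Ω u u1 u2) (i : Fin d) :
    weakPartial Ω i u =ᵐ[volume.restrict (interior Ω)] u1 i :=
  (hu.first i).weakPartial_ae_eq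

lemma IsH2Triple.isWeakPartial_weakPartial (hu : IsH2Triple Ω u u1 u2) (i j : Fin d) :
    IsWeakPartial Ω i (weakPartial Ω j u) (u2 i j) :=
  (hu.second i j).congr (hu.weakPartial_ae_eq j).symm EventuallyEq.rfl

lemma IsH2Triple.weakPartial_weakPartial_ae_eq (hu : IsH2Triple Ω u u1 u2) (i j : Fin d) :
    weakPartial Ω i (weakPartial Ω j u) =ᵐ[volume.restrict (interior Ω)] u2 i j :=
  (hu.isWeakPartial_weakPartial i j).weakPartial_ae_eq

lemma IsH2Triple.canonical (hu : IsH2Triple Ω u u1 u2) :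
    IsH2Triple Ω u (fun i => weakPartial Ω i u) (fun i j => weakPartial Ω i (weakPartial Ω j u)) :=
  ⟨fun i => PINN.isWeakPartial_weakPartial ⟨_, hu.first i⟩,
    fun i j => PINN.isWeakPartial_weakPartial ⟨_, hu.isWeakPartial_weakPartial i j⟩, hu.memLp,
    fun i => (hu.memLp1 i).ae_eq (hu.weakPartial_ae_eq i).symm,
    fun i j => (hu.memLp2 i j).ae_eq (hu.weakPartial_weakPartial_ae_eq i j).symm⟩

include hc in
lemma MemH2.isH2Triple (hu : MemH2 Ω μ u) :
    IsH2Triple Ω u (fun i => weakPartial Ω i u) (fun i j => weakPartial Ω i (weakPartial Ω j u)) :=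
  ⟨fun i => PINN.isWeakPartial_weakPartial (hu.1.2 i).1,
    fun i j => PINN.isWeakPartial_weakPartial ((hu.2 j).2 i).1, hc.symm.memLp hu.1.1,
    fun i => hc.symm.memLp (hu.1.2 i).2, fun i j => hc.symm.memLp ((hu.2 j).2 i).2⟩

include hc in
lemma IsH2Triple.memH2 (hu : IsH2Triple Ω u u1 u2) : MemH2 Ω μ u :=
  ⟨⟨hc.memLp hu.memLp, fun i => ⟨⟨_, hu.first i⟩, hc.memLp (hu.canonical.memLp1 i)⟩⟩,
    fun j => ⟨hc.memLp (hu.canonical.memLp1 j), fun i => ⟨⟨_, hu.isWeakPartial_weakPartial i j⟩,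
      hc.memLp (hu.canonical.memLp2 i j)⟩⟩⟩

/-- The differential operator, applied to a function with given derivatives. -/
def DiffOp.onJet (A : DiffOp d) (u : Euc d → ℝ) (u1 : Fin d → Euc d → ℝ)
    (u2 : Fin d → Fin d → Euc d → ℝ) (x : Euc d) : ℝ :=
  ∑ i, ∑ j, A.a i j x * u2 i j x + ∑ i, A.b i x * u1 i x + A.c x * u x

/-- By uniqueness of weak derivatives, the operator can be computed from any derivatives at hand
rather than from the chosen ones. -/
lemma IsH2Triple.weak_ae_eq (hu : IsH2Triple Ω u u1 u2) :
    A.weak Ω u =ᵐ[volume.restrict (interior Ω)] A.onJet u u1 u2 := by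
  have h1 := eventually_all.2 hu.weakPartial_ae_eq
  have h2 := eventually_all.2 fun i => eventually_all.2 (hu.weakPartial_weakPartial_ae_eq i)
  filter_upwards [h1, h2] with x hx1 hx2
  simp only [DiffOp.weak, DiffOp.applyWith, DiffOp.onJet, hx1, hx2]

lemma memLp_mul_of_abs_le_on {α f : Euc d → ℝ} (hα : Measurable α) {K : ℝ}
    (hαK : ∀ x ∈ Ω, |α x| ≤ K) (hf : MemLp f 2 (volume.restrict (interior Ω))) :
    MemLp (fun x => α x * f x) 2 (volume.restrict (interior Ω)) := by
  refine (hf.const_mul K).mono (hα.aestronglyMeasurable.mul hf.1) ?_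
  filter_upwards [ae_restrict_mem isOpen_interior.measurableSet] with x hx
  rw [norm_mul, norm_mul]
  exact mul_le_mul_of_nonneg_right ((hαK x (interior_subset hx)).trans (le_abs_self K))
    (norm_nonneg _)

lemma IsH2Triple.memLp_onJet (hA : A.IsLipschitz Ω) (hu : IsH2Triple Ω u u1 u2) :
    MemLp (A.onJet u u1 u2) 2 (volume.restrict (interior Ω)) := by
  obtain ⟨K, -, hK⟩ := hA.bdd
  exact ((memLp_finsetSum _ fun i _ => memLp_finsetSum _ fun j _ => memLp_mul_of_abs_le_on (hA.meas_a i j)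
    (fun x hx => (hK x hx).1 i j) (hu.memLp2 i j)).add (memLp_finsetSum _ fun i _ =>
      memLp_mul_of_abs_le_on (hA.meas_b i) (fun x hx => (hK x hx).2.1 i) (hu.memLp1 i))).add
    (memLp_mul_of_abs_le_on hA.meas_c (fun x hx => (hK x hx).2.2) hu.memLp)

lemma IsH2Triple.memLp_weak (hA : A.IsLipschitz Ω) (hu : IsH2Triple Ω u u1 u2) :
    MemLp (A.weak Ω u) 2 (volume.restrict (interior Ω)) :=
  (hu.memLp_onJet hA).ae_eq hu.weak_ae_eq.symm

lemma IsH2Triple.weak_linear_ae_eq (hu : IsH2Triple Ω u u1 u2) (hv : IsH2Triple Ω v v1 v2) (a b : ℝ) :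
    A.weak Ω (fun x => a * u x + b * v x) =ᵐ[volume.restrict (interior Ω)]
      fun x => a * A.weak Ω u x + b * A.weak Ω v x := by
  filter_upwards [hu.weak_ae_eq (A := A), hv.weak_ae_eq (A := A), (hu.linear hv a b).weak_ae_eq (A := A)]
    with x h1 h2 h3
  rw [h1, h2, h3]
  simp only [DiffOp.onJet, mul_add, Finset.sum_add_distrib, Finset.mul_sum, mul_left_comm]
  ring

lemma eLpNorm_fun_sum_le {α ι : Type*} [MeasurableSpace α] {μ : Measure α} (s : Finset ι)
    {f : ι → α → ℝ} (hf : ∀ i, AEStronglyMeasurable (f i) μ) :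
    eLpNorm (fun x => ∑ i ∈ s, f i x) 2 μ ≤ ∑ i ∈ s, eLpNorm (f i) 2 μ := by
  rw [show (fun x => ∑ i ∈ s, f i x) = ∑ i ∈ s, f i by funext x; simp]
  exact eLpNorm_sum_le (fun i _ => hf i) one_le_two

include hc in
-- The coefficients are bounded on `Ω`. This continuity carries the `ℋ²` derivative of the dynamics
-- over to an `L²` derivative of the residual.
lemma IsH2Triple.eLpNorm_weak_le (hA : A.IsLipschitz Ω) :
    ∃ K : ℝ≥0∞, K ≠ ⊤ ∧ ∀ {u u1 u2}, IsH2Triple Ω u u1 u2 →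
      eLpNorm (A.weak Ω u) 2 μ ≤ K * h2Norm Ω μ u := by
  obtain ⟨K, hK0, hK⟩ := hA.bdd
  refine ⟨ENNReal.ofReal K, ENNReal.ofReal_ne_top, fun {u u1 u2} hu => ?_⟩
  have hae : ∀ᵐ x ∂μ, x ∈ interior Ω := hc.absolutelyContinuous.ae_le
    (ae_restrict_mem isOpen_interior.measurableSet)
  have hm : ∀ {α f : Euc d → ℝ}, (∀ x ∈ Ω, |α x| ≤ K) →
      eLpNorm (fun x => α x * f x) 2 μ ≤ ENNReal.ofReal K * eLpNorm f 2 μ := fun hα =>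
    eLpNorm_le_mul_eLpNorm_of_ae_le_mul (by
      filter_upwards [hae] with x hx
      rw [norm_mul]
      exact mul_le_mul_of_nonneg_right (hα x (interior_subset hx)) (norm_nonneg _)) 2
  have hw := hu.canonical
  have m0 := hc.memLp (memLp_mul_of_abs_le_on hA.meas_c (fun x hx => (hK x hx).2.2) hw.memLp)
  have m1 := fun i => hc.memLp (memLp_mul_of_abs_le_on (hA.meas_b i) (fun x hx => (hK x hx).2.1 i) (hw.memLp1 i))
  have m2 := fun i j => hc.memLp (memLp_mul_of_abs_le_on (hA.meas_a i j) (fun x hx => (hK x hx).1 i j)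
    (hw.memLp2 i j))
  have m2' := fun i => memLp_finsetSum (Finset.univ : Finset (Fin d)) fun j _ => m2 i j
  have m2'' := memLp_finsetSum (Finset.univ : Finset (Fin d)) fun i _ => m2' i
  have m1' := memLp_finsetSum (Finset.univ : Finset (Fin d)) fun i _ => m1 i
  have e0 := hm (f := u) fun x hx => (hK x hx).2.2
  have e1 : eLpNorm (fun x => ∑ i, A.b i x * weakPartial Ω i u x) 2 μ
      ≤ ENNReal.ofReal K * ∑ i, eLpNorm (weakPartial Ω i u) 2 μ := by
    rw [Finset.mul_sum]
    refine (eLpNorm_fun_sum_le _ fun i => (m1 i).1).trans ?_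
    exact Finset.sum_le_sum fun i _ => hm fun x hx => (hK x hx).2.1 i
  have e2 : eLpNorm (fun x => ∑ i, ∑ j, A.a i j x * weakPartial Ω i (weakPartial Ω j u) x) 2 μ
      ≤ ENNReal.ofReal K * ∑ i, ∑ j, eLpNorm (weakPartial Ω i (weakPartial Ω j u)) 2 μ := by
    rw [Finset.mul_sum]
    refine (eLpNorm_fun_sum_le _ fun i => (m2' i).1).trans ?_
    refine Finset.sum_le_sum fun i _ => ?_
    rw [Finset.mul_sum]
    refine (eLpNorm_fun_sum_le _ fun j => (m2 i j).1).trans ?_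
    exact Finset.sum_le_sum fun j _ => hm fun x hx => (hK x hx).1 i j
  refine (eLpNorm_add_le (m2''.add m1').1 m0.1 one_le_two).trans ?_
  refine (add_le_add (eLpNorm_add_le m2''.1 m1'.1 one_le_two) le_rfl).trans ?_
  refine (add_le_add (add_le_add e2 e1) e0).trans ?_
  rw [h2Norm, h1Norm, ← mul_add, ← mul_add]
  refine mul_le_mul' le_rfl (le_of_eq ?_)
  ring

lemma IsTestFunction.isWeakPartial {φ : Euc d → ℝ} (hφ : IsTestFunction Ω φ) (i : Fin d) :
    IsWeakPartial Ω i φ (partialDeriv i φ) :=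
  isWeakPartial_of_contDiffOn (hφ.smooth.of_le (by norm_cast)).contDiffOn

include hc in
lemma MemH10.isLimitOfTest (hu : MemH10 Ω μ u) : IsLimitOfTest Ω u fun i => weakPartial Ω i u := by
  obtain ⟨hu1, φ, hφ, hl⟩ := hu
  refine ⟨φ, hφ, hc.symm.tendsto_eLpNorm (tendsto_of_tendsto_of_tendsto_of_le_of_le
    tendsto_const_nhds hl (fun _ => zero_le) fun n => le_self_add), fun i =>
    hc.symm.tendsto_eLpNorm (tendsto_of_tendsto_of_tendsto_of_le_of_le
      tendsto_const_nhds hl (fun _ => zero_le) fun n => ?_)⟩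
  have h1 : IsWeakPartial Ω i (u - φ n) (weakPartial Ω i u - partialDeriv i (φ n)) := by
    have := (isWeakPartial_weakPartial (hu1.2 i).1).linear ((hφ n).isWeakPartial i) 1 (-1)
    convert this using 1 <;> (funext x; simp [sub_eq_add_neg])
  rw [← eLpNorm_congr_ae (hc.ae_eq h1.weakPartial_ae_eq)]
  exact le_add_left (Finset.single_le_sum (f := fun i => eLpNorm (weakPartial Ω i (u - φ n)) 2 μ)
    (fun _ _ => zero_le) (Finset.mem_univ i))

include hc in
lemma h1Norm_sub_le (hu : ∀ i, IsWeakPartial Ω i u (u1 i)) (hv : ∀ i, IsWeakPartial Ω i v (v1 i))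
    (hum : AEStronglyMeasurable u μ) (hvm : AEStronglyMeasurable v μ)
    (hum1 : ∀ i, AEStronglyMeasurable (u1 i) μ) (hvm1 : ∀ i, AEStronglyMeasurable (v1 i) μ) :
    h1Norm Ω μ (u - v) ≤ h1Norm Ω μ u + h1Norm Ω μ v := by
  have h1 : ∀ i, eLpNorm (weakPartial Ω i (u - v)) 2 μ
      ≤ eLpNorm (weakPartial Ω i u) 2 μ + eLpNorm (weakPartial Ω i v) 2 μ := fun i => by
    have h2 : IsWeakPartial Ω i (u - v) (u1 i - v1 i) := by
      have := (hu i).linear (hv i) 1 (-1)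
      convert this using 1 <;> (funext x; simp [sub_eq_add_neg])
    rw [eLpNorm_congr_ae (hc.ae_eq h2.weakPartial_ae_eq),
      eLpNorm_congr_ae (hc.ae_eq (hu i).weakPartial_ae_eq),
      eLpNorm_congr_ae (hc.ae_eq (hv i).weakPartial_ae_eq)]
    exact eLpNorm_sub_le (hum1 i) (hvm1 i) one_le_two
  refine (add_le_add (eLpNorm_sub_le hum hvm one_le_two) (Finset.sum_le_sum fun i _ => h1 i)).trans ?_
  rw [Finset.sum_add_distrib, h1Norm, h1Norm]
  exact le_of_eq (by ring)

include hc in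
lemma MemH20.sub (hu : MemH20 Ω μ u) (hv : MemH20 Ω μ v) : MemH20 Ω μ (u - v) := by
  have hH2 : MemH2 Ω μ (u - v) :=
    (((hu.1.isH2Triple hc).linear (hv.1.isH2Triple hc) 1 (-1)).congr
      (Eventually.of_forall fun x => by simp [sub_eq_add_neg])).memH2 hc
  obtain ⟨-, φ, hφ, hl⟩ := hu.2
  obtain ⟨-, ψ, hψ, hl'⟩ := hv.2
  refine ⟨hH2, hH2.1, φ - ψ, fun n => ⟨(hφ n).smooth.sub (hψ n).smooth,
    (hφ n).compact.sub (hψ n).compact, (tsupport_sub _ _).trans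
      (Set.union_subset (hφ n).support (hψ n).support)⟩, ?_⟩
  have hsum := hl.add hl'
  rw [add_zero] at hsum
  refine tendsto_of_tendsto_of_tendsto_of_le_of_le tendsto_const_nhds hsum (fun _ => zero_le)
    fun n => ?_
  have hpd : ∀ {u : Euc d → ℝ} {φ : Euc d → ℝ}, MemH1 Ω μ u → IsTestFunction Ω φ →
      (∀ i, IsWeakPartial Ω i (u - φ) (weakPartial Ω i u - partialDeriv i φ)) ∧
      AEStronglyMeasurable (u - φ) μ ∧
      ∀ i, AEStronglyMeasurable (weakPartial Ω i u - partialDeriv i φ) μ := by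
    intro u φ hu hφ
    refine ⟨fun i => ?_, hu.1.1.sub hφ.smooth.continuous.aestronglyMeasurable, fun i =>
      (hu.2 i).2.1.sub (ContDiff.partialDeriv (m := 0) hφ.smooth
        (by simp)).continuous.aestronglyMeasurable⟩
    have := (isWeakPartial_weakPartial (hu.2 i).1).linear (hφ.isWeakPartial i) 1 (-1)
    convert this using 1 <;> (funext x; simp [sub_eq_add_neg])
  obtain ⟨a1, a2, a3⟩ := hpd hu.1.1 (hφ n)
  obtain ⟨b1, b2, b3⟩ := hpd hv.1.1 (hψ n)
  have := h1Norm_sub_le hc a1 b1 a2 b2 a3 b3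
  rwa [show u - φ n - (v - ψ n) = u - v - (φ - ψ) n by
    rw [Pi.sub_apply]; abel] at this

end Sobolev

end PINN

namespace PINN

/-! ### The measure of the residuals -/

section ResidualMeasure

variable {α : Type*} [MeasurableSpace α] {μ : Measure α} {M : ℕ}

/-- The sum of `μ` and the normalized counting measure of the observations. -/
noncomputable def residualMeasure (μ : Measure α) (M : ℕ) : Measure (α ⊕ Fin M) :=
  μ.map Sum.inl + (M : ℝ≥0∞)⁻¹ • Measure.count.map Sum.inr

lemma measurableEmbedding_inl {β : Type*} [MeasurableSpace β] :
    MeasurableEmbedding (Sum.inl : α → α ⊕ β) :=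
  ⟨Sum.inl_injective, measurable_inl, fun _ hs => hs.inl_image⟩

lemma measurableEmbedding_inr {β : Type*} [MeasurableSpace β] :
    MeasurableEmbedding (Sum.inr : β → α ⊕ β) :=
  ⟨Sum.inr_injective, measurable_inr, fun _ hs => measurableSet_inr_image.2 hs⟩

variable (hM : 0 < M)

include hM in
lemma isFiniteMeasure_residualMeasure [IsFiniteMeasure μ] :
    IsFiniteMeasure (residualMeasure μ M) := by
  have : IsFiniteMeasure ((M : ℝ≥0∞)⁻¹ • (Measure.count : Measure (Fin M)).map
      (Sum.inr : Fin M → α ⊕ Fin M)) := Measure.smul_finite _ (by simp [hM.ne'])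
  unfold residualMeasure
  infer_instance

lemma ae_residualMeasure {p : α ⊕ Fin M → Prop} (h : ∀ᵐ x ∂μ, p (Sum.inl x))
    (h' : ∀ i, p (Sum.inr i)) : ∀ᵐ y ∂(residualMeasure μ M), p y := by
  rw [residualMeasure, ae_add_measure_iff]
  exact ⟨measurableEmbedding_inl.ae_map_iff.2 h, Measure.ae_smul_measure
    (measurableEmbedding_inr.ae_map_iff.2 (Eventually.of_forall h')) _⟩

lemma ae_inl_of_ae_residualMeasure {p : α ⊕ Fin M → Prop} (h : ∀ᵐ y ∂(residualMeasure μ M), p y) :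
    ∀ᵐ x ∂μ, p (Sum.inl x) := by
  rw [residualMeasure, ae_add_measure_iff] at h
  exact measurableEmbedding_inl.ae_map_iff.1 h.1

/-- Each observation is an atom of positive mass, so statements valid almost everywhere hold at
every observation. -/
lemma apply_inr_of_ae_residualMeasure {p : α ⊕ Fin M → Prop}
    (h : ∀ᵐ y ∂(residualMeasure μ M), p y) (i : Fin M) : p (Sum.inr i) := by
  rw [residualMeasure, ae_add_measure_iff,
    Measure.ae_ennreal_smul_measure_iff (by simp)] at h
  have := measurableEmbedding_inr.ae_map_iff.1 h.2
  rw [Measure.ae_count_iff] at this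
  exact this i

include hM in
lemma integral_residualMeasure {f : α ⊕ Fin M → ℝ} (hf : Integrable (fun x => f (Sum.inl x)) μ) :
    ∫ y, f y ∂(residualMeasure μ M) = (∫ x, f (Sum.inl x) ∂μ) + 1 / (M : ℝ) * ∑ i, f (Sum.inr i) := by
  have h1 : Integrable f (μ.map Sum.inl) := measurableEmbedding_inl.integrable_map_iff.2 hf
  have h2 : Integrable f ((M : ℝ≥0∞)⁻¹ • Measure.count.map Sum.inr) :=
    (measurableEmbedding_inr.integrable_map_iff.2 Integrable.of_finite).smul_measure
      (by simp [hM.ne'])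
  rw [residualMeasure, integral_add_measure h1 h2, measurableEmbedding_inl.integral_map,
    integral_smul_measure, measurableEmbedding_inr.integral_map, integral_count]
  simp

lemma lintegral_residualMeasure (f : α ⊕ Fin M → ℝ≥0∞) :
    ∫⁻ y, f y ∂(residualMeasure μ M)
      = (∫⁻ x, f (Sum.inl x) ∂μ) + (M : ℝ≥0∞)⁻¹ * ∑ i, f (Sum.inr i) := by
  rw [residualMeasure, lintegral_add_measure, measurableEmbedding_inl.lintegral_map,
    lintegral_smul_measure, measurableEmbedding_inr.lintegral_map, lintegral_count, tsum_fintype]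
  rfl

lemma eLpNorm_residualMeasure (f : α ⊕ Fin M → ℝ) :
    eLpNorm f 2 (residualMeasure μ M) ^ 2
      = eLpNorm (fun x => f (Sum.inl x)) 2 μ ^ 2 + (M : ℝ≥0∞)⁻¹ * ∑ i, ‖f (Sum.inr i)‖ₑ ^ 2 := by
  rw [eLpNorm_two_sq, eLpNorm_two_sq, lintegral_residualMeasure]

include hM in
lemma memLp_residualMeasure {f : α ⊕ Fin M → ℝ} (hf : MemLp (fun x => f (Sum.inl x)) 2 μ) :
    MemLp f 2 (residualMeasure μ M) := by
  have h1 : MemLp f 2 (μ.map Sum.inl) := measurableEmbedding_inl.memLp_map_measure_iff.2 hf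
  have h2 : MemLp f 2 ((Measure.count : Measure (Fin M)).map (Sum.inr : Fin M → α ⊕ Fin M)) :=
    measurableEmbedding_inr.memLp_map_measure_iff.2 (MemLp.of_discrete)
  have h3 := h2.smul_measure (c := (M : ℝ≥0∞)⁻¹) (by simp [hM.ne'])
  refine ⟨h1.1.add_measure h3.1, ?_⟩
  have h4 : eLpNorm f 2 (residualMeasure μ M) ^ 2 < ⊤ := by
    rw [eLpNorm_residualMeasure]
    refine ENNReal.add_lt_top.2 ⟨ENNReal.pow_lt_top hf.2, ENNReal.mul_lt_top (by simp [hM]) ?_⟩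
    exact ENNReal.sum_lt_top.2 fun i _ => ENNReal.pow_lt_top enorm_lt_top
  by_contra hcon
  rw [not_lt, top_le_iff] at hcon
  rw [hcon] at h4
  simp at h4

lemma memLp_inl_of_residualMeasure {f : α ⊕ Fin M → ℝ} (hf : MemLp f 2 (residualMeasure μ M)) :
    MemLp (fun x => f (Sum.inl x)) 2 μ :=
  measurableEmbedding_inl.memLp_map_measure_iff.1
    (hf.mono_measure (Measure.le_add_right le_rfl))

lemma Dominated.sumElim {Θ : Type*} [MeasurableSpace Θ] {ν : Measure Θ} {β : Type*}
    [MeasurableSpace β] {k : α → Θ → ℝ} {k' : β → Θ → ℝ} (h : Dominated ν k) (h' : Dominated ν k') :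
    Dominated ν (Sum.elim k k') := by
  obtain ⟨G, hG⟩ := h
  obtain ⟨G', hG'⟩ := h'
  refine ⟨fun θ => |G θ| + |G' θ|, ?_, ?_, hG.memLp.abs.add hG'.memLp.abs⟩
  · have : Function.uncurry (Sum.elim k k') = Sum.elim (Function.uncurry k) (Function.uncurry k')
        ∘ MeasurableEquiv.sumProdDistrib α β Θ := by
      funext ⟨y, θ⟩
      cases y <;> rfl
    rw [this]
    exact (hG.meas.sumElim hG'.meas).comp (MeasurableEquiv.measurable _)
  · rintro (y | y) θ
    · exact (hG.bound y θ).trans ((le_abs_self _).trans (le_add_of_nonneg_right (abs_nonneg _)))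
    · exact (hG'.bound y θ).trans ((le_abs_self _).trans (le_add_of_nonneg_left (abs_nonneg _)))

end ResidualMeasure

end PINN

namespace PINN

/-! ### The training dynamics as a gradient flow -/

section Network

variable {d M : ℕ} {Ω : Set (Euc d)} {μ : Measure (Euc d)} {A : DiffOp d} {η : Euc d → ℝ}
  {σ : ℝ → ℝ} {ν : Measure (ℝ × Euc d × ℝ)} {X : Fin M → Euc d}

/-- The derivatives of the residuals with respect to the parameters of a hidden unit. -/
noncomputable def residualKernel (Ω : Set (Euc d)) (A : DiffOp d) (η : Euc d → ℝ) (σ : ℝ → ℝ)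
    (X : Fin M → Euc d) : Euc d ⊕ Fin M → (ℝ × Euc d × ℝ) × Param d → ℝ :=
  Sum.elim (fun x q => Ω.indicator (A.classical (feature η σ q)) x)
    (fun i q => Ω.indicator (feature η σ q) (X i))

variable (hΩ : IsCompact Ω) (hη : IsAuxiliary Ω η) (hσ : IsActivation σ) (hν : IsInitialLaw ν)
  (hA : A.IsLipschitz Ω)

include hΩ hη hσ hν

include hA in
lemma dominated_residualKernel :
    Dominated (ν.prod Measure.count) (residualKernel Ω A η σ X) := by
  refine (dominated_classical_feature hΩ hη hσ hν hA).sumElim ?_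
  obtain ⟨G, hG⟩ := dominated_feature hΩ hη hσ hν
  exact ⟨G, hG.meas.comp (measurable_from_top.prodMap measurable_id), fun i q => hG.bound (X i) q,
    hG.memLp⟩

omit hΩ hη hσ in
lemma integral_prod_count {f : (ℝ × Euc d × ℝ) × Param d → ℝ}
    (hf : Integrable f (ν.prod Measure.count)) :
    ∫ q, f q ∂(ν.prod Measure.count) = ∫ θ, ∑ j, f (θ, j) ∂ν := by
  have := hν.prob
  rw [integral_prod f hf]
  simp only [integral_count]

include hA in
-- Write the scalar product of parameter gradients as a sum over `Param d`; differentiation in the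
-- parameters passes inside the operator. On `Ω` the indicators in the dominated kernels are
-- invisible.
lemma kernelU_eq {x y : Euc d} (hx : x ∈ Ω) (hy : y ∈ Ω) : kernelU A η σ ν x y
    = ∫ q, Ω.indicator (A.classical (feature η σ q)) x * Ω.indicator (feature η σ q) y
      ∂(ν.prod Measure.count) := by
  have := hν.prob
  obtain ⟨G, hG⟩ := dominated_classical_feature hΩ hη hσ hν hA
  obtain ⟨G', hG'⟩ := dominated_feature hΩ hη hσ hν
  have hm : MemLp (fun q => Ω.indicator (feature η σ q) y) 2 (ν.prod Measure.count) :=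
    hG'.memLp.mono (hG'.meas.comp (measurable_const.prodMk measurable_id)).aestronglyMeasurable
      (Eventually.of_forall fun q => (hG'.bound y q).trans (le_abs_self _))
  rw [integral_prod_count hν (hG.integrable_mul_right hm x)]
  refine integral_congr_ae (Eventually.of_forall fun θ => ?_)
  simp only [Set.indicator_of_mem hx, Set.indicator_of_mem hy]
  exact paramGradDot_eq (f := fun j => A.classical (feature η σ (θ, j)) x)
    (g := fun j => feature η σ (θ, j) y)
    (paramDeriv_classical_neuron A (hη.contDiff.of_le (by norm_num)) hσ.contDiff _ _ _ x)
    (paramDeriv_neuron hσ.contDiff _ _ _ y)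

lemma kernelB_eq {x y : Euc d} (hx : x ∈ Ω) (hy : y ∈ Ω) : kernelB η σ ν x y
    = ∫ q, Ω.indicator (feature η σ q) x * Ω.indicator (feature η σ q) y
      ∂(ν.prod Measure.count) := by
  have := hν.prob
  obtain ⟨G', hG'⟩ := dominated_feature hΩ hη hσ hν
  have hm : MemLp (fun q => Ω.indicator (feature η σ q) y) 2 (ν.prod Measure.count) :=
    hG'.memLp.mono (hG'.meas.comp (measurable_const.prodMk measurable_id)).aestronglyMeasurable
      (Eventually.of_forall fun q => (hG'.bound y q).trans (le_abs_self _))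
  rw [integral_prod_count hν (hG'.integrable_mul_right hm x)]
  refine integral_congr_ae (Eventually.of_forall fun θ => ?_)
  simp only [Set.indicator_of_mem hx, Set.indicator_of_mem hy]
  exact paramGradDot_eq (f := fun j => feature η σ (θ, j) x) (g := fun j => feature η σ (θ, j) y)
    (paramDeriv_neuron hσ.contDiff _ _ _ x) (paramDeriv_neuron hσ.contDiff _ _ _ y)

include hA in
/-- The vector field of the training dynamics is a superposition of features. -/
lemma limitField_eq (hM : 0 < M) [IsFiniteMeasure μ] (hμΩ : ∀ᵐ x ∂μ, x ∈ Ω) (hX : ∀ i, X i ∈ Ω)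
    {g u q : Euc d → ℝ} (hr : MemLp (fun x => A.weak Ω q x - g x) 2 μ) {y : Euc d} (hy : y ∈ Ω) :
    limitField Ω μ A η σ ν X g u q y = -∫ p, Ω.indicator (feature η σ p) y *
      (∫ y', residualKernel Ω A η σ X y' p * Sum.elim (fun x => A.weak Ω q x - g x)
        (fun i => q (X i) - u (X i)) y' ∂(residualMeasure μ M)) ∂(ν.prod Measure.count) := by
  have := hν.prob
  have := isFiniteMeasure_residualMeasure (μ := μ) hM
  obtain ⟨G, hG⟩ := dominated_residualKernel (X := X) hΩ hη hσ hν hA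
  obtain ⟨G', hG'⟩ := dominated_feature hΩ hη hσ hν
  set z : Euc d ⊕ Fin M → ℝ := Sum.elim (fun x => A.weak Ω q x - g x)
    (fun i => q (X i) - u (X i)) with hz
  have hzL : MemLp z 2 (residualMeasure μ M) := memLp_residualMeasure hM hr
  have hm : MemLp (fun q => Ω.indicator (feature η σ q) y) 2 (ν.prod Measure.count) :=
    hG'.memLp.mono (hG'.meas.comp (measurable_const.prodMk measurable_id)).aestronglyMeasurable
      (Eventually.of_forall fun q => (hG'.bound y q).trans (le_abs_self _))
  have h1 := hG.integral_comm (hzL.integrable one_le_two) hm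
  have h2 : Integrable (fun y' => (∫ p, residualKernel Ω A η σ X y' p *
      Ω.indicator (feature η σ p) y ∂(ν.prod Measure.count)) * z y') (residualMeasure μ M) :=
    (hG.memLp_integral_right hm).integrable_mul hzL
  have h3 : Integrable (fun x => (∫ p, residualKernel Ω A η σ X (Sum.inl x) p *
      Ω.indicator (feature η σ p) y ∂(ν.prod Measure.count)) * z (Sum.inl x)) μ :=
    (memLp_inl_of_residualMeasure (hG.memLp_integral_right hm)).integrable_mul
      (memLp_inl_of_residualMeasure hzL)
  rw [integral_residualMeasure hM h3] at h1
  simp only [mul_comm (Ω.indicator _ y)]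
  rw [h1, limitField, opU, opB, neg_add, ← sub_eq_add_neg]
  congr 2
  · refine integral_congr_ae ?_
    filter_upwards [hμΩ] with x hx
    rw [kernelU_eq hΩ hη hσ hν hA hx hy, mul_comm]
    rfl
  · refine Finset.sum_congr rfl fun i _ => ?_
    rw [kernelB_eq hΩ hη hσ hν (hX i) hy, mul_comm]
    rfl

/-- Superpositions of features are twice weakly differentiable. -/
lemma isH2Triple_superposition {h : (ℝ × Euc d × ℝ) × Param d → ℝ}
    (hh : MemLp h 2 (ν.prod Measure.count)) :
    IsH2Triple Ω (fun y => ∫ q, Ω.indicator (feature η σ q) y * h q ∂(ν.prod Measure.count))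
      (fun i y => ∫ q, Ω.indicator (partialDeriv i (feature η σ q)) y * h q ∂(ν.prod Measure.count))
      (fun i j y => ∫ q, Ω.indicator (partialDeriv i (partialDeriv j (feature η σ q))) y * h q
        ∂(ν.prod Measure.count)) := by
  have := hν.prob
  have : IsFiniteMeasure (volume.restrict (interior Ω)) := ⟨by
    rw [Measure.restrict_apply_univ]
    exact (measure_mono interior_subset).trans_lt hΩ.measure_lt_top⟩
  have hd0 := dominated_feature hΩ hη hσ hν
  have hd1 := dominated_feature_partialDeriv hΩ hη hσ hν
  have hd2 := dominated_feature_partialDeriv_partialDeriv hΩ hη hσ hν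
  have hind : ∀ f : Euc d → ℝ, f =ᵐ[volume.restrict (interior Ω)] Ω.indicator f := fun f => by
    filter_upwards [ae_restrict_mem isOpen_interior.measurableSet] with x hx
    rw [Set.indicator_of_mem (interior_subset hx)]
  have hf := feature_contDiff_two hη hσ
  have hw : ∀ {f : Euc d → ℝ}, ContDiff ℝ 1 f → ∀ i, IsWeakPartial Ω i (Ω.indicator f)
      (Ω.indicator (partialDeriv i f)) := fun hf i =>
    (isWeakPartial_of_contDiffOn hf.contDiffOn).congr (hind _) (hind _)
  refine ⟨fun i => isWeakPartial_integral hΩ hd0 (hd1 i)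
      (fun q => hw ((hf q).of_le (by norm_num)) i) hh,
    fun i j => isWeakPartial_integral hΩ (hd1 j) (hd2 i j)
      (fun q => hw (ContDiff.partialDeriv (hf q) (by norm_num)) i) hh, ?_, fun i => ?_, fun i j => ?_⟩
  · obtain ⟨G, hG⟩ := hd0
    exact hG.memLp_integral_right hh
  · obtain ⟨G, hG⟩ := hd1 i
    exact hG.memLp_integral_right hh
  · obtain ⟨G, hG⟩ := hd2 i j
    exact hG.memLp_integral_right hh

/-- The weak derivatives of a superposition are the superpositions of the derivatives, and the
operator is linear in them. -/
lemma weak_superposition {h : (ℝ × Euc d × ℝ) × Param d → ℝ}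
    (hh : MemLp h 2 (ν.prod Measure.count)) :
    A.weak Ω (fun y => ∫ q, Ω.indicator (feature η σ q) y * h q ∂(ν.prod Measure.count))
      =ᵐ[volume.restrict (interior Ω)] fun x => ∫ q, Ω.indicator (A.classical (feature η σ q)) x * h q
        ∂(ν.prod Measure.count) := by
  have := hν.prob
  refine (isH2Triple_superposition hΩ hη hσ hν hh).weak_ae_eq.trans ?_
  obtain ⟨G0, hG0⟩ := dominated_feature hΩ hη hσ hν
  choose G1 hG1 using dominated_feature_partialDeriv hΩ hη hσ hν
  choose G2 hG2 using dominated_feature_partialDeriv_partialDeriv hΩ hη hσ hν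
  filter_upwards [ae_restrict_mem isOpen_interior.measurableSet] with x hx
  have hxΩ := interior_subset hx
  have i0 := hG0.integrable_mul_right hh x
  have i1 := fun i => (hG1 i).integrable_mul_right hh x
  have i2 := fun i j => (hG2 i j).integrable_mul_right hh x
  simp only [Set.indicator_of_mem hxΩ] at i0 i1 i2 ⊢
  simp only [DiffOp.onJet, DiffOp.classical, DiffOp.applyWith, Set.indicator_of_mem hxΩ]
  simp only [← integral_const_mul]
  have e : ∀ q, (∑ i, ∑ j, A.a i j x * partialDeriv i (partialDeriv j (feature η σ q)) x
      + ∑ i, A.b i x * partialDeriv i (feature η σ q) x + A.c x * feature η σ q x) * h q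
      = A.c x * (feature η σ q x * h q) + ∑ i, A.b i x * (partialDeriv i (feature η σ q) x * h q)
        + ∑ i, ∑ j, A.a i j x * (partialDeriv i (partialDeriv j (feature η σ q)) x * h q) := by
    intro q
    simp only [add_mul, Finset.sum_mul, mul_assoc]
    ring
  simp only [e]
  rw [integral_add_sum_add_sum (i0.const_mul _) (fun i => (i1 i).const_mul _)
    fun i j => (i2 i j).const_mul _]
  ring

end Network

end PINN

/-! ### The differential equation satisfied by the residuals. -/

namespace PINN

section Flow

variable {d M : ℕ} {Ω : Set (Euc d)} {μ : Measure (Euc d)} {A : DiffOp d} {η : Euc d → ℝ}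
  {σ : ℝ → ℝ} {ν : Measure (ℝ × Euc d × ℝ)} {X : Fin M → Euc d} {g u : Euc d → ℝ}
  {Q : ℝ → Euc d → ℝ}

lemma tendsto_zero_of_tendsto_sq {ι : Type*} {L : Filter ι} {f : ι → ℝ≥0∞}
    (h : Tendsto (fun n => f n ^ 2) L (𝓝 0)) : Tendsto f L (𝓝 0) := by
  have := (ENNReal.continuous_rpow_const (y := (1 / 2 : ℝ))).tendsto 0 |>.comp h
  rw [ENNReal.zero_rpow_of_pos (by norm_num)] at this
  refine this.congr fun n => ?_
  simp only [Function.comp]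
  rw [← ENNReal.rpow_natCast, ← ENNReal.rpow_mul]
  norm_num

/-- The residuals of the differential equation and of the observations. -/
noncomputable def residual (Ω : Set (Euc d)) (A : DiffOp d) (X : Fin M → Euc d) (g u q : Euc d → ℝ) :
    Euc d ⊕ Fin M → ℝ :=
  Sum.elim (fun x => A.weak Ω q x - g x) (fun i => q (X i) - u (X i))

lemma IsH2Triple.weak_congr {u v : Euc d → ℝ} {u1 : Fin d → Euc d → ℝ}
    {u2 : Fin d → Fin d → Euc d → ℝ} (hu : IsH2Triple Ω u u1 u2)
    (h : u =ᵐ[volume.restrict (interior Ω)] v) :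
    A.weak Ω u =ᵐ[volume.restrict (interior Ω)] A.weak Ω v := by
  filter_upwards [hu.weak_ae_eq (A := A), (hu.congr h).weak_ae_eq (A := A), h] with x h1 h2 h3
  rw [h1, h2, DiffOp.onJet, DiffOp.onJet, h3]

variable (hΩ : IsCompact Ω) (hη : IsAuxiliary Ω η) (hσ : IsActivation σ) (hν : IsInitialLaw ν)
  (hA : A.IsLipschitz Ω) {C : ℝ≥0∞} (hc : IsComparable μ (volume.restrict (interior Ω)) C)
  [IsFiniteMeasure μ] (hX : ∀ i, X i ∈ Ω) (hM : 0 < M) (hg : MemLp g 2 μ)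

omit [IsFiniteMeasure μ] in
include hA hc hg in
lemma memLp_residual {q : Euc d → ℝ} (hq : MemH2 Ω μ q) :
    MemLp (fun x => A.weak Ω q x - g x) 2 μ :=
  (hc.memLp ((hq.isH2Triple hc).memLp_weak hA)).sub hg

omit [IsFiniteMeasure μ] in
include hc in
lemma ae_mem_of_isComparable : ∀ᵐ x ∂μ, x ∈ Ω :=
  hc.absolutelyContinuous.ae_le ((ae_restrict_mem isOpen_interior.measurableSet).mono
    fun _ hx => interior_subset hx)

include hΩ hη hσ hν hA hc hX hM hg in
/-- The derivatives of the residuals along the training dynamics. -/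
lemma neg_adjoint_ae_eq {G : (ℝ × Euc d × ℝ) × Param d → ℝ}
    [IsFiniteMeasure (residualMeasure μ M)] [IsProbabilityMeasure ν]
    (hG : IsDominatedKernel (ν.prod Measure.count) (residualKernel Ω A η σ X) G)
    {q : Euc d → ℝ} (hq : MemH2 Ω μ q) {z : Lp ℝ 2 (residualMeasure μ M)}
    (hz : z =ᵐ[residualMeasure μ M] residual Ω A X g u q) :
    (∃ u1 u2, IsH2Triple Ω (limitField Ω μ A η σ ν X g u q) u1 u2) ∧
    ((-(ContinuousLinearMap.adjoint (hG.op (residualMeasure μ M))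
        (hG.op (residualMeasure μ M) z)) : Lp ℝ 2 (residualMeasure μ M)) : Euc d ⊕ Fin M → ℝ)
      =ᵐ[residualMeasure μ M] Sum.elim (A.weak Ω (limitField Ω μ A η σ ν X g u q))
        (fun i => limitField Ω μ A η σ ν X g u q (X i)) := by
  have hr := memLp_residual (g := g) hA hc hg hq
  set T := hG.op (residualMeasure μ M) with hT
  set h : (ℝ × Euc d × ℝ) × Param d → ℝ := ((T z : Lp ℝ 2 (ν.prod Measure.count)) :
    (ℝ × Euc d × ℝ) × Param d → ℝ) with hh
  have hhL : MemLp h 2 (ν.prod Measure.count) := Lp.memLp _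
  have hh1 : h =ᵐ[ν.prod Measure.count] fun p =>
      ∫ y, residualKernel Ω A η σ X y p * residual Ω A X g u q y ∂(residualMeasure μ M) := by
    filter_upwards [hG.op_coeFn z] with p hp
    rw [hh, hp]
    refine integral_congr_ae ?_
    filter_upwards [hz] with y hy
    rw [hy]
  set F : Euc d → ℝ := fun y => ∫ p, Ω.indicator (feature η σ p) y * h p ∂(ν.prod Measure.count)
    with hF
  have hLF : ∀ y ∈ Ω, limitField Ω μ A η σ ν X g u q y = -F y := by
    intro y hy
    rw [limitField_eq hΩ hη hσ hν hA hM (ae_mem_of_isComparable hc) hX hr hy, hF]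
    refine congrArg Neg.neg (integral_congr_ae ?_)
    filter_upwards [hh1] with p hp
    rw [hp]
    rfl
  have hFT := isH2Triple_superposition hΩ hη hσ hν hhL
  -- The field is `-F` on `Ω`, put into the shape of the lemmas on linear combinations.
  have hae : (fun y => -1 * F y + 0 * F y) =ᵐ[volume.restrict (interior Ω)]
      limitField Ω μ A η σ ν X g u q := by
    filter_upwards [ae_restrict_mem isOpen_interior.measurableSet] with y hy
    rw [hLF y (interior_subset hy)]
    ring
  refine ⟨⟨_, _, (hFT.linear hFT (-1) 0).congr hae⟩, ?_⟩
  have hw := ((hFT.linear hFT (-1) 0).weak_congr (A := A) hae).symm.trans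
    (hFT.weak_linear_ae_eq (A := A) hFT (-1) 0)
  have hadj : ∀ᵐ y ∂(residualMeasure μ M),
      (-(ContinuousLinearMap.adjoint T (T z)) : Lp ℝ 2 (residualMeasure μ M)) y
        = -∫ p, residualKernel Ω A η σ X y p * h p ∂(ν.prod Measure.count) := by
    filter_upwards [Lp.coeFn_neg (ContinuousLinearMap.adjoint T (T z)),
      hG.adjoint_op_coeFn (m := residualMeasure μ M) (T z)] with y h1 h2
    rw [h1, Pi.neg_apply, h2]
  refine ae_residualMeasure ?_ fun i => ?_
  · filter_upwards [ae_inl_of_ae_residualMeasure hadj, hc.ae_eq hw,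
      hc.ae_eq (weak_superposition (A := A) hΩ hη hσ hν hhL)] with x h1 h2 h3
    rw [h1]
    simp only [Sum.elim_inl]
    rw [h2, h3]
    simp only [residualKernel, Sum.elim_inl]
    ring
  · rw [apply_inr_of_ae_residualMeasure hadj i]
    simp only [Sum.elim_inr]
    rw [hLF _ (hX i)]
    rfl

include hΩ hη hσ hν hA hc hX hM hg in
-- The residual is affine in `Q`. Its first part is differentiable because the operator is
-- continuous from `ℋ²` to `L²`, its second part by the pointwise equation at the observation
-- points. The derivative is the operator and the evaluations applied to the vector field,
-- identified in `neg_adjoint_ae_eq`.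
lemma isGradientFlow_residual {G : (ℝ × Euc d × ℝ) × Param d → ℝ}
    [IsFiniteMeasure (residualMeasure μ M)] [IsProbabilityMeasure ν]
    (hG : IsDominatedKernel (ν.prod Measure.count) (residualKernel Ω A η σ X) G)
    (hQ : IsWideLimit Ω μ A η σ ν X g u Q) {z : ℝ → Lp ℝ 2 (residualMeasure μ M)}
    (hz : ∀ t, 0 ≤ t → z t =ᵐ[residualMeasure μ M] residual Ω A X g u (Q t)) :
    IsGradientFlow (hG.op (residualMeasure μ M)) z := by
  intro t ht
  rw [hasDerivWithinAt_iff_tendsto_slope, Lp.tendsto_Lp_iff_tendsto_eLpNorm']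
  obtain ⟨⟨l1, l2, hLT⟩, hadj⟩ := neg_adjoint_ae_eq hΩ hη hσ hν hA hc hX hM hg hG (hQ.mem t ht).1
    (hz t ht)
  set LF := limitField Ω μ A η σ ν X g u (Q t) with hLF
  obtain ⟨K, hK, hKle⟩ := IsH2Triple.eLpNorm_weak_le (A := A) hc hA
  apply tendsto_zero_of_tendsto_sq
  have hbound : ∀ s ∈ Set.Ici (0 : ℝ) \ {t},
      eLpNorm (⇑(slope z t s) - ⇑(-(ContinuousLinearMap.adjoint (hG.op (residualMeasure μ M))
        (hG.op (residualMeasure μ M) (z t))))) 2 (residualMeasure μ M) ^ 2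
      ≤ (K * h2Norm Ω μ fun y => (s - t)⁻¹ * (Q s y - Q t y) - LF y) ^ 2
        + (M : ℝ≥0∞)⁻¹ * ∑ i, ‖(s - t)⁻¹ * (Q s (X i) - Q t (X i)) - LF (X i)‖ₑ ^ 2 := by
    rintro s ⟨hs, -⟩
    have hQs := (hQ.mem s hs).1.isH2Triple hc
    have hQt := (hQ.mem t ht).1.isH2Triple hc
    have hcongr : (⇑(slope z t s) - ⇑(-(ContinuousLinearMap.adjoint (hG.op (residualMeasure μ M))
        (hG.op (residualMeasure μ M) (z t))))) =ᵐ[residualMeasure μ M]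
        fun y => (s - t)⁻¹ * (residual Ω A X g u (Q s) y - residual Ω A X g u (Q t) y)
          - Sum.elim (A.weak Ω LF) (fun i => LF (X i)) y := by
      have h1 : slope z t s = (s - t)⁻¹ • (z s - z t) := by rw [slope, vsub_eq_sub]
      rw [h1]
      filter_upwards [hadj, Lp.coeFn_smul (s - t)⁻¹ (z s - z t), Lp.coeFn_sub (z s) (z t),
        hz s hs, hz t ht] with y e1 e2 e3 e4 e5
      rw [Pi.sub_apply, e1, e2, Pi.smul_apply, e3, Pi.sub_apply, e4, e5, smul_eq_mul]
    rw [eLpNorm_congr_ae hcongr, eLpNorm_residualMeasure]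
    -- The squared norm splits into the contribution of `μ`, bounded through the `ℋ²` norm, and
    -- finitely many point values.
    refine add_le_add (pow_le_pow_left₀ zero_le ?_ 2) (mul_le_mul' le_rfl
      (Finset.sum_le_sum fun i _ => le_of_eq ?_))
    · have hD := (hQs.linear hQt (s - t)⁻¹ (-(s - t)⁻¹)).linear hLT 1 (-1)
      have hDe : (fun y => 1 * ((s - t)⁻¹ * Q s y + -(s - t)⁻¹ * Q t y) + -1 * LF y)
          = fun y => (s - t)⁻¹ * (Q s y - Q t y) - LF y := by
        funext y; ring
      refine le_trans (le_of_eq ?_) (hDe ▸ hKle hD)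
      refine eLpNorm_congr_ae ?_
      filter_upwards [hc.ae_eq ((hQs.linear hQt (s - t)⁻¹ (-(s - t)⁻¹)).weak_linear_ae_eq (A := A)
        hLT 1 (-1)), hc.ae_eq (hQs.weak_linear_ae_eq (A := A) hQt (s - t)⁻¹ (-(s - t)⁻¹))]
        with x e1 e2
      rw [hDe] at e1
      rw [e1, e2]
      simp only [residual, Sum.elim_inl]
      ring
    · simp only [residual, Sum.elim_inr]
      congr 3
      ring
  have hlim1 := hQ.ode t ht
  have hlim2 : ∀ i, Tendsto (fun s => ‖(s - t)⁻¹ * (Q s (X i) - Q t (X i)) - LF (X i)‖ₑ ^ 2)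
      (𝓝[Set.Ici 0 \ {t}] t) (𝓝 0) := by
    intro i
    have h1 := hasDerivWithinAt_iff_tendsto_slope.1 (hQ.ode_pointwise t ht (X i) (hX i))
    have h2 : Tendsto (fun s => (s - t)⁻¹ * (Q s (X i) - Q t (X i)) - LF (X i))
        (𝓝[Set.Ici 0 \ {t}] t) (𝓝 0) := by
      have := h1.sub_const (LF (X i))
      rw [sub_self] at this
      exact this
    have := ((ENNReal.continuous_pow 2).tendsto _).comp ((continuous_enorm.tendsto _).comp h2)
    simpa [Function.comp_def] using this
  have hlim : Tendsto (fun s => (K * h2Norm Ω μ fun y => (s - t)⁻¹ * (Q s y - Q t y) - LF y) ^ 2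
        + (M : ℝ≥0∞)⁻¹ * ∑ i, ‖(s - t)⁻¹ * (Q s (X i) - Q t (X i)) - LF (X i)‖ₑ ^ 2)
      (𝓝[Set.Ici 0 \ {t}] t) (𝓝 0) := by
    have a1 := ENNReal.Tendsto.const_mul (a := K) hlim1 (Or.inr hK)
    have a2 := ((ENNReal.continuous_pow 2).tendsto _).comp a1
    have a3 := ENNReal.Tendsto.const_mul (a := (M : ℝ≥0∞)⁻¹)
      (tendsto_finsetSum Finset.univ fun i _ => hlim2 i) (Or.inr (by simp [hM.ne']))
    have := a2.add a3
    simpa [Function.comp_def] using this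
  refine tendsto_of_tendsto_of_tendsto_of_le_of_le' tendsto_const_nhds hlim
    (Eventually.of_forall fun _ => zero_le) ?_
  filter_upwards [self_mem_nhdsWithin] with s hs
  exact hbound s hs

end Flow

end PINN

namespace PINN

/-! ### The kernel of the residual operator -/

section BoundedMeasurable

variable {Y : Type*} [MeasurableSpace Y]

/-- Bounded measurable functions. -/
def IsBoundedMeasurable (f : Y → ℝ) : Prop := Measurable f ∧ ∃ C : ℝ, ∀ y, |f y| ≤ C

lemma IsBoundedMeasurable.add {f g : Y → ℝ} (hf : IsBoundedMeasurable f)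
    (hg : IsBoundedMeasurable g) : IsBoundedMeasurable (fun y => f y + g y) := by
  obtain ⟨hf, C, hC⟩ := hf
  obtain ⟨hg, C', hC'⟩ := hg
  exact ⟨hf.add hg, C + C', fun y => (abs_add_le _ _).trans (add_le_add (hC y) (hC' y))⟩

lemma IsBoundedMeasurable.mul {f g : Y → ℝ} (hf : IsBoundedMeasurable f)
    (hg : IsBoundedMeasurable g) : IsBoundedMeasurable (fun y => f y * g y) := by
  obtain ⟨hf, C, hC⟩ := hf
  obtain ⟨hg, C', hC'⟩ := hg
  refine ⟨hf.mul hg, C * C', fun y => ?_⟩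
  rw [abs_mul]
  exact mul_le_mul (hC y) (hC' y) (abs_nonneg _) ((abs_nonneg _).trans (hC y))

lemma IsBoundedMeasurable.sum {ι : Type*} (s : Finset ι) {f : ι → Y → ℝ}
    (hf : ∀ i, IsBoundedMeasurable (f i)) : IsBoundedMeasurable (fun y => ∑ i ∈ s, f i y) := by
  choose hf C hC using hf
  exact ⟨Finset.measurable_fun_sum s fun i _ => hf i, ∑ i ∈ s, C i, fun y =>
    (Finset.abs_sum_le_sum_abs _ _).trans (Finset.sum_le_sum fun i _ => hC i y)⟩

lemma IsBoundedMeasurable.integrable_mul {m : Measure Y} {f v : Y → ℝ}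
    (hf : IsBoundedMeasurable f) (hv : Integrable v m) : Integrable (fun y => f y * v y) m := by
  obtain ⟨hf, C, hC⟩ := hf
  exact hv.bdd_mul (c := C) hf.aestronglyMeasurable (Eventually.of_forall hC)

lemma IsBoundedMeasurable.sumElim {β : Type*} [Finite β] [MeasurableSpace β]
    [DiscreteMeasurableSpace β] {f : Y → ℝ} (hf : IsBoundedMeasurable f) (g : β → ℝ) :
    IsBoundedMeasurable (Sum.elim f g) := by
  obtain ⟨hf, C, hC⟩ := hf
  obtain ⟨C', hC'⟩ := (Set.finite_range fun b => |g b|).bddAbove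
  refine ⟨hf.sumElim (measurable_of_countable g), max C C', ?_⟩
  rintro (y | b)
  · exact (hC y).trans (le_max_left _ _)
  · exact (hC' ⟨b, rfl⟩).trans (le_max_right _ _)

end BoundedMeasurable

/-! ### The residual of a ridge function as a functional of order two. -/

section Symbol

variable {d M : ℕ} {Ω : Set (Euc d)} {A : DiffOp d} {η : Euc d → ℝ} {σ : ℝ → ℝ}
  {X : Fin M → Euc d}

/-- The points of the residuals. -/
noncomputable def residualPoint (Ω : Set (Euc d)) (X : Fin M → Euc d) : Euc d ⊕ Fin M → Euc d :=
  Sum.elim (Ω.indicator id) X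

/-- The coefficients of order zero of the residuals of `p ↦ η p`. -/
noncomputable def symbol0 (Ω : Set (Euc d)) (A : DiffOp d) (η : Euc d → ℝ) (X : Fin M → Euc d) :
    Euc d ⊕ Fin M → ℝ :=
  Sum.elim (Ω.indicator (A.classical η)) fun i => η (X i)

/-- The coefficients of order one of the residuals of `p ↦ η p`. -/
noncomputable def symbol1 (Ω : Set (Euc d)) (A : DiffOp d) (η : Euc d → ℝ) (M : ℕ) (i : Fin d) :
    Euc d ⊕ Fin M → ℝ :=
  Sum.elim (Ω.indicator fun x => A.b i x * η x
    + ∑ j, (A.a i j x + A.a j i x) * partialDeriv j η x) fun _ => 0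

/-- The coefficients of order two of the residuals of `p ↦ η p`. -/
noncomputable def symbol2 (Ω : Set (Euc d)) (A : DiffOp d) (η : Euc d → ℝ) (M : ℕ) (i j : Fin d) :
    Euc d ⊕ Fin M → ℝ :=
  Sum.elim (Ω.indicator fun x => A.a i j x * η x) fun _ => 0

lemma isBoundedMeasurable_symbol (hΩ : IsCompact Ω) (hη : IsAuxiliary Ω η) (hA : A.IsLipschitz Ω) :
    IsBoundedMeasurable (symbol0 Ω A η X) ∧ (∀ i, IsBoundedMeasurable (symbol1 Ω A η M i)) ∧
      ∀ i j, IsBoundedMeasurable (symbol2 Ω A η M i j) := by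
  obtain ⟨K, hK, hAK⟩ := hA.bdd
  obtain ⟨C, -, hC⟩ := hη.exists_bound
  have hη1 : ∀ i, ContDiff ℝ 2 (partialDeriv i η) := fun i =>
    ContDiff.partialDeriv hη.contDiff (by norm_num)
  have b0 : IsBoundedMeasurable η := ⟨hη.contDiff.continuous.measurable, C, fun x => (hC x).1⟩
  have b1 : ∀ i, IsBoundedMeasurable (partialDeriv i η) := fun i =>
    ⟨(hη1 i).continuous.measurable, C, fun x => (hC x).2.1 i⟩
  have b2 : ∀ i j, IsBoundedMeasurable (partialDeriv i (partialDeriv j η)) := fun i j =>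
    ⟨(ContDiff.partialDeriv (m := 1) (hη1 j) (by norm_num)).continuous.measurable, C,
      fun x => (hC x).2.2 i j⟩
  have hi : ∀ {α : Euc d → ℝ}, Measurable α → (∀ x ∈ Ω, |α x| ≤ K) →
      IsBoundedMeasurable (Ω.indicator α) := by
    refine fun hm hb => ⟨hm.indicator hΩ.measurableSet, K, fun y => ?_⟩
    by_cases hy : y ∈ Ω
    · rw [Set.indicator_of_mem hy]; exact hb y hy
    · rw [Set.indicator_of_notMem hy, abs_zero]; exact hK.le
  have a2 := fun i j => hi (hA.meas_a i j) fun x hx => (hAK x hx).1 i j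
  have a1 := fun i => hi (hA.meas_b i) fun x hx => (hAK x hx).2.1 i
  have a0 := hi hA.meas_c fun x hx => (hAK x hx).2.2
  refine ⟨?_, fun i => ?_, fun i j => ?_⟩
  · refine IsBoundedMeasurable.sumElim (Eq.mp (congrArg _ ?_) (((IsBoundedMeasurable.sum Finset.univ
      fun i => IsBoundedMeasurable.sum Finset.univ fun j => (a2 i j).mul (b2 i j)).add
      (IsBoundedMeasurable.sum Finset.univ fun i => (a1 i).mul (b1 i))).add (a0.mul b0))) _
    funext x
    by_cases hx : x ∈ Ω
    · simp only [Set.indicator_of_mem hx]; rfl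
    · simp [Set.indicator_of_notMem hx]
  · refine IsBoundedMeasurable.sumElim (Eq.mp (congrArg _ ?_) (((a1 i).mul b0).add
      (IsBoundedMeasurable.sum Finset.univ fun j => ((a2 i j).add (a2 j i)).mul (b1 j)))) _
    funext x
    by_cases hx : x ∈ Ω
    · simp only [Set.indicator_of_mem hx]
    · simp [Set.indicator_of_notMem hx]
  · refine IsBoundedMeasurable.sumElim (Eq.mp (congrArg _ ?_) ((a2 i j).mul b0)) _
    funext x
    by_cases hx : x ∈ Ω
    · simp only [Set.indicator_of_mem hx]
    · simp [Set.indicator_of_notMem hx]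

/-- The derivative with respect to the outer weight does not depend on `c`: it is the residual of `η
σ(w · x + b)`. This component alone determines what is needed about the kernel of the residual
operator. -/
lemma residualKernel_none (hη : IsAuxiliary Ω η) (hσ : IsActivation σ) (hX : ∀ i, X i ∈ Ω)
    (c : ℝ) (w : Euc d) (b : ℝ) (y : Euc d ⊕ Fin M) :
    residualKernel Ω A η σ X y ((c, w, b), none)
      = symbol0 Ω A η X y * σ (inner ℝ w (residualPoint Ω X y) + b)
        + (∑ i, w i * symbol1 Ω A η M i y) * deriv σ (inner ℝ w (residualPoint Ω X y) + b)
        + (∑ i, ∑ j, w i * w j * symbol2 Ω A η M i j y)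
          * deriv (deriv σ) (inner ℝ w (residualPoint Ω X y) + b) := by
  have hfe : feature η σ ((c, w, b), none) = ridge σ η w b := by
    funext x
    simp [feature, coef, act, profile]
  rcases y with x | i
  · by_cases hx : x ∈ Ω
    · simp only [residualKernel, symbol0, symbol1, symbol2, residualPoint, Sum.elim_inl,
        Set.indicator_of_mem hx, hfe, id]
      rw [A.classical_ridge (hσ.contDiff.of_le (by norm_num)) (hη.contDiff.of_le (by norm_num))]
      simp only [ridge, DiffOp.classical, DiffOp.applyWith]
      generalize σ (inner ℝ w x + b) = s0
      generalize deriv σ (inner ℝ w x + b) = s1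
      generalize deriv (deriv σ) (inner ℝ w x + b) = s2
      have h1 : ∑ i, w i * ∑ j, (A.a i j x + A.a j i x) * partialDeriv j η x
          = ∑ i, ∑ j, A.a i j x * (w i * partialDeriv j η x + w j * partialDeriv i η x) := by
        simp only [add_mul, mul_add, Finset.sum_add_distrib, Finset.mul_sum]
        congr 1
        · exact Finset.sum_congr rfl fun i _ => Finset.sum_congr rfl fun j _ => by ring
        · rw [Finset.sum_comm]
          exact Finset.sum_congr rfl fun i _ => Finset.sum_congr rfl fun j _ => by ring
      simp only [mul_add (w _), Finset.sum_add_distrib, h1]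
      simp only [add_mul, mul_add, Finset.sum_add_distrib, Finset.sum_mul]
      simp only [mul_assoc, mul_comm, mul_left_comm]
      ring
    · simp [residualKernel, symbol0, symbol1, symbol2, Set.indicator_of_notMem hx]
  · simp [residualKernel, symbol0, symbol1, symbol2, residualPoint, Set.indicator_of_mem (hX i),
      hfe, ridge]

lemma measurable_residualPoint (hΩ : IsCompact Ω) : Measurable (residualPoint Ω X) :=
  (measurable_id.indicator hΩ.measurableSet).sumElim (measurable_of_countable _)

lemma exists_norm_residualPoint_le (hΩ : IsCompact Ω) (hX : ∀ i, X i ∈ Ω) :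
    ∃ R : ℝ, 0 ≤ R ∧ ∀ y, ‖residualPoint Ω X y‖ ≤ R := by
  obtain ⟨R, hR, h⟩ := hΩ.isBounded.exists_pos_norm_le
  refine ⟨R, hR.le, ?_⟩
  rintro (x | i)
  · by_cases hx : x ∈ Ω
    · simpa [residualPoint, Set.indicator_of_mem hx] using h x hx
    · simpa [residualPoint, Set.indicator_of_notMem hx] using hR.le
  · exact h _ (hX i)

lemma continuous_integral_ridge {Y : Type*} [MeasurableSpace Y] {m : Measure Y} {f : Y → ℝ}
    (hf : Integrable f m) {s : ℝ → ℝ} (hs : Continuous s) {C : ℝ} (hC : ∀ z, |s z| ≤ C)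
    {π : Y → Euc d} (hπ : Measurable π) :
    Continuous fun p : Euc d × ℝ => ∫ y, f y * s (inner ℝ p.1 (π y) + p.2) ∂m := by
  refine continuous_of_dominated (bound := fun y => |f y| * C) (fun p => ?_) (fun p => ?_)
    (hf.abs.mul_const C) (Eventually.of_forall fun y => by fun_prop)
  · exact hf.aestronglyMeasurable.mul
      (hs.measurable.comp ((measurable_const.inner hπ).add_const _)).aestronglyMeasurable
  · refine Eventually.of_forall fun y => ?_
    rw [norm_mul, Real.norm_eq_abs, Real.norm_eq_abs]
    exact mul_le_mul_of_nonneg_left (hC _) (abs_nonneg _)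

end Symbol

end PINN

namespace PINN

/-! ### Orthogonality of the initial residual to the kernel -/

section RidgeTransform

variable {d : ℕ} {Y : Type*} [MeasurableSpace Y] {m : Measure Y} {α : Y → ℝ} {β : Fin d → Y → ℝ}
  {γ : Fin d → Fin d → Y → ℝ} (hα : Integrable α m) (hβ : ∀ i, Integrable (β i) m)
  (hγ : ∀ i j, Integrable (γ i j) m) {π : Y → Euc d} (hπ : Measurable π) {σ : ℝ → ℝ}
  (hσ : IsActivation σ)

lemma IsActivation.continuous (hσ : IsActivation σ) :
    Continuous σ ∧ Continuous (deriv σ) ∧ Continuous (deriv (deriv σ)) := by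
  have h1 : ContDiff ℝ 3 (deriv σ) := hσ.contDiff.deriv'
  have h2 : ContDiff ℝ 2 (deriv (deriv σ)) := h1.deriv'
  exact ⟨hσ.contDiff.continuous, h1.continuous, h2.continuous⟩

/-- The integral of the derivatives of order at most two of ridge functions. -/
noncomputable def ridgeTransform (m : Measure Y) (α : Y → ℝ) (β : Fin d → Y → ℝ)
    (γ : Fin d → Fin d → Y → ℝ) (π : Y → Euc d) (σ : ℝ → ℝ) (w : Euc d) (b : ℝ) : ℝ :=
  (∫ y, α y * σ (inner ℝ w (π y) + b) ∂m)
    + ∑ i, w i * (∫ y, β i y * deriv σ (inner ℝ w (π y) + b) ∂m)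
    + ∑ i, ∑ j, w i * w j * (∫ y, γ i j y * deriv (deriv σ) (inner ℝ w (π y) + b) ∂m)

include hπ in
lemma integrable_mul_ridge {f : Y → ℝ} (hf : Integrable f m) {s : ℝ → ℝ} (hs : Continuous s) {C : ℝ}
    (hC : ∀ z, |s z| ≤ C) (w : Euc d) (b : ℝ) :
    Integrable (fun y => f y * s (inner ℝ w (π y) + b)) m :=
  hf.mul_bdd (c := C)
    (hs.measurable.comp ((measurable_const.inner hπ).add_const _)).aestronglyMeasurable
    (Eventually.of_forall fun _ => hC _)

include hα hβ hγ hπ hσ in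
lemma ridgeTransform_eq_integral (w : Euc d) (b : ℝ) :
    ridgeTransform m α β γ π σ w b = ∫ y, (α y * σ (inner ℝ w (π y) + b)
      + (∑ i, w i * β i y) * deriv σ (inner ℝ w (π y) + b)
      + (∑ i, ∑ j, w i * w j * γ i j y) * deriv (deriv σ) (inner ℝ w (π y) + b)) ∂m := by
  obtain ⟨c0, c1, c2⟩ := hσ.continuous
  obtain ⟨C, hC⟩ := hσ.exists_bound
  have h := integral_add_sum_add_sum
    (integrable_mul_ridge hπ hα c0 (fun z => (hC z).1) w b)
    (fun i => (integrable_mul_ridge hπ (hβ i) c1 (fun z => (hC z).2.1) w b).const_mul (w i))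
    (fun i j => (integrable_mul_ridge hπ (hγ i j) c2 (fun z => (hC z).2.2.1) w b).const_mul
      (w i * w j))
  simp only [integral_const_mul] at h
  rw [ridgeTransform, ← h]
  refine integral_congr_ae (Eventually.of_forall fun y => ?_)
  simp only [Finset.sum_mul, mul_assoc]

include hα hβ hγ hπ hσ in
lemma continuous_ridgeTransform :
    Continuous fun p : Euc d × ℝ => ridgeTransform m α β γ π σ p.1 p.2 := by
  obtain ⟨c0, c1, c2⟩ := hσ.continuous
  obtain ⟨C, hC⟩ := hσ.exists_bound
  have h0 := continuous_integral_ridge hα c0 (fun z => (hC z).1) hπ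
  have h1 := fun i => continuous_integral_ridge (hβ i) c1 (fun z => (hC z).2.1) hπ
  have h2 := fun i j => continuous_integral_ridge (hγ i j) c2 (fun z => (hC z).2.2.1) hπ
  have hw : ∀ i, Continuous fun p : Euc d × ℝ => p.1 i := fun i => by fun_prop
  exact (h0.add (continuous_finsetSum _ fun i _ => (hw i).mul (h1 i))).add
    (continuous_finsetSum _ fun i _ => continuous_finsetSum _ fun j _ =>
      ((hw i).mul (hw j)).mul (h2 i j))

include hα hβ hγ hπ hσ in
/-- The ridge functions of a non-constant activation function determine a distribution of order at
most two with compact support. -/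
theorem integral_eq_zero_of_ridgeTransform [SFinite m] {R : ℝ} (hR : ∀ y, ‖π y‖ ≤ R)
    (h : ∀ w b, ridgeTransform m α β γ π σ w b = 0)
    {p : Euc d → ℝ} (hp : ContDiff ℝ ∞ p) (hpc : HasCompactSupport p) :
    ∫ y, α y * p (π y) ∂m + ∑ i, ∫ y, β i y * partialDeriv i p (π y) ∂m
      + ∑ i, ∑ j, ∫ y, γ i j y * partialDeriv i (partialDeriv j p) (π y) ∂m = 0 := by
  obtain ⟨c0, c1, c2⟩ := hσ.continuous
  obtain ⟨C, hC⟩ := hσ.exists_bound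
  refine integral_eq_zero_of_planeWaves hπ hα hβ hγ (fun w => ?_) hp hpc
  have d1 : ContDiff ℝ 3 (deriv σ) := hσ.contDiff.deriv'
  have hne : ∃ z z', σ z ≠ σ z' := by
    by_contra! hcon
    exact hσ.nonconst ⟨σ 0, fun z => hcon z 0⟩
  -- For fixed `w` everything depends on the scalar `τ = w · π(y)`, and the weights `l • w` provide
  -- all dilations of it.
  refine integral_exp_eq_zero_of_annihilates (R := ‖w‖ * R) (C := C) hα
    (integrable_finsetSum _ fun i _ => (hβ i).const_mul _)
    (integrable_finsetSum _ fun i _ => integrable_finsetSum _ fun j _ => (hγ i j).const_mul _)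
    (measurable_const.inner hπ)
    (fun y => (abs_real_inner_le_norm _ _).trans (mul_le_mul_of_nonneg_left (hR y) (norm_nonneg _)))
    (fun z => (hσ.contDiff.differentiable (by norm_num)).differentiableAt.hasDerivAt)
    (fun z => (d1.differentiable (by norm_num)).differentiableAt.hasDerivAt) c2
    (fun z => (hC z).1) (fun z => (hC z).2.1) (fun z => (hC z).2.2.1) hne fun l b => ?_
  rw [← h (l • w) b, ridgeTransform]
  have e1 : ∀ i, Integrable (fun y => w i * l * (β i y * deriv σ (l * inner ℝ w (π y) + b))) m :=
    fun i => by
      simpa only [inner_smul_left, RCLike.conj_to_real] using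
        (integrable_mul_ridge hπ (hβ i) c1 (fun z => (hC z).2.1) (l • w) b).const_mul (w i * l)
  have e2 : ∀ i j, Integrable (fun y => w i * l * (w j * l)
      * (γ i j y * deriv (deriv σ) (l * inner ℝ w (π y) + b))) m := fun i j => by
    simpa only [inner_smul_left, RCLike.conj_to_real] using
      (integrable_mul_ridge hπ (hγ i j) c2 (fun z => (hC z).2.2.1) (l • w) b).const_mul
        (w i * l * (w j * l))
  simp only [inner_smul_left, RCLike.conj_to_real, PiLp.smul_apply, smul_eq_mul]
  congr 1
  · congr 1
    simp only [mul_comm l (w _)]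
    simp only [← integral_const_mul]
    rw [← integral_finsetSum _ fun i _ => e1 i]
    refine integral_congr_ae (Eventually.of_forall fun y => ?_)
    simp only [Finset.sum_mul]
    exact Finset.sum_congr rfl fun i _ => by ring
  · simp only [mul_comm l (w _)]
    simp only [← integral_const_mul]
    simp only [← integral_finsetSum _ fun j _ => e2 _ j]
    rw [← integral_finsetSum _ fun i _ => integrable_finsetSum _ fun j _ => e2 i j]
    refine integral_congr_ae (Eventually.of_forall fun y => ?_)
    simp only [Finset.sum_mul]
    exact Finset.sum_congr rfl fun i _ => Finset.sum_congr rfl fun j _ => by ring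

end RidgeTransform

end PINN

namespace PINN

section Kernel

variable {d M : ℕ} {Ω : Set (Euc d)} {μ : Measure (Euc d)} {A : DiffOp d} {η : Euc d → ℝ}
  {σ : ℝ → ℝ} {ν : Measure (ℝ × Euc d × ℝ)} {X : Fin M → Euc d} {g u : Euc d → ℝ}

/-- An element of the kernel of the residual operator annihilates the products of `η` with test
functions. -/
lemma integral_symbol_eq_zero (hΩ : IsCompact Ω) (hη : IsAuxiliary Ω η) (hσ : IsActivation σ)
    (hν : IsInitialLaw ν) (hA : A.IsLipschitz Ω) (hX : ∀ i, X i ∈ Ω) {m : Measure (Euc d ⊕ Fin M)}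
    [IsFiniteMeasure m] [IsProbabilityMeasure ν] {G : (ℝ × Euc d × ℝ) × Param d → ℝ}
    (hG : IsDominatedKernel (ν.prod Measure.count) (residualKernel Ω A η σ X) G)
    {v : Lp ℝ 2 m} (hv : hG.op m v = 0) {p : Euc d → ℝ} (hp : ContDiff ℝ ∞ p)
    (hpc : HasCompactSupport p) :
    ∫ y, symbol0 Ω A η X y * v y * p (residualPoint Ω X y) ∂m
      + ∑ i, ∫ y, symbol1 Ω A η M i y * v y * partialDeriv i p (residualPoint Ω X y) ∂m
      + ∑ i, ∑ j, ∫ y, symbol2 Ω A η M i j y * v y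
        * partialDeriv i (partialDeriv j p) (residualPoint Ω X y) ∂m = 0 := by
  obtain ⟨b0, b1, b2⟩ := isBoundedMeasurable_symbol (X := X) hΩ hη hA
  have hvi : Integrable v m := (Lp.memLp v).integrable one_le_two
  have i0 := b0.integrable_mul hvi
  have i1 := fun i => (b1 i).integrable_mul hvi
  have i2 := fun i j => (b2 i j).integrable_mul hvi
  have hπ := measurable_residualPoint (X := X) hΩ
  obtain ⟨R, -, hR⟩ := exists_norm_residualPoint_le hΩ hX
  refine integral_eq_zero_of_ridgeTransform i0 i1 i2 hπ hσ hR (fun w b => ?_) hp hpc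
  -- Counting measure charges every parameter, so the identity for the outer weight holds for almost
  -- every `θ`.
  have hae : ∀ᵐ θ ∂ν, ridgeTransform m (fun y => symbol0 Ω A η X y * v y)
      (fun i y => symbol1 Ω A η M i y * v y) (fun i j y => symbol2 Ω A η M i j y * v y)
      (residualPoint Ω X) σ θ.2.1 θ.2.2 = 0 := by
    have h1 : ∀ᵐ q ∂(ν.prod (Measure.count : Measure (Param d))),
        ∫ y, residualKernel Ω A η σ X y q * v y ∂m = 0 := by
      have := hG.op_coeFn v
      rw [hv] at this
      filter_upwards [this, Lp.coeFn_zero ℝ 2 (ν.prod (Measure.count : Measure (Param d)))]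
        with q e1 e2
      rw [← e1, e2]; rfl
    filter_upwards [Measure.ae_ae_of_ae_prod h1] with θ hθ
    rw [Measure.ae_count_iff] at hθ
    rw [ridgeTransform_eq_integral i0 i1 i2 hπ hσ, ← hθ none]
    refine integral_congr_ae (Eventually.of_forall fun y => ?_)
    simp only
    rw [residualKernel_none hη hσ hX]
    simp only [← mul_assoc, ← Finset.sum_mul]
    ring
  -- The transform is continuous in `(w, b)`: if it were nonzero somewhere, it would be so on an
  -- open set, which has positive probability.
  by_contra hne
  refine (hν.full_support _ ((continuous_ridgeTransform i0 i1 i2 hπ hσ).isOpen_preimage _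
    isOpen_compl_singleton) ⟨(w, b), hne⟩).ne' ?_
  exact measure_mono_null (fun θ hθ => hθ) (ae_iff.1 hae)

lemma integral_mul_comp_residualPoint (hΩ : IsCompact Ω) (hM : 0 < M) {ρ : Euc d → ℝ}
    (hρ : ∀ f : Euc d → ℝ, ∫ x, f x ∂μ = ∫ x in interior Ω, ρ x * f x)
    {s v : Euc d ⊕ Fin M → ℝ} (hs : IsBoundedMeasurable s) (hv : Integrable v (residualMeasure μ M))
    {p : Euc d → ℝ} (hp : Continuous p) (hpc : HasCompactSupport p) :
    ∫ y, s y * v y * p (residualPoint Ω X y) ∂(residualMeasure μ M)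
      = (∫ x in interior Ω, s (Sum.inl x) * (ρ x * v (Sum.inl x)) * p x)
        + 1 / (M : ℝ) * ∑ i, s (Sum.inr i) * v (Sum.inr i) * p (X i) := by
  obtain ⟨C, hC⟩ := hp.bounded_above_of_compact_support hpc
  have hi : Integrable (fun y => s y * v y * p (residualPoint Ω X y)) (residualMeasure μ M) :=
    (hs.integrable_mul hv).mul_bdd (c := C)
      (hp.measurable.comp (measurable_residualPoint hΩ)).aestronglyMeasurable
      (Eventually.of_forall fun _ => hC _)
  rw [integral_residualMeasure hM (measurableEmbedding_inl.integrable_map_iff.1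
    (hi.mono_measure (Measure.le_add_right le_rfl))), hρ]
  congr 1
  refine setIntegral_congr_fun isOpen_interior.measurableSet fun x hx => ?_
  simp only [residualPoint, Sum.elim_inl, Set.indicator_of_mem (interior_subset hx), id]
  ring

/-- The kernel of the residual operator is orthogonal to the residuals of the functions which
vanish on the boundary. -/
theorem integral_mul_weak_add_sum_eq_zero (hΩ : IsCompact Ω) (hΩ' : HasC3HolderBoundary Ω)
    (hη : IsAuxiliary Ω η) (hσ : IsActivation σ) (hν : IsInitialLaw ν) (hA : A.IsLipschitz Ω)
    (hM : 0 < M) (hX : ∀ i, X i ∈ Ω) {ρ : Euc d → ℝ} {K : ℝ} (hρm : Measurable ρ)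
    (hρK : ∀ᵐ x ∂(volume.restrict (interior Ω)), 0 < ρ x ∧ ρ x ≤ K ∧ 1 ≤ K * ρ x)
    (hρ : ∀ f : Euc d → ℝ, ∫ x, f x ∂μ = ∫ x in interior Ω, ρ x * f x) {C : ℝ≥0∞}
    (hc : IsComparable μ (volume.restrict (interior Ω)) C)
    [IsFiniteMeasure (residualMeasure μ M)] [IsProbabilityMeasure ν]
    {G : (ℝ × Euc d × ℝ) × Param d → ℝ}
    (hG : IsDominatedKernel (ν.prod Measure.count) (residualKernel Ω A η σ X) G)
    {v : Lp ℝ 2 (residualMeasure μ M)} (hv : hG.op (residualMeasure μ M) v = 0)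
    (hu : MemH20 Ω μ u) (hu_bdry : ∀ x ∈ frontier Ω, u x = 0)
    (hu_obs : ∀ i, X i ∈ interior Ω →
      Tendsto (fun r : ℝ => ⨍ y in Metric.ball (X i) r, u y) (𝓝[>] 0) (𝓝 (u (X i)))) :
    ∫ x, v (Sum.inl x) * A.weak Ω u x ∂μ + 1 / (M : ℝ) * ∑ i, v (Sum.inr i) * u (X i) = 0 := by
  obtain ⟨K', hK', hAK⟩ := hA.bdd
  -- The density turns integrals over `μ` into Lebesgue integrals; being bounded, it keeps `ω'` in
  -- `L²`. The functional then has the coefficients of the operator times `ω'`.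
  set ω' : Euc d → ℝ := fun x => ρ x * v (Sum.inl x) with hω
  have hωL : MemLp ω' 2 (volume.restrict (interior Ω)) := by
    have h1 := hc.symm.memLp (memLp_inl_of_residualMeasure (Lp.memLp v))
    refine (h1.const_mul K).mono (hρm.aestronglyMeasurable.mul h1.1) ?_
    filter_upwards [hρK] with x hx
    rw [norm_mul, norm_mul, Real.norm_of_nonneg hx.1.le]
    exact mul_le_mul_of_nonneg_right (hx.2.1.trans (le_abs_self K)) (norm_nonneg _)
  have hL : ∀ {f : Euc d → ℝ}, Measurable f → (∀ x ∈ Ω, |f x| ≤ K') →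
      MemLp ((interior Ω).indicator fun x => f x * ω' x) 2 := fun hf hb =>
    (memLp_indicator_iff_restrict isOpen_interior.measurableSet).2 (memLp_mul_of_abs_le_on hf hb hωL)
  set q0 := (interior Ω).indicator fun x => A.c x * ω' x with hq0
  set q1 := fun i => (interior Ω).indicator fun x => A.b i x * ω' x with hq1
  set q2 := fun i j => (interior Ω).indicator fun x => A.a i j x * ω' x with hq2
  have hq : IsCoefficient Ω q0 q1 q2 :=
    ⟨hL hA.meas_c fun x hx => (hAK x hx).2.2, fun i => hL (hA.meas_b i) fun x hx => (hAK x hx).2.1 i,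
      fun i j => hL (hA.meas_a i j) fun x hx => (hAK x hx).1 i j,
      fun x hx => Set.indicator_of_notMem hx _, fun i x hx => Set.indicator_of_notMem hx _,
      fun i j x hx => Set.indicator_of_notMem hx _⟩
  obtain ⟨b0, b1, b2⟩ := isBoundedMeasurable_symbol (X := X) hΩ hη hA
  have hvi : Integrable v (residualMeasure μ M) := (Lp.memLp v).integrable one_le_two
  -- The symbols of the residuals, multiplied by `ω'`, are the coefficients of the functional
  -- composed with multiplication by `η`.
  have hann : Annihilates (adj0 η q0 q1 q2) (adj1 η q1 q2) (adj2 η q2)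
      (fun i => 1 / (M : ℝ) * v (Sum.inr i) * η (X i)) X := by
    intro p hp hpc
    have hp1 : ∀ i, ContDiff ℝ ∞ (partialDeriv i p) ∧ HasCompactSupport (partialDeriv i p) :=
      fun i => ⟨ContDiff.partialDeriv hp (by simp), hpc.partialDeriv⟩
    have hp2 : ∀ i j, ContDiff ℝ ∞ (partialDeriv i (partialDeriv j p))
        ∧ HasCompactSupport (partialDeriv i (partialDeriv j p)) :=
      fun i j => ⟨ContDiff.partialDeriv (hp1 j).1 (by simp), (hp1 j).2.partialDeriv⟩
    have h := integral_symbol_eq_zero hΩ hη hσ hν hA hX hG hv hp hpc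
    rw [integral_mul_comp_residualPoint hΩ hM hρ b0 hvi hp.continuous hpc] at h
    simp only [integral_mul_comp_residualPoint hΩ hM hρ (b1 _) hvi (hp1 _).1.continuous (hp1 _).2,
      integral_mul_comp_residualPoint hΩ hM hρ (b2 _ _) hvi (hp2 _ _).1.continuous (hp2 _ _).2] at h
    have hcut : ∀ {f s P : Euc d → ℝ}, (∀ x, x ∉ interior Ω → f x = 0) →
        (∀ x ∈ interior Ω, f x = s x * ω' x) →
        ∫ x, f x * P x = ∫ x in interior Ω, s x * ω' x * P x := fun {f s P} h0 h1 => by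
      rw [← setIntegral_eq_integral_of_forall_compl_eq_zero (s := interior Ω)
        fun x hx => by rw [h0 x hx, zero_mul]]
      exact setIntegral_congr_fun isOpen_interior.measurableSet fun x hx => by
        simp only [h1 x hx]
    rw [hcut (s := fun x => symbol0 Ω A η X (Sum.inl x)) (fun x hx => (hq.adj_zero hx).1) ?_,
      Finset.sum_congr rfl fun i _ => hcut (s := fun x => symbol1 Ω A η M i (Sum.inl x))
        (fun x hx => (hq.adj_zero hx).2.1 i) ?_,
      Finset.sum_congr rfl fun i _ => Finset.sum_congr rfl fun j _ => hcut
        (s := fun x => symbol2 Ω A η M i j (Sum.inl x)) (fun x hx => (hq.adj_zero hx).2.2 i j) ?_]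
    · rw [← h]
      simp only [symbol0, symbol1, symbol2, Sum.elim_inl, Sum.elim_inr, zero_mul,
        Finset.sum_const_zero, mul_zero, add_zero, Finset.mul_sum]
      have : ∀ i, 1 / (M : ℝ) * v (Sum.inr i) * η (X i) * p (X i)
        = 1 / (M : ℝ) * (η (X i) * v (Sum.inr i) * p (X i)) := fun i => by ring
      simp only [this]
      ring
    · intro x hx
      simp only [hq2, symbol2, adj2, Sum.elim_inl, Set.indicator_of_mem hx,
        Set.indicator_of_mem (interior_subset hx)]
      ring
    · intro x hx
      simp only [hq2, hq1, symbol1, adj1, Sum.elim_inl, Set.indicator_of_mem hx,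
        Set.indicator_of_mem (interior_subset hx), add_mul, Finset.sum_mul]
      congr 1
      · ring
      · exact Finset.sum_congr rfl fun j _ => by ring
    · intro x hx
      simp only [hq2, hq1, hq0, symbol0, adj0, Sum.elim_inl, Set.indicator_of_mem hx,
        Set.indicator_of_mem (interior_subset hx), DiffOp.classical, DiffOp.applyWith, add_mul,
        Finset.sum_mul, mul_right_comm _ (ω' x)]
      ring
  have h := pairing_eq_zero hΩ hΩ' hη hq hann hX (hu.1.isH2Triple hc) (hu.2.isLimitOfTest hc)
    hu_bdry hu_obs
  rw [← h, hρ, pairing]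
  congr 1
  · refine setIntegral_congr_fun isOpen_interior.measurableSet fun x hx => ?_
    simp only [hq0, hq1, hq2, Set.indicator_of_mem hx, DiffOp.weak, DiffOp.applyWith, hω, mul_add,
      Finset.mul_sum]
    have e2 : ∀ i j, A.a i j x * (ρ x * v (Sum.inl x)) * weakPartial Ω i (weakPartial Ω j u) x
        = ρ x * (v (Sum.inl x) * (A.a i j x * weakPartial Ω i (weakPartial Ω j u) x)) :=
      fun i j => by ring
    have e1 : ∀ i, A.b i x * (ρ x * v (Sum.inl x)) * weakPartial Ω i u x
        = ρ x * (v (Sum.inl x) * (A.b i x * weakPartial Ω i u x)) := fun i => by ring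
    simp only [e1, e2]
    ring
  · rw [Finset.mul_sum]
    exact Finset.sum_congr rfl fun i _ => by ring

end Kernel

end PINN

namespace PINN

/-! ### Convergence of the wide limit -/

section Convergence

variable {d M : ℕ} {Ω : Set (Euc d)} {μ : Measure (Euc d)} {A : DiffOp d} {η : Euc d → ℝ}
  {σ : ℝ → ℝ} {ν : Measure (ℝ × Euc d × ℝ)} {X : Fin M → Euc d} {g u : Euc d → ℝ} {C : ℝ≥0∞}

lemma residual_zero_ae_eq (hc : IsComparable μ (volume.restrict (interior Ω)) C)
    (hu : A.weak Ω u =ᵐ[μ] g) {q : Euc d → ℝ} (hq : MemH2 Ω μ q) (hq0 : ∀ y ∈ Ω, q y = 0)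
    (hX : ∀ i, X i ∈ Ω) :
    residual Ω A X g u q =ᵐ[residualMeasure μ M]
      Sum.elim (fun x => -A.weak Ω u x) fun i => -u (X i) := by
  have hT := hq.isH2Triple hc
  have h0 : A.weak Ω q =ᵐ[volume.restrict (interior Ω)] fun _ => 0 := by
    have h1 : q =ᵐ[volume.restrict (interior Ω)] fun x => 0 * q x + 0 * q x := by
      filter_upwards [ae_restrict_mem isOpen_interior.measurableSet] with x hx
      rw [hq0 x (interior_subset hx)]; simp
    refine (hT.weak_congr h1).trans ((hT.weak_linear_ae_eq hT 0 0).trans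
      (Eventually.of_forall fun x => by simp))
  refine ae_residualMeasure ?_ fun i => ?_
  · filter_upwards [hc.ae_eq h0, hu] with x h1 h2
    simp only [residual, Sum.elim_inl]
    rw [h1, h2, zero_sub]
  · simp [residual, hq0 _ (hX i)]

/-- The difference `q - u` lies in `ℋ²₍₀₎` and solves the problem with right-hand side `𝒜(q - u) =
𝒜q - g`. By uniqueness it coincides with the solution for which the bound is assumed. -/
lemma HasBoundedInverse.exists_eLpNorm_le (hinv : HasBoundedInverse Ω μ A)
    (hc : IsComparable μ (volume.restrict (interior Ω)) C) (hA : A.IsLipschitz Ω)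
    (hu : IsSolution Ω μ A g u) : ∃ k : ℝ≥0, ∀ q, MemH20 Ω μ q →
      eLpNorm (q - u) 2 μ ≤ k * eLpNorm (fun x => A.weak Ω q x - g x) 2 μ := by
  obtain ⟨k, -, hk⟩ := hinv
  refine ⟨k, fun q hq => ?_⟩
  have hq' := MemH20.sub hc hq hu.1
  obtain ⟨⟨v, hv, hvk⟩, huniq⟩ := hk (A.weak Ω (q - u))
    (hc.memLp ((hq'.1.isH2Triple hc).memLp_weak hA))
  rw [eLpNorm_congr_ae (huniq (q - u) v ⟨hq', EventuallyEq.rfl⟩ hv)]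
  refine hvk.trans_eq ?_
  congr 1
  refine eLpNorm_congr_ae ?_
  have h1 : A.weak Ω (q - u) =ᵐ[volume.restrict (interior Ω)]
      fun x => 1 * A.weak Ω q x + (-1) * A.weak Ω u x :=
    ((hq'.1.isH2Triple hc).weak_congr (Eventually.of_forall fun x => by
      simp [sub_eq_add_neg])).trans
      ((hq.1.isH2Triple hc).weak_linear_ae_eq (hu.1.1.isH2Triple hc) 1 (-1))
  filter_upwards [hc.ae_eq h1, hu.2] with x e1 e2
  rw [e1, e2]
  ring

lemma eLpNorm_empiricalMeasure (f : Euc d → ℝ) :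
    eLpNorm f 2 (empiricalMeasure X) ^ 2 = (M : ℝ≥0∞)⁻¹ * ∑ i, ‖f (X i)‖ₑ ^ 2 := by
  rw [eLpNorm_two_sq, empiricalMeasure, lintegral_smul_measure, lintegral_finsetSum_measure]
  simp [lintegral_dirac]

end Convergence

end PINN

theorem mainTheorem5 {d M : ℕ} (hd : 0 < d) (hM : 0 < M)
    (Ω : Set (PINN.Euc d)) (hΩ : IsCompact Ω) (hΩ' : PINN.HasC3HolderBoundary Ω)
    (μ : Measure (PINN.Euc d)) (hμ : PINN.IsSamplingMeasure Ω μ)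
    (A : PINN.DiffOp d) (hA : A.IsLipschitz Ω)
    (η : PINN.Euc d → ℝ) (hη : PINN.IsAuxiliary Ω η)
    (σ : ℝ → ℝ) (hσ : PINN.IsActivation σ)
    (ν : Measure (ℝ × PINN.Euc d × ℝ)) (hν : PINN.IsInitialLaw ν)
    (hinv : PINN.HasBoundedInverse Ω μ A)
    (g : PINN.Euc d → ℝ) (hg : MemLp g 2 μ)
    (u : PINN.Euc d → ℝ) (hu : PINN.IsSolution Ω μ A g u)
    (X : Fin M → PINN.Euc d) (hX : ∀ i, X i ∈ Ω)
    -- the representative `u` of the solution has the right values where it is observed: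
    -- `0` on the boundary, the limit of the means over small balls in the interior
    (hu_bdry : ∀ x ∈ frontier Ω, u x = 0)
    (hu_obs : ∀ i, X i ∈ interior Ω →
      Tendsto (fun r : ℝ => ⨍ y in Metric.ball (X i) r, u y) (𝓝[>] 0) (𝓝 (u (X i))))
    (Q : ℝ → PINN.Euc d → ℝ) (hQ : PINN.IsWideLimit Ω μ A η σ ν X g u Q) :
    Tendsto (fun t => eLpNorm (Q t - u) 2 μ ^ 2
        + eLpNorm (Q t - u) 2 (PINN.empiricalMeasure X) ^ 2) atTop (𝓝 0) := by
  have := hμ.finite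
  have := hν.prob
  have := PINN.isFiniteMeasure_residualMeasure (μ := μ) hM
  obtain ⟨ρ, K, -, hρm, hρK, hρ, hle, hge⟩ := hμ.exists_density hΩ (hη.volume_frontier)
  have hc : PINN.IsComparable μ (volume.restrict (interior Ω)) (ENNReal.ofReal K) :=
    ⟨ENNReal.ofReal_ne_top, hle, hge⟩
  obtain ⟨G, hG⟩ := PINN.dominated_residualKernel (X := X) hΩ hη hσ hν hA
  -- The curve of residuals must be defined for all real times, but the dynamics only for `t ≥ 0`;
  -- it is frozen at its initial value before.
  have hmem : ∀ t, MemLp (PINN.residual Ω A X g u (Q (max t 0))) 2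
      (PINN.residualMeasure μ M) := fun t =>
    PINN.memLp_residualMeasure hM (PINN.memLp_residual hA hc hg (hQ.mem _ (le_max_right t 0)).1)
  set z : ℝ → Lp ℝ 2 (PINN.residualMeasure μ M) := fun t => (hmem t).toLp with hz
  have hzt : ∀ t, 0 ≤ t → z t =ᵐ[PINN.residualMeasure μ M] PINN.residual Ω A X g u (Q t) :=
    fun t ht => (hmem t).coeFn_toLp.trans (by rw [max_eq_left ht])
  have hflow := PINN.isGradientFlow_residual hΩ hη hσ hν hA hc hX hM hg hG hQ hzt
  have hinit := (hzt 0 le_rfl).trans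
    (PINN.residual_zero_ae_eq hc hu.2 (hQ.mem 0 le_rfl).1 hQ.init hX)
  -- Up to sign, the scalar product with the initial residual is the functional applied to `u`.
  have horth : z 0 ∈ (hG.op (PINN.residualMeasure μ M)).kerᗮ := by
    rw [Submodule.mem_orthogonal]
    intro v hv
    rw [L2.inner_def]
    have hi : Integrable (fun y => v y * z 0 y) (PINN.residualMeasure μ M) :=
      PINN.integrable_mul_of_memLp (Lp.memLp v) (Lp.memLp (z 0))
    have h1 : ∀ᵐ y ∂(PINN.residualMeasure μ M), v y * z 0 y
        = Sum.elim (fun x => -(v (Sum.inl x) * A.weak Ω u x))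
          (fun i => -(v (Sum.inr i) * u (X i))) y := by
      filter_upwards [hinit] with y hy
      rw [hy]
      rcases y with x | i <;> simp
    have h2 : ∀ y, inner ℝ (v y) (z 0 y) = v y * z 0 y := fun y => by
      simp [mul_comm]
    simp only [h2]
    rw [integral_congr_ae h1, PINN.integral_residualMeasure hM]
    · have h := PINN.integral_mul_weak_add_sum_eq_zero hΩ hΩ' hη hσ hν hA hM hX hρm hρK hρ hc hG
        (LinearMap.mem_ker.1 hv) hu.1 hu_bdry hu_obs
      simp only [Sum.elim_inl, Sum.elim_inr, integral_neg, Finset.sum_neg_distrib]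
      linarith
    · exact (PINN.measurableEmbedding_inl.integrable_map_iff.1
        ((hi.congr h1).mono_measure (Measure.le_add_right le_rfl)))
  have hlim : Tendsto (fun t => eLpNorm (PINN.residual Ω A X g u (Q t)) 2
      (PINN.residualMeasure μ M) ^ 2) atTop (𝓝 0) := by
    have h1 := (Lp.tendsto_Lp_iff_tendsto_eLpNorm' _ _).1 (hflow.tendsto_zero horth)
    have h2 := (ENNReal.continuous_pow 2).tendsto 0 |>.comp h1
    rw [zero_pow two_ne_zero] at h2
    refine h2.congr' ?_
    filter_upwards [eventually_ge_atTop 0] with t ht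
    simp only [Function.comp]
    rw [eLpNorm_congr_ae]
    filter_upwards [hzt t ht, Lp.coeFn_zero ℝ 2 (PINN.residualMeasure μ M)] with y h3 h4
    rw [Pi.sub_apply, h3, h4, Pi.zero_apply, sub_zero]
  simp only [PINN.eLpNorm_residualMeasure, PINN.residual, Sum.elim_inl, Sum.elim_inr] at hlim
  obtain ⟨k, hk⟩ := hinv.exists_eLpNorm_le hc hA hu
  -- The factor `k ^ 2` pays for the bounded inverse in the `μ` part, and the `1` covers the
  -- observation part, which is already the squared norm for the empirical measure.
  have hlim' := ENNReal.Tendsto.const_mul (a := (k : ℝ≥0∞) ^ 2 + 1) hlim (Or.inr (by finiteness))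
  rw [mul_zero] at hlim'
  refine tendsto_of_tendsto_of_tendsto_of_le_of_le' tendsto_const_nhds hlim'
    (Eventually.of_forall fun _ => zero_le) ?_
  filter_upwards [eventually_ge_atTop 0] with t ht
  rw [PINN.eLpNorm_empiricalMeasure, mul_add]
  refine add_le_add ?_ (le_mul_of_one_le_left' le_add_self)
  calc eLpNorm (Q t - u) 2 μ ^ 2
      ≤ (k * eLpNorm (fun x => A.weak Ω (Q t) x - g x) 2 μ) ^ 2 :=
        pow_le_pow_left' (hk _ (hQ.mem t ht)) 2
    _ = k ^ 2 * eLpNorm (fun x => A.weak Ω (Q t) x - g x) 2 μ ^ 2 := mul_pow _ _ _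
    _ ≤ _ := mul_le_mul_left le_self_add _
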